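/- **Setting.** Let $d\ge 2$ and let $\Omega\subset\mathbb R^d$ be open and bounded with $C^1$ boundary $\Gamma=\partial\Omega$; write $(\cdot,\cdot)$, $\|\cdot\|$ for the inner product and norm of $L^2(\Omega)$ and $\langle\cdot,\cdot\rangle$ for the pairing $\int_\Gamma uv\,d\sigma$. Let $g(s)=\sum_{i=0}^N a_i s^{\alpha_i}$ with $N\ge1$, $0=\alpha_0<\alpha_1<\dots<\alpha_N$, $a_i\ge0$, $a_0>0$, $a_N>0$. For $\xi\ge0$ let $s(\xi)$ be the unique $s\ge0$ with $s\,g(s)=\xi$, and put $$K(\xi)=\frac1{g(s(\xi))},\qquad a=\frac{\alpha_N}{\alpha_N+1},\qquad \beta=2-a,\qquad \lambda=\frac{2-a}{1-a}.$$ *Finite elements.* A triangulation $\mathcal T_h$ of $\Omega$ of mesh size $h>0$ with quasi-uniformity constant $\sigma>0$ is a finite face-to-face family of (closed, nondegenerate) $d$-simplices $S$ covering $\overline\Omega$, with $\operatorname{diam} S\le h$, such that each element $S\cap\Omega$ contains a ball of radius $\sigma h$. (Elements next to the curved boundary are the sets $S\cap\Omega$.) For $r\ge 0$, $W_h\subset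 H^1(\Omega)$ is the space of restrictions to $\overline\Omega$ of the functions that are continuous on $\bigcup_S S$ and polynomial of degree at most $r$ on each $S$. Let $\pi$ be the $L^2(\Omega)$-projection onto $W_h$. *Data.* $\psi\in C^1([0,T];L^\infty(\Gamma))$ with derivative $\psi_t$; $f:[0,T]\to L^2(\Omega)$ with $f_t\in L^2(0,T;L^2(\Omega))$, i.e. $f(t)=f(0)+\int_0^t f_t\,ds$; $\rho^0\in L^\infty(\Omega)$ with weak gradient $\nabla\rho^0\in L^\beta(\Omega)$. *Semidiscrete problem.* $\rho_h:[0,T]\to W_h$ is continuous on $[0,T]$, differentiable on $(0,T)$, $\rho_h(0)=\pi\rho^0$, and for all $t\in(0,T)$ and $w_h\in W_h$ $$(\rho_{h,t},w_h)+(K(|\nabla\rho_h|)\nabla\rho_h,\nabla w_h)=-\langle\psi,w_h\rangle+(f,w_h).$$ Put $g_\psi(t)=1+\|\psi(t)\|_{L^\infty(\Gamma)}^\lambda$, $h(t)=1+\|\psi_t(t)\|_{L^\infty(\Gamma)}^\lambda$, $k(t)=g_\psi(t)+\|f(t)\|^2$ and $$\mathcal M=\max_{[0,T]}g_\psi+\int_0^T[h(t)+k(t)]\,dt+\int_0^T\!\!\int_0^t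 k(\tau)\,d\tau\,dt+\|\rho^0\|^2+\|\nabla\rho^0\|_{L^\beta(\Omega)}^\beta+\|\psi(0)\|_{L^2(\Gamma)}\|\rho^0\|_{L^2(\Gamma)},$$ where the last norm is that of the trace of $\rho^0$. **Theorem.** For all $d,\Omega,g$, all $r\ge0$, $\sigma>0$ and every $T_{\max}$ there is a constant $C>0$, depending only on these, such that for all $0<t_0<T\le T_{\max}$, all triangulations as above (of any mesh size $h$), all data $\psi,f,\rho^0$ as above and every solution $\rho_h$ of the semidiscrete problem, $$\|\rho_{h,t}\|_{L^\infty(t_0,T;L^2(\Omega))}^2\le C\,t_0^{-1}\mathcal M+C\mathcal M+C\int_0^T h(t)\bigl(1+\|f_t(t)\|^2\bigr)\,dt .$$ -/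

import Mathlib

open MeasureTheory Set Filter Topology
open scoped ENNReal ContDiff

noncomputable section

namespace Forchheimer

/-- `d`-dimensional Euclidean space. -/
abbrev Space (d : ℕ) := EuclideanSpace ℝ (Fin d)

/-! ### The nonlinearity -/

/-- The data of a generalized polynomial `g(s) = a₀ s^α₀ + ⋯ + a_N s^α_N`, with `N ≥ 1`,
`0 = α₀ < α₁ < ⋯ < α_N`, nonnegative coefficients, `a₀ > 0` and `a_N > 0`. -/
structure GenPoly where
  N : ℕ
  one_le_N : 1 ≤ N
  expo : Fin (N + 1) → ℝ
  coeff : Fin (N + 1) → ℝ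
  expo_zero : expo 0 = 0
  expo_strictMono : StrictMono expo
  coeff_nonneg : ∀ i, 0 ≤ coeff i
  coeff_zero_pos : 0 < coeff 0
  coeff_last_pos : 0 < coeff (Fin.last N)

namespace GenPoly

variable (P : GenPoly)

/-- The function `g`. -/
def g (s : ℝ) : ℝ := ∑ i, P.coeff i * s ^ P.expo i

/-- `a = α_N / (α_N + 1)`. -/
def a : ℝ := P.expo (Fin.last P.N) / (P.expo (Fin.last P.N) + 1)

/-- `β = 2 - a`. -/
def β : ℝ := 2 - P.a

/-- `λ = (2 - a) / (1 - a)`. -/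
def lam : ℝ := (2 - P.a) / (1 - P.a)

theorem expo_nonneg (i : Fin (P.N + 1)) : 0 ≤ P.expo i := by
  rw [← P.expo_zero]
  exact P.expo_strictMono.monotone (Fin.zero_le i)

theorem g_monotoneOn : MonotoneOn P.g (Ici 0) := by
  intro s hs t _ hst
  refine Finset.sum_le_sum fun i _ => ?_
  exact mul_le_mul_of_nonneg_left (Real.rpow_le_rpow hs hst (P.expo_nonneg i)) (P.coeff_nonneg i)

theorem coeff_zero_le_g {s : ℝ} (hs : 0 ≤ s) : P.coeff 0 ≤ P.g s := by
  have h := Finset.single_le_sum (f := fun i => P.coeff i * s ^ P.expo i)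
    (fun i _ => mul_nonneg (P.coeff_nonneg i) (Real.rpow_nonneg hs _)) (Finset.mem_univ 0)
  simpa [g, P.expo_zero] using h

theorem g_pos {s : ℝ} (hs : 0 ≤ s) : 0 < P.g s :=
  P.coeff_zero_pos.trans_le (P.coeff_zero_le_g hs)

theorem continuous_g : Continuous P.g :=
  continuous_finsetSum _ fun i _ =>
    continuous_const.mul (Real.continuous_rpow_const (P.expo_nonneg i))

theorem strictMonoOn_mul_g : StrictMonoOn (fun s => s * P.g s) (Ici 0) := by
  intro s hs t ht hst
  calc s * P.g s ≤ s * P.g t := mul_le_mul_of_nonneg_left (P.g_monotoneOn hs ht hst.le) hs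
    _ < t * P.g t := mul_lt_mul_of_pos_right hst (P.g_pos ht)

/-- For `ξ ≥ 0` the equation `s g(s) = ξ` has exactly one nonnegative solution. -/
theorem existsUnique_root {ξ : ℝ} (hξ : 0 ≤ ξ) : ∃! s : ℝ, 0 ≤ s ∧ s * P.g s = ξ := by
  have hc := P.coeff_zero_pos
  have hb : 0 ≤ ξ / P.coeff 0 := div_nonneg hξ hc.le
  have hcont : ContinuousOn (fun s => s * P.g s) (Icc 0 (ξ / P.coeff 0)) :=
    (continuous_id.mul P.continuous_g).continuousOn
  have hmem : ξ ∈ Icc ((fun s => s * P.g s) 0) ((fun s => s * P.g s) (ξ / P.coeff 0)) := by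
    refine ⟨by simpa using hξ, ?_⟩
    calc ξ = ξ / P.coeff 0 * P.coeff 0 := by field_simp
      _ ≤ ξ / P.coeff 0 * P.g (ξ / P.coeff 0) :=
        mul_le_mul_of_nonneg_left (P.coeff_zero_le_g hb) hb
  obtain ⟨s, hs, hs'⟩ := intermediate_value_Icc hb hcont hmem
  refine ⟨s, ⟨hs.1, hs'⟩, ?_⟩
  rintro t ⟨ht, ht'⟩
  exact P.strictMonoOn_mul_g.injOn ht hs.1 (ht'.trans hs'.symm)

/-- `s(ξ)`: the unique nonnegative solution of `s g(s) = ξ` when `ξ ≥ 0` (and `0` for `ξ < 0`,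
a value that is never used). -/
def root (ξ : ℝ) : ℝ :=
  if hξ : 0 ≤ ξ then (P.existsUnique_root hξ).choose else 0

theorem root_spec {ξ : ℝ} (hξ : 0 ≤ ξ) : 0 ≤ P.root ξ ∧ P.root ξ * P.g (P.root ξ) = ξ := by
  rw [root, dif_pos hξ]
  exact (P.existsUnique_root hξ).choose_spec.1

/-- `K(ξ) = 1 / g(s(ξ))`. -/
def K (ξ : ℝ) : ℝ := 1 / P.g (P.root ξ)

end GenPoly

/-! ### The domain, its boundary, weak gradients and traces -/

/-- `Ω` has a `C¹` boundary: near each boundary point, `Ω` is the sublevel set `{φ < 0}` of a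
`C¹` function `φ` without critical points. -/
def HasC1Boundary {d : ℕ} (Ω : Set (Space d)) : Prop :=
  ∀ x ∈ frontier Ω, ∃ (U : Set (Space d)) (φ : Space d → ℝ),
    IsOpen U ∧ x ∈ U ∧ ContDiffOn ℝ 1 φ U ∧ (∀ y ∈ U, fderiv ℝ φ y ≠ 0) ∧
      Ω ∩ U = {y | y ∈ U ∧ φ y < 0}

/-- Lebesgue measure on `Ω`. -/
abbrev vol {d : ℕ} (Ω : Set (Space d)) : Measure (Space d) := volume.restrict Ω

/-- Surface measure on `Γ = ∂Ω`: the normalized `(d-1)`-dimensional Hausdorff measure. -/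
abbrev surf {d : ℕ} (Ω : Set (Space d)) : Measure (Space d) :=
  (Measure.euclideanHausdorffMeasure (d - 1) : Measure (Space d)).restrict (frontier Ω)

/-- The norm of `u` in `L^p(μ)`, as a real number. -/
def lpNorm {X F : Type*} [MeasurableSpace X] [NormedAddCommGroup F] (u : X → F) (p : ℝ≥0∞)
    (μ : Measure X) : ℝ := (eLpNorm u p μ).toReal

/-- `G` is the weak gradient of `u` in the open set `Ω`. -/
def HasWeakGradient {d : ℕ} (Ω : Set (Space d)) (u : Space d → ℝ) (G : Space d → Space d) : Prop :=
  LocallyIntegrableOn u Ω ∧ LocallyIntegrableOn G Ω ∧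
    ∀ φ : Space d → ℝ, ContDiff ℝ ∞ φ → HasCompactSupport φ → tsupport φ ⊆ Ω →
      ∫ x in Ω, u x • gradient φ x = - ∫ x in Ω, φ x • G x

/-- `τ` is the boundary trace of the `W^{1,1}(Ω)` function `u` with weak gradient `G`: there are
`C¹` functions on the whole space which converge to `u` in `W^{1,1}(Ω)` and whose restrictions to
`∂Ω` converge to `τ` in `L¹(∂Ω)`. -/
def HasTrace {d : ℕ} (Ω : Set (Space d)) (u : Space d → ℝ) (G : Space d → Space d)
    (τ : Space d → ℝ) : Prop :=
  AEStronglyMeasurable τ (surf Ω) ∧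
    ∃ v : ℕ → Space d → ℝ, (∀ n, ContDiff ℝ 1 (v n)) ∧
      Tendsto (fun n => eLpNorm (fun x => v n x - u x) 1 (vol Ω)) atTop (𝓝 0) ∧
      Tendsto (fun n => eLpNorm (fun x => gradient (v n) x - G x) 1 (vol Ω)) atTop (𝓝 0) ∧
      Tendsto (fun n => eLpNorm (fun x => v n x - τ x) 1 (surf Ω)) atTop (𝓝 0)

/-! ### Finite elements -/

/-- The cells of a simplicial complex in `ℝ^d`: its (closed) `d`-dimensional simplices. -/
def cells {d : ℕ} (𝒯 : Geometry.SimplicialComplex ℝ (Space d)) : Set (Set (Space d)) :=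
  {S | ∃ s ∈ 𝒯.faces, s.card = d + 1 ∧ S = convexHull ℝ (s : Set (Space d))}

/-- `𝒯` is a triangulation of `Ω` with mesh size `h` and quasi-uniformity constant `σ`: a finite
face-to-face simplicial mesh whose cells `S` cover the closure of `Ω`, have diameter at most `h`,
and are such that the element `S ∩ Ω` contains a ball of radius `σ h`. (As `∂Ω` is curved, `Ω` is
not a union of simplices; the elements next to the boundary are the sets `S ∩ Ω`.) -/
structure IsQuasiUniformTriangulation {d : ℕ} (Ω : Set (Space d)) (σ h : ℝ)
    (𝒯 : Geometry.SimplicialComplex ℝ (Space d)) : Prop where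
  h_pos : 0 < h
  finite : 𝒯.faces.Finite
  covers : closure Ω ⊆ ⋃₀ cells 𝒯
  diam_le : ∀ S ∈ cells 𝒯, Metric.diam S ≤ h
  exists_ball : ∀ S ∈ cells 𝒯, ∃ x, Metric.ball x (σ * h) ⊆ S ∩ Ω

/-- The finite element space `W_h`: functions that are continuous on the union of the cells and on
each cell coincide with a polynomial of degree at most `r`. (Values off the cells are irrelevant:
only the restriction to the closure of `Ω` is ever used.) -/
def feSpace {d : ℕ} (𝒯 : Geometry.SimplicialComplex ℝ (Space d)) (r : ℕ) : Set (Space d → ℝ) :=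
  {w | ContinuousOn w (⋃₀ cells 𝒯) ∧
    ∀ S ∈ cells 𝒯, ∃ p : MvPolynomial (Fin d) ℝ, p.totalDegree ≤ r ∧
      ∀ x ∈ S, w x = MvPolynomial.eval (fun i => x i) p}

/-- `v` is the `L²(Ω)`-projection of `u` onto the space `W`. -/
def IsL2Projection {d : ℕ} (Ω : Set (Space d)) (W : Set (Space d → ℝ)) (u v : Space d → ℝ) :
    Prop :=
  v ∈ W ∧ ∀ w ∈ W, ∫ x in Ω, v x * w x = ∫ x in Ω, u x * w x

/-- `ρ : [0,T] → W`, with time derivative `ρt` on `(0,T)`, solves the semidiscrete problem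
`(ρ_t, w) + (K(|∇ρ|)∇ρ, ∇w) = -⟨ψ, w⟩ + (f, w)` for all `w ∈ W`, with `ρ(0)` the `L²`-projection
of `ρ0`. Elements of `W` are piecewise polynomials, so `gradient` is their (almost everywhere
defined) gradient, and time derivatives in the finite-dimensional space `W` are taken pointwise. -/
structure IsSemidiscreteSolution {d : ℕ} (P : GenPoly) (Ω : Set (Space d))
    (W : Set (Space d → ℝ)) (T : ℝ) (ψ : ℝ → Space d → ℝ) (f : ℝ → Space d → ℝ)
    (ρ0 : Space d → ℝ) (ρ ρt : ℝ → Space d → ℝ) : Prop where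
  mem : ∀ t ∈ Icc 0 T, ρ t ∈ W
  initial : IsL2Projection Ω W ρ0 (ρ 0)
  continuousOn : ∀ x ∈ Ω, ContinuousOn (fun t => ρ t x) (Icc 0 T)
  hasDerivAt : ∀ t ∈ Ioo 0 T, ∀ x ∈ Ω, HasDerivAt (fun s => ρ s x) (ρt t x) t
  equation : ∀ t ∈ Ioo 0 T, ∀ w ∈ W,
    (∫ x in Ω, ρt t x * w x) +
        ∫ x in Ω, P.K ‖gradient (ρ t) x‖ * inner ℝ (gradient (ρ t) x) (gradient w x) =
      -(∫ x, ψ t x * w x ∂(surf Ω)) + ∫ x in Ω, f t x * w x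

/-! ### The quantities in the estimate -/

section Quantities

variable {d : ℕ} (P : GenPoly) {Ω : Set (Space d)}

/-- `1 + ‖ψ(t)‖_{L^∞(Γ)}^λ`; this is `g(t)` when `ψ` is the boundary datum, and `h(t)` when it is
the time derivative of the boundary datum. -/
def bdryWeight (ψ : ℝ → Lp ℝ ∞ (surf Ω)) (t : ℝ) : ℝ := 1 + ‖ψ t‖ ^ P.lam

/-- `k(t) = g(t) + ‖f(t)‖²`. -/
def dataWeight (ψ : ℝ → Lp ℝ ∞ (surf Ω)) (f : ℝ → Lp ℝ 2 (vol Ω)) (t : ℝ) : ℝ :=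
  bdryWeight P ψ t + ‖f t‖ ^ 2

/-- The quantity `𝓜`, for boundary datum `ψ` with time derivative `ψt`, source `f`, and initial
datum `ρ0` with weak gradient `G0` and trace `τ0`. -/
def bigM (T : ℝ) (ψ ψt : ℝ → Lp ℝ ∞ (surf Ω)) (f : ℝ → Lp ℝ 2 (vol Ω))
    (ρ0 : Space d → ℝ) (G0 : Space d → Space d) (τ0 : Space d → ℝ) : ℝ :=
  sSup (bdryWeight P ψ '' Icc 0 T)
    + (∫ t in 0..T, (bdryWeight P ψt t + dataWeight P ψ f t))
    + (∫ t in 0..T, ∫ s in 0..t, dataWeight P ψ f s)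
    + lpNorm ρ0 2 (vol Ω) ^ 2
    + lpNorm G0 (ENNReal.ofReal P.β) (vol Ω) ^ P.β
    + lpNorm (ψ 0) 2 (surf Ω) * lpNorm τ0 2 (surf Ω)

end Quantities

/-- The norm of `u` in `L^∞(J; L²(Ω))`, as an extended nonnegative real number. -/
def normLinftyL2 {d : ℕ} (Ω : Set (Space d)) (J : Set ℝ) (u : ℝ → Space d → ℝ) : ℝ≥0∞ :=
  essSup (fun t => eLpNorm (u t) 2 (vol Ω)) (volume.restrict J)

end Forchheimer

end

/-! The proof has an abstract energy argument, valid in any finite-dimensional Galerkin space, and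
two finite element facts whose constants do not depend on the mesh.

Energy argument (`exists_galerkin_bound`). Let F(y) = K(|y|)y. It inverts the map p ↦ g(|p|)p, so it
is Lipschitz and monotone, and its monotonicity degenerates only like K(ξ) ≳ (1 + ξ^a)⁻¹. It is the
gradient of a convex potential Φ with Φ(y) ~ |y|^β up to constants. Write u for the discrete
solution. Boundary terms are turned into volume integrals by a W^{1,1} trace inequality and then
absorbed by Young's inequality with the conjugate exponents β, λ. (1) Testing with u and Gronwall's
inequality bound ‖u‖² and ∫∫K(|∇u|)|∇u|², hence ∫∫|∇u|^β. (2) Testing with u_t makes ∫Φ(∇u) + ⟨ψ,u⟩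
a Lyapunov function: its derivative is -‖u_t‖² + (f,u_t) + ⟨ψ_t,u⟩. This bounds ∫‖u_t‖² by the data
and the initial energy ∫Φ(∇u(0)). (3) Formally one differentiates the equation in time and tests
with u_t. Since u_t need not be differentiable, this is done with difference quotients. Degenerate
monotonicity absorbs the boundary term in ψ_t at the price of ∫∫|∇u|^β, and ‖u_t(t)‖² - ‖u_t(s)‖² is
bounded. Averaging over s in [t₀/2, t₀] and inserting (2) produces the factor t₀⁻¹.

Finite element facts. The trace inequality `exists_trace_bound` follows by integrating along
coordinate lines that enter Ω from its boundary, which is locally a Lipschitz graph. The initial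
energy requires ∫|∇πρ⁰|^β ≤ C‖ρ⁰‖^β in W^{1,β} (`exists_projection_stability`). For this, the
projection is tested with its own Bernstein coefficients multiplied by a squared, slowly varying
weight. This shows that |∇πu| on a cell is at most an average of |u| against a weight decaying
polynomially in distance/h (`exists_gradient_projection_bound`). Constants are reproduced by π, so u
may be replaced by u - u(x₀). Hölder's inequality then reduces the claim to ∫|u(y+z) - u(y)|^β ≤
C|z|^β‖u‖^β, which is proved by joining y and y + z inside Ω by three short segments
(`exists_difference_bound`). -/

noncomputable section

/-! ### Scalar growth bounds for the nonlinearity. -/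

namespace Forchheimer

namespace GenPoly

variable (P : GenPoly)

/-- The degree `α_N` of the generalized polynomial. -/
def deg : ℝ := P.expo (Fin.last P.N)

theorem deg_pos : 0 < P.deg := by
  have h : (0 : Fin (P.N + 1)) < Fin.last P.N := by
    rw [Fin.lt_def]
    simpa using Nat.lt_of_lt_of_le one_pos P.one_le_N
  simpa [deg, P.expo_zero] using P.expo_strictMono h

theorem expo_le_deg (i : Fin (P.N + 1)) : P.expo i ≤ P.deg :=
  P.expo_strictMono.monotone (Fin.le_last i)

theorem a_eq : P.a = P.deg / (P.deg + 1) := rfl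

theorem one_sub_a : 1 - P.a = 1 / (P.deg + 1) := by
  have := P.deg_pos
  rw [a_eq]
  field_simp
  ring

theorem a_pos : 0 < P.a := by
  have := P.deg_pos
  rw [a_eq]
  positivity

theorem a_lt_one : P.a < 1 := by
  have h : 0 < 1 - P.a := by
    have := P.deg_pos
    rw [one_sub_a]
    positivity
  linarith

theorem one_lt_β : 1 < P.β := by
  have := P.a_lt_one
  unfold β
  linarith

theorem β_lt_two : P.β < 2 := by
  have := P.a_pos
  unfold β
  linarith

theorem β_pos : 0 < P.β := one_pos.trans P.one_lt_β

theorem two_lt_lam : 2 < P.lam := by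
  have h1 := P.a_lt_one
  have h2 := P.a_pos
  rw [lam, lt_div_iff₀ (by linarith)]
  linarith

theorem one_sub_a_mul : (1 - P.a) * (P.deg + 1) = 1 := by
  have := P.deg_pos
  rw [one_sub_a]
  field_simp

theorem one_sub_a_mul_deg : (1 - P.a) * P.deg = P.a := by
  have := P.one_sub_a_mul
  linarith

theorem root_nonneg {ξ : ℝ} (hξ : 0 ≤ ξ) : 0 ≤ P.root ξ := (P.root_spec hξ).1

theorem root_mul_g {ξ : ℝ} (hξ : 0 ≤ ξ) : P.root ξ * P.g (P.root ξ) = ξ := (P.root_spec hξ).2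

theorem root_mono {ξ η : ℝ} (hξ : 0 ≤ ξ) (h : ξ ≤ η) : P.root ξ ≤ P.root η := by
  by_contra! hlt
  have h2 := P.strictMonoOn_mul_g (P.root_nonneg (hξ.trans h)) (P.root_nonneg hξ) hlt
  simp only [P.root_mul_g hξ, P.root_mul_g (hξ.trans h)] at h2
  linarith

theorem root_zero : P.root 0 = 0 := by
  have h := P.root_mul_g le_rfl
  rcases mul_eq_zero.1 h with h | h
  · exact h
  · exact absurd h (P.g_pos (P.root_nonneg le_rfl)).ne'

theorem K_pos {ξ : ℝ} (hξ : 0 ≤ ξ) : 0 < P.K ξ :=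
  one_div_pos.2 (P.g_pos (P.root_nonneg hξ))

theorem K_mul_self {ξ : ℝ} (hξ : 0 ≤ ξ) : P.K ξ * ξ = P.root ξ := by
  have h1 := P.root_mul_g hξ
  have h2 := (P.g_pos (P.root_nonneg hξ)).ne'
  rw [K]
  field_simp
  linarith

theorem coeff_last_mul_le_g {s : ℝ} (hs : 0 ≤ s) :
    P.coeff (Fin.last P.N) * s ^ P.deg ≤ P.g s :=
  Finset.single_le_sum (f := fun i => P.coeff i * s ^ P.expo i)
    (fun i _ => mul_nonneg (P.coeff_nonneg i) (Real.rpow_nonneg hs _)) (Finset.mem_univ _)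

/-- The sum of the coefficients. -/
def coeffSum : ℝ := ∑ i, P.coeff i

theorem coeffSum_pos : 0 < P.coeffSum :=
  P.coeff_zero_pos.trans_le
    (Finset.single_le_sum (f := P.coeff) (fun i _ => P.coeff_nonneg i) (Finset.mem_univ 0))

theorem g_le {s : ℝ} (hs : 0 ≤ s) : P.g s ≤ P.coeffSum * (1 + s ^ P.deg) := by
  rw [coeffSum, Finset.sum_mul]
  refine Finset.sum_le_sum fun i _ => mul_le_mul_of_nonneg_left ?_ (P.coeff_nonneg i)
  have h0 : 0 ≤ s ^ P.deg := Real.rpow_nonneg hs _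
  rcases le_total s 1 with h | h
  · have := Real.rpow_le_one hs h (P.expo_nonneg i)
    linarith
  · have := Real.rpow_le_rpow_of_exponent_le h (P.expo_le_deg i)
    linarith

/-- Keeping only the top term of g gives a_N s^(α_N+1) ≤ s g(s) = ξ, and 1 - a is the reciprocal of
α_N + 1. -/
theorem root_le :
    ∃ C, 0 < C ∧ ∀ ξ, 0 ≤ ξ → P.root ξ ≤ C * ξ ^ (1 - P.a) := by
  set c := P.coeff (Fin.last P.N) with hc
  have hcpos : 0 < c := P.coeff_last_pos
  refine ⟨(1 / c) ^ (1 - P.a), by positivity, fun ξ hξ => ?_⟩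
  have hs := P.root_nonneg hξ
  set s := P.root ξ with hsdef
  have h1 : c * s ^ (P.deg + 1) ≤ ξ := by
    calc c * s ^ (P.deg + 1) = s * (c * s ^ P.deg) := by
          rw [Real.rpow_add_one' hs (by have := P.deg_pos; linarith)]
          ring
      _ ≤ s * P.g s := mul_le_mul_of_nonneg_left (P.coeff_last_mul_le_g hs) hs
      _ = ξ := P.root_mul_g hξ
  have h2 : s ^ (P.deg + 1) ≤ 1 / c * ξ := by
    rw [one_div, inv_mul_eq_div, le_div_iff₀ hcpos]
    linarith
  have h3 := Real.rpow_le_rpow (Real.rpow_nonneg hs _) h2 (sub_nonneg.2 P.a_lt_one.le)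
  rwa [← Real.rpow_mul hs, mul_comm (P.deg + 1), P.one_sub_a_mul, Real.rpow_one,
    Real.mul_rpow (by positivity) hξ] at h3

/-- For s = s(ξ) ≥ 1 all powers in g are dominated by the top one, so ξ^(1-a) ≲ s, and multiplying
by ξ gives ξ^β ≲ ξs. For s ≤ 1, ξ itself is bounded. -/
theorem rpow_β_le : ∃ C, 0 < C ∧ ∀ ξ, 0 ≤ ξ → ξ ^ P.β ≤ C * (1 + ξ * P.root ξ) := by
  set A := 2 * P.coeffSum with hA
  have hApos : 0 < A := by have := P.coeffSum_pos; positivity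
  refine ⟨A ^ (1 - P.a) + A ^ P.β, by positivity, fun ξ hξ => ?_⟩
  have hs := P.root_nonneg hξ
  have hsg := P.root_mul_g hξ
  set s := P.root ξ with hsdef
  have hgle := P.g_le hs
  have hp : 0 < A ^ (1 - P.a) := by positivity
  have hp' : 0 < A ^ P.β := by positivity
  have hξs : 0 ≤ ξ * s := mul_nonneg hξ hs
  rcases le_total 1 s with h | h
  · have h1 : 1 ≤ s ^ P.deg := Real.one_le_rpow h P.deg_pos.le
    have h2 : ξ ≤ A * s ^ (P.deg + 1) := by
      rw [Real.rpow_add_one' hs (by have := P.deg_pos; linarith), ← hsg]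
      have : P.g s ≤ A * s ^ P.deg := by
        have := P.coeffSum_pos
        nlinarith
      nlinarith
    have h3 := Real.rpow_le_rpow hξ h2 (sub_nonneg.2 P.a_lt_one.le)
    rw [Real.mul_rpow hApos.le (Real.rpow_nonneg hs _), ← Real.rpow_mul hs, mul_comm (P.deg + 1),
      P.one_sub_a_mul, Real.rpow_one] at h3
    have h4 : ξ ^ P.β = ξ * ξ ^ (1 - P.a) := by
      rw [show P.β = (1 - P.a) + 1 by unfold β; ring,
        Real.rpow_add_one' hξ (by have := P.a_lt_one; linarith), mul_comm]
    rw [h4]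
    have := mul_le_mul_of_nonneg_left h3 hξ
    nlinarith
  · have h1 : s ^ P.deg ≤ 1 := Real.rpow_le_one hs h P.deg_pos.le
    have h2 : ξ ≤ A := by
      have hg0 := (P.g_pos hs).le
      have := P.coeffSum_pos
      nlinarith
    have := Real.rpow_le_rpow hξ h2 P.β_pos.le
    nlinarith

/-- 1/K is g(s(ξ)), of order at most 1 + s^α_N, and s ≲ ξ^(1-a) with (1-a)α_N = a. This is the rate
at which the diffusion degenerates. -/
theorem inv_K_le : ∃ C, 0 < C ∧ ∀ ξ, 0 ≤ ξ → 1 / P.K ξ ≤ C * (1 + ξ ^ P.a) := by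
  obtain ⟨C, hC, h⟩ := P.root_le
  refine ⟨P.coeffSum * (1 + C ^ P.deg), by have := P.coeffSum_pos; positivity, fun ξ hξ => ?_⟩
  have hs := P.root_nonneg hξ
  rw [K, one_div_one_div]
  have h1 : P.root ξ ^ P.deg ≤ C ^ P.deg * ξ ^ P.a := by
    have := Real.rpow_le_rpow hs (h ξ hξ) P.deg_pos.le
    rwa [Real.mul_rpow hC.le (Real.rpow_nonneg hξ _), ← Real.rpow_mul hξ,
      P.one_sub_a_mul_deg] at this
  have h2 : 0 ≤ ξ ^ P.a := Real.rpow_nonneg hξ _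
  have h3 : 0 < C ^ P.deg := by positivity
  calc P.g (P.root ξ) ≤ P.coeffSum * (1 + P.root ξ ^ P.deg) := P.g_le hs
    _ ≤ P.coeffSum * ((1 + C ^ P.deg) * (1 + ξ ^ P.a)) :=
        mul_le_mul_of_nonneg_left (by nlinarith) P.coeffSum_pos.le
    _ = _ := by ring

/-- The elementary inequality `x² (1 - x^α) ≤ (1 + α) (1 - x²)` for `0 ≤ x ≤ 1`, in homogeneous
form. -/
theorem sq_mul_rpow_sub_le {p q α : ℝ} (hq : 0 ≤ q) (hqp : q ≤ p) (hα : 0 ≤ α) :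
    q ^ 2 * (p ^ α - q ^ α) ≤ (1 + α) * p ^ α * (p ^ 2 - q ^ 2) := by
  rcases hq.eq_or_lt with rfl | hq0
  · have : 0 ≤ p ^ α := Real.rpow_nonneg hqp _
    have h2 : 0 ≤ p ^ 2 := sq_nonneg p
    have h3 : (0 : ℝ) ^ 2 * (p ^ α - 0 ^ α) = 0 := by ring
    rw [h3]
    have : 0 ≤ (1 + α) * p ^ α * p ^ 2 := by positivity
    nlinarith
  have hp0 : 0 < p := hq0.trans_le hqp
  obtain ⟨x, hx⟩ : ∃ x, x = q / p := ⟨_, rfl⟩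
  have hx0 : 0 < x := hx ▸ div_pos hq0 hp0
  have hx1 : x ≤ 1 := hx ▸ (div_le_one hp0).2 hqp
  have hqx : q = p * x := by rw [hx]; field_simp
  have hpα : 0 < p ^ α := Real.rpow_pos_of_pos hp0 α
  -- Bernoulli's inequality covers α ≥ 1; for α ≤ 1 one has x ≤ x^α.
  have key : 1 - x ^ α ≤ (1 + α) * (1 - x) := by
    rcases le_total 1 α with h | h
    · have := one_add_mul_self_le_rpow_one_add (s := x - 1) (by linarith) h
      rw [show 1 + (x - 1) = x by ring] at this
      nlinarith
    · have := Real.rpow_le_rpow_of_exponent_ge hx0 hx1 h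
      rw [Real.rpow_one] at this
      nlinarith
  have key2 : x ^ 2 * (1 - x ^ α) ≤ (1 + α) * (1 - x ^ 2) := by
    have h1 : 0 ≤ 1 - x ^ α := by
      have := Real.rpow_le_one hx0.le hx1 hα
      linarith
    have h2 : x ^ 2 ≤ 1 := by nlinarith
    have h3 : (1 + α) * (1 - x) ≤ (1 + α) * (1 - x ^ 2) :=
      mul_le_mul_of_nonneg_left (by nlinarith) (by linarith)
    nlinarith
  rw [hqx, Real.mul_rpow hp0.le hx0.le]
  calc (p * x) ^ 2 * (p ^ α - p ^ α * x ^ α) = p ^ 2 * p ^ α * (x ^ 2 * (1 - x ^ α)) := by ring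
    _ ≤ p ^ 2 * p ^ α * ((1 + α) * (1 - x ^ 2)) :=
        mul_le_mul_of_nonneg_left key2 (by positivity)
    _ = _ := by ring

theorem sq_mul_g_sub_le {p q : ℝ} (hq : 0 ≤ q) (hqp : q ≤ p) :
    q ^ 2 * (P.g p - P.g q) ≤ (1 + P.deg) * P.g p * (p ^ 2 - q ^ 2) := by
  have hpq : 0 ≤ p ^ 2 - q ^ 2 := by nlinarith
  have e1 : q ^ 2 * (P.g p - P.g q)
      = ∑ i, P.coeff i * (q ^ 2 * (p ^ P.expo i - q ^ P.expo i)) := by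
    simp only [g, ← Finset.sum_sub_distrib, Finset.mul_sum]
    exact Finset.sum_congr rfl fun i _ => by ring
  have e2 : (1 + P.deg) * P.g p * (p ^ 2 - q ^ 2)
      = ∑ i, P.coeff i * ((1 + P.deg) * p ^ P.expo i * (p ^ 2 - q ^ 2)) := by
    simp only [g, Finset.mul_sum, Finset.sum_mul]
    exact Finset.sum_congr rfl fun i _ => by ring
  rw [e1, e2]
  refine Finset.sum_le_sum fun i _ => mul_le_mul_of_nonneg_left ?_ (P.coeff_nonneg i)
  refine (sq_mul_rpow_sub_le hq hqp (P.expo_nonneg i)).trans ?_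
  have h1 : 0 ≤ p ^ P.expo i := Real.rpow_nonneg (hq.trans hqp) _
  have h2 := P.expo_le_deg i
  gcongr

/-! ### The vector flux: monotonicity, Lipschitz continuity and its convex potential. -/

section Flux

set_option linter.unusedSectionVars false

variable {E : Type*} [NormedAddCommGroup E] [InnerProductSpace ℝ E]

/-- The nonlinear flux `K(|y|) y`. -/
def flux (y : E) : E := P.K ‖y‖ • y

theorem norm_flux (y : E) : ‖P.flux y‖ = P.root ‖y‖ := by
  rw [flux, norm_smul, Real.norm_of_nonneg (P.K_pos (norm_nonneg _)).le,
    P.K_mul_self (norm_nonneg _)]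

theorem g_smul_flux (y : E) : P.g ‖P.flux y‖ • P.flux y = y := by
  rw [norm_flux, flux, smul_smul, K,
    mul_one_div_cancel (P.g_pos (P.root_nonneg (norm_nonneg _))).ne', one_smul]

theorem K_norm (y : E) : P.K ‖y‖ = 1 / P.g ‖P.flux y‖ := by rw [norm_flux, K]

theorem inner_flux_self (y : E) : inner ℝ (P.flux y) y = ‖y‖ * P.root ‖y‖ := by
  rw [flux, real_inner_smul_left, real_inner_self_eq_norm_sq, ← P.K_mul_self (norm_nonneg _)]
  ring

theorem flux_zero : P.flux (0 : E) = 0 := by simp [flux]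

/-- Splits the pairing into a coercive part and a part that is nonnegative whenever A and B are
ordered like ‖p‖ and ‖q‖, as for values of g. -/
theorem inner_sub_smul_sub (p q : E) (A B : ℝ) :
    inner ℝ (p - q) (A • p - B • q)
      = (A + B) / 2 * ‖p - q‖ ^ 2 + (A - B) / 2 * (‖p‖ ^ 2 - ‖q‖ ^ 2) := by
  rw [norm_sub_sq_real]
  simp only [inner_sub_left, inner_sub_right, real_inner_smul_right, real_inner_self_eq_norm_sq]
  rw [real_inner_comm q p]
  ring

/-- Write Ap - Bq = A(p - q) + (A - B)q. The first piece is controlled by the coercive part of the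
pairing, the second by the part with ‖p‖² - ‖q‖², through `sq_mul_g_sub_le`. -/
theorem smul_sub_sq_le {p q : E} (hqp : ‖q‖ ≤ ‖p‖) :
    ‖P.g ‖p‖ • p - P.g ‖q‖ • q‖ ^ 2
      ≤ 4 * (1 + P.deg) * P.g ‖p‖ * inner ℝ (p - q) (P.g ‖p‖ • p - P.g ‖q‖ • q) := by
  have h1 := P.sq_mul_g_sub_le (norm_nonneg q) hqp
  have hAB : P.g ‖q‖ ≤ P.g ‖p‖ := P.g_monotoneOn (norm_nonneg _) (norm_nonneg _) hqp
  have hB := P.g_pos (norm_nonneg q)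
  rw [inner_sub_smul_sub]
  set A := P.g ‖p‖
  set B := P.g ‖q‖
  have e : A • p - B • q = A • (p - q) + (A - B) • q := by
    rw [smul_sub, sub_smul]
    abel
  have h2 : ‖A • p - B • q‖ ≤ A * ‖p - q‖ + (A - B) * ‖q‖ := by
    rw [e]
    refine (norm_add_le _ _).trans ?_
    rw [norm_smul, norm_smul, Real.norm_of_nonneg (hB.le.trans hAB),
      Real.norm_of_nonneg (sub_nonneg.2 hAB)]
  have h3 : ‖A • p - B • q‖ ^ 2 ≤ 2 * (A * ‖p - q‖) ^ 2 + 2 * ((A - B) * ‖q‖) ^ 2 := by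
    have h0 := norm_nonneg (A • p - B • q)
    nlinarith [sq_nonneg (A * ‖p - q‖ - (A - B) * ‖q‖)]
  have hdeg := P.deg_pos
  have hA : 0 < A := hB.trans_le hAB
  have h4 := mul_le_mul_of_nonneg_left h1 (sub_nonneg.2 hAB)
  have h5 : A * (A * ‖p - q‖ ^ 2) ≤ (1 + P.deg) * A * ((A + B) * ‖p - q‖ ^ 2) := by
    have t1 : A * ‖p - q‖ ^ 2 ≤ (A + B) * ‖p - q‖ ^ 2 :=
      mul_le_mul_of_nonneg_right (by linarith) (sq_nonneg _)
    have t2 : A ≤ (1 + P.deg) * A := by nlinarith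
    exact mul_le_mul t2 t1 (by positivity) (by positivity)
  nlinarith

/-- The flux is monotone, degenerately for large arguments. -/
theorem min_K_mul_le_inner (y z : E) :
    min (P.K ‖y‖) (P.K ‖z‖) * ‖y - z‖ ^ 2
      ≤ 4 * (1 + P.deg) * inner ℝ (P.flux y - P.flux z) (y - z) := by
  -- In terms of p = F(y) one has y = g(‖p‖)p and K(‖y‖) = 1/g(‖p‖), so the weight belongs to the
  -- argument with the larger flux.
  have main : ∀ p q : E, ‖q‖ ≤ ‖p‖ →
      1 / P.g ‖p‖ * ‖P.g ‖p‖ • p - P.g ‖q‖ • q‖ ^ 2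
        ≤ 4 * (1 + P.deg) * inner ℝ (p - q) (P.g ‖p‖ • p - P.g ‖q‖ • q) := by
    intro p q hqp
    have h := P.smul_sub_sq_le hqp
    have hg := P.g_pos (norm_nonneg p)
    rw [one_div, inv_mul_le_iff₀ hg]
    linarith
  rcases le_total ‖P.flux z‖ ‖P.flux y‖ with h | h
  · have h1 := main _ _ h
    rw [g_smul_flux, g_smul_flux, ← K_norm] at h1
    exact (mul_le_mul_of_nonneg_right (min_le_left _ _) (sq_nonneg _)).trans h1
  · have h1 := main _ _ h
    rw [g_smul_flux, g_smul_flux, ← K_norm, norm_sub_rev, ← neg_sub (P.flux y), ← neg_sub y,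
      inner_neg_neg] at h1
    exact (mul_le_mul_of_nonneg_right (min_le_right _ _) (sq_nonneg _)).trans h1

/-- F is the inverse of p ↦ g(‖p‖)p, which is strongly monotone with constant a₀ because g ≥ a₀.
Strong monotonicity of the inverse is cocoercivity of F, hence its Lipschitz bound. -/
theorem mul_sq_norm_flux_sub_le_inner (y z : E) :
    P.coeff 0 * ‖P.flux y - P.flux z‖ ^ 2 ≤ inner ℝ (P.flux y - P.flux z) (y - z) := by
  suffices H : ∀ p q : E,
      P.coeff 0 * ‖p - q‖ ^ 2 ≤ inner ℝ (p - q) (P.g ‖p‖ • p - P.g ‖q‖ • q) by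
    simpa only [g_smul_flux] using H (P.flux y) (P.flux z)
  intro p q
  rw [inner_sub_smul_sub]
  have h1 := P.coeff_zero_le_g (norm_nonneg p)
  have h2 := P.coeff_zero_le_g (norm_nonneg q)
  have h3 : 0 ≤ (P.g ‖p‖ - P.g ‖q‖) / 2 * (‖p‖ ^ 2 - ‖q‖ ^ 2) := by
    rcases le_total ‖p‖ ‖q‖ with h | h
    · have h4 : P.g ‖p‖ ≤ P.g ‖q‖ := P.g_monotoneOn (norm_nonneg _) (norm_nonneg _) h
      refine mul_nonneg_of_nonpos_of_nonpos (by linarith) ?_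
      have := pow_le_pow_left₀ (norm_nonneg p) h 2
      linarith
    · have h4 : P.g ‖q‖ ≤ P.g ‖p‖ := P.g_monotoneOn (norm_nonneg _) (norm_nonneg _) h
      refine mul_nonneg (by linarith) ?_
      have := pow_le_pow_left₀ (norm_nonneg q) h 2
      linarith
  have h5 : P.coeff 0 * ‖p - q‖ ^ 2 ≤ (P.g ‖p‖ + P.g ‖q‖) / 2 * ‖p - q‖ ^ 2 :=
    mul_le_mul_of_nonneg_right (by linarith) (sq_nonneg _)
  linarith

theorem norm_flux_sub_le (y z : E) : ‖P.flux y - P.flux z‖ ≤ (P.coeff 0)⁻¹ * ‖y - z‖ := by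
  have h := P.mul_sq_norm_flux_sub_le_inner y z
  have h2 := real_inner_le_norm (P.flux y - P.flux z) (y - z)
  have hc := P.coeff_zero_pos
  rw [← div_eq_inv_mul, le_div_iff₀ hc]
  rcases (norm_nonneg (P.flux y - P.flux z)).eq_or_lt with h0 | h0
  · rw [← h0]
    simp
  · refine le_of_mul_le_mul_left ?_ h0
    nlinarith

theorem lipschitzWith_flux : LipschitzWith (P.coeff 0)⁻¹.toNNReal (P.flux : E → E) :=
  LipschitzWith.of_dist_le_mul fun y z => by
    rw [dist_eq_norm, dist_eq_norm, Real.coe_toNNReal _ (inv_nonneg.2 P.coeff_zero_pos.le)]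
    exact P.norm_flux_sub_le y z

theorem monotone_root : Monotone P.root := by
  intro ξ η h
  by_cases hξ : 0 ≤ ξ
  · exact P.root_mono hξ h
  · rw [root, dif_neg hξ]
    by_cases hη : 0 ≤ η
    · exact P.root_nonneg hη
    · rw [root, dif_neg hη]

/-- The potential of the flux. -/
def potential (y : E) : ℝ := ∫ t in (0 : ℝ)..‖y‖, P.root t

/-- The primitive of a nondecreasing function is convex and lies above its tangents. -/
theorem root_mul_sub_le {ξ η : ℝ} :
    P.root η * (ξ - η) ≤ (∫ t in (0 : ℝ)..ξ, P.root t) - ∫ t in (0 : ℝ)..η, P.root t := by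
  have hint : ∀ u v : ℝ, IntervalIntegrable P.root volume u v :=
    fun u v => P.monotone_root.intervalIntegrable
  rw [intervalIntegral.integral_interval_sub_left (hint _ _) (hint _ _)]
  rcases le_total η ξ with h | h
  · have := intervalIntegral.integral_mono_on h (intervalIntegrable_const (c := P.root η))
      (hint η ξ) fun x hx => P.monotone_root hx.1
    rw [intervalIntegral.integral_const, smul_eq_mul] at this
    linarith
  · have := intervalIntegral.integral_mono_on h (hint ξ η)
      (intervalIntegrable_const (c := P.root η)) fun x hx => P.monotone_root hx.2
    rw [intervalIntegral.integral_const, smul_eq_mul] at this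
    rw [intervalIntegral.integral_symm]
    linarith

/-- Subgradient inequality: reduce to the radial one by Cauchy–Schwarz, using ‖F(z)‖ = s(‖z‖). -/
theorem inner_flux_le (y z : E) :
    inner ℝ (P.flux z) (y - z) ≤ P.potential y - P.potential z := by
  have h1 := P.root_mul_sub_le (ξ := ‖y‖) (η := ‖z‖)
  have h2 := real_inner_le_norm (P.flux z) y
  rw [norm_flux] at h2
  rw [inner_sub_right, inner_flux_self]
  unfold potential
  linarith

theorem potential_zero : P.potential (0 : E) = 0 := by simp [potential]

theorem potential_nonneg (y : E) : 0 ≤ P.potential y := by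
  have := P.inner_flux_le y 0
  simpa [flux_zero, potential_zero] using this

theorem potential_le_inner (y : E) : P.potential y ≤ inner ℝ (P.flux y) y := by
  have := P.inner_flux_le 0 y
  rw [zero_sub, inner_neg_right, potential_zero] at this
  linarith

/-- The subgradient inequalities at y and at z place the Taylor remainder between 0 and ⟨F(y) -
F(z), y - z⟩, which is quadratic by the Lipschitz bound. -/
theorem potential_sub_le (y z : E) :
    |P.potential y - P.potential z - inner ℝ (P.flux z) (y - z)|
      ≤ (P.coeff 0)⁻¹ * ‖y - z‖ ^ 2 := by
  have h1 := P.inner_flux_le y z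
  have h2 := P.inner_flux_le z y
  have h3 := real_inner_le_norm (P.flux y - P.flux z) (y - z)
  have h4 := mul_le_mul_of_nonneg_right (P.norm_flux_sub_le y z) (norm_nonneg (y - z))
  rw [inner_sub_left] at h3
  rw [← neg_sub y z, inner_neg_right] at h2
  rw [abs_of_nonneg (by linarith)]
  nlinarith

theorem continuous_potential : Continuous (P.potential : E → ℝ) :=
  (intervalIntegral.continuous_primitive
    (fun _ _ => P.monotone_root.intervalIntegrable) 0).comp continuous_norm

theorem rpow_β_le_inner :
    ∃ C, 0 < C ∧ ∀ y : E, ‖y‖ ^ P.β ≤ C * (1 + inner ℝ (P.flux y) y) := by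
  obtain ⟨C, hC, h⟩ := P.rpow_β_le
  exact ⟨C, hC, fun y => by simpa [inner_flux_self] using h ‖y‖ (norm_nonneg _)⟩

/-- Monotonicity of s gives Φ(y) ≥ (‖y‖/2) s(‖y‖/2), so the bound follows from the scalar one at
half the argument. -/
theorem rpow_β_le_potential :
    ∃ C, 0 < C ∧ ∀ y : E, ‖y‖ ^ P.β ≤ C * (1 + P.potential y) := by
  obtain ⟨C, hC, h⟩ := P.rpow_β_le
  refine ⟨2 ^ P.β * C, by positivity, fun y => ?_⟩
  have h1 := h (‖y‖ / 2) (by positivity)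
  have h2 := P.root_mul_sub_le (ξ := ‖y‖) (η := ‖y‖ / 2)
  have h3 := P.root_mul_sub_le (ξ := ‖y‖ / 2) (η := 0)
  rw [P.root_zero, intervalIntegral.integral_same] at h3
  have h4 : ‖y‖ / 2 * P.root (‖y‖ / 2) ≤ P.potential y := by
    unfold potential
    linarith
  rw [Real.div_rpow (norm_nonneg _) (by norm_num), div_le_iff₀ (by positivity)] at h1
  have h5 : C * (1 + ‖y‖ / 2 * P.root (‖y‖ / 2)) ≤ C * (1 + P.potential y) :=
    mul_le_mul_of_nonneg_left (by linarith) hC.le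
  have h6 := mul_le_mul_of_nonneg_right h5 (show (0 : ℝ) ≤ 2 ^ P.β by positivity)
  linarith

theorem potential_le :
    ∃ C, 0 < C ∧ ∀ y : E, P.potential y ≤ C * ‖y‖ ^ P.β := by
  obtain ⟨C, hC, h⟩ := P.root_le
  refine ⟨C, hC, fun y => (P.potential_le_inner y).trans ?_⟩
  rw [inner_flux_self, show P.β = (1 - P.a) + 1 by unfold β; ring,
    Real.rpow_add_one' (norm_nonneg _) (by have := P.a_lt_one; linarith)]
  have := mul_le_mul_of_nonneg_left (h ‖y‖ (norm_nonneg _)) (norm_nonneg y)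
  linarith

end Flux

/-! ### Young's inequalities with the exponents of the problem. -/

theorem holderConjugate_β_lam : P.β.HolderConjugate P.lam := by
  rw [Real.holderConjugate_iff]
  refine ⟨P.one_lt_β, ?_⟩
  have h1 := P.a_lt_one
  have h2 : (2 - P.a) ≠ 0 := by linarith
  have h3 : (1 - P.a) ≠ 0 := by linarith
  unfold β lam
  field_simp
  ring

/-- The small factor is obtained by applying Young's inequality to ε^(1/β) y and ε^(-1/β) x. -/
theorem young_β {ε : ℝ} (hε : 0 < ε) :
    ∃ C, 0 < C ∧ ∀ x y : ℝ, 0 ≤ x → 0 ≤ y → x * y ≤ ε * y ^ P.β + C * x ^ P.lam := by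
  set δ := ε ^ (1 / P.β) with hδ
  have hδ0 : 0 < δ := by positivity
  have hβ := P.β_pos
  have hlam : 0 < P.lam := by have := P.two_lt_lam; linarith
  refine ⟨(δ⁻¹) ^ P.lam, by positivity, fun x y hx hy => ?_⟩
  have h := Real.young_inequality_of_nonneg (a := δ * y) (b := δ⁻¹ * x) (by positivity)
    (by positivity) P.holderConjugate_β_lam
  rw [Real.mul_rpow hδ0.le hy, Real.mul_rpow (by positivity) hx, hδ, ← Real.rpow_mul hε.le,
    one_div_mul_cancel hβ.ne', Real.rpow_one, ← hδ] at h
  have h1 : ε * y ^ P.β / P.β ≤ ε * y ^ P.β :=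
    div_le_self (by positivity) P.one_lt_β.le
  have h2 : δ⁻¹ ^ P.lam * x ^ P.lam / P.lam ≤ δ⁻¹ ^ P.lam * x ^ P.lam :=
    div_le_self (by positivity) (by have := P.two_lt_lam; linarith)
  have h3 : δ * y * (δ⁻¹ * x) = x * y := by field_simp
  linarith

/-- Young's inequality with the conjugate pair λ/2 and β/a. It pays for dividing by the degenerate
weight K. -/
theorem sq_mul_rpow_a_le {x ξ : ℝ} (hx : 0 ≤ x) (hξ : 0 ≤ ξ) :
    x ^ 2 * ξ ^ P.a ≤ x ^ P.lam + ξ ^ P.β := by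
  have ha := P.a_pos
  have h1 := P.a_lt_one
  have hpq : (P.lam / 2).HolderConjugate (P.β / P.a) := by
    rw [Real.holderConjugate_iff]
    have h2 : (2 - P.a) ≠ 0 := by linarith
    have h3 : (1 - P.a) ≠ 0 := by linarith
    refine ⟨by have := P.two_lt_lam; linarith, ?_⟩
    unfold β lam
    field_simp
    ring
  have h := Real.young_inequality_of_nonneg (a := x ^ 2) (b := ξ ^ P.a) (by positivity)
    (by positivity) hpq
  rw [← Real.rpow_natCast, ← Real.rpow_mul hx, ← Real.rpow_mul hξ] at h
  rw [show ((2 : ℕ) : ℝ) * (P.lam / 2) = P.lam by push_cast; ring,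
    show P.a * (P.β / P.a) = P.β by field_simp, Real.rpow_natCast] at h
  have h4 : x ^ P.lam / (P.lam / 2) ≤ x ^ P.lam :=
    div_le_self (by positivity) (hpq.lt.le)
  have h5 : ξ ^ P.β / (P.β / P.a) ≤ ξ ^ P.β :=
    div_le_self (by positivity) (hpq.symm.lt.le)
  linarith

theorem sq_le_one_add_rpow_lam {x : ℝ} (hx : 0 ≤ x) : x ^ 2 ≤ 1 + x ^ P.lam := by
  have h0 : 0 ≤ x ^ P.lam := Real.rpow_nonneg hx _
  rcases le_total x 1 with h | h
  · nlinarith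
  · have := Real.rpow_le_rpow_of_exponent_le h P.two_lt_lam.le
    rw [Real.rpow_two] at this
    linarith

end GenPoly

end Forchheimer

end

/-! ### Energy functionals on L² and absorption of boundary terms. -/

noncomputable section

namespace Forchheimer

namespace GenPoly

variable (P : GenPoly)

section L2

set_option linter.unusedSectionVars false

variable {X : Type*} [MeasurableSpace X] {μ : Measure X} [IsFiniteMeasure μ]
  {E : Type*} [NormedAddCommGroup E] [InnerProductSpace ℝ E]

/-- The flux as a map on `L²`. -/
def fluxL2 (v : Lp E 2 μ) : Lp E 2 μ := P.lipschitzWith_flux.compLp P.flux_zero v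

theorem coeFn_fluxL2 (v : Lp E 2 μ) : P.fluxL2 v =ᵐ[μ] fun x => P.flux (v x) :=
  P.lipschitzWith_flux.coeFn_compLp P.flux_zero v

theorem continuous_fluxL2 : Continuous (P.fluxL2 : Lp E 2 μ → Lp E 2 μ) :=
  P.lipschitzWith_flux.continuous_compLp P.flux_zero

theorem integrable_sq_norm (v : Lp E 2 μ) : Integrable (fun x => ‖v x‖ ^ 2) μ :=
  (memLp_two_iff_integrable_sq_norm (Lp.memLp v).1).1 (Lp.memLp v)

theorem integral_sq_norm (v : Lp E 2 μ) : ∫ x, ‖v x‖ ^ 2 ∂μ = ‖v‖ ^ 2 := by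
  rw [← real_inner_self_eq_norm_sq, L2.inner_def]
  simp

theorem integrable_norm (v : Lp E 2 μ) : Integrable (fun x => ‖v x‖) μ :=
  ((Lp.memLp v).integrable one_le_two).norm

theorem integrable_norm_rpow_β (v : Lp E 2 μ) : Integrable (fun x => ‖v x‖ ^ P.β) μ := by
  refine Integrable.mono' ((integrable_const (1 : ℝ)).add (integrable_sq_norm v)) ?_ ?_
  · exact ((Real.continuous_rpow_const P.β_pos.le).comp continuous_norm).comp_aestronglyMeasurable
      (Lp.aestronglyMeasurable v)
  · refine ae_of_all _ fun x => ?_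
    rw [Real.norm_of_nonneg (Real.rpow_nonneg (norm_nonneg _) _)]
    simp only [Pi.add_apply]
    rcases le_total ‖v x‖ 1 with h | h
    · have := Real.rpow_le_one (norm_nonneg _) h P.β_pos.le
      nlinarith [sq_nonneg ‖v x‖]
    · have := Real.rpow_le_rpow_of_exponent_le h P.β_lt_two.le
      rw [Real.rpow_two] at this
      linarith

/-- The modular `∫ |v|^β`. -/
def modular (v : Lp E 2 μ) : ℝ := ∫ x, ‖v x‖ ^ P.β ∂μ

/-- The dissipation `∫ K(|v|) |v|²`. -/
def dissipation (v : Lp E 2 μ) : ℝ := inner ℝ (P.fluxL2 v) v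

/-- The energy `∫ Φ(v)`, `Φ` the potential of the flux. -/
def energy (v : Lp E 2 μ) : ℝ := ∫ x, P.potential (v x) ∂μ

theorem inner_fluxL2 (v w : Lp E 2 μ) :
    inner ℝ (P.fluxL2 v) w = ∫ x, inner ℝ (P.flux (v x)) (w x) ∂μ := by
  rw [L2.inner_def]
  refine integral_congr_ae ?_
  filter_upwards [P.coeFn_fluxL2 v] with x hx
  rw [hx]

theorem integrable_inner_flux (v w : Lp E 2 μ) :
    Integrable (fun x => inner ℝ (P.flux (v x)) (w x)) μ := by
  refine (L2.integrable_inner (𝕜 := ℝ) (P.fluxL2 v) w).congr ?_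
  filter_upwards [P.coeFn_fluxL2 v] with x hx
  rw [hx]

theorem integrable_potential (v : Lp E 2 μ) : Integrable (fun x => P.potential (v x)) μ := by
  refine Integrable.mono' (P.integrable_inner_flux v v) ?_ ?_
  · exact P.continuous_potential.comp_aestronglyMeasurable (Lp.aestronglyMeasurable v)
  · refine ae_of_all _ fun x => ?_
    rw [Real.norm_of_nonneg (P.potential_nonneg _)]
    exact P.potential_le_inner _

theorem modular_nonneg (v : Lp E 2 μ) : 0 ≤ P.modular v :=
  integral_nonneg fun _ => Real.rpow_nonneg (norm_nonneg _) _

theorem energy_nonneg (v : Lp E 2 μ) : 0 ≤ P.energy v :=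
  integral_nonneg fun _ => P.potential_nonneg _

theorem energy_le_dissipation (v : Lp E 2 μ) : P.energy v ≤ P.dissipation v := by
  rw [dissipation, inner_fluxL2]
  exact integral_mono (P.integrable_potential v) (P.integrable_inner_flux v v)
    fun x => P.potential_le_inner _

theorem dissipation_nonneg (v : Lp E 2 μ) : 0 ≤ P.dissipation v :=
  (P.energy_nonneg v).trans (P.energy_le_dissipation v)

theorem continuous_dissipation : Continuous (P.dissipation : Lp E 2 μ → ℝ) :=
  P.continuous_fluxL2.inner continuous_id

variable (μ E) in
theorem modular_le_dissipation :
    ∃ C, 0 < C ∧ ∀ v : Lp E 2 μ, P.modular v ≤ C * (1 + P.dissipation v) := by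
  obtain ⟨C, hC, h⟩ := P.rpow_β_le_inner (E := E)
  refine ⟨C * (1 + μ.real univ), by positivity, fun v => ?_⟩
  have h1 : P.modular v ≤ ∫ x, C * (1 + inner ℝ (P.flux (v x)) (v x)) ∂μ :=
    integral_mono (P.integrable_norm_rpow_β v)
      (((integrable_const _).add (P.integrable_inner_flux v v)).const_mul C) fun x => h _
  rw [integral_const_mul, integral_add (integrable_const _) (P.integrable_inner_flux v v),
    integral_const, smul_eq_mul, mul_one, ← inner_fluxL2] at h1
  have h2 := P.dissipation_nonneg v
  refine h1.trans ?_
  rw [mul_assoc]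
  refine mul_le_mul_of_nonneg_left ?_ hC.le
  have : 0 ≤ μ.real univ * P.dissipation v := by positivity
  unfold dissipation at *
  linarith

variable (μ E) in
-- Counterpart of `modular_le_dissipation` for the second energy estimate, where the Lyapunov
-- functional contains the potential rather than the dissipation.
theorem modular_le_energy :
    ∃ C, 0 < C ∧ ∀ v : Lp E 2 μ, P.modular v ≤ C * (1 + P.energy v) := by
  obtain ⟨C, hC, h⟩ := P.rpow_β_le_potential (E := E)
  refine ⟨C * (1 + μ.real univ), by positivity, fun v => ?_⟩
  have h1 : P.modular v ≤ ∫ x, C * (1 + P.potential (v x)) ∂μ :=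
    integral_mono (P.integrable_norm_rpow_β v)
      (((integrable_const _).add (P.integrable_potential v)).const_mul C) fun x => h _
  rw [integral_const_mul, integral_add (integrable_const _) (P.integrable_potential v),
    integral_const, smul_eq_mul, mul_one] at h1
  have h2 := P.energy_nonneg v
  refine h1.trans ?_
  rw [mul_assoc]
  refine mul_le_mul_of_nonneg_left ?_ hC.le
  have : 0 ≤ μ.real univ * P.energy v := by positivity
  unfold energy at *
  linarith

variable (μ E) in
theorem energy_le_modular : ∃ C, 0 < C ∧ ∀ v : Lp E 2 μ, P.energy v ≤ C * P.modular v := by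
  obtain ⟨C, hC, h⟩ := P.potential_le (E := E)
  refine ⟨C, hC, fun v => ?_⟩
  rw [modular, ← integral_const_mul]
  exact integral_mono (P.integrable_potential v) ((P.integrable_norm_rpow_β v).const_mul C)
    fun x => h _

/-- The pointwise Taylor remainder is at most a constant times ‖w - v‖², so its integral is O of the
squared L² norm. -/
theorem hasFDerivAt_energy (v : Lp E 2 μ) :
    HasFDerivAt (P.energy : Lp E 2 μ → ℝ) (innerSL ℝ (P.fluxL2 v)) v := by
  have hb : ∀ w : Lp E 2 μ, |P.energy w - P.energy v - inner ℝ (P.fluxL2 v) (w - v)|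
      ≤ (P.coeff 0)⁻¹ * ‖w - v‖ ^ 2 := by
    intro w
    have e : P.energy w - P.energy v - inner ℝ (P.fluxL2 v) (w - v)
        = ∫ x, (P.potential (w x) - P.potential (v x)
            - inner ℝ (P.flux (v x)) ((w - v : Lp E 2 μ) x)) ∂μ := by
      have hi : Integrable (fun x => P.potential (w x) - P.potential (v x)) μ :=
        (P.integrable_potential w).sub (P.integrable_potential v)
      rw [integral_sub hi (P.integrable_inner_flux v _), integral_sub (P.integrable_potential w)
        (P.integrable_potential v), inner_fluxL2]
      rfl
    rw [e, ← integral_sq_norm, ← integral_const_mul]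
    refine (abs_integral_le_integral_abs).trans (integral_mono_ae ?_ ?_ ?_)
    · exact (((P.integrable_potential w).sub (P.integrable_potential v)).sub
        (P.integrable_inner_flux v _)).abs
    · exact (integrable_sq_norm _).const_mul _
    · filter_upwards [Lp.coeFn_sub w v] with x hx
      rw [hx]
      exact P.potential_sub_le _ _
  refine HasFDerivAt.of_isLittleO ?_
  have h1 : (fun w : Lp E 2 μ => P.energy w - P.energy v - innerSL ℝ (P.fluxL2 v) (w - v))
      =O[𝓝 v] fun w => ‖w - v‖ ^ 2 := by
    refine Asymptotics.IsBigO.of_bound (P.coeff 0)⁻¹ (Eventually.of_forall fun w => ?_)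
    rw [Real.norm_eq_abs, innerSL_apply_apply, Real.norm_of_nonneg (sq_nonneg _)]
    exact hb w
  refine h1.trans_isLittleO ?_
  have h2 : Tendsto (fun w : Lp E 2 μ => w - v) (𝓝 v) (𝓝 0) :=
    tendsto_sub_nhds_zero_iff.2 tendsto_id
  exact ((Asymptotics.isLittleO_norm_pow_id one_lt_two).comp_tendsto h2)

theorem continuous_energy : Continuous (P.energy : Lp E 2 μ → ℝ) :=
  continuous_iff_continuousAt.2 fun v => (P.hasFDerivAt_energy v).continuousAt

/-- Young's inequality for boundary terms, after a trace inequality. -/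
theorem boundary_young (μ : Measure X) [IsFiniteMeasure μ] (E : Type*) [NormedAddCommGroup E]
    [InnerProductSpace ℝ E] {κ ε : ℝ} (hκ : 0 ≤ κ) (hε : 0 < ε) :
    ∃ C, 0 < C ∧ ∀ (s : ℝ) (u : Lp ℝ 2 μ) (v : Lp E 2 μ), 0 ≤ s →
      κ * s * ((∫ x, ‖u x‖ ∂μ) + ∫ x, ‖v x‖ ∂μ)
        ≤ ε * P.modular v + ‖u‖ ^ 2 + C * (1 + s ^ P.lam) := by
  obtain ⟨C, hC, h⟩ := P.young_β hε
  set m := μ.real univ with hm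
  -- The first summand pays for the term in u, the second for the term in v, and 1 ensures
  -- positivity.
  refine ⟨κ ^ 2 * m + C * κ ^ P.lam * m + 1, by positivity, fun s u v hs => ?_⟩
  have hv : κ * s * ∫ x, ‖v x‖ ∂μ ≤ ε * P.modular v + C * (κ * s) ^ P.lam * m := by
    rw [modular, ← integral_const_mul, ← integral_const_mul, mul_comm _ m,
      ← smul_eq_mul m, hm, ← integral_const (μ := μ),
      ← integral_add ((P.integrable_norm_rpow_β v).const_mul _) (integrable_const _)]
    exact integral_mono ((integrable_norm v).const_mul _)
      (((P.integrable_norm_rpow_β v).const_mul _).add (integrable_const _))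
      fun x => h _ _ (by positivity) (norm_nonneg _)
  have hu : κ * s * ∫ x, ‖u x‖ ∂μ ≤ ‖u‖ ^ 2 + κ ^ 2 * s ^ 2 * m := by
    rw [← integral_sq_norm, ← integral_const_mul, mul_comm _ m, ← smul_eq_mul m, hm,
      ← integral_const (μ := μ), ← integral_add (integrable_sq_norm u) (integrable_const _)]
    refine integral_mono ((integrable_norm u).const_mul _)
      ((integrable_sq_norm u).add (integrable_const _)) fun x => ?_
    simp only
    nlinarith [sq_nonneg (‖u x‖ - κ * s), mul_nonneg (mul_nonneg hκ hs) (norm_nonneg (u x))]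
  have hs2 := P.sq_le_one_add_rpow_lam hs
  rw [Real.mul_rpow hκ hs] at hv
  have hsl : 0 ≤ s ^ P.lam := Real.rpow_nonneg hs _
  have hm0 : 0 ≤ m := measureReal_nonneg
  have t1 : κ ^ 2 * s ^ 2 * m ≤ κ ^ 2 * m * (1 + s ^ P.lam) := by
    rw [mul_right_comm]
    exact mul_le_mul_of_nonneg_left hs2 (by positivity)
  have t2 : 0 ≤ C * κ ^ P.lam * m := by positivity
  nlinarith

/-- Young's inequality for boundary terms of differences, using the degenerate monotonicity of the
flux. -/
theorem boundary_young_sub (μ : Measure X) [IsFiniteMeasure μ] (E : Type*) [NormedAddCommGroup E]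
    [InnerProductSpace ℝ E] {κ : ℝ} (hκ : 0 ≤ κ) :
    ∃ C, 0 < C ∧ ∀ (s τ : ℝ) (u : Lp ℝ 2 μ) (v w : Lp E 2 μ), 0 ≤ s → 0 < τ →
      κ * s * ((∫ x, ‖u x‖ ∂μ) + ∫ x, ‖(τ⁻¹ • (v - w) : Lp E 2 μ) x‖ ∂μ)
        ≤ (τ⁻¹) ^ 2 * inner ℝ (P.fluxL2 v - P.fluxL2 w) (v - w) + ‖u‖ ^ 2
          + C * (1 + s ^ P.lam + P.modular v + P.modular w) := by
  obtain ⟨C, hC, h⟩ := P.inv_K_le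
  set m := μ.real univ with hm
  set c := 4 * (1 + P.deg) with hc
  have hc0 : 0 < c := by have := P.deg_pos; positivity
  set C' := c * κ ^ 2 * C with hC'
  have hC'0 : 0 ≤ C' := by positivity
  refine ⟨κ ^ 2 * m + C' * (4 * m + 1) + 1, by positivity, fun s τ u v w hs hτ => ?_⟩
  have hsl : 0 ≤ s ^ P.lam := Real.rpow_nonneg hs _
  have hm0 : 0 ≤ m := measureReal_nonneg
  have hs2 := P.sq_le_one_add_rpow_lam hs
  have hpt : ∀ y z : E, κ * s * (τ⁻¹ * ‖y - z‖)
      ≤ (τ⁻¹) ^ 2 * inner ℝ (P.flux y - P.flux z) (y - z)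
        + C' * (4 * (1 + s ^ P.lam) + ‖y‖ ^ P.β + ‖z‖ ^ P.β) := by
    intro y z
    have hmin := P.min_K_mul_le_inner y z
    set k := min (P.K ‖y‖) (P.K ‖z‖) with hk
    have hk0 : 0 < k := lt_min (P.K_pos (norm_nonneg _)) (P.K_pos (norm_nonneg _))
    have hya := P.sq_mul_rpow_a_le hs (norm_nonneg y)
    have hza := P.sq_mul_rpow_a_le hs (norm_nonneg z)
    have hy0 : 0 ≤ ‖y‖ ^ P.a := Real.rpow_nonneg (norm_nonneg _) _
    have hz0 : 0 ≤ ‖z‖ ^ P.a := Real.rpow_nonneg (norm_nonneg _) _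
    have hinv : 1 / k ≤ C * (2 + ‖y‖ ^ P.a + ‖z‖ ^ P.a) := by
      have h1 := h ‖y‖ (norm_nonneg _)
      have h2 := h ‖z‖ (norm_nonneg _)
      rcases min_choice (P.K ‖y‖) (P.K ‖z‖) with e | e
      · rw [hk, e]
        nlinarith
      · rw [hk, e]
        nlinarith
    set A := τ⁻¹ * ‖y - z‖ with hA
    have hI : k * A ^ 2 ≤ c * ((τ⁻¹) ^ 2 * inner ℝ (P.flux y - P.flux z) (y - z)) := by
      rw [hA, mul_pow]
      have := mul_le_mul_of_nonneg_left hmin (sq_nonneg τ⁻¹)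
      linarith
    set I := (τ⁻¹) ^ 2 * inner ℝ (P.flux y - P.flux z) (y - z)
    have h3 : κ * s * A ≤ I + c * (κ * s) ^ 2 * (1 / k) := by
      -- Young's inequality balanced by the local coercivity k. The remainder contains 1/k, which
      -- grows at most like ‖y‖^a + ‖z‖^a, and s² times these powers is controlled by s^λ and the
      -- β-th powers.
      have h5 : κ * s * A ≤ k * A ^ 2 / c + c * (κ * s) ^ 2 * (1 / k) := by
        have e : k * A ^ 2 / c + c * (κ * s) ^ 2 * (1 / k) - κ * s * A
            = ((k * A - c * (κ * s) / 2) ^ 2 + 3 / 4 * (c * (κ * s)) ^ 2) / (c * k) := by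
          field_simp
          ring
        have h6 : 0 ≤ ((k * A - c * (κ * s) / 2) ^ 2 + 3 / 4 * (c * (κ * s)) ^ 2) / (c * k) := by
          positivity
        linarith
      have h4 : k * A ^ 2 / c ≤ I := by
        rw [div_le_iff₀ hc0]
        linarith
      linarith
    have h4 : c * (κ * s) ^ 2 * (1 / k) ≤ C' * (s ^ 2 * (2 + ‖y‖ ^ P.a + ‖z‖ ^ P.a)) := by
      have := mul_le_mul_of_nonneg_left hinv (show 0 ≤ c * (κ * s) ^ 2 by positivity)
      rw [hC']
      linarith
    have h5 := mul_le_mul_of_nonneg_left (show s ^ 2 * (2 + ‖y‖ ^ P.a + ‖z‖ ^ P.a)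
      ≤ 4 * (1 + s ^ P.lam) + ‖y‖ ^ P.β + ‖z‖ ^ P.β by linarith) hC'0
    linarith
  have hv : κ * s * ∫ x, ‖(τ⁻¹ • (v - w) : Lp E 2 μ) x‖ ∂μ
      ≤ (τ⁻¹) ^ 2 * inner ℝ (P.fluxL2 v - P.fluxL2 w) (v - w)
        + C' * (4 * m * (1 + s ^ P.lam) + P.modular v + P.modular w) := by
    have hi1 : Integrable (fun x => inner ℝ (P.flux (v x) - P.flux (w x)) (v x - w x)) μ := by
      refine (L2.integrable_inner (𝕜 := ℝ) (P.fluxL2 v - P.fluxL2 w) (v - w)).congr ?_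
      filter_upwards [P.coeFn_fluxL2 v, P.coeFn_fluxL2 w, Lp.coeFn_sub v w,
        Lp.coeFn_sub (P.fluxL2 v) (P.fluxL2 w)] with x h1 h2 h3 h4
      rw [h3, h4, Pi.sub_apply, Pi.sub_apply, h1, h2]
    have e1 : inner ℝ (P.fluxL2 v - P.fluxL2 w) (v - w)
        = ∫ x, inner ℝ (P.flux (v x) - P.flux (w x)) (v x - w x) ∂μ := by
      rw [L2.inner_def]
      refine integral_congr_ae ?_
      filter_upwards [P.coeFn_fluxL2 v, P.coeFn_fluxL2 w, Lp.coeFn_sub v w,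
        Lp.coeFn_sub (P.fluxL2 v) (P.fluxL2 w)] with x h1 h2 h3 h4
      rw [h3, h4, Pi.sub_apply, Pi.sub_apply, h1, h2]
    have hi2 := P.integrable_norm_rpow_β v
    have hi3 := P.integrable_norm_rpow_β w
    have hi4 : Integrable (fun _ : X => 4 * (1 + s ^ P.lam)) μ := integrable_const _
    have e2 : ∫ x, ((τ⁻¹) ^ 2 * inner ℝ (P.flux (v x) - P.flux (w x)) (v x - w x)
        + C' * (4 * (1 + s ^ P.lam) + ‖v x‖ ^ P.β + ‖w x‖ ^ P.β)) ∂μ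
        = (τ⁻¹) ^ 2 * inner ℝ (P.fluxL2 v - P.fluxL2 w) (v - w)
        + C' * (4 * m * (1 + s ^ P.lam) + P.modular v + P.modular w) := by
      have hi5 : Integrable (fun x => 4 * (1 + s ^ P.lam) + ‖v x‖ ^ P.β) μ := hi4.add hi2
      have hi6 : Integrable (fun x => 4 * (1 + s ^ P.lam) + ‖v x‖ ^ P.β + ‖w x‖ ^ P.β) μ :=
        hi5.add hi3
      rw [integral_add (hi1.const_mul _) (hi6.const_mul _),
        integral_const_mul, integral_const_mul, integral_add hi5 hi3,
        integral_add hi4 hi2, integral_const, e1, smul_eq_mul]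
      unfold modular
      ring
    rw [← e2, ← integral_const_mul]
    refine integral_mono_ae ((integrable_norm _).const_mul _)
      ((hi1.const_mul _).add (((hi4.add hi2).add hi3).const_mul _)) ?_
    filter_upwards [Lp.coeFn_sub v w, Lp.coeFn_smul τ⁻¹ (v - w)] with x h1 h2
    rw [h2, Pi.smul_apply, h1, Pi.sub_apply, norm_smul, Real.norm_of_nonneg (inv_nonneg.2 hτ.le)]
    exact hpt _ _
  have hu : κ * s * ∫ x, ‖u x‖ ∂μ ≤ ‖u‖ ^ 2 + κ ^ 2 * s ^ 2 * m := by
    rw [← integral_sq_norm, ← integral_const_mul, mul_comm _ m, ← smul_eq_mul m, hm,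
      ← integral_const (μ := μ), ← integral_add (integrable_sq_norm u) (integrable_const _)]
    refine integral_mono ((integrable_norm u).const_mul _)
      ((integrable_sq_norm u).add (integrable_const _)) fun x => ?_
    simp only
    nlinarith [sq_nonneg (‖u x‖ - κ * s), mul_nonneg (mul_nonneg hκ hs) (norm_nonneg (u x))]
  have t1 : κ ^ 2 * s ^ 2 * m ≤ κ ^ 2 * m * (1 + s ^ P.lam) := by
    rw [mul_right_comm]
    exact mul_le_mul_of_nonneg_left hs2 (by positivity)
  have hMv := P.modular_nonneg v
  have hMw := P.modular_nonneg w
  have t2 : κ ^ 2 * m * (1 + s ^ P.lam)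
      ≤ κ ^ 2 * m * (1 + s ^ P.lam + P.modular v + P.modular w) :=
    mul_le_mul_of_nonneg_left (by linarith) (by positivity)
  have t3 : C' * (4 * m * (1 + s ^ P.lam) + P.modular v + P.modular w)
      ≤ C' * ((4 * m + 1) * (1 + s ^ P.lam + P.modular v + P.modular w)) := by
    refine mul_le_mul_of_nonneg_left ?_ hC'0
    have : 0 ≤ m * (P.modular v + P.modular w) := by positivity
    nlinarith
  nlinarith

end L2

end GenPoly

end Forchheimer

end

/-! ### One-dimensional tools: Gronwall, sliding windows, difference quotients. -/

noncomputable section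

namespace Forchheimer

/-- A form of Gronwall's inequality which keeps a dissipation term. -/
theorem gronwall_dissipation {T α : ℝ} (hα : 0 ≤ α) {y y' z k : ℝ → ℝ}
    (hy : ContinuousOn y (Icc 0 T)) (hz : ContinuousOn z (Icc 0 T))
    (hk : ContinuousOn k (Icc 0 T)) (hy0 : ∀ t ∈ Icc 0 T, 0 ≤ y t)
    (hz0 : ∀ t ∈ Icc 0 T, 0 ≤ z t) (hk0 : ∀ t ∈ Icc 0 T, 0 ≤ k t)
    (hder : ∀ t ∈ Ioo 0 T, HasDerivAt y (y' t) t)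
    (hle : ∀ t ∈ Ioo 0 T, y' t ≤ -z t + α * y t + k t) {t : ℝ} (ht : t ∈ Icc 0 T) :
    y t + ∫ s in 0..t, z s ≤ Real.exp (α * T) * (y 0 + ∫ s in 0..T, k s) := by
  have hexp : Continuous fun s : ℝ => Real.exp (-(α * s)) := by fun_prop
  have hsub : Icc 0 t ⊆ Icc 0 T := Icc_subset_Icc_right ht.2
  have hφ : ContinuousOn (fun s => Real.exp (-(α * s)) * (k s - z s)) (Icc 0 t) :=
    hexp.continuousOn.mul ((hk.mono hsub).sub (hz.mono hsub))
  -- The integrating factor e^(-αs) removes the term αy.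
  have h1 : Real.exp (-(α * t)) * y t - Real.exp (-(α * 0)) * y 0
      ≤ ∫ s in 0..t, Real.exp (-(α * s)) * (k s - z s) :=
    intervalIntegral.sub_le_integral_of_hasDeriv_right_of_le ht.1
    (hexp.continuousOn.mul (hy.mono hsub))
    (g' := fun s => Real.exp (-(α * s)) * (-α) * y s + Real.exp (-(α * s)) * y' s)
    (φ := fun s => Real.exp (-(α * s)) * (k s - z s))
    (fun s hs => by
      have hs' : s ∈ Ioo 0 T := ⟨hs.1, hs.2.trans_le ht.2⟩
      have e : HasDerivAt (fun s : ℝ => Real.exp (-(α * s))) (Real.exp (-(α * s)) * (-α)) s := by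
        have := (((hasDerivAt_id s).const_mul α).neg).exp
        simpa using this
      exact (e.mul (hder s hs')).hasDerivWithinAt)
    (hφ.integrableOn_Icc)
    (fun s hs => by
      have hs' : s ∈ Ioo 0 T := ⟨hs.1, hs.2.trans_le ht.2⟩
      have := mul_le_mul_of_nonneg_left (hle s hs') (Real.exp_pos (-(α * s))).le
      linarith)
  have hT : 0 ≤ T := ht.1.trans ht.2
  have hzi : IntervalIntegrable z volume 0 t :=
    (hz.mono hsub).intervalIntegrable_of_Icc ht.1
  have hki : IntervalIntegrable k volume 0 t :=
    (hk.mono hsub).intervalIntegrable_of_Icc ht.1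
  have hkT : IntervalIntegrable k volume 0 T := hk.intervalIntegrable_of_Icc hT
  -- The factor is bounded above by 1 where it multiplies k and below by its final value where it
  -- multiplies z, so the dissipation survives.
  have h2 : ∫ s in 0..t, Real.exp (-(α * s)) * (k s - z s)
      ≤ ∫ s in 0..t, (k s - Real.exp (-(α * t)) * z s) := by
    refine intervalIntegral.integral_mono_on ht.1
      (hφ.intervalIntegrable_of_Icc ht.1) (hki.sub (hzi.const_mul _)) fun s hs => ?_
    have e1 : Real.exp (-(α * s)) ≤ 1 := Real.exp_le_one_iff.2 (by nlinarith [hs.1])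
    have e2 : Real.exp (-(α * t)) ≤ Real.exp (-(α * s)) :=
      Real.exp_le_exp.2 (by nlinarith [hs.2])
    have := hk0 s (hsub hs)
    have := hz0 s (hsub hs)
    nlinarith
  rw [intervalIntegral.integral_sub hki (hzi.const_mul _), intervalIntegral.integral_const_mul]
    at h2
  have h3 : ∫ s in 0..t, k s ≤ ∫ s in 0..T, k s := by
    refine intervalIntegral.integral_mono_interval le_rfl ht.1 ht.2 ?_ hkT
    filter_upwards [ae_restrict_mem measurableSet_Ioc] with s hs
    exact hk0 s ⟨hs.1.le, hs.2⟩
  simp only [mul_zero, neg_zero, Real.exp_zero, one_mul] at h1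
  have h4 : Real.exp (-(α * t)) * (y t + ∫ s in 0..t, z s) ≤ y 0 + ∫ s in 0..T, k s := by
    linarith
  have h5 : y t + ∫ s in 0..t, z s ≤ Real.exp (α * t) * (y 0 + ∫ s in 0..T, k s) := by
    have := mul_le_mul_of_nonneg_left h4 (Real.exp_pos (α * t)).le
    rwa [← mul_assoc, ← Real.exp_add, add_neg_cancel, Real.exp_zero, one_mul] at this
  refine h5.trans (mul_le_mul_of_nonneg_right
    (Real.exp_le_exp.2 (mul_le_mul_of_nonneg_left ht.2 hα)) ?_)
  have : 0 ≤ ∫ s in 0..T, k s := intervalIntegral.integral_nonneg hT hk0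
  have := hy0 0 ⟨le_rfl, hT⟩
  linarith

/-- Averages over sliding windows: `∫ₛᵗ τ⁻¹ ∫ₓ^{x+τ} G dr dx ≤ ∫ₛ^{t+τ} G`. -/
theorem integral_window_le {s t τ : ℝ} (hst : s ≤ t) (hτ : 0 < τ) {G : ℝ → ℝ}
    (hG : IntervalIntegrable G volume s (t + τ)) (hG0 : ∀ x ∈ Icc s (t + τ), 0 ≤ G x) :
    ∫ x in s..t, τ⁻¹ * ∫ r in x..(x + τ), G r ≤ ∫ r in s..(t + τ), G r := by
  set Γ : ℝ → ℝ := fun x => ∫ r in s..x, G r with hΓ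
  have hsub : ∀ x ∈ Icc s (t + τ), IntervalIntegrable G volume s x := fun x hx =>
    hG.mono_set (by
      rw [uIcc_of_le hx.1, uIcc_of_le (hx.1.trans hx.2)]
      exact Icc_subset_Icc_right hx.2)
  have hcont : ContinuousOn Γ (Icc s (t + τ)) := by
    have := intervalIntegral.continuousOn_primitive_interval' hG left_mem_uIcc
    rwa [uIcc_of_le (by linarith)] at this
  have hle : ∀ x ∈ Icc s (t + τ), Γ x ≤ Γ (t + τ) := by
    intro x hx
    refine intervalIntegral.integral_mono_interval le_rfl hx.1 hx.2 ?_ hG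
    filter_upwards [ae_restrict_mem measurableSet_Ioc] with r hr
    exact hG0 r ⟨hr.1.le, hr.2⟩
  have h0 : ∀ x ∈ Icc s (t + τ), 0 ≤ Γ x := fun x hx =>
    intervalIntegral.integral_nonneg hx.1 fun r hr => hG0 r ⟨hr.1, hr.2.trans hx.2⟩
  have e1 : ∀ x ∈ uIcc s t, τ⁻¹ * ∫ r in x..(x + τ), G r = τ⁻¹ * (Γ (x + τ) - Γ x) := by
    intro x hx
    rw [uIcc_of_le hst] at hx
    rw [hΓ, intervalIntegral.integral_interval_sub_left
      (hsub _ ⟨by linarith [hx.1], by linarith [hx.2]⟩) (hsub _ ⟨hx.1, by linarith [hx.2]⟩)]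
  have hi : ∀ u v, s ≤ u → u ≤ v → v ≤ t + τ → IntervalIntegrable Γ volume u v :=
    fun u v h1 h2 h3 => (hcont.mono (Icc_subset_Icc h1 h3)).intervalIntegrable_of_Icc h2
  -- With the primitive Γ, τ times the left side is the integral of Γ over [t, t+τ] minus that over
  -- [s, s+τ]; the latter is nonnegative and Γ is monotone.
  rw [intervalIntegral.integral_congr e1, intervalIntegral.integral_const_mul,
    intervalIntegral.integral_sub
      (by simpa using (hi (s + τ) (t + τ) (by linarith) (by linarith) le_rfl).comp_add_right τ)
      (hi s t le_rfl hst (by linarith)), intervalIntegral.integral_comp_add_right]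
  have e2 := intervalIntegral.integral_add_adjacent_intervals
    (hi s (s + τ) le_rfl (by linarith) (by linarith))
    (hi (s + τ) (t + τ) (by linarith) (by linarith) le_rfl)
  have e3 := intervalIntegral.integral_add_adjacent_intervals
    (hi s t le_rfl hst (by linarith)) (hi t (t + τ) hst (by linarith) le_rfl)
  have e4 : 0 ≤ ∫ x in s..(s + τ), Γ x :=
    intervalIntegral.integral_nonneg (by linarith) fun x hx => h0 x ⟨hx.1, by linarith [hx.2]⟩
  have e5 : ∫ x in t..(t + τ), Γ x ≤ τ * Γ (t + τ) := by
    have := intervalIntegral.integral_mono_on (show t ≤ t + τ by linarith)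
      (hi t (t + τ) hst (by linarith) le_rfl) (intervalIntegrable_const (c := Γ (t + τ)))
      fun x hx => hle x ⟨hst.trans hx.1, hx.2⟩
    simpa using this
  rw [inv_mul_le_iff₀ hτ]
  linarith

theorem continuousOn_diffQuotient {B : Type*} [NormedAddCommGroup B] [NormedSpace ℝ B]
    {s t τ : ℝ} (hτ : 0 ≤ τ) {F : ℝ → B} (hF : ContinuousOn F (Icc s (t + τ))) :
    ContinuousOn (fun x => τ⁻¹ • (F (x + τ) - F x)) (Icc s t) := by
  have hshift : MapsTo (fun x => x + τ) (Icc s t) (Icc s (t + τ)) :=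
    fun x hx => ⟨by linarith [hx.1], by linarith [hx.2]⟩
  have hadd : ContinuousOn (fun x : ℝ => x + τ) (Icc s t) := by fun_prop
  exact ((hF.comp hadd hshift).sub
    (hF.mono (Icc_subset_Icc_right (by linarith)))).const_smul τ⁻¹

/-- The `L^p` norm of a difference quotient is at most that of the derivative. -/
theorem integral_diffQuotient_rpow_le {B : Type*} [NormedAddCommGroup B] [NormedSpace ℝ B]
    {p s t τ : ℝ} (hp : 1 ≤ p) (hst : s ≤ t) (hτ : 0 < τ) {F F' : ℝ → B}
    (hF : ContinuousOn F (Icc s (t + τ))) (hF' : IntervalIntegrable F' volume s (t + τ))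
    (hF'p : IntervalIntegrable (fun x => ‖F' x‖ ^ p) volume s (t + τ))
    (hFF' : ∀ x ∈ Icc s t, F (x + τ) - F x = ∫ r in x..(x + τ), F' r) :
    ∫ x in s..t, ‖τ⁻¹ • (F (x + τ) - F x)‖ ^ p ≤ ∫ r in s..(t + τ), ‖F' r‖ ^ p := by
  have hsub : ∀ x ∈ Icc s t, uIcc x (x + τ) ⊆ uIcc s (t + τ) := fun x hx => by
    rw [uIcc_of_le (by linarith), uIcc_of_le (by linarith)]
    exact Icc_subset_Icc hx.1 (by linarith [hx.2])
  have hpt : ∀ x ∈ Icc s t, ‖τ⁻¹ • (F (x + τ) - F x)‖ ^ p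
      ≤ τ⁻¹ * ∫ r in x..(x + τ), ‖F' r‖ ^ p := by
    intro x hx
    have hxτ : x ≤ x + τ := by linarith
    have h1 : ‖τ⁻¹ • (F (x + τ) - F x)‖ ≤ τ⁻¹ * ∫ r in x..(x + τ), ‖F' r‖ := by
      rw [hFF' x hx, norm_smul, Real.norm_of_nonneg (inv_nonneg.2 hτ.le)]
      exact mul_le_mul_of_nonneg_left (intervalIntegral.norm_integral_le_integral_norm hxτ)
        (inv_nonneg.2 hτ.le)
    have i1 : IntegrableOn (fun r => ‖F' r‖) (Ioc x (x + τ)) volume :=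
      ((intervalIntegrable_iff_integrableOn_Ioc_of_le hxτ).1 (hF'.mono_set (hsub x hx))).norm
    have i2 : IntegrableOn (fun r => ‖F' r‖ ^ p) (Ioc x (x + τ)) volume :=
      (intervalIntegrable_iff_integrableOn_Ioc_of_le hxτ).1 (hF'p.mono_set (hsub x hx))
    -- Jensen's inequality for the average over a window of length τ.
    have h2 := (convexOn_rpow hp).map_set_average_le
      (Real.continuous_rpow_const (by linarith)).continuousOn isClosed_Ici
      (μ := volume) (t := Ioc x (x + τ)) (f := fun r => ‖F' r‖) (by simp [hτ])
      (by simp) (ae_of_all _ fun r => norm_nonneg _) i1 i2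
    simp only [setAverage_eq, smul_eq_mul, Real.volume_real_Ioc_of_le hxτ,
      add_sub_cancel_left, ← intervalIntegral.integral_of_le hxτ] at h2
    exact (Real.rpow_le_rpow (norm_nonneg _) h1 (by linarith)).trans h2
  have hprim : ContinuousOn (fun x => ∫ r in s..x, ‖F' r‖ ^ p) (Icc s (t + τ)) := by
    have := intervalIntegral.continuousOn_primitive_interval' hF'p left_mem_uIcc
    rwa [uIcc_of_le (by linarith)] at this
  have hshift : MapsTo (fun x => x + τ) (Icc s t) (Icc s (t + τ)) :=
    fun x hx => ⟨by linarith [hx.1], by linarith [hx.2]⟩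
  have hincl : Icc s t ⊆ Icc s (t + τ) := Icc_subset_Icc_right (by linarith)
  have hadd : ContinuousOn (fun x : ℝ => x + τ) (Icc s t) := by fun_prop
  have hR : ContinuousOn (fun x => τ⁻¹ * ∫ r in x..(x + τ), ‖F' r‖ ^ p) (Icc s t) := by
    refine ContinuousOn.congr (f := fun x => τ⁻¹ * ((∫ r in s..(x + τ), ‖F' r‖ ^ p)
      - ∫ r in s..x, ‖F' r‖ ^ p))
      (continuousOn_const.mul ((hprim.comp hadd hshift).sub (hprim.mono hincl))) fun x hx => ?_
    have hi : ∀ u ∈ Icc s (t + τ), IntervalIntegrable (fun x => ‖F' x‖ ^ p) volume s u :=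
      fun u hu => hF'p.mono_set (by
        rw [uIcc_of_le hu.1, uIcc_of_le (hu.1.trans hu.2)]
        exact Icc_subset_Icc_right hu.2)
    simp only
    rw [intervalIntegral.integral_interval_sub_left (hi _ (hshift hx)) (hi _ (hincl hx))]
  have hL : ContinuousOn (fun x => ‖τ⁻¹ • (F (x + τ) - F x)‖ ^ p) (Icc s t) :=
    (continuousOn_diffQuotient hτ.le hF).norm.rpow_const
      fun _ _ => Or.inr (by linarith)
  refine (intervalIntegral.integral_mono_on hst (hL.intervalIntegrable_of_Icc hst)
    (hR.intervalIntegrable_of_Icc hst) hpt).trans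
    (integral_window_le hst hτ hF'p fun x _ => Real.rpow_nonneg (norm_nonneg _) _)

end Forchheimer

end

/-! ### The abstract Galerkin evolution and its time-derivative estimate. -/

noncomputable section

namespace Forchheimer

/-- A finite dimensional (Galerkin) evolution `(u_t, w) + (K(|∇u|)∇u, ∇w) = -ℓ(ψ, w) + (f, w)`,
written in terms of a coefficient vector `c` in a finite dimensional space `V`: `ι` maps
coefficients to functions and `D` maps them to gradients. The boundary functional `ℓ` obeys a trace
inequality with constant `κ`. -/
structure GalerkinFlow (P : GenPoly) {X : Type*} [MeasurableSpace X] (μ : Measure X)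
    (E : Type*) [NormedAddCommGroup E] [InnerProductSpace ℝ E]
    (Y : Type*) [NormedAddCommGroup Y] [NormedSpace ℝ Y]
    (V : Type*) [NormedAddCommGroup V] [NormedSpace ℝ V] (κ T : ℝ) where
  ι : V →L[ℝ] Lp ℝ 2 μ
  D : V →L[ℝ] Lp E 2 μ
  ℓ : Y →L[ℝ] V →L[ℝ] ℝ
  ψ : ℝ → Y
  ψt : ℝ → Y
  f : ℝ → Lp ℝ 2 μ
  ft : ℝ → Lp ℝ 2 μ
  c : ℝ → V
  c' : ℝ → V
  ι_injective : Function.Injective ι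
  trace : ∀ y w, |ℓ y w| ≤ κ * ‖y‖ * ((∫ x, ‖ι w x‖ ∂μ) + ∫ x, ‖D w x‖ ∂μ)
  hasDeriv_ψ : ∀ t ∈ Icc 0 T, HasDerivWithinAt ψ (ψt t) (Icc 0 T) t
  cont_ψt : ContinuousOn ψt (Icc 0 T)
  memLp_ft : MemLp ft 2 (volume.restrict (Ioo 0 T))
  f_eq : ∀ t ∈ Icc 0 T, f t = f 0 + ∫ s in 0..t, ft s
  cont_c : ContinuousOn c (Icc 0 T)
  hasDeriv_c : ∀ t ∈ Ioo 0 T, HasDerivAt c (c' t) t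
  equation : ∀ t ∈ Ioo 0 T, ∀ w,
    inner ℝ (ι (c' t)) (ι w) + inner ℝ (P.fluxL2 (D (c t))) (D w) = -ℓ (ψ t) w + inner ℝ (f t) (ι w)

namespace GalerkinFlow

variable {P : GenPoly} {X : Type*} [MeasurableSpace X] {μ : Measure X} [IsFiniteMeasure μ]
  {E : Type*} [NormedAddCommGroup E] [InnerProductSpace ℝ E]
  {Y : Type*} [NormedAddCommGroup Y] [NormedSpace ℝ Y]
  {V : Type*} [NormedAddCommGroup V] [NormedSpace ℝ V] [FiniteDimensional ℝ V] {κ T : ℝ}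
  (S : GalerkinFlow P μ E Y V κ T)

set_option linter.unusedSectionVars false

/-- `1 + ‖ψ_t‖^λ`. -/
def ht (t : ℝ) : ℝ := 1 + ‖S.ψt t‖ ^ P.lam

/-- `1 + ‖ψ‖^λ + ‖f‖²`. -/
def kt (t : ℝ) : ℝ := 1 + ‖S.ψ t‖ ^ P.lam + ‖S.f t‖ ^ 2

theorem one_le_ht (t : ℝ) : 1 ≤ S.ht t := by
  have : 0 ≤ ‖S.ψt t‖ ^ P.lam := Real.rpow_nonneg (norm_nonneg _) _
  unfold ht
  linarith

theorem one_le_kt (t : ℝ) : 1 ≤ S.kt t := by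
  have : 0 ≤ ‖S.ψ t‖ ^ P.lam := Real.rpow_nonneg (norm_nonneg _) _
  have : 0 ≤ ‖S.f t‖ ^ 2 := by positivity
  unfold kt
  linarith

theorem lam_nonneg : 0 ≤ P.lam := by
  have := P.two_lt_lam
  linarith

theorem integrableOn_ft : IntegrableOn S.ft (Ioo 0 T) :=
  S.memLp_ft.integrable one_le_two

theorem intervalIntegrable_ft {u v : ℝ} (hu : u ∈ Icc 0 T) (hv : v ∈ Icc 0 T) :
    IntervalIntegrable S.ft volume u v := by
  have hT : 0 ≤ T := hu.1.trans hu.2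
  have h : IntervalIntegrable S.ft volume 0 T := by
    rw [intervalIntegrable_iff_integrableOn_Ioo_of_le hT]
    exact S.integrableOn_ft
  refine h.mono_set ?_
  rw [uIcc_of_le hT]
  exact uIcc_subset_Icc hu hv

theorem intervalIntegrable_sq_ft {u v : ℝ} (hu : u ∈ Icc 0 T) (hv : v ∈ Icc 0 T) :
    IntervalIntegrable (fun x => ‖S.ft x‖ ^ (2 : ℝ)) volume u v := by
  have hT : 0 ≤ T := hu.1.trans hu.2
  have h : IntervalIntegrable (fun x => ‖S.ft x‖ ^ (2 : ℝ)) volume 0 T := by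
    rw [intervalIntegrable_iff_integrableOn_Ioo_of_le hT]
    have := S.memLp_ft.integrable_norm_rpow (by simp) (by simp)
    rwa [ENNReal.toReal_ofNat] at this
  refine h.mono_set ?_
  rw [uIcc_of_le hT]
  exact uIcc_subset_Icc hu hv

theorem cont_f : ContinuousOn S.f (Icc 0 T) := by
  rcases lt_or_ge T 0 with h | hT
  · simp [Icc_eq_empty (not_le.2 h)]
  have h1 := intervalIntegral.continuousOn_primitive_interval'
    (S.intervalIntegrable_ft ⟨le_rfl, hT⟩ ⟨hT, le_rfl⟩) left_mem_uIcc
  rw [uIcc_of_le hT] at h1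
  exact (continuousOn_const.add h1).congr fun t ht => S.f_eq t ht

theorem cont_ψ : ContinuousOn S.ψ (Icc 0 T) := fun t ht =>
  (S.hasDeriv_ψ t ht).continuousWithinAt

theorem cont_ht : ContinuousOn S.ht (Icc 0 T) :=
  continuousOn_const.add (S.cont_ψt.norm.rpow_const fun _ _ => Or.inr lam_nonneg)

theorem cont_kt : ContinuousOn S.kt (Icc 0 T) :=
  (continuousOn_const.add (S.cont_ψ.norm.rpow_const fun _ _ => Or.inr lam_nonneg)).add
    (S.cont_f.norm.pow 2)

theorem cont_ι : ContinuousOn (fun t => S.ι (S.c t)) (Icc 0 T) :=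
  S.ι.continuous.comp_continuousOn S.cont_c

theorem cont_D : ContinuousOn (fun t => S.D (S.c t)) (Icc 0 T) :=
  S.D.continuous.comp_continuousOn S.cont_c

theorem cont_sq : ContinuousOn (fun t => ‖S.ι (S.c t)‖ ^ 2) (Icc 0 T) := S.cont_ι.norm.pow 2

theorem cont_dissipation : ContinuousOn (fun t => P.dissipation (S.D (S.c t))) (Icc 0 T) :=
  P.continuous_dissipation.comp_continuousOn S.cont_D

/-- The Gram operator A is injective and so has a continuous left inverse in finite dimension; the
equation writes A c' as a continuous function of time. Continuity makes the integrals of ‖u_t‖²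
below meaningful. -/
theorem cont_c' : ContinuousOn S.c' (Ioo 0 T) := by
  let A : V →ₗ[ℝ] (V →L[ℝ] ℝ) :=
    { toFun := fun v => (innerSL ℝ (S.ι v)).comp S.ι
      map_add' := fun v w => by ext; simp
      map_smul' := fun r v => by ext; simp }
  have hA : LinearMap.ker A = ⊥ := by
    rw [LinearMap.ker_eq_bot']
    intro v hv
    have h1 : inner ℝ (S.ι v) (S.ι v) = 0 := by
      have := congrArg (fun L : V →L[ℝ] ℝ => L v) hv
      simpa [A] using this
    rw [inner_self_eq_zero] at h1
    exact S.ι_injective (by rw [h1, map_zero])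
  obtain ⟨B, hB⟩ := A.exists_leftInverse_of_injective hA
  have hBc : Continuous B := LinearMap.continuous_of_finiteDimensional B
  have h1 : ContinuousOn (fun t => -(innerSL ℝ (P.fluxL2 (S.D (S.c t)))).comp S.D - S.ℓ (S.ψ t)
      + (innerSL ℝ (S.f t)).comp S.ι) (Ioo 0 T) := by
    have hs : Ioo 0 T ⊆ Icc 0 T := Ioo_subset_Icc_self
    have e1 := (innerSL ℝ).continuous.comp_continuousOn
      (P.continuous_fluxL2.comp_continuousOn (S.cont_D.mono hs))
    have e2 := S.ℓ.continuous.comp_continuousOn (S.cont_ψ.mono hs)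
    have e3 := (innerSL ℝ).continuous.comp_continuousOn (S.cont_f.mono hs)
    exact ((e1.clm_comp continuousOn_const).neg.sub e2).add (e3.clm_comp continuousOn_const)
  refine (hBc.comp_continuousOn h1).congr fun t ht => ?_
  have e : A (S.c' t) = -(innerSL ℝ (P.fluxL2 (S.D (S.c t)))).comp S.D - S.ℓ (S.ψ t)
      + (innerSL ℝ (S.f t)).comp S.ι := by
    ext w
    have := S.equation t ht w
    simp [A]
    linarith
  have := congrArg (fun L : V →ₗ[ℝ] V => L (S.c' t)) hB
  simp only [LinearMap.comp_apply, LinearMap.id_apply] at this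
  rw [Function.comp_apply, ← e, this]

theorem cont_ι' : ContinuousOn (fun t => S.ι (S.c' t)) (Ioo 0 T) :=
  S.ι.continuous.comp_continuousOn S.cont_c'

theorem hasDeriv_ι {t : ℝ} (ht : t ∈ Ioo 0 T) :
    HasDerivAt (fun t => S.ι (S.c t)) (S.ι (S.c' t)) t :=
  S.ι.hasFDerivAt.comp_hasDerivAt t (S.hasDeriv_c t ht)

theorem hasDeriv_energy {t : ℝ} (ht : t ∈ Ioo 0 T) :
    HasDerivAt (fun t => P.energy (S.D (S.c t)))
      (inner ℝ (P.fluxL2 (S.D (S.c t))) (S.D (S.c' t))) t :=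
  (P.hasFDerivAt_energy _).comp_hasDerivAt t (S.D.hasFDerivAt.comp_hasDerivAt t (S.hasDeriv_c t ht))

theorem hasDeriv_bdry {t : ℝ} (ht : t ∈ Ioo 0 T) :
    HasDerivAt (fun t => S.ℓ (S.ψ t) (S.c t))
      (S.ℓ (S.ψt t) (S.c t) + S.ℓ (S.ψ t) (S.c' t)) t :=
  (S.ℓ.hasFDerivAt.comp_hasDerivAt t ((S.hasDeriv_ψ t (Ioo_subset_Icc_self ht)).hasDerivAt
    (Icc_mem_nhds ht.1 ht.2))).clm_apply (S.hasDeriv_c t ht)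

variable {C₀ C₁ C₂ C₃ : ℝ}

/-- Q is either the dissipation or the energy; both dominate the modular. The weight 1/(2C₀) in
Young's inequality leaves the factor 1/2 in front of Q, which the estimates can absorb. -/
theorem abs_bdry_le (hC₀ : 0 < C₀) {Q : Lp E 2 μ → ℝ}
    (h0 : ∀ v : Lp E 2 μ, P.modular v ≤ C₀ * (1 + Q v))
    (h1 : ∀ (s : ℝ) (u : Lp ℝ 2 μ) (v : Lp E 2 μ), 0 ≤ s →
      κ * s * ((∫ x, ‖u x‖ ∂μ) + ∫ x, ‖v x‖ ∂μ)
        ≤ 1 / (2 * C₀) * P.modular v + ‖u‖ ^ 2 + C₁ * (1 + s ^ P.lam)) (y : Y) (w : V) :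
    |S.ℓ y w| ≤ 1 / 2 * (1 + Q (S.D w)) + ‖S.ι w‖ ^ 2 + C₁ * (1 + ‖y‖ ^ P.lam) := by
  have h2 := S.trace y w
  have h3 := h1 ‖y‖ (S.ι w) (S.D w) (norm_nonneg _)
  have h4 := mul_le_mul_of_nonneg_left (h0 (S.D w)) (show 0 ≤ 1 / (2 * C₀) by positivity)
  have e : 1 / (2 * C₀) * (C₀ * (1 + Q (S.D w))) = 1 / 2 * (1 + Q (S.D w)) := by
    field_simp
  linarith

/-- The bound of the basic energy estimate. -/
def basicBound (C₁ : ℝ) : ℝ :=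
  Real.exp (3 * T) * (‖S.ι (S.c 0)‖ ^ 2 + ∫ s in 0..T, (2 * C₁ + 1) * S.kt s)

/-- Test with the solution. Twice the boundary term costs one dissipation and 2‖u‖², and 2(f,u)
costs another ‖u‖², which explains the rate 3 in the Gronwall factor. -/
theorem basic_estimate (hC₀ : 0 < C₀) (hC₁ : 0 < C₁)
    (h0 : ∀ v : Lp E 2 μ, P.modular v ≤ C₀ * (1 + P.dissipation v))
    (h1 : ∀ (s : ℝ) (u : Lp ℝ 2 μ) (v : Lp E 2 μ), 0 ≤ s →
      κ * s * ((∫ x, ‖u x‖ ∂μ) + ∫ x, ‖v x‖ ∂μ)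
        ≤ 1 / (2 * C₀) * P.modular v + ‖u‖ ^ 2 + C₁ * (1 + s ^ P.lam)) {t : ℝ}
    (ht : t ∈ Icc 0 T) :
    ‖S.ι (S.c t)‖ ^ 2 + ∫ s in 0..t, P.dissipation (S.D (S.c s)) ≤ S.basicBound C₁ := by
  refine gronwall_dissipation (y := fun t => ‖S.ι (S.c t)‖ ^ 2)
    (y' := fun t => 2 * inner ℝ (S.ι (S.c t)) (S.ι (S.c' t)))
    (z := fun s => P.dissipation (S.D (S.c s))) (k := fun s => (2 * C₁ + 1) * S.kt s)
    (by norm_num) S.cont_sq S.cont_dissipation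
    (continuousOn_const.mul S.cont_kt) (fun _ _ => sq_nonneg _)
    (fun _ _ => P.dissipation_nonneg _) (fun t _ => ?_) (fun t ht => ?_) (fun t ht => ?_) ht
  · have := S.one_le_kt t
    positivity
  · exact (S.hasDeriv_ι ht).norm_sq
  · have e1 := S.equation t ht (S.c t)
    rw [real_inner_comm] at e1
    have e2 := S.abs_bdry_le hC₀ h0 h1 (S.ψ t) (S.c t)
    have e3 := abs_le.1 e2
    have e4 := real_inner_le_norm (S.f t) (S.ι (S.c t))
    have e5 : P.dissipation (S.D (S.c t)) = inner ℝ (P.fluxL2 (S.D (S.c t))) (S.D (S.c t)) := rfl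
    have e6 : 0 ≤ ‖S.ψ t‖ ^ P.lam := Real.rpow_nonneg (norm_nonneg _) _
    have e7 : 0 ≤ C₁ * ‖S.f t‖ ^ 2 := by positivity
    have e8 := sq_nonneg (‖S.f t‖ - ‖S.ι (S.c t)‖)
    unfold kt
    nlinarith

/-- The part of the bound for `∫ ‖u_t‖²` which does not involve the initial energy. -/
def derivBound (C₁ C₂ B : ℝ) : ℝ :=
  2 * (1 + (3 + T) * S.basicBound C₁ + 2 * C₂ * B + (C₁ + 1) * ∫ s in 0..T, (S.ht s + S.kt s))

/-- Test with u_t. Adding ⟨ψ,u⟩ to the energy cancels the boundary pairing with u_t and leaves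
⟨ψ_t,u⟩. At the endpoints ⟨ψ,u⟩ is bounded with half of the energy, which yields the factor 3 on the
initial energy. -/
theorem integral_sq_deriv_le (hC₀ : 0 < C₀) (hC₁ : 0 < C₁) (hC₂ : 0 < C₂)
    (h0 : ∀ v : Lp E 2 μ, P.modular v ≤ C₀ * (1 + P.dissipation v))
    (h1 : ∀ (s : ℝ) (u : Lp ℝ 2 μ) (v : Lp E 2 μ), 0 ≤ s →
      κ * s * ((∫ x, ‖u x‖ ∂μ) + ∫ x, ‖v x‖ ∂μ)
        ≤ 1 / (2 * C₀) * P.modular v + ‖u‖ ^ 2 + C₁ * (1 + s ^ P.lam))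
    {C₀' : ℝ} (hC₀' : 0 < C₀')
    (h0' : ∀ v : Lp E 2 μ, P.modular v ≤ C₀' * (1 + P.energy v))
    (h2 : ∀ (s : ℝ) (u : Lp ℝ 2 μ) (v : Lp E 2 μ), 0 ≤ s →
      κ * s * ((∫ x, ‖u x‖ ∂μ) + ∫ x, ‖v x‖ ∂μ)
        ≤ 1 / (2 * C₀') * P.modular v + ‖u‖ ^ 2 + C₂ * (1 + s ^ P.lam))
    {B : ℝ} (hB : ∀ t ∈ Icc 0 T, 1 + ‖S.ψ t‖ ^ P.lam ≤ B) {s t : ℝ} (hs : 0 < s) (hst : s ≤ t)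
    (htT : t < T) :
    ∫ x in s..t, ‖S.ι (S.c' x)‖ ^ 2 ≤ 3 * P.energy (S.D (S.c 0)) + S.derivBound C₁ C₂ B := by
  have hT : 0 ≤ T := hs.le.trans (hst.trans htT.le)
  set Y₀ := S.basicBound C₁ with hY₀
  have hbasic : ∀ x ∈ Icc 0 T, ‖S.ι (S.c x)‖ ^ 2 ≤ Y₀ := fun x hx => by
    have := S.basic_estimate hC₀ hC₁ h0 h1 hx
    have h3 : 0 ≤ ∫ s in 0..x, P.dissipation (S.D (S.c s)) :=
      intervalIntegral.integral_nonneg hx.1 fun _ _ => P.dissipation_nonneg _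
    linarith
  have hY0 : 0 ≤ Y₀ := (sq_nonneg _).trans (hbasic 0 ⟨le_rfl, hT⟩)
  have hZ : ∫ s in 0..T, P.dissipation (S.D (S.c s)) ≤ Y₀ := by
    have := S.basic_estimate hC₀ hC₁ h0 h1 (t := T) ⟨hT, le_rfl⟩
    have := sq_nonneg ‖S.ι (S.c T)‖
    linarith
  have key : ∀ s, 0 < s → s ≤ t → ∫ x in s..t, ‖S.ι (S.c' x)‖ ^ 2
      ≤ 3 * P.energy (S.D (S.c s)) + S.derivBound C₁ C₂ B := by
    intro s hs hst
    have hIcc : Icc s t ⊆ Ioo 0 T := fun x hx => ⟨hs.trans_le hx.1, hx.2.trans_lt htT⟩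
    have hIcc' : Icc s t ⊆ Icc 0 T := hIcc.trans Ioo_subset_Icc_self
    have cR' : ContinuousOn (fun x => ‖S.ι (S.c' x)‖ ^ 2) (Icc s t) :=
      (S.cont_ι'.mono hIcc).norm.pow 2
    set q : ℝ → ℝ := fun x => 1 / 2 * P.dissipation (S.D (S.c x)) + ‖S.ι (S.c x)‖ ^ 2
      + (C₁ + 1) * (S.ht x + S.kt x) with hq
    have cq : ContinuousOn q (Icc 0 T) :=
      ((continuousOn_const.mul S.cont_dissipation).add S.cont_sq).add
        (continuousOn_const.mul (S.cont_ht.add S.cont_kt))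
    have q0 : ∀ x, 0 ≤ q x := fun x => by
      have h3 := P.dissipation_nonneg (S.D (S.c x))
      have h4 := S.one_le_ht x
      have h5 := S.one_le_kt x
      positivity
    have hder : ∀ x ∈ Ioo 0 T, HasDerivAt
        (fun x => P.energy (S.D (S.c x)) + S.ℓ (S.ψ x) (S.c x))
        (inner ℝ (P.fluxL2 (S.D (S.c x))) (S.D (S.c' x))
          + (S.ℓ (S.ψt x) (S.c x) + S.ℓ (S.ψ x) (S.c' x))) x :=
      fun x hx => (S.hasDeriv_energy hx).add (S.hasDeriv_bdry hx)
    have h3 := intervalIntegral.sub_le_integral_of_hasDeriv_right_of_le hst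
      (fun x hx => (hder x (hIcc hx)).continuousAt.continuousWithinAt)
      (fun x hx => (hder x (hIcc (Ioo_subset_Icc_self hx))).hasDerivWithinAt)
      (φ := fun x => q x - 1 / 2 * ‖S.ι (S.c' x)‖ ^ 2)
      (((cq.mono hIcc').sub (continuousOn_const.mul cR')).integrableOn_Icc)
      (fun x hx => by
        have e1 := S.equation x (hIcc (Ioo_subset_Icc_self hx)) (S.c' x)
        rw [real_inner_self_eq_norm_sq] at e1
        have e2 := (abs_le.1 (S.abs_bdry_le hC₀ h0 h1 (S.ψt x) (S.c x))).2
        have e3 := real_inner_le_norm (S.f x) (S.ι (S.c' x))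
        have e4 : 0 ≤ ‖S.ψ x‖ ^ P.lam := Real.rpow_nonneg (norm_nonneg _) _
        have e5 := S.one_le_ht x
        have e6 := S.one_le_kt x
        have e7 := sq_nonneg (‖S.f x‖ - ‖S.ι (S.c' x)‖)
        have e8 : 0 ≤ C₁ * S.kt x := by positivity
        have e9 : S.kt x = 1 + ‖S.ψ x‖ ^ P.lam + ‖S.f x‖ ^ 2 := rfl
        have e10 : S.ht x = 1 + ‖S.ψt x‖ ^ P.lam := rfl
        rw [← e10] at e2
        simp only [hq]
        nlinarith)
    have iR : IntervalIntegrable (fun x => 1 / 2 * ‖S.ι (S.c' x)‖ ^ 2) volume s t :=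
      (continuousOn_const.mul cR').intervalIntegrable_of_Icc hst
    rw [intervalIntegral.integral_sub ((cq.mono hIcc').intervalIntegrable_of_Icc hst) iR,
      intervalIntegral.integral_const_mul] at h3
    have hsT := hIcc' ⟨le_rfl, hst⟩
    have htT' := hIcc' ⟨hst, le_rfl⟩
    have b1 := (abs_le.1 (S.abs_bdry_le hC₀' h0' h2 (S.ψ t) (S.c t))).1
    have b2 := (abs_le.1 (S.abs_bdry_le hC₀' h0' h2 (S.ψ s) (S.c s))).2
    have b3 := mul_le_mul_of_nonneg_left (hB s hsT) hC₂.le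
    have b4 := mul_le_mul_of_nonneg_left (hB t htT') hC₂.le
    have b5 := P.energy_nonneg (S.D (S.c t))
    have b6 := hbasic s hsT
    have b7 := hbasic t htT'
    have q1 : ∫ x in s..t, q x ≤ ∫ x in 0..T, q x :=
      intervalIntegral.integral_mono_interval hs.le hst htT.le
        (ae_of_all _ q0) (cq.intervalIntegrable_of_Icc hT)
    have q2 : ∫ x in 0..T, q x ≤ 1 / 2 * Y₀ + T * Y₀
        + (C₁ + 1) * ∫ s in 0..T, (S.ht s + S.kt s) := by
      have i1 := (S.cont_dissipation).intervalIntegrable_of_Icc (μ := volume) hT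
      have i2 := (S.cont_sq).intervalIntegrable_of_Icc (μ := volume) hT
      have i3 : IntervalIntegrable (fun x => S.ht x + S.kt x) volume 0 T :=
        (S.cont_ht.add S.cont_kt).intervalIntegrable_of_Icc hT
      simp only [hq]
      rw [intervalIntegral.integral_add ((i1.const_mul _).add i2) (i3.const_mul _),
        intervalIntegral.integral_add (i1.const_mul _) i2, intervalIntegral.integral_const_mul,
        intervalIntegral.integral_const_mul]
      have := intervalIntegral.integral_mono_on hT i2 intervalIntegrable_const hbasic
      rw [intervalIntegral.integral_const, smul_eq_mul, sub_zero] at this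
      linarith
    unfold derivBound
    rw [← hY₀]
    linarith
  -- The equation holds only for positive times; the initial energy is reached by continuity, the
  -- integrals increasing as s' decreases to 0.
  have hlim : Tendsto (fun s' => 3 * P.energy (S.D (S.c s')) + S.derivBound C₁ C₂ B) (𝓝[>] 0)
      (𝓝 (3 * P.energy (S.D (S.c 0)) + S.derivBound C₁ C₂ B)) := by
    have h3 := ((P.continuous_energy.comp_continuousOn S.cont_D) 0 ⟨le_rfl, hT⟩).tendsto
    have h4 : 𝓝[>] (0 : ℝ) ≤ 𝓝[Icc 0 T] 0 := by
      rw [nhdsWithin_Icc_eq_nhdsGE (hs.trans_le (hst.trans htT.le))]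
      exact nhdsWithin_mono _ Ioi_subset_Ici_self
    exact ((h3.mono_left h4).const_mul 3).add_const _
  refine ge_of_tendsto hlim ?_
  filter_upwards [Ioo_mem_nhdsGT hs] with s' hs'
  refine le_trans ?_ (key s' hs'.1 (hs'.2.le.trans hst))
  refine intervalIntegral.integral_mono_interval hs'.2.le hst le_rfl
    (ae_of_all _ fun _ => sq_nonneg _) ?_
  refine ContinuousOn.intervalIntegrable_of_Icc (hs'.2.le.trans hst) ?_
  exact (S.cont_ι'.mono fun x hx => ⟨hs'.1.trans_le hx.1, hx.2.trans_lt htT⟩).norm.pow 2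

/-- Subtract the equations at times x + τ and x and test with the difference quotient δ.
Monotonicity supplies a nonnegative term that absorbs the gradient part of the boundary pairing;
what is left is integrable by the two previous estimates. The 3‖δ‖² collects 2 from the boundary and
1 from the source. -/
theorem sq_diffQuotient_sub_le [CompleteSpace Y] (hC₀ : 0 < C₀) (hC₁ : 0 < C₁) (hC₃ : 0 < C₃)
    (h0 : ∀ v : Lp E 2 μ, P.modular v ≤ C₀ * (1 + P.dissipation v))
    (h1 : ∀ (s : ℝ) (u : Lp ℝ 2 μ) (v : Lp E 2 μ), 0 ≤ s →
      κ * s * ((∫ x, ‖u x‖ ∂μ) + ∫ x, ‖v x‖ ∂μ)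
        ≤ 1 / (2 * C₀) * P.modular v + ‖u‖ ^ 2 + C₁ * (1 + s ^ P.lam))
    (h3 : ∀ (s τ : ℝ) (u : Lp ℝ 2 μ) (v w : Lp E 2 μ), 0 ≤ s → 0 < τ →
      κ * s * ((∫ x, ‖u x‖ ∂μ) + ∫ x, ‖(τ⁻¹ • (v - w) : Lp E 2 μ) x‖ ∂μ)
        ≤ (τ⁻¹) ^ 2 * inner ℝ (P.fluxL2 v - P.fluxL2 w) (v - w) + ‖u‖ ^ 2
          + C₃ * (1 + s ^ P.lam + P.modular v + P.modular w))
    {N : ℝ} (hN : ∀ s t, 0 < s → s ≤ t → t < T → ∫ x in s..t, ‖S.ι (S.c' x)‖ ^ 2 ≤ N)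
    {s t τ : ℝ} (hs : 0 < s) (hst : s ≤ t) (hτ : 0 < τ) (htT : t + τ < T) :
    ‖τ⁻¹ • (S.ι (S.c (t + τ)) - S.ι (S.c t))‖ ^ 2 - ‖τ⁻¹ • (S.ι (S.c (s + τ)) - S.ι (S.c s))‖ ^ 2
      ≤ 3 * N + 2 * C₃ * ((∫ x in 0..T, S.ht x) + 2 * C₀ * (T + S.basicBound C₁))
        + ∫ x in 0..T, ‖S.ft x‖ ^ (2 : ℝ) := by
  have hT : 0 ≤ T := by linarith
  have hsub : Icc s (t + τ) ⊆ Ioo 0 T := fun x hx => ⟨hs.trans_le hx.1, hx.2.trans_lt htT⟩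
  have hsub' : Icc s (t + τ) ⊆ Icc 0 T := hsub.trans Ioo_subset_Icc_self
  have hincl : Icc s t ⊆ Icc s (t + τ) := Icc_subset_Icc_right (by linarith)
  have hshift : MapsTo (fun x => x + τ) (Icc s t) (Icc s (t + τ)) :=
    fun x hx => ⟨by linarith [hx.1], by linarith [hx.2]⟩
  have hadd : ContinuousOn (fun x : ℝ => x + τ) (Icc s t) := by fun_prop
  set δ : ℝ → Lp ℝ 2 μ := fun x => τ⁻¹ • (S.ι (S.c (x + τ)) - S.ι (S.c x)) with hδ
  set p : ℝ → Y := fun x => τ⁻¹ • (S.ψ (x + τ) - S.ψ x) with hp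
  set q : ℝ → Lp ℝ 2 μ := fun x => τ⁻¹ • (S.f (x + τ) - S.f x) with hq
  set Z : ℝ → ℝ := fun x => P.dissipation (S.D (S.c x)) with hZdef
  have cδ : ContinuousOn δ (Icc s t) :=
    continuousOn_diffQuotient hτ.le (S.cont_ι.mono hsub')
  have cp : ContinuousOn p (Icc s t) :=
    continuousOn_diffQuotient hτ.le (S.cont_ψ.mono hsub')
  have cq : ContinuousOn q (Icc s t) :=
    continuousOn_diffQuotient hτ.le (S.cont_f.mono hsub')
  have cZ : ContinuousOn Z (Icc s t) := S.cont_dissipation.mono (hincl.trans hsub')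
  have cZτ : ContinuousOn (fun x => Z (x + τ)) (Icc s t) :=
    (S.cont_dissipation.mono hsub').comp hadd hshift
  have i1 : IntervalIntegrable (fun x => 3 * ‖δ x‖ ^ (2 : ℝ)) volume s t :=
    ((cδ.norm.rpow_const fun _ _ => Or.inr (by norm_num)).intervalIntegrable_of_Icc hst).const_mul _
  have i2 : IntervalIntegrable (fun x => ‖p x‖ ^ P.lam) volume s t :=
    (cp.norm.rpow_const fun _ _ => Or.inr lam_nonneg).intervalIntegrable_of_Icc hst
  have i3 : IntervalIntegrable Z volume s t := cZ.intervalIntegrable_of_Icc hst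
  have i4 : IntervalIntegrable (fun x => Z (x + τ)) volume s t :=
    cZτ.intervalIntegrable_of_Icc hst
  have i5 : IntervalIntegrable (fun x => ‖q x‖ ^ (2 : ℝ)) volume s t :=
    (cq.norm.rpow_const fun _ _ => Or.inr (by norm_num)).intervalIntegrable_of_Icc hst
  have i6 : IntervalIntegrable (fun x => 2 * C₃ * (1 + ‖p x‖ ^ P.lam + C₀ * (1 + Z x)
      + C₀ * (1 + Z (x + τ)))) volume s t :=
    ((((intervalIntegrable_const.add i2).add
      ((intervalIntegrable_const.add i3).const_mul C₀)).add
      ((intervalIntegrable_const.add i4).const_mul C₀)).const_mul _)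
  have hder : ∀ x ∈ Icc s t, HasDerivAt (fun x => ‖δ x‖ ^ 2)
      (2 * inner ℝ (δ x) (τ⁻¹ • (S.ι (S.c' (x + τ)) - S.ι (S.c' x)))) x := fun x hx =>
    ((((S.hasDeriv_ι (hsub (hshift hx))).comp_add_const x τ).sub
      (S.hasDeriv_ι (hsub (hincl hx)))).const_smul τ⁻¹).norm_sq
  have h4 := intervalIntegral.sub_le_integral_of_hasDeriv_right_of_le hst
    (fun x hx => (hder x hx).continuousAt.continuousWithinAt)
    (fun x hx => (hder x (Ioo_subset_Icc_self hx)).hasDerivWithinAt)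
    (φ := fun x => 3 * ‖δ x‖ ^ (2 : ℝ) + 2 * C₃ * (1 + ‖p x‖ ^ P.lam + C₀ * (1 + Z x)
      + C₀ * (1 + Z (x + τ))) + ‖q x‖ ^ (2 : ℝ))
    (by
      rw [integrableOn_Icc_iff_integrableOn_Ioc, ← intervalIntegrable_iff_integrableOn_Ioc_of_le hst]
      exact (i1.add i6).add i5)
    (fun x hx => by
      have hx' := Ioo_subset_Icc_self hx
      -- One factor τ⁻¹ forms δ, the other turns the difference of the two equations into a
      -- difference quotient.
      set w : V := τ⁻¹ • (τ⁻¹ • (S.c (x + τ) - S.c x)) with hw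
      have e1 := S.equation x (hsub (hincl hx')) w
      have e2 := S.equation (x + τ) (hsub (hshift hx')) w
      have hιw : S.ι w = τ⁻¹ • δ x := by simp [hw, hδ, map_sub]
      have hDw : S.D w = τ⁻¹ • τ⁻¹ • (S.D (S.c (x + τ)) - S.D (S.c x)) := by simp [hw, map_sub]
      have e3 := S.trace (p x) (τ⁻¹ • (S.c (x + τ) - S.c x))
      have hD' : S.D (τ⁻¹ • (S.c (x + τ) - S.c x)) = τ⁻¹ • (S.D (S.c (x + τ)) - S.D (S.c x)) := by
        simp [map_sub]
      have hι' : S.ι (τ⁻¹ • (S.c (x + τ) - S.c x)) = δ x := by simp [hδ, map_sub]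
      have hℓ : S.ℓ (p x) (τ⁻¹ • (S.c (x + τ) - S.c x)) = S.ℓ (S.ψ (x + τ)) w - S.ℓ (S.ψ x) w := by
        simp only [hp, hw, map_smul, map_sub, _root_.smul_apply,
          _root_.sub_apply, smul_eq_mul]
        ring
      have e4 := h3 ‖p x‖ τ (δ x) (S.D (S.c (x + τ))) (S.D (S.c x)) (norm_nonneg _) hτ
      rw [hD', hι', hℓ] at e3
      have e5 := (abs_le.1 e3).1
      have e6 := h0 (S.D (S.c (x + τ)))
      have e7 := h0 (S.D (S.c x))
      have e8 := real_inner_le_norm (q x) (δ x)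
      have e9 := sq_nonneg (‖q x‖ - ‖δ x‖)
      have e10 : inner ℝ (q x) (δ x) = inner ℝ (S.f (x + τ)) (S.ι w) - inner ℝ (S.f x) (S.ι w) := by
        rw [hιw, ← inner_sub_left, hq]
        simp only [real_inner_smul_left, real_inner_smul_right]
      have e11 : inner ℝ (P.fluxL2 (S.D (S.c (x + τ)))) (S.D w)
          - inner ℝ (P.fluxL2 (S.D (S.c x))) (S.D w)
          = (τ⁻¹) ^ 2 * inner ℝ (P.fluxL2 (S.D (S.c (x + τ))) - P.fluxL2 (S.D (S.c x)))
            (S.D (S.c (x + τ)) - S.D (S.c x)) := by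
        rw [← inner_sub_left, hDw]
        simp only [real_inner_smul_right]
        ring
      have e12 : inner ℝ (δ x) (τ⁻¹ • (S.ι (S.c' (x + τ)) - S.ι (S.c' x)))
          = inner ℝ (S.ι (S.c' (x + τ))) (S.ι w) - inner ℝ (S.ι (S.c' x)) (S.ι w) := by
        rw [← inner_sub_left, hιw, real_inner_comm]
        simp only [real_inner_smul_left, real_inner_smul_right]
      have e13 : C₃ * (1 + ‖p x‖ ^ P.lam + P.modular (S.D (S.c (x + τ)))
          + P.modular (S.D (S.c x))) ≤ C₃ * (1 + ‖p x‖ ^ P.lam + C₀ * (1 + Z x)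
          + C₀ * (1 + Z (x + τ))) := mul_le_mul_of_nonneg_left (by simp only [hZdef]; linarith) hC₃.le
      rw [e12, Real.rpow_two, Real.rpow_two]
      linarith)
  rw [intervalIntegral.integral_add (i1.add i6) i5, intervalIntegral.integral_add i1 i6,
    intervalIntegral.integral_const_mul, intervalIntegral.integral_const_mul] at h4
  have m0 : (0 : ℝ) ∈ Icc 0 T := ⟨le_rfl, hT⟩
  have mT : T ∈ Icc 0 T := ⟨hT, le_rfl⟩
  have ms : s ∈ Icc 0 T := hsub' ⟨le_rfl, by linarith⟩
  have mt : t + τ ∈ Icc 0 T := hsub' ⟨by linarith, le_rfl⟩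
  have hsτ : s ≤ t + τ := by linarith
  have b1 : ∫ x in s..t, ‖δ x‖ ^ (2 : ℝ) ≤ N := by
    have cR' : ContinuousOn (fun x => S.ι (S.c' x)) (Icc s (t + τ)) := S.cont_ι'.mono hsub
    have hftc : ∀ x ∈ Icc s t,
        S.ι (S.c (x + τ)) - S.ι (S.c x) = ∫ r in x..(x + τ), S.ι (S.c' r) := fun x hx => by
      have hxτ : x ≤ x + τ := by linarith
      refine (intervalIntegral.integral_eq_sub_of_hasDerivAt (f := fun t => S.ι (S.c t))
        (fun r hr => ?_) ((cR'.mono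
        (Icc_subset_Icc hx.1 (by linarith [hx.2]))).intervalIntegrable_of_Icc hxτ)).symm
      rw [uIcc_of_le hxτ] at hr
      exact S.hasDeriv_ι (hsub ⟨hx.1.trans hr.1, by linarith [hr.2, hx.2]⟩)
    have := integral_diffQuotient_rpow_le (p := 2) one_le_two hst hτ (S.cont_ι.mono hsub')
      (cR'.intervalIntegrable_of_Icc hsτ)
      ((cR'.norm.rpow_const fun _ _ => Or.inr (by norm_num)).intervalIntegrable_of_Icc hsτ) hftc
    refine this.trans ?_
    simp only [Real.rpow_two]
    exact hN s (t + τ) hs hsτ htT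
  have b2 : ∫ x in s..t, ‖p x‖ ^ P.lam ≤ ∫ x in s..(t + τ), ‖S.ψt x‖ ^ P.lam := by
    have cψ : ContinuousOn S.ψt (Icc s (t + τ)) := S.cont_ψt.mono hsub'
    refine integral_diffQuotient_rpow_le (by have := P.two_lt_lam; linarith) hst hτ
      (S.cont_ψ.mono hsub') (cψ.intervalIntegrable_of_Icc hsτ)
      ((cψ.norm.rpow_const fun _ _ => Or.inr lam_nonneg).intervalIntegrable_of_Icc hsτ)
      fun x hx => ?_
    refine (intervalIntegral.integral_eq_sub_of_hasDerivAt (f := S.ψ) (fun r hr => ?_) ((cψ.mono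
      (Icc_subset_Icc hx.1 (by linarith [hx.2]))).intervalIntegrable_of_Icc (by linarith))).symm
    rw [uIcc_of_le (by linarith)] at hr
    have hr' := hsub (show r ∈ Icc s (t + τ) from ⟨hx.1.trans hr.1, by linarith [hr.2, hx.2]⟩)
    exact (S.hasDeriv_ψ r (Ioo_subset_Icc_self hr')).hasDerivAt (Icc_mem_nhds hr'.1 hr'.2)
  have b3 : ∫ x in s..t, ‖q x‖ ^ (2 : ℝ) ≤ ∫ x in s..(t + τ), ‖S.ft x‖ ^ (2 : ℝ) := by
    refine integral_diffQuotient_rpow_le one_le_two hst hτ (S.cont_f.mono hsub')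
      (S.intervalIntegrable_ft ms mt) (S.intervalIntegrable_sq_ft ms mt) fun x hx => ?_
    have hx1 := hsub' (hincl hx)
    have hx2 := hsub' (hshift hx)
    rw [S.f_eq x hx1, S.f_eq _ hx2, add_sub_add_left_eq_sub,
      intervalIntegral.integral_interval_sub_left (S.intervalIntegrable_ft m0 hx2)
      (S.intervalIntegrable_ft m0 hx1)]
  have b4 : ∫ x in s..(t + τ), ‖S.ft x‖ ^ (2 : ℝ) ≤ ∫ x in 0..T, ‖S.ft x‖ ^ (2 : ℝ) :=
    intervalIntegral.integral_mono_interval hs.le hsτ htT.le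
      (ae_of_all _ fun _ => Real.rpow_nonneg (norm_nonneg _) _) (S.intervalIntegrable_sq_ft m0 mT)
  have iZ : IntervalIntegrable Z volume 0 T := S.cont_dissipation.intervalIntegrable_of_Icc hT
  have hZ0 : ∀ x, 0 ≤ Z x := fun x => P.dissipation_nonneg _
  have hZ : ∫ x in 0..T, Z x ≤ S.basicBound C₁ := by
    have := S.basic_estimate hC₀ hC₁ h0 h1 mT
    have := sq_nonneg ‖S.ι (S.c T)‖
    linarith
  have b5 : ∫ x in s..t, Z x ≤ ∫ x in 0..T, Z x :=
    intervalIntegral.integral_mono_interval hs.le hst (by linarith) (ae_of_all _ hZ0) iZ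
  have b6 : ∫ x in s..t, Z (x + τ) ≤ ∫ x in 0..T, Z x := by
    rw [intervalIntegral.integral_comp_add_right]
    exact intervalIntegral.integral_mono_interval (by linarith) (by linarith) htT.le
      (ae_of_all _ hZ0) iZ
  have iψ : IntervalIntegrable (fun x => ‖S.ψt x‖ ^ P.lam) volume 0 T :=
    (S.cont_ψt.norm.rpow_const fun _ _ => Or.inr lam_nonneg).intervalIntegrable_of_Icc hT
  have b7 : ∫ x in s..(t + τ), ‖S.ψt x‖ ^ P.lam ≤ ∫ x in 0..T, ‖S.ψt x‖ ^ P.lam :=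
    intervalIntegral.integral_mono_interval hs.le hsτ htT.le
      (ae_of_all _ fun _ => Real.rpow_nonneg (norm_nonneg _) _) iψ
  have b8 : ∫ x in 0..T, S.ht x = T + ∫ x in 0..T, ‖S.ψt x‖ ^ P.lam := by
    unfold ht
    rw [intervalIntegral.integral_add intervalIntegrable_const iψ]
    simp
  have b9 : ∫ x in s..t, (1 + ‖p x‖ ^ P.lam + C₀ * (1 + Z x) + C₀ * (1 + Z (x + τ)))
      = (t - s) + (∫ x in s..t, ‖p x‖ ^ P.lam) + C₀ * ((t - s) + ∫ x in s..t, Z x)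
        + C₀ * ((t - s) + ∫ x in s..t, Z (x + τ)) := by
    rw [intervalIntegral.integral_add ((intervalIntegrable_const.add i2).add
      ((intervalIntegrable_const.add i3).const_mul C₀))
      ((intervalIntegrable_const.add i4).const_mul C₀),
      intervalIntegral.integral_add (intervalIntegrable_const.add i2)
      ((intervalIntegrable_const.add i3).const_mul C₀),
      intervalIntegral.integral_add intervalIntegrable_const i2,
      intervalIntegral.integral_const_mul, intervalIntegral.integral_const_mul,
      intervalIntegral.integral_add intervalIntegrable_const i3,
      intervalIntegral.integral_add intervalIntegrable_const i4]
    simp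
  rw [b9] at h4
  have hts : t - s ≤ T := by linarith
  have b10 : C₀ * ((t - s) + ∫ x in s..t, Z x) ≤ C₀ * (T + S.basicBound C₁) :=
    mul_le_mul_of_nonneg_left (by linarith) hC₀.le
  have b11 : C₀ * ((t - s) + ∫ x in s..t, Z (x + τ)) ≤ C₀ * (T + S.basicBound C₁) :=
    mul_le_mul_of_nonneg_left (by linarith) hC₀.le
  have b12 := mul_le_mul_of_nonneg_left (show (t - s) + (∫ x in s..t, ‖p x‖ ^ P.lam)
    + C₀ * ((t - s) + ∫ x in s..t, Z x) + C₀ * ((t - s) + ∫ x in s..t, Z (x + τ))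
    ≤ (∫ x in 0..T, S.ht x) + 2 * C₀ * (T + S.basicBound C₁) by linarith)
    (show 0 ≤ 2 * C₃ by positivity)
  simp only [hδ] at h4 b1 ⊢
  linarith

/-- Pass to the limit τ → 0⁺ in `sq_diffQuotient_sub_le`, whose bound does not involve τ. -/
theorem sq_deriv_sub_le [CompleteSpace Y] (hC₀ : 0 < C₀) (hC₁ : 0 < C₁) (hC₃ : 0 < C₃)
    (h0 : ∀ v : Lp E 2 μ, P.modular v ≤ C₀ * (1 + P.dissipation v))
    (h1 : ∀ (s : ℝ) (u : Lp ℝ 2 μ) (v : Lp E 2 μ), 0 ≤ s →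
      κ * s * ((∫ x, ‖u x‖ ∂μ) + ∫ x, ‖v x‖ ∂μ)
        ≤ 1 / (2 * C₀) * P.modular v + ‖u‖ ^ 2 + C₁ * (1 + s ^ P.lam))
    (h3 : ∀ (s τ : ℝ) (u : Lp ℝ 2 μ) (v w : Lp E 2 μ), 0 ≤ s → 0 < τ →
      κ * s * ((∫ x, ‖u x‖ ∂μ) + ∫ x, ‖(τ⁻¹ • (v - w) : Lp E 2 μ) x‖ ∂μ)
        ≤ (τ⁻¹) ^ 2 * inner ℝ (P.fluxL2 v - P.fluxL2 w) (v - w) + ‖u‖ ^ 2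
          + C₃ * (1 + s ^ P.lam + P.modular v + P.modular w))
    {N : ℝ} (hN : ∀ s t, 0 < s → s ≤ t → t < T → ∫ x in s..t, ‖S.ι (S.c' x)‖ ^ 2 ≤ N)
    {s t : ℝ} (hs : 0 < s) (hst : s ≤ t) (htT : t < T) :
    ‖S.ι (S.c' t)‖ ^ 2 - ‖S.ι (S.c' s)‖ ^ 2
      ≤ 3 * N + 2 * C₃ * ((∫ x in 0..T, S.ht x) + 2 * C₀ * (T + S.basicBound C₁))
        + ∫ x in 0..T, ‖S.ft x‖ ^ (2 : ℝ) := by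
  have l1 := (S.hasDeriv_ι (t := t) ⟨hs.trans_le hst, htT⟩).tendsto_slope_zero_right
  have l2 := (S.hasDeriv_ι (t := s) ⟨hs, hst.trans_lt htT⟩).tendsto_slope_zero_right
  refine le_of_tendsto ((l1.norm.pow 2).sub (l2.norm.pow 2)) ?_
  filter_upwards [Ioo_mem_nhdsGT (sub_pos.2 htT)] with τ hτ
  exact S.sq_diffQuotient_sub_le hC₀ hC₁ hC₃ h0 h1 h3 hN hs hst hτ.1 (by linarith [hτ.2])

end GalerkinFlow

/-- Bookkeeping: x is ‖u_t‖², τ is t₀⁻¹, J the initial energy, A the other data, I the integral with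
f_t, and R the allowed increase of ‖u_t‖². -/
theorem galerkin_bound_arith {x τ c₂ c₃ J A I R : ℝ} (hτ : 0 ≤ τ) (hc₂ : 0 ≤ c₂) (hc₃ : 0 ≤ c₃)
    (hJ : 0 ≤ J) (hA : 0 ≤ A) (hI : 0 ≤ I) (hx : x ≤ 2 * τ * (3 * J + c₂ * A) + R)
    (hR : R ≤ 3 * (3 * J + c₂ * A) + c₃ * A + I) :
    x ≤ (5 * (3 + c₂) + c₃ + 1) * τ * (J + A) + (5 * (3 + c₂) + c₃ + 1) * (J + A)
      + (5 * (3 + c₂) + c₃ + 1) * I := by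
  have f1 : 3 * J + c₂ * A ≤ (3 + c₂) * (J + A) := by nlinarith
  have f2 := mul_le_mul_of_nonneg_left f1 (show 0 ≤ 2 * τ by positivity)
  have f3 : 0 ≤ (3 * (3 + c₂) + c₃ + 1) * τ * (J + A) := by positivity
  have f5 : 0 ≤ (2 * (3 + c₂) + 1) * (J + A) + c₃ * J := by positivity
  have f6 : 0 ≤ (5 * (3 + c₂) + c₃) * I := by positivity
  linarith

/-- The estimate of the time derivative of a Galerkin evolution, with a constant which depends
neither on the Galerkin space nor on the data. -/
theorem exists_galerkin_bound (P : GenPoly) {X : Type*} [MeasurableSpace X] (μ : Measure X)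
    [IsFiniteMeasure μ] (E : Type*) [NormedAddCommGroup E] [InnerProductSpace ℝ E]
    (Y : Type*) [NormedAddCommGroup Y] [NormedSpace ℝ Y] [CompleteSpace Y]
    {κ : ℝ} (hκ : 0 ≤ κ) (Tmax : ℝ) :
    ∃ C, 0 < C ∧ ∀ (V : Type) [NormedAddCommGroup V] [NormedSpace ℝ V] [FiniteDimensional ℝ V]
      (T : ℝ) (S : GalerkinFlow P μ E Y V κ T) (B t₀ t : ℝ), T ≤ Tmax →
      (∀ t ∈ Icc 0 T, 1 + ‖S.ψ t‖ ^ P.lam ≤ B) → 0 < t₀ → t₀ < t → t < T →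
      ‖S.ι (S.c' t)‖ ^ 2 ≤
        C * t₀⁻¹ * (P.energy (S.D (S.c 0)) + (‖S.ι (S.c 0)‖ ^ 2 + B + ∫ s in 0..T, (S.ht s + S.kt s)))
        + C * (P.energy (S.D (S.c 0)) + (‖S.ι (S.c 0)‖ ^ 2 + B + ∫ s in 0..T, (S.ht s + S.kt s)))
        + C * ∫ s in 0..T, S.ht s * (1 + ‖S.ft s‖ ^ 2) := by
  -- For Tmax ≤ 0 there is no admissible time; otherwise Tmax may enter the constants as a positive
  -- number.
  rcases le_or_gt Tmax 0 with hTm | hTm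
  · refine ⟨1, one_pos, fun V _ _ _ T S B t₀ t hT _ h1 h2 h3 => ?_⟩
    linarith
  obtain ⟨C₀, hC₀, h0⟩ := P.modular_le_dissipation μ E
  obtain ⟨C₀', hC₀', h0'⟩ := P.modular_le_energy μ E
  obtain ⟨C₁, hC₁, h1⟩ := P.boundary_young μ E hκ (ε := 1 / (2 * C₀)) (by positivity)
  obtain ⟨C₂, hC₂, h2⟩ := P.boundary_young μ E hκ (ε := 1 / (2 * C₀')) (by positivity)
  obtain ⟨C₃, hC₃, h3⟩ := P.boundary_young_sub μ E hκ
  set c₁ := Real.exp (3 * Tmax) * (2 * C₁ + 1) with hc₁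
  set c₂ := 2 * (1 + (3 + Tmax) * c₁ + 2 * C₂ + (C₁ + 1)) with hc₂
  set c₃ := 2 * C₃ * (1 + 2 * C₀ * (Tmax + c₁)) with hc₃
  have hc₁0 : 0 < c₁ := by positivity
  have hc₂0 : 0 < c₂ := by positivity
  have hc₃0 : 0 < c₃ := by positivity
  refine ⟨5 * (3 + c₂) + c₃ + 1, by positivity, fun V _ _ _ T S B t₀ t hTT hB ht₀ ht₀t htT => ?_⟩
  have hT : 0 < T := by linarith
  set J₀ := P.energy (S.D (S.c 0)) with hJ₀
  have hJ : 0 ≤ J₀ := P.energy_nonneg _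
  have ih := S.cont_ht.intervalIntegrable_of_Icc (μ := volume) hT.le
  have ik := S.cont_kt.intervalIntegrable_of_Icc (μ := volume) hT.le
  have hh0 : 0 ≤ ∫ s in 0..T, S.ht s := intervalIntegral.integral_nonneg hT.le fun s _ =>
    zero_le_one.trans (S.one_le_ht s)
  have hk0 : 0 ≤ ∫ s in 0..T, S.kt s := intervalIntegral.integral_nonneg hT.le fun s _ =>
    zero_le_one.trans (S.one_le_kt s)
  have hB1 : 1 ≤ B := by
    have := hB 0 ⟨le_rfl, hT.le⟩
    have h5 : 0 ≤ ‖S.ψ 0‖ ^ P.lam := Real.rpow_nonneg (norm_nonneg _) _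
    linarith
  have ehk : ∫ s in 0..T, (S.ht s + S.kt s) = (∫ s in 0..T, S.ht s) + ∫ s in 0..T, S.kt s :=
    intervalIntegral.integral_add ih ik
  set A := ‖S.ι (S.c 0)‖ ^ 2 + B + ∫ s in 0..T, (S.ht s + S.kt s) with hA
  have hR0 := sq_nonneg ‖S.ι (S.c 0)‖
  have hA1 : 1 ≤ A := by rw [hA, ehk]; linarith
  set I := ∫ s in 0..T, S.ht s * (1 + ‖S.ft s‖ ^ 2) with hI
  have hY : S.basicBound C₁ ≤ c₁ * A := by
    unfold GalerkinFlow.basicBound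
    rw [intervalIntegral.integral_const_mul, hc₁, mul_assoc]
    refine mul_le_mul (Real.exp_le_exp.2 (by linarith)) ?_ (by positivity) (by positivity)
    rw [hA, ehk]
    have h6 : 0 ≤ 2 * C₁ * (‖S.ι (S.c 0)‖ ^ 2 + B + ∫ s in 0..T, S.ht s) := by positivity
    linarith only [h6, hh0, hB1]
  have hY0 : 0 ≤ S.basicBound C₁ := by
    unfold GalerkinFlow.basicBound
    rw [intervalIntegral.integral_const_mul]
    positivity
  have hD : S.derivBound C₁ C₂ B ≤ c₂ * A := by
    unfold GalerkinFlow.derivBound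
    have e1 : (3 + T) * S.basicBound C₁ ≤ (3 + Tmax) * (c₁ * A) :=
      mul_le_mul (by linarith) hY hY0 (by linarith)
    have e2 : 2 * C₂ * B ≤ 2 * C₂ * A :=
      mul_le_mul_of_nonneg_left (by rw [hA, ehk]; linarith) (by positivity)
    have e3 : (C₁ + 1) * ∫ s in 0..T, (S.ht s + S.kt s) ≤ (C₁ + 1) * A :=
      mul_le_mul_of_nonneg_left (by rw [hA]; linarith) (by positivity)
    rw [hc₂]
    linarith
  have hN : ∀ s t, 0 < s → s ≤ t → t < T →
      ∫ x in s..t, ‖S.ι (S.c' x)‖ ^ 2 ≤ 3 * J₀ + c₂ * A := fun s t hs hst htT =>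
    (S.integral_sq_deriv_le hC₀ hC₁ hC₂ h0 h1 hC₀' h0' h2 hB hs hst htT).trans (by linarith)
  set R := 3 * (3 * J₀ + c₂ * A) + 2 * C₃ * ((∫ x in 0..T, S.ht x)
    + 2 * C₀ * (T + S.basicBound C₁)) + ∫ x in 0..T, ‖S.ft x‖ ^ (2 : ℝ) with hR
  -- Averaging this over the window [t₀/2, t₀], of length t₀/2, replaces the unknown ‖u_t(x)‖² by
  -- its time integral and costs a factor 2t₀⁻¹.
  have hsub : ∀ x ∈ Icc (t₀ / 2) t₀, ‖S.ι (S.c' t)‖ ^ 2 - R ≤ ‖S.ι (S.c' x)‖ ^ 2 := by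
    intro x hx
    have := S.sq_deriv_sub_le hC₀ hC₁ hC₃ h0 h1 h3 hN (s := x) (t := t) (by linarith [hx.1])
      (by linarith [hx.2]) htT
    rw [← hR] at this
    linarith
  have havg : t₀ / 2 * (‖S.ι (S.c' t)‖ ^ 2 - R) ≤ 3 * J₀ + c₂ * A := by
    have e1 := intervalIntegral.integral_mono_on (show t₀ / 2 ≤ t₀ by linarith)
      (intervalIntegrable_const (c := ‖S.ι (S.c' t)‖ ^ 2 - R) (μ := volume))
      (((S.cont_ι'.mono fun x hx => ⟨by linarith [hx.1], by linarith [hx.2]⟩).norm.pow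
        2).intervalIntegrable_of_Icc (by linarith)) hsub
    rw [intervalIntegral.integral_const, smul_eq_mul] at e1
    have e2 := hN (t₀ / 2) t₀ (by linarith) (by linarith) (by linarith)
    have e3 : t₀ - t₀ / 2 = t₀ / 2 := by ring
    rw [e3] at e1
    exact e1.trans e2
  have hR2 : ‖S.ι (S.c' t)‖ ^ 2 ≤ 2 * t₀⁻¹ * (3 * J₀ + c₂ * A) + R := by
    have := mul_le_mul_of_nonneg_left havg (show 0 ≤ 2 * t₀⁻¹ by positivity)
    have e : 2 * t₀⁻¹ * (t₀ / 2 * (‖S.ι (S.c' t)‖ ^ 2 - R)) = ‖S.ι (S.c' t)‖ ^ 2 - R := by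
      field_simp
    linarith
  -- The weight 1 + ‖ψ_t‖^λ is at least 1, so the plain integral of ‖f_t‖² is below the weighted
  -- one.
  have hft : ∫ x in 0..T, ‖S.ft x‖ ^ (2 : ℝ) ≤ I := by
    have i2 := S.intervalIntegrable_sq_ft (u := 0) (v := T) ⟨le_rfl, hT.le⟩ ⟨hT.le, le_rfl⟩
    simp only [Real.rpow_two] at i2 ⊢
    refine intervalIntegral.integral_mono_on hT.le i2 ?_ fun x hx => ?_
    · exact ((intervalIntegrable_const.add i2).continuousOn_mul
        (by rw [uIcc_of_le hT.le]; exact S.cont_ht))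
    · have h7 := mul_le_mul_of_nonneg_right (S.one_le_ht x)
        (show 0 ≤ 1 + ‖S.ft x‖ ^ 2 by positivity)
      linarith only [h7]
  have hRle : R ≤ 3 * (3 * J₀ + c₂ * A) + c₃ * A + I := by
    have e1 : (∫ x in 0..T, S.ht x) + 2 * C₀ * (T + S.basicBound C₁)
        ≤ (1 + 2 * C₀ * (Tmax + c₁)) * A := by
      have e2 : ∫ x in 0..T, S.ht x ≤ A := by rw [hA, ehk]; linarith
      have e3 : T + S.basicBound C₁ ≤ (Tmax + c₁) * A := by
        have h8 := mul_le_mul_of_nonneg_left hA1 hTm.le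
        linarith only [h8, hY, hTT]
      have e4 := mul_le_mul_of_nonneg_left e3 (show 0 ≤ 2 * C₀ by positivity)
      linarith
    have e5 := mul_le_mul_of_nonneg_left e1 (show 0 ≤ 2 * C₃ by positivity)
    rw [hR, hc₃]
    linarith
  have hI0 : 0 ≤ I := intervalIntegral.integral_nonneg hT.le fun x _ => by
    have := S.one_le_ht x
    positivity
  have ht : 0 < t₀⁻¹ := by positivity
  exact galerkin_bound_arith ht.le hc₂0.le hc₃0.le hJ (zero_le_one.trans hA1) hI0 hR2 hRle

end Forchheimer

end

/-! ### Finite element functions as piecewise polynomials. -/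

noncomputable section

namespace Forchheimer

variable {d : ℕ}

/-- The polynomial function on `ℝ^d` given by a formal polynomial. -/
def polyFun (p : MvPolynomial (Fin d) ℝ) (x : Space d) : ℝ := MvPolynomial.eval (fun i => x i) p

theorem contDiff_polyFun (p : MvPolynomial (Fin d) ℝ) : ContDiff ℝ ∞ (polyFun p) := by
  unfold polyFun
  induction p using MvPolynomial.induction_on with
  | C a => simpa using contDiff_const
  | add p q hp hq => simpa using hp.add hq
  | mul_X p i hp =>
    simp only [map_mul, MvPolynomial.eval_X]
    exact hp.mul (contDiff_piLp_apply (p := 2))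

theorem continuous_polyFun (p : MvPolynomial (Fin d) ℝ) : Continuous (polyFun p) :=
  (contDiff_polyFun p).continuous

theorem differentiable_polyFun (p : MvPolynomial (Fin d) ℝ) : Differentiable ℝ (polyFun p) :=
  (contDiff_polyFun p).differentiable (by simp)

theorem continuous_gradient_polyFun (p : MvPolynomial (Fin d) ℝ) :
    Continuous (gradient (polyFun p)) := by
  unfold gradient
  exact (LinearIsometryEquiv.continuous _).comp ((contDiff_polyFun p).continuous_fderiv (by simp))

theorem measurable_gradient (w : Space d → ℝ) : Measurable (gradient w) := by
  unfold gradient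
  exact (LinearIsometryEquiv.continuous _).measurable.comp (measurable_fderiv ℝ w)

theorem norm_gradient (w : Space d → ℝ) (x : Space d) : ‖gradient w x‖ = ‖fderiv ℝ w x‖ := by
  unfold gradient
  exact LinearIsometryEquiv.norm_map _ _

section Complex

variable {𝒯 : Geometry.SimplicialComplex ℝ (Space d)} {r : ℕ}

theorem finite_cells (h : 𝒯.faces.Finite) : (cells 𝒯).Finite := by
  refine (h.image fun s : Finset (Space d) => convexHull ℝ (s : Set (Space d))).subset ?_
  rintro S ⟨s, hs, -, rfl⟩
  exact ⟨s, hs, rfl⟩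

theorem isCompact_cell {S : Set (Space d)} (hS : S ∈ cells 𝒯) : IsCompact S := by
  obtain ⟨s, -, -, rfl⟩ := hS
  exact s.finite_toSet.isCompact_convexHull ℝ

theorem convex_cell {S : Set (Space d)} (hS : S ∈ cells 𝒯) : Convex ℝ S := by
  obtain ⟨s, -, -, rfl⟩ := hS
  exact convex_convexHull ℝ _

theorem isCompact_sUnion_cells (h : 𝒯.faces.Finite) : IsCompact (⋃₀ cells 𝒯) :=
  (finite_cells h).isCompact_sUnion fun _ hS => isCompact_cell hS

variable (𝒯) in
/-- The union of the boundaries of the cells. -/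
def skeleton : Set (Space d) := ⋃ S ∈ cells 𝒯, frontier S

theorem isClosed_skeleton (h : 𝒯.faces.Finite) : IsClosed (skeleton 𝒯) :=
  (finite_cells h).isClosed_biUnion fun _ _ => isClosed_frontier

theorem volume_skeleton (h : 𝒯.faces.Finite) : volume (skeleton 𝒯) = 0 :=
  (measure_biUnion_null_iff (finite_cells h).countable).2 fun _ hS =>
    (convex_cell hS).addHaar_frontier _

theorem mem_interior_cell {x : Space d} (hx : x ∈ ⋃₀ cells 𝒯) (hx' : x ∉ skeleton 𝒯) :
    ∃ S ∈ cells 𝒯, x ∈ interior S := by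
  obtain ⟨S, hS, hxS⟩ := hx
  refine ⟨S, hS, ?_⟩
  by_contra h
  exact hx' (mem_biUnion hS ⟨subset_closure hxS, h⟩)

/-- Cells are convex, so their frontiers are Lebesgue null, and there are finitely many of them. -/
theorem ae_mem_interior_cell {Ω : Set (Space d)} (hΩ : MeasurableSet Ω) (h : 𝒯.faces.Finite)
    (hcov : Ω ⊆ ⋃₀ cells 𝒯) : ∀ᵐ x ∂(vol Ω), ∃ S ∈ cells 𝒯, x ∈ interior S := by
  have h1 : ∀ᵐ x ∂(vol Ω), x ∉ skeleton 𝒯 :=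
    ae_restrict_of_ae (measure_eq_zero_iff_ae_notMem.1 (volume_skeleton h))
  filter_upwards [h1, ae_restrict_mem hΩ] with x hx hxΩ
  exact mem_interior_cell (hcov hxΩ) hx

variable (𝒯 r) in
/-- The finite element space as a submodule of the space of all functions. -/
def feSubmodule : Submodule ℝ (Space d → ℝ) where
  carrier := feSpace 𝒯 r
  add_mem' := by
    rintro u v ⟨hu, hu'⟩ ⟨hv, hv'⟩
    refine ⟨hu.add hv, fun S hS => ?_⟩
    obtain ⟨p, hp, hp'⟩ := hu' S hS
    obtain ⟨q, hq, hq'⟩ := hv' S hS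
    refine ⟨p + q, (MvPolynomial.totalDegree_add p q).trans (max_le hp hq), fun x hx => ?_⟩
    rw [Pi.add_apply, hp' x hx, hq' x hx, map_add]
  zero_mem' := ⟨continuousOn_const, fun S _ => ⟨0, by simp, fun x _ => by simp⟩⟩
  smul_mem' := by
    rintro c u ⟨hu, hu'⟩
    refine ⟨hu.const_smul c, fun S hS => ?_⟩
    obtain ⟨p, hp, hp'⟩ := hu' S hS
    refine ⟨c • p, (MvPolynomial.totalDegree_smul_le c p).trans hp, fun x hx => ?_⟩
    rw [Pi.smul_apply, hp' x hx, MvPolynomial.smul_eval, smul_eq_mul]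

theorem mem_feSubmodule {w : Space d → ℝ} : w ∈ feSubmodule 𝒯 r ↔ w ∈ feSpace 𝒯 r := Iff.rfl

theorem const_mem_feSpace (c : ℝ) : (fun _ => c) ∈ feSpace 𝒯 r :=
  ⟨continuousOn_const, fun S _ => ⟨MvPolynomial.C c, by simp, fun x _ => by simp⟩⟩

theorem feSpace_mono {r' : ℕ} (h : r ≤ r') : feSpace 𝒯 r ⊆ feSpace 𝒯 r' := by
  rintro w ⟨hw, hw'⟩
  refine ⟨hw, fun S hS => ?_⟩
  obtain ⟨p, hp, hp'⟩ := hw' S hS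
  exact ⟨p, hp.trans h, hp'⟩

theorem eventuallyEq_polyFun {w : Space d → ℝ} {S : Set (Space d)} {p : MvPolynomial (Fin d) ℝ}
    (hp : ∀ x ∈ S, w x = MvPolynomial.eval (fun i => x i) p) {x : Space d}
    (hx : x ∈ interior S) : w =ᶠ[𝓝 x] polyFun p := by
  filter_upwards [mem_interior_iff_mem_nhds.1 hx] with y hy
  exact hp y hy

theorem gradient_eq_of_mem_interior {w : Space d → ℝ} {S : Set (Space d)}
    {p : MvPolynomial (Fin d) ℝ}
    (hp : ∀ x ∈ S, w x = MvPolynomial.eval (fun i => x i) p) {x : Space d}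
    (hx : x ∈ interior S) : gradient w x = gradient (polyFun p) x := by
  unfold gradient
  rw [(eventuallyEq_polyFun hp hx).fderiv_eq]

theorem differentiableAt_of_mem_interior {w : Space d → ℝ} (hw : w ∈ feSpace 𝒯 r)
    {S : Set (Space d)} (hS : S ∈ cells 𝒯) {x : Space d} (hx : x ∈ interior S) :
    DifferentiableAt ℝ w x := by
  obtain ⟨p, -, hp⟩ := hw.2 S hS
  exact (eventuallyEq_polyFun hp hx).differentiableAt_iff.2 (differentiable_polyFun p x)

theorem exists_bound_feSpace (h : 𝒯.faces.Finite) {w : Space d → ℝ} (hw : w ∈ feSpace 𝒯 r) :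
    ∃ M, ∀ x ∈ ⋃₀ cells 𝒯, |w x| ≤ M := by
  obtain ⟨M, hM⟩ := (isCompact_sUnion_cells h).exists_bound_of_continuousOn hw.1
  exact ⟨M, hM⟩

theorem exists_bound_gradient_feSpace (h : 𝒯.faces.Finite) {w : Space d → ℝ}
    (hw : w ∈ feSpace 𝒯 r) :
    ∃ M, ∀ S ∈ cells 𝒯, ∀ x ∈ interior S, ‖gradient w x‖ ≤ M := by
  have h1 : ∀ S ∈ cells 𝒯, ∃ M, ∀ x ∈ interior S, ‖gradient w x‖ ≤ M := fun S hS => by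
    obtain ⟨p, -, hp⟩ := hw.2 S hS
    obtain ⟨M, hM⟩ := (isCompact_cell hS).exists_bound_of_continuousOn
      (continuous_gradient_polyFun p).continuousOn
    exact ⟨M, fun x hx => by
      rw [gradient_eq_of_mem_interior hp hx]
      exact hM x (interior_subset hx)⟩
  choose! M hM using h1
  obtain ⟨B, hB⟩ := ((finite_cells h).image M).bddAbove
  exact ⟨B, fun S hS x hx => (hM S hS x hx).trans (hB ⟨S, hS, rfl⟩)⟩

section Omega

variable {Ω : Set (Space d)} (hΩ : IsOpen Ω) (hΩb : Bornology.IsBounded Ω)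
  (hfin : 𝒯.faces.Finite) (hcov : closure Ω ⊆ ⋃₀ cells 𝒯)

include hΩb in
theorem isFiniteMeasure_vol : IsFiniteMeasure (vol Ω) :=
  ⟨by rw [Measure.restrict_apply_univ]; exact hΩb.measure_lt_top⟩

include hΩ hΩb hfin hcov in
theorem memLp_feSpace {w : Space d → ℝ} (hw : w ∈ feSpace 𝒯 r) (p : ℝ≥0∞) :
    MemLp w p (vol Ω) := by
  have := isFiniteMeasure_vol hΩb
  obtain ⟨M, hM⟩ := exists_bound_feSpace hfin hw
  refine MemLp.of_bound ((hw.1.mono (subset_closure.trans hcov)).aestronglyMeasurable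
    hΩ.measurableSet) M ?_
  filter_upwards [ae_restrict_mem hΩ.measurableSet] with x hx
  exact hM x (hcov (subset_closure hx))

include hΩ hΩb hfin hcov in
theorem memLp_gradient_feSpace {w : Space d → ℝ} (hw : w ∈ feSpace 𝒯 r) (p : ℝ≥0∞) :
    MemLp (gradient w) p (vol Ω) := by
  have := isFiniteMeasure_vol hΩb
  obtain ⟨M, hM⟩ := exists_bound_gradient_feSpace hfin hw
  refine MemLp.of_bound (measurable_gradient w).aestronglyMeasurable M ?_
  filter_upwards [ae_mem_interior_cell hΩ.measurableSet hfin (subset_closure.trans hcov)]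
    with x ⟨S, hS, hx⟩
  exact hM S hS x hx

include hΩ hfin hcov in
theorem ae_differentiableAt_feSpace {w : Space d → ℝ} (hw : w ∈ feSpace 𝒯 r) :
    ∀ᵐ x ∂(vol Ω), DifferentiableAt ℝ w x := by
  filter_upwards [ae_mem_interior_cell hΩ.measurableSet hfin (subset_closure.trans hcov)]
    with x ⟨S, hS, hx⟩
  exact differentiableAt_of_mem_interior hw hS hx

end Omega

end Complex

end Forchheimer

end

/-! ### Local boundary charts, coordinate slicing and restriction to lines. -/

noncomputable section

namespace Forchheimer

/-- Near a boundary point, `Ω` is a sublevel set of a function which is nearly linear. -/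
theorem HasC1Boundary.exists_chart {d : ℕ} {Ω : Set (Space d)} (hC : HasC1Boundary Ω)
    (hΩ : IsOpen Ω) {x : Space d} (hx : x ∈ frontier Ω) :
    ∃ (φ : Space d → ℝ) (D : Space d →L[ℝ] ℝ), D ≠ 0 ∧ ∀ η : ℝ, 0 < η → ∃ R : ℝ, 0 < R ∧
      (∀ y ∈ Metric.ball x R, (y ∈ Ω ↔ φ y < 0)) ∧
      (∀ y ∈ Metric.ball x R, y ∈ frontier Ω → φ y = 0) ∧
      ∀ y ∈ Metric.ball x R, ∀ z ∈ Metric.ball x R, |φ y - φ z - D (y - z)| ≤ η * ‖y - z‖ := by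
  obtain ⟨U, φ, hU, hxU, hφ, hφ', hΩU⟩ := hC x hx
  -- Strict differentiability gives an approximation by D uniform in pairs of points, which is
  -- needed to compare two boundary points.
  have hs : HasStrictFDerivAt φ (fderiv ℝ φ x) x :=
    (hφ.contDiffAt (hU.mem_nhds hxU)).hasStrictFDerivAt one_ne_zero
  refine ⟨φ, fderiv ℝ φ x, hφ' x hxU, fun η hη => ?_⟩
  have h1 := hs.isLittleO.bound hη
  obtain ⟨R₁, hR₁, h1⟩ := Metric.eventually_nhds_iff.1 h1
  obtain ⟨R₂, hR₂, h2⟩ := Metric.isOpen_iff.1 hU x hxU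
  have hball : ∀ y ∈ Metric.ball x (min R₁ R₂), y ∈ U := fun y hy =>
    h2 (Metric.ball_subset_ball (min_le_right _ _) hy)
  have hiff : ∀ y ∈ U, (y ∈ Ω ↔ φ y < 0) := fun y hy => by
    have := Set.ext_iff.1 hΩU y
    simpa [hy] using this
  refine ⟨min R₁ R₂, lt_min hR₁ hR₂, fun y hy => hiff y (hball y hy), fun y hy hyΓ => ?_,
    fun y hy z hz => ?_⟩
  · have hyU := hball y hy
    rw [hΩ.frontier_eq] at hyΓ
    refine le_antisymm ?_ (not_lt.1 fun h => hyΓ.2 ((hiff y hyU).2 h))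
    have hcont : ContinuousAt φ y := (hφ.continuousOn).continuousAt (hU.mem_nhds hyU)
    by_contra! hpos
    have h3 : ∀ᶠ z in 𝓝 y, 0 < φ z ∧ z ∈ U :=
      (hcont.eventually (lt_mem_nhds hpos)).and (hU.mem_nhds hyU)
    obtain ⟨z, ⟨hz1, hz2⟩, hz3⟩ := mem_closure_iff_nhds.1 hyΓ.1 _ h3
    exact absurd ((hiff z hz2).1 hz3) (by linarith)
  · have h3 : dist (y, z) (x, x) < R₁ := by
      rw [Prod.dist_eq]
      exact max_lt (hy.trans_le (min_le_left _ _)) (hz.trans_le (min_le_left _ _))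
    exact h1 h3

section Coordinates

variable {n : ℕ}

/-- Dropping the coordinate `i`. -/
def dropCoord (i : Fin (n + 1)) (y : Space (n + 1)) : Space n :=
  WithLp.toLp 2 fun j => y (i.succAbove j)

/-- Inserting the coordinate `t` in position `i`. -/
def insCoord (i : Fin (n + 1)) (t : ℝ) (z : Space n) : Space (n + 1) :=
  WithLp.toLp 2 (i.insertNth t fun j => z j)

theorem continuous_dropCoord (i : Fin (n + 1)) : Continuous (dropCoord i) := by
  unfold dropCoord
  fun_prop

theorem norm_sq_eq_dropCoord (i : Fin (n + 1)) (y : Space (n + 1)) :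
    ‖y‖ ^ 2 = y i ^ 2 + ‖dropCoord i y‖ ^ 2 := by
  rw [EuclideanSpace.norm_sq_eq, EuclideanSpace.norm_sq_eq, Fin.sum_univ_succAbove _ i]
  simp [dropCoord]

theorem dropCoord_sub (i : Fin (n + 1)) (y z : Space (n + 1)) :
    dropCoord i (y - z) = dropCoord i y - dropCoord i z := by
  ext j
  simp [dropCoord]

theorem add_smul_single_eq (i : Fin (n + 1)) (y : Space (n + 1)) (s : ℝ) :
    y + s • EuclideanSpace.single i (1 : ℝ) = insCoord i (y i + s) (dropCoord i y) := by
  ext j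
  rcases Fin.eq_self_or_eq_succAbove i j with rfl | ⟨k, rfl⟩
  · simp [insCoord]
  · simp [insCoord, dropCoord, Fin.succAbove_ne]

theorem measurable_insCoord (i : Fin (n + 1)) :
    Measurable fun p : ℝ × Space n => insCoord i p.1 p.2 := by
  have h : Measurable fun p : ℝ × Space n =>
      (MeasurableEquiv.piFinSuccAbove (fun _ => ℝ) i).symm (p.1, fun j => p.2 j) :=
    (MeasurableEquiv.measurable _).comp (measurable_fst.prodMk (by fun_prop))
  exact (PiLp.continuous_toLp 2 _).measurable.comp h

theorem lintegral_insCoord (i : Fin (n + 1)) {F : Space (n + 1) → ℝ≥0∞} (hF : Measurable F) :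
    ∫⁻ z : Space n, ∫⁻ t : ℝ, F (insCoord i t z) = ∫⁻ y, F y := by
  have hG : Measurable fun f : Fin (n + 1) → ℝ => F (WithLp.toLp 2 f) :=
    hF.comp (PiLp.continuous_toLp 2 _).measurable
  rw [← (PiLp.volume_preserving_toLp (Fin (n + 1))).lintegral_comp hF,
    ← ((volume_preserving_piFinSuccAbove (fun _ : Fin (n + 1) => ℝ) i).symm _).lintegral_comp hG,
    Measure.volume_eq_prod, lintegral_prod_symm]
  · have h2 : Measurable fun z : Space n => ∫⁻ t : ℝ, F (insCoord i t z) :=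
      (hF.comp (measurable_insCoord i)).lintegral_prod_left'
    rw [← (PiLp.volume_preserving_toLp (Fin n)).lintegral_comp h2]
    rfl
  · exact (hG.comp (MeasurableEquiv.measurable _)).aemeasurable

/-- The surface measure of a Lipschitz graph over the hyperplane `y i = 0` is controlled by the
Lebesgue measure of its projection. -/
theorem euclideanHausdorffMeasure_inter_preimage_le (i : Fin (n + 1)) {A : Set (Space (n + 1))}
    {L : NNReal} (hA : ∀ y ∈ A, ∀ z ∈ A, ‖y - z‖ ≤ L * ‖dropCoord i y - dropCoord i z‖)
    (B : Set (Space n)) :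
    (Measure.euclideanHausdorffMeasure n : Measure (Space (n + 1))) (A ∩ dropCoord i ⁻¹' B)
      ≤ (L : ℝ≥0∞) ^ (n : ℝ) * volume B := by
  set A' := A ∩ dropCoord i ⁻¹' B with hA'
  have hinj : InjOn (dropCoord i) A' := fun y hy z hz h => by
    have := hA y hy.1 z hz.1
    rw [h, sub_self, norm_zero, mul_zero] at this
    exact sub_eq_zero.1 (norm_le_zero_iff.1 this)
  -- The projection is injective on A' with an L-Lipschitz inverse, and a Lipschitz map enlarges
  -- n-dimensional Hausdorff measure by at most L^n.
  set g := Function.invFunOn (dropCoord i) A' with hg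
  have hgl : ∀ y ∈ A', g (dropCoord i y) = y := fun y hy => hinj.leftInvOn_invFunOn hy
  have hlip : LipschitzOnWith L g (dropCoord i '' A') := by
    refine LipschitzOnWith.of_dist_le_mul ?_
    rintro _ ⟨y, hy, rfl⟩ _ ⟨z, hz, rfl⟩
    rw [hgl y hy, hgl z hz, dist_eq_norm, dist_eq_norm]
    exact hA y hy.1 z hz.1
  have himg : g '' (dropCoord i '' A') = A' := by
    rw [image_image]
    exact (image_congr hgl).trans (image_id' _)
  have h1 := hlip.hausdorffMeasure_image_le (d := n) (Nat.cast_nonneg n)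
  rw [himg] at h1
  rw [← EuclideanSpace.euclideanHausdorffMeasure_eq_volume,
    Measure.euclideanHausdorffMeasure_def, Measure.euclideanHausdorffMeasure_def,
    Measure.smul_apply, Measure.smul_apply, mul_smul_comm]
  refine smul_le_smul_of_nonneg_left (h1.trans ?_) bot_le
  gcongr
  rintro _ ⟨y, hy, rfl⟩
  exact hy.2

/-- The integral over a full coordinate line depends on the base point only through its projection.
Pushed forward by the projection, the surface measure is at most L^n times Lebesgue measure, and
Tonelli reassembles the volume integral. -/
theorem lintegral_graph_le (i : Fin (n + 1)) {A : Set (Space (n + 1))}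
    {L : NNReal} (hA : ∀ y ∈ A, ∀ z ∈ A, ‖y - z‖ ≤ L * ‖dropCoord i y - dropCoord i z‖)
    {ε : ℝ} (hε : ε = 1 ∨ ε = -1) {F : Space (n + 1) → ℝ≥0∞} (hF : Measurable F) :
    ∫⁻ y in A, (∫⁻ s : ℝ, F (y + s • (ε • EuclideanSpace.single i (1 : ℝ))))
        ∂(Measure.euclideanHausdorffMeasure n : Measure (Space (n + 1)))
      ≤ (L : ℝ≥0∞) ^ (n : ℝ) * ∫⁻ y, F y := by
  set H : Space n → ℝ≥0∞ := fun z => ∫⁻ t : ℝ, F (insCoord i t z) with hH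
  have hHm : Measurable H := (hF.comp (measurable_insCoord i)).lintegral_prod_left'
  have e1 : ∀ y : Space (n + 1), ∫⁻ s : ℝ, F (y + s • (ε • EuclideanSpace.single i (1 : ℝ)))
      = H (dropCoord i y) := by
    intro y
    simp only [smul_smul, add_smul_single_eq]
    rcases hε with rfl | rfl
    · simp only [mul_one]
      exact lintegral_add_left_eq_self (fun t => F (insCoord i t (dropCoord i y))) (y i)
    · simp only [mul_neg, mul_one, ← sub_eq_add_neg]
      exact lintegral_sub_left_eq_self (fun t => F (insCoord i t (dropCoord i y))) (y i)
  simp only [e1]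
  rw [← lintegral_map hHm (continuous_dropCoord i).measurable, ← lintegral_insCoord i hF]
  have hle : (((Measure.euclideanHausdorffMeasure n : Measure (Space (n + 1))).restrict A).map
      (dropCoord i)) ≤ ((L : ℝ≥0∞) ^ (n : ℝ)) • (volume : Measure (Space n)) := by
    refine Measure.le_iff.2 fun B hB => ?_
    rw [Measure.map_apply (continuous_dropCoord i).measurable hB,
      Measure.restrict_apply ((continuous_dropCoord i).measurable hB), inter_comm,
      Measure.smul_apply, smul_eq_mul]
    exact euclideanHausdorffMeasure_inter_preimage_le i hA B
  refine (lintegral_mono' hle le_rfl).trans ?_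
  rw [lintegral_smul_measure, smul_eq_mul]

end Coordinates

section Line

/-- Applied to the parameters at which a line lies in a cell: only countably many transition times
occur. -/
theorem countable_frontier_of_convex_compact {I : Set ℝ} (h : Convex ℝ I) (hc : IsCompact I) :
    (frontier I).Countable := by
  rcases I.eq_empty_or_nonempty with rfl | hne
  · simp
  rw [eq_Icc_of_connected_compact ⟨hne, h.isPreconnected⟩ hc, frontier_Icc]
  · exact (Set.toFinite _).countable
  · exact csInf_le_csSup hne hc.bddBelow hc.bddAbove

/-- The fundamental theorem of calculus tolerates a countable exceptional set for a continuous
function with integrable derivative; if the derivative is not integrable, the right side is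
infinite. -/
theorem enorm_le_add_lintegral_deriv {u : ℝ → ℝ} {δ : ℝ} {E : Set ℝ} (hE : E.Countable)
    (hc : ContinuousOn u (Icc 0 δ)) (hd : ∀ t ∈ Ioo 0 δ \ E, DifferentiableAt ℝ u t)
    {s : ℝ} (hs : s ∈ Ioo 0 δ) :
    ‖u 0‖ₑ ≤ ‖u s‖ₑ + ∫⁻ t in Ioo 0 δ, ‖deriv u t‖ₑ := by
  by_cases htop : ∫⁻ t in Ioo 0 δ, ‖deriv u t‖ₑ = ⊤
  · simp [htop]
  have hint : IntegrableOn (deriv u) (Ioo 0 δ) :=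
    ⟨(measurable_deriv u).aestronglyMeasurable, lt_top_iff_ne_top.2 htop⟩
  have hii : IntervalIntegrable (deriv u) volume 0 s := by
    rw [intervalIntegrable_iff_integrableOn_Ioo_of_le hs.1.le]
    exact hint.mono_set (Ioo_subset_Ioo_right hs.2.le)
  have h1 := integral_eq_of_hasDerivAt_off_countable_of_le u (deriv u) hs.1.le hE
    (hc.mono (Icc_subset_Icc_right hs.2.le))
    (fun t ht => (hd t ⟨Ioo_subset_Ioo_right hs.2.le ht.1, ht.2⟩).hasDerivAt) hii
  have h2 : u 0 = u s - ∫ t in 0..s, deriv u t := by rw [h1]; ring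
  rw [h2]
  refine (enorm_sub_le).trans (add_le_add le_rfl ?_)
  rw [intervalIntegral.integral_of_le hs.1.le, integral_Ioc_eq_integral_Ioo]
  exact (enorm_integral_le_lintegral_enorm _).trans
    (lintegral_mono_set (Ioo_subset_Ioo_right hs.2.le))

variable {d : ℕ} {𝒯 : Geometry.SimplicialComplex ℝ (Space d)} {r : ℕ}

/-- Along the line w is continuous and piecewise polynomial. The condition on the skeleton ensures
that at almost every parameter the derivative along the line is a component of the full gradient. -/
theorem enorm_le_along_line (hfin : 𝒯.faces.Finite) {w : Space d → ℝ} (hw : w ∈ feSpace 𝒯 r)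
    {y v : Space d} (hv : ‖v‖ = 1) {δ : ℝ}
    (hmem : ∀ s ∈ Icc 0 δ, y + s • v ∈ ⋃₀ cells 𝒯)
    (hae : ∀ᵐ s ∂(volume.restrict (Ioo 0 δ)), y + s • v ∉ skeleton 𝒯) {s : ℝ} (hs : s ∈ Ioo 0 δ) :
    ‖w y‖ₑ ≤ ‖w (y + s • v)‖ₑ + ∫⁻ t in Ioo 0 δ, ‖gradient w (y + t • v)‖ₑ := by
  set γ : ℝ → Space d := fun s => y + s • v with hγ
  have hγc : Continuous γ := by fun_prop
  have hv0 : v ≠ 0 := by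
    rintro rfl
    simp at hv
  have hγd : ∀ t, HasDerivAt γ v t := fun t => by
    have h := ((hasDerivAt_id t).smul_const v).const_add y
    rw [one_smul] at h
    exact h
  have hcpt : ∀ S ∈ cells 𝒯, IsCompact (γ ⁻¹' S) := fun S hS => by
    have hiso : Isometry γ := Isometry.of_dist_eq fun a b => by
      simp only [hγ, dist_eq_norm]
      rw [add_sub_add_left_eq_sub, ← sub_smul, norm_smul, hv, mul_one]
    exact hiso.isClosedEmbedding.isCompact_preimage (isCompact_cell hS)
  have hconv : ∀ S ∈ cells 𝒯, Convex ℝ (γ ⁻¹' S) := fun S hS => by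
    have : γ = AffineMap.lineMap y (y + v) := by
      ext t
      simp [hγ, AffineMap.lineMap_apply, add_comm]
    rw [this]
    exact (convex_cell hS).affine_preimage _
  -- These are frontiers within the line, not preimages of cell frontiers: a line running inside a
  -- face would make the latter uncountable.
  set E : Set ℝ := ⋃ S ∈ cells 𝒯, frontier (γ ⁻¹' S) with hE
  have hEc : E.Countable := (finite_cells hfin).countable.biUnion fun S hS =>
    countable_frontier_of_convex_compact (hconv S hS) (hcpt S hS)
  have hcont : ContinuousOn (w ∘ γ) (Icc 0 δ) := hw.1.comp hγc.continuousOn hmem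
  have hdiff : ∀ t ∈ Ioo 0 δ \ E, DifferentiableAt ℝ (w ∘ γ) t := by
    rintro t ⟨ht, htE⟩
    obtain ⟨S, hS, htS⟩ := hmem t (Ioo_subset_Icc_self ht)
    have hint : t ∈ interior (γ ⁻¹' S) := by
      by_contra hn
      exact htE (mem_biUnion hS ⟨subset_closure htS, hn⟩)
    obtain ⟨p, -, hp⟩ := hw.2 S hS
    have heq : w ∘ γ =ᶠ[𝓝 t] polyFun p ∘ γ := by
      filter_upwards [mem_interior_iff_mem_nhds.1 hint] with τ hτ
      exact hp _ hτ
    refine heq.differentiableAt_iff.2 ?_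
    exact (differentiable_polyFun p _).comp t (hγd t).differentiableAt
  have h1 := enorm_le_add_lintegral_deriv hEc hcont hdiff hs
  simp only [Function.comp_apply, hγ, zero_smul, add_zero] at h1
  refine h1.trans (add_le_add le_rfl (lintegral_mono_ae ?_))
  filter_upwards [hae, ae_restrict_mem measurableSet_Ioo] with t ht ht'
  obtain ⟨S, hS, htS⟩ := mem_interior_cell (hmem t (Ioo_subset_Icc_self ht')) ht
  have hd := (differentiableAt_of_mem_interior hw hS htS).hasFDerivAt.comp_hasDerivAt t (hγd t)
  rw [enorm_le_iff_norm_le, norm_gradient]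
  have e : deriv (w ∘ fun s => y + s • v) t = fderiv ℝ w (y + t • v) v := hd.deriv
  rw [e]
  simpa [hv] using (fderiv ℝ w (y + t • v)).le_opNorm v

end Line

end Forchheimer

end

/-! ### The trace inequality, uniformly in the mesh. -/

noncomputable section

namespace Forchheimer

section TraceInequality

variable {n : ℕ}

theorem exists_single_ne_zero {d : ℕ} {D : Space d →L[ℝ] ℝ} (hD : D ≠ 0) :
    ∃ i, D (EuclideanSpace.single i 1) ≠ 0 := by
  by_contra! h
  apply hD
  refine ContinuousLinearMap.coe_injective ((EuclideanSpace.basisFun (Fin d) ℝ).toBasis.ext fun i => ?_)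
  simpa using h i

/-- A vector almost in the kernel of D cannot be large only in direction i, where D has size 2η. For
differences of boundary points this is the graph property. -/
theorem norm_le_mul_norm_dropCoord {D : Space (n + 1) →L[ℝ] ℝ} {i : Fin (n + 1)} {η : ℝ}
    (hη : 0 < η) (hD : |D (EuclideanSpace.single i 1)| = 2 * η) {y : Space (n + 1)}
    (hy : |D y| ≤ η * ‖y‖) : ‖y‖ ≤ ((‖D‖ + η) / η + 1) * ‖dropCoord i y‖ := by
  set q := y - y i • EuclideanSpace.single i (1 : ℝ) with hq
  have hyq : y = y i • EuclideanSpace.single i (1 : ℝ) + q := by rw [hq]; abel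
  have hqi : q i = 0 := by simp [hq]
  have hqd : dropCoord i q = dropCoord i y := by
    ext j
    simp [hq, dropCoord, Fin.succAbove_ne]
  have hqn : ‖q‖ = ‖dropCoord i y‖ := by
    have := norm_sq_eq_dropCoord i q
    rw [hqi, hqd] at this
    exact (sq_eq_sq₀ (norm_nonneg _) (norm_nonneg _)).1 (by linarith)
  have h1 : ‖y‖ ≤ |y i| + ‖q‖ := by
    calc ‖y‖ = ‖y i • EuclideanSpace.single i (1 : ℝ) + q‖ := by rw [← hyq]
      _ ≤ ‖y i • EuclideanSpace.single i (1 : ℝ)‖ + ‖q‖ := norm_add_le _ _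
      _ = _ := by rw [norm_smul]; simp
  have h2 : D y = y i * D (EuclideanSpace.single i 1) + D q := by
    conv_lhs => rw [hyq]
    simp
  have h3 : |y i| * (2 * η) ≤ |D y| + ‖D‖ * ‖q‖ := by
    rw [← hD, ← abs_mul, show y i * D (EuclideanSpace.single i 1) = D y - D q by rw [h2]; ring]
    exact (abs_sub _ _).trans (add_le_add le_rfl (D.le_opNorm q))
  rw [← hqn]
  have h4 : |y i| * η ≤ (‖D‖ + η) * ‖q‖ := by nlinarith
  have h5 : |y i| ≤ (‖D‖ + η) / η * ‖q‖ := by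
    rw [div_mul_eq_mul_div, le_div_iff₀ hη]
    exact h4
  linarith

/-- Apply `lintegral_graph_le` to the indicator of N. With N the skeleton, lines from almost every
boundary point meet it in a null set. -/
theorem ae_ae_notMem_of_null {A : Set (Space (n + 1))} (i : Fin (n + 1))
    {L : NNReal} (hA : ∀ y ∈ A, ∀ z ∈ A, ‖y - z‖ ≤ L * ‖dropCoord i y - dropCoord i z‖)
    {ε : ℝ} (hε : ε = 1 ∨ ε = -1) {N : Set (Space (n + 1))} (hN : MeasurableSet N)
    (hN0 : volume N = 0) :
    ∀ᵐ y ∂((Measure.euclideanHausdorffMeasure n : Measure (Space (n + 1))).restrict A),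
      ∀ᵐ s : ℝ, y + s • (ε • EuclideanSpace.single i (1 : ℝ)) ∉ N := by
  have hF : Measurable (N.indicator (1 : Space (n + 1) → ℝ≥0∞)) := measurable_one.indicator hN
  have h := lintegral_graph_le i hA hε hF
  rw [lintegral_indicator_one hN, hN0, mul_zero, nonpos_iff_eq_zero] at h
  have hline : Measurable fun p : Space (n + 1) × ℝ =>
      p.1 + p.2 • (ε • EuclideanSpace.single i (1 : ℝ)) := by fun_prop
  have hm : Measurable fun y => ∫⁻ s : ℝ, N.indicator (1 : Space (n + 1) → ℝ≥0∞)
      (y + s • (ε • EuclideanSpace.single i (1 : ℝ))) := (hF.comp hline).lintegral_prod_right'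
  rw [lintegral_eq_zero_iff hm] at h
  filter_upwards [h] with y hy
  have hy' := (lintegral_eq_zero_iff (hF.comp (hline.comp measurable_prodMk_left))).1 hy
  filter_upwards [hy'] with s hs hmem
  simp [hmem] at hs

/-- Bound |w(y)| by |w(y + sv)| plus the integral of |∇w| along the line, integrate over s in (0,
δ), then over the boundary piece with the graph inequality. -/
theorem lintegral_boundary_le_of_graph {Ω : Set (Space (n + 1))} (hΩ : IsOpen Ω)
    {A : Set (Space (n + 1))} (hAm : MeasurableSet A) (i : Fin (n + 1))
    {L : NNReal} (hA : ∀ y ∈ A, ∀ z ∈ A, ‖y - z‖ ≤ L * ‖dropCoord i y - dropCoord i z‖)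
    {ε : ℝ} (hε : ε = 1 ∨ ε = -1) {δ : ℝ} (hAΩ : A ⊆ closure Ω)
    (hin : ∀ y ∈ A, ∀ s ∈ Ioc 0 δ, y + s • (ε • EuclideanSpace.single i (1 : ℝ)) ∈ Ω)
    {𝒯 : Geometry.SimplicialComplex ℝ (Space (n + 1))} (hfin : 𝒯.faces.Finite)
    (hcov : closure Ω ⊆ ⋃₀ cells 𝒯) {r : ℕ} {w : Space (n + 1) → ℝ} (hw : w ∈ feSpace 𝒯 r) :
    ENNReal.ofReal δ * ∫⁻ y in A, ‖w y‖ₑ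
        ∂(Measure.euclideanHausdorffMeasure n : Measure (Space (n + 1)))
      ≤ (L : ℝ≥0∞) ^ (n : ℝ) * (∫⁻ y in Ω, ‖w y‖ₑ) +
        ENNReal.ofReal δ * ((L : ℝ≥0∞) ^ (n : ℝ) * ∫⁻ y in Ω, ‖gradient w y‖ₑ) := by
  classical
  set v : Space (n + 1) := ε • EuclideanSpace.single i (1 : ℝ) with hv
  have hv1 : ‖v‖ = 1 := by
    rw [hv, norm_smul]
    rcases hε with rfl | rfl <;> simp
  set F₁ : Space (n + 1) → ℝ≥0∞ := Ω.indicator fun y => ‖w y‖ₑ with hF₁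
  set F₂ : Space (n + 1) → ℝ≥0∞ := Ω.indicator fun y => ‖gradient w y‖ₑ with hF₂
  have hF₁m : Measurable F₁ := by
    have h1 : Measurable (Ω.indicator w) := by
      rw [← piecewise_eq_indicator]
      exact ContinuousOn.measurable_piecewise (hw.1.mono (subset_closure.trans hcov))
        continuousOn_const hΩ.measurableSet
    have h2 : F₁ = fun y => ‖Ω.indicator w y‖ₑ := by
      ext y
      by_cases hy : y ∈ Ω <;> simp [hF₁, hy]
    rw [h2]
    exact h1.enorm
  have hF₂m : Measurable F₂ := (measurable_gradient w).enorm.indicator hΩ.measurableSet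
  have hline : Measurable fun p : Space (n + 1) × ℝ => p.1 + p.2 • v := by fun_prop
  have key : ∀ᵐ y ∂((Measure.euclideanHausdorffMeasure n : Measure (Space (n + 1))).restrict A),
      ENNReal.ofReal δ * ‖w y‖ₑ ≤
        (∫⁻ s : ℝ, F₁ (y + s • v)) + ENNReal.ofReal δ * ∫⁻ s : ℝ, F₂ (y + s • v) := by
    filter_upwards [ae_ae_notMem_of_null i hA hε (isClosed_skeleton hfin).measurableSet
      (volume_skeleton hfin), ae_restrict_mem hAm] with y hy hyA
    have hmem : ∀ s ∈ Icc 0 δ, y + s • v ∈ ⋃₀ cells 𝒯 := by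
      rintro s ⟨hs0, hsδ⟩
      rcases hs0.eq_or_lt with rfl | hs0
      · simpa using hcov (hAΩ hyA)
      · exact hcov (subset_closure (hin y hyA s ⟨hs0, hsδ⟩))
    have hI : ∀ F : Space (n + 1) → ℝ≥0∞, ∫⁻ s in Ioo 0 δ, F (y + s • v) ≤
        ∫⁻ s : ℝ, Ω.indicator F (y + s • v) := fun F => by
      rw [← lintegral_indicator measurableSet_Ioo]
      refine lintegral_mono fun s => ?_
      by_cases hs : s ∈ Ioo 0 δ
      · rw [indicator_of_mem hs, indicator_of_mem (hin y hyA s ⟨hs.1, hs.2.le⟩)]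
      · simp [hs]
    have h1 : ∀ s ∈ Ioo 0 δ, ‖w y‖ₑ ≤ ‖w (y + s • v)‖ₑ + ∫⁻ s : ℝ, F₂ (y + s • v) :=
      fun s hs => (enorm_le_along_line hfin hw hv1 hmem (ae_restrict_of_ae hy) hs).trans
        (add_le_add le_rfl (hI fun y => ‖gradient w y‖ₑ))
    have h2 : ∫⁻ _ in Ioo 0 δ, ‖w y‖ₑ ≤
        ∫⁻ s in Ioo 0 δ, (‖w (y + s • v)‖ₑ + ∫⁻ s : ℝ, F₂ (y + s • v)) :=
      setLIntegral_mono' measurableSet_Ioo h1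
    rw [lintegral_add_right _ measurable_const, setLIntegral_const, setLIntegral_const,
      Real.volume_Ioo, sub_zero, mul_comm, mul_comm (∫⁻ s : ℝ, F₂ (y + s • v))] at h2
    exact h2.trans (add_le_add (hI fun y => ‖w y‖ₑ) le_rfl)
  have hm₁ : Measurable fun y => ∫⁻ s : ℝ, F₁ (y + s • v) :=
    (hF₁m.comp hline).lintegral_prod_right'
  have hm₂ : Measurable fun y => ∫⁻ s : ℝ, F₂ (y + s • v) :=
    (hF₂m.comp hline).lintegral_prod_right'
  rw [← lintegral_const_mul' _ _ ENNReal.ofReal_ne_top]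
  refine (lintegral_mono_ae key).trans ?_
  rw [lintegral_add_left hm₁, lintegral_const_mul _ hm₂,
    ← lintegral_indicator hΩ.measurableSet, ← lintegral_indicator hΩ.measurableSet]
  gcongr
  · exact lintegral_graph_le i hA hε hF₁m
  · exact lintegral_graph_le i hA hε hF₂m

/-- Near x the boundary is a Lipschitz graph over the hyperplane orthogonal to some coordinate axis,
and one of the two directions of this axis points into Ω. -/
theorem HasC1Boundary.exists_local_trace {Ω : Set (Space (n + 1))} (hC : HasC1Boundary Ω)
    (hΩ : IsOpen Ω) {x : Space (n + 1)} (hx : x ∈ frontier Ω) :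
    ∃ R : ℝ, 0 < R ∧ ∃ C : ℝ≥0∞, C ≠ ⊤ ∧
      ∀ (𝒯 : Geometry.SimplicialComplex ℝ (Space (n + 1))), 𝒯.faces.Finite →
        closure Ω ⊆ ⋃₀ cells 𝒯 → ∀ (r : ℕ), ∀ w ∈ feSpace 𝒯 r,
        ∫⁻ y in frontier Ω ∩ Metric.ball x R, ‖w y‖ₑ
          ∂(Measure.euclideanHausdorffMeasure n : Measure (Space (n + 1))) ≤
          C * ((∫⁻ y in Ω, ‖w y‖ₑ) + ∫⁻ y in Ω, ‖gradient w y‖ₑ) := by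
  obtain ⟨φ, D, hD, hchart⟩ := hC.exists_chart hΩ hx
  obtain ⟨i, hi⟩ := exists_single_ne_zero hD
  -- With this choice the linear part dominates the chart error twice: on boundary points (graph
  -- property) and along v, where φ decreases at rate at least 2η - η.
  set η : ℝ := |D (EuclideanSpace.single i 1)| / 2 with hη
  have hη0 : 0 < η := by positivity
  obtain ⟨R, hR, hin, hfr, hφ⟩ := hchart η hη0
  obtain ⟨ε, hε, hεD⟩ : ∃ ε : ℝ, (ε = 1 ∨ ε = -1) ∧ D (ε • EuclideanSpace.single i 1) = -(2 * η) := by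
    rcases le_total 0 (D (EuclideanSpace.single i 1)) with h | h
    · refine ⟨-1, Or.inr rfl, ?_⟩
      rw [map_smul, hη, abs_of_nonneg h, smul_eq_mul]
      ring
    · refine ⟨1, Or.inl rfl, ?_⟩
      rw [map_smul, hη, abs_of_nonpos h, smul_eq_mul]
      ring
  set v : Space (n + 1) := ε • EuclideanSpace.single i (1 : ℝ) with hv
  have hv1 : ‖v‖ = 1 := by
    rw [hv, norm_smul]
    rcases hε with rfl | rfl <;> simp
  set A := frontier Ω ∩ Metric.ball x (R / 2) with hA
  have hAR : ∀ y ∈ A, y ∈ Metric.ball x R := fun y hy =>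
    Metric.ball_subset_ball (by linarith) hy.2
  set L : NNReal := ⟨(‖D‖ + η) / η + 1, by positivity⟩ with hL
  have hAL : ∀ y ∈ A, ∀ z ∈ A, ‖y - z‖ ≤ L * ‖dropCoord i y - dropCoord i z‖ := by
    intro y hy z hz
    rw [← dropCoord_sub]
    refine norm_le_mul_norm_dropCoord hη0 (by rw [hη]; ring) ?_
    have h := hφ y (hAR y hy) z (hAR z hz)
    rw [hfr y (hAR y hy) hy.1, hfr z (hAR z hz) hz.1] at h
    rwa [sub_zero, zero_sub, abs_neg] at h
  have hAin : ∀ y ∈ A, ∀ s ∈ Ioc 0 (R / 4), y + s • v ∈ Ω := by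
    rintro y hy s ⟨hs0, hs⟩
    have hmem : y + s • v ∈ Metric.ball x R := by
      have h1 : dist (y + s • v) y = s := by
        rw [dist_eq_norm, add_sub_cancel_left, norm_smul, hv1, Real.norm_of_nonneg hs0.le, mul_one]
      have h2 : dist y x < R / 2 := hy.2
      exact lt_of_le_of_lt (dist_triangle _ y x) (by linarith)
    rw [hin _ hmem]
    have h := hφ _ hmem y (hAR y hy)
    rw [hfr y (hAR y hy) hy.1, add_sub_cancel_left, map_smul, hεD, norm_smul, hv1,
      Real.norm_of_nonneg hs0.le, smul_eq_mul] at h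
    have := (abs_le.1 h).2
    nlinarith
  refine ⟨R / 2, by positivity, (ENNReal.ofReal (R / 4))⁻¹ *
    ((L : ℝ≥0∞) ^ (n : ℝ) * (1 + ENNReal.ofReal (R / 4))), ?_, ?_⟩
  · refine ENNReal.mul_ne_top (ENNReal.inv_ne_top.2 (by simpa using hR))
      (ENNReal.mul_ne_top (ENNReal.rpow_ne_top_of_nonneg (Nat.cast_nonneg n) (by simp))
      (by simp))
  · intro 𝒯 hfin hcov r w hw
    have h := lintegral_boundary_le_of_graph hΩ
      (isClosed_frontier.measurableSet.inter Metric.isOpen_ball.measurableSet) i hAL hε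
      (fun y hy => frontier_subset_closure hy.1) hAin hfin hcov hw
    have hδ0 : ENNReal.ofReal (R / 4) ≠ 0 := by simpa using hR
    rw [mul_assoc, mul_comm, ← div_eq_mul_inv, ENNReal.le_div_iff_mul_le (Or.inl hδ0)
      (Or.inl ENNReal.ofReal_ne_top), mul_comm]
    refine h.trans ?_
    set I₁ := ∫⁻ y in Ω, ‖w y‖ₑ
    set I₂ := ∫⁻ y in Ω, ‖gradient w y‖ₑ
    set δ := ENNReal.ofReal (R / 4)
    set M := (L : ℝ≥0∞) ^ (n : ℝ)
    calc M * I₁ + δ * (M * I₂) ≤ (M * I₁ + δ * (M * I₂)) + (M * I₂ + δ * (M * I₁)) := le_self_add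
      _ = _ := by ring

/-- The trace inequality `W^{1,1}(Ω) → L¹(∂Ω)` for finite element functions. -/
theorem exists_trace_bound {d : ℕ} (hd : 1 ≤ d) {Ω : Set (Space d)} (hΩ : IsOpen Ω)
    (hΩb : Bornology.IsBounded Ω) (hC : HasC1Boundary Ω) :
    ∃ C : ℝ≥0∞, C ≠ ⊤ ∧
      ∀ (𝒯 : Geometry.SimplicialComplex ℝ (Space d)), 𝒯.faces.Finite →
        closure Ω ⊆ ⋃₀ cells 𝒯 → ∀ (r : ℕ), ∀ w ∈ feSpace 𝒯 r,
        ∫⁻ y, ‖w y‖ₑ ∂(surf Ω) ≤ C * ((∫⁻ y in Ω, ‖w y‖ₑ) + ∫⁻ y in Ω, ‖gradient w y‖ₑ) := by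
  obtain ⟨n, rfl⟩ : ∃ n, d = n + 1 := ⟨d - 1, by omega⟩
  have hK : IsCompact (frontier Ω) := Metric.isCompact_of_isClosed_isBounded isClosed_frontier
    (hΩb.closure.subset frontier_subset_closure)
  -- The bound passes to subsets and to finite unions, so compactness makes it global.
  have := hK.induction_on (p := fun s => ∃ C : ℝ≥0∞, C ≠ ⊤ ∧
      ∀ (𝒯 : Geometry.SimplicialComplex ℝ (Space (n + 1))), 𝒯.faces.Finite →
        closure Ω ⊆ ⋃₀ cells 𝒯 → ∀ (r : ℕ), ∀ w ∈ feSpace 𝒯 r,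
        ∫⁻ y in s, ‖w y‖ₑ ∂(Measure.euclideanHausdorffMeasure n : Measure (Space (n + 1))) ≤
          C * ((∫⁻ y in Ω, ‖w y‖ₑ) + ∫⁻ y in Ω, ‖gradient w y‖ₑ))
    ⟨0, by simp, by simp⟩
    (fun s t hst ⟨C, hC, h⟩ => ⟨C, hC, fun 𝒯 h1 h2 r w hw =>
      (lintegral_mono_set hst).trans (h 𝒯 h1 h2 r w hw)⟩)
    (fun s t ⟨C, hC, h⟩ ⟨C', hC', h'⟩ => ⟨C + C', by simp [hC, hC'], fun 𝒯 h1 h2 r w hw => by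
      refine (lintegral_union_le _ _ _).trans ?_
      rw [add_mul]
      exact add_le_add (h 𝒯 h1 h2 r w hw) (h' 𝒯 h1 h2 r w hw)⟩)
    (fun x hx => by
      obtain ⟨R, hR, C, hCt, h⟩ := hC.exists_local_trace hΩ hx
      exact ⟨frontier Ω ∩ Metric.ball x R, inter_mem self_mem_nhdsWithin
        (mem_nhdsWithin_of_mem_nhds (Metric.ball_mem_nhds x hR)), C, hCt, h⟩)
  exact this

end TraceInequality

end Forchheimer

end

/-! ### Homogeneous polynomials in barycentric coordinates. -/

noncomputable section

namespace Forchheimer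

/-- All linear maps on a finite-dimensional space are continuous for the norm induced by T. The
mesh-independent constants in the polynomial estimates come from here, on fixed reference spaces. -/
theorem exists_norm_le_of_injective {V F G : Type*} [AddCommGroup V] [Module ℝ V]
    [FiniteDimensional ℝ V] [NormedAddCommGroup F] [NormedSpace ℝ F] [NormedAddCommGroup G]
    [NormedSpace ℝ G] (T : V →ₗ[ℝ] F) (hT : Function.Injective T) (A : V →ₗ[ℝ] G) :
    ∃ C : ℝ, 0 < C ∧ ∀ v, ‖A v‖ ≤ C * ‖T v‖ := by
  set e := LinearEquiv.ofInjective T hT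
  set L := LinearMap.toContinuousLinearMap (A ∘ₗ e.symm.toLinearMap)
  refine ⟨‖L‖ + 1, by positivity, fun v => ?_⟩
  have h1 : A v = L (e v) := by simp [L]
  have h2 : ‖e v‖ = ‖T v‖ := rfl
  rw [h1, ← h2]
  exact (L.le_opNorm _).trans (by nlinarith [norm_nonneg (e v)])

section Simplex

/-- A homogeneous polynomial of degree `r` in the variables `λ v`, `v ∈ s`. -/
def homPoly {ι : Type*} [DecidableEq ι] (s : Finset ι) (r : ℕ) (a : (ι →₀ ℕ) → ℝ) (l : ι → ℝ) : ℝ :=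
  ∑ m ∈ s.finsuppAntidiag r, a m * ∏ v ∈ s, l v ^ m v

theorem homPoly_smul {ι : Type*} [DecidableEq ι] (s : Finset ι) (r : ℕ) (a : (ι →₀ ℕ) → ℝ)
    (l : ι → ℝ) (t : ℝ) : homPoly s r a (fun v => t * l v) = t ^ r * homPoly s r a l := by
  unfold homPoly
  rw [Finset.mul_sum]
  refine Finset.sum_congr rfl fun m hm => ?_
  simp only [mul_pow, Finset.prod_mul_distrib, Finset.prod_pow_eq_pow_sum]
  rw [(Finset.mem_finsuppAntidiag.1 hm).1]
  ring

/-- A polynomial vanishing on a product of infinite sets is zero. -/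
theorem coeff_eq_zero_of_homPoly {n r : ℕ} {a : (Fin n →₀ ℕ) → ℝ}
    (h : ∀ l : Fin n → ℝ, (∀ v, 0 < l v) → homPoly Finset.univ r a l = 0) {m : Fin n →₀ ℕ}
    (hm : m ∈ Finset.univ.finsuppAntidiag r) : a m = 0 := by
  set q : MvPolynomial (Fin n) ℝ :=
    ∑ m ∈ Finset.univ.finsuppAntidiag r, MvPolynomial.monomial m (a m) with hq
  have hq0 : q = 0 := by
    refine MvPolynomial.funext_set (fun _ => Ioi (0 : ℝ)) (fun _ => Ioi_infinite _) fun l hl => ?_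
    have h1 := h l fun v => hl v (mem_univ v)
    rw [hq, map_zero, map_sum, ← h1]
    refine Finset.sum_congr rfl fun m _ => ?_
    rw [MvPolynomial.eval_monomial, Finsupp.prod_fintype _ _ (by simp)]
  have h2 : MvPolynomial.coeff m q = a m := by
    rw [hq, MvPolynomial.coeff_sum]
    simp only [MvPolynomial.coeff_monomial]
    rw [Finset.sum_ite_eq_of_mem' _ _ _ hm]
  rw [← h2, hq0, MvPolynomial.coeff_zero]

/-- Relabelling the vertices by `Fin n` removes the simplex from the estimate, so the constant
depends only on the number of vertices and the degree. -/
theorem homPoly_embDomain {ι : Type*} [DecidableEq ι] {n : ℕ} (E : Fin n ↪ ι) (r : ℕ)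
    (a : (ι →₀ ℕ) → ℝ) (l : ι → ℝ) :
    homPoly (Finset.univ.map E) r a l =
      homPoly Finset.univ r (fun k => a (k.embDomain E)) (fun i => l (E i)) := by
  unfold homPoly
  symm
  refine Finset.sum_bij (fun k _ => k.embDomain E) ?_ ?_ ?_ ?_
  · intro k hk
    rw [Finset.mem_finsuppAntidiag] at hk ⊢
    refine ⟨by simpa using hk.1, ?_⟩
    rw [Finsupp.support_embDomain]
    exact Finset.map_subset_map.2 hk.2
  · intro k _ k' _ h
    exact Finsupp.embDomain_injective E h
  · intro m hm
    rw [Finset.mem_finsuppAntidiag] at hm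
    have hr : (m.support : Set ι) ⊆ range E := fun v hv => by
      have := hm.2 hv
      simpa using this
    have h2 := Finsupp.embDomain_comapDomain hr
    refine ⟨Finsupp.comapDomain E m E.injective.injOn, ?_, h2⟩
    rw [Finset.mem_finsuppAntidiag]
    exact ⟨(Finset.sum_map _ _ _).symm.trans hm.1, Finset.subset_univ _⟩
  · intro k _
    simp

/-- The coefficients of a homogeneous polynomial are controlled by its values on the standard
simplex. -/
theorem exists_coeff_bound (n r : ℕ) (hn : n ≠ 0) : ∃ C : ℝ, 0 < C ∧
    ∀ {ι : Type*} [DecidableEq ι] (s : Finset ι), s.card = n → ∀ (a : (ι →₀ ℕ) → ℝ) (M : ℝ),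
      (∀ l : ι → ℝ, (∀ v, 0 ≤ l v) → ∑ v ∈ s, l v = 1 → (∀ v ∉ s, l v = 0) →
        |homPoly s r a l| ≤ M) → ∀ m ∈ s.finsuppAntidiag r, |a m| ≤ C * M := by
  classical
  set I := (Finset.univ : Finset (Fin n)).finsuppAntidiag r
  set ext0 : (I → ℝ) → ((Fin n →₀ ℕ) → ℝ) := fun b m => if h : m ∈ I then b ⟨m, h⟩ else 0 with hext
  have hval : ∀ (b : I → ℝ) (l : Fin n → ℝ), homPoly Finset.univ r (ext0 b) l =
      ∑ m : I, b m * ∏ v, l v ^ m.1 v := fun b l => by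
    unfold homPoly
    rw [← Finset.sum_coe_sort]
    refine Finset.sum_congr rfl fun m _ => ?_
    simp [hext]
  let T : (I → ℝ) →ₗ[ℝ] C(stdSimplex ℝ (Fin n), ℝ) :=
    { toFun := fun b => ⟨fun l => ∑ m : I, b m * ∏ v, l.1 v ^ m.1 v,
        continuous_finsetSum _ fun m _ => continuous_const.mul (continuous_finsetProd _ fun v _ =>
          ((continuous_apply v).comp continuous_subtype_val).pow _)⟩
      map_add' := fun b c => by
        ext l
        simp [add_mul, Finset.sum_add_distrib]
      map_smul' := fun t b => by
        ext l
        simp [mul_assoc, Finset.mul_sum] }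
  -- By homogeneity, vanishing on the standard simplex extends to the open positive cone, which
  -- determines the coefficients.
  have hTinj : Function.Injective T := by
    rw [← LinearMap.ker_eq_bot, LinearMap.ker_eq_bot']
    intro b hb
    have h0 : ∀ l : Fin n → ℝ, (∀ v, 0 < l v) → homPoly Finset.univ r (ext0 b) l = 0 := by
      intro l hl
      have hne : (Finset.univ : Finset (Fin n)).Nonempty := by
        rw [Finset.univ_nonempty_iff]
        exact ⟨⟨0, Nat.pos_of_ne_zero hn⟩⟩
      set t := ∑ v, l v with ht
      have ht0 : 0 < t := Finset.sum_pos (fun v _ => hl v) hne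
      have hmem : (fun v => t⁻¹ * l v) ∈ stdSimplex ℝ (Fin n) :=
        ⟨fun v => mul_nonneg (by positivity) (hl v).le, by
          rw [← Finset.mul_sum, ← ht, inv_mul_cancel₀ ht0.ne']⟩
      have h1 := DFunLike.congr_fun hb ⟨_, hmem⟩
      have h2 : homPoly Finset.univ r (ext0 b) (fun v => t⁻¹ * l v) = 0 := by
        rw [hval]
        exact h1
      rw [homPoly_smul] at h2
      exact (mul_eq_zero.1 h2).resolve_left (by positivity)
    ext ⟨m, hm⟩
    have := coeff_eq_zero_of_homPoly h0 hm
    simpa [hext, hm] using this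
  obtain ⟨C, hC, hCT⟩ := exists_norm_le_of_injective T hTinj LinearMap.id
  refine ⟨C, hC, ?_⟩
  intro ι _ s hs a M hM m hm
  obtain ⟨e⟩ : Nonempty (Fin n ≃ s) := ⟨(Finset.equivFinOfCardEq hs).symm⟩
  set E : Fin n ↪ ι := e.toEmbedding.trans (Function.Embedding.subtype _) with hE
  have hsE : s = Finset.univ.map E := by
    ext v
    simp only [Finset.mem_map, Finset.mem_univ, true_and]
    exact ⟨fun hv => ⟨e.symm ⟨v, hv⟩, by simp [hE]⟩, by rintro ⟨i, rfl⟩; exact (e i).2⟩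
  set b : I → ℝ := fun k => a (k.1.embDomain E) with hb
  have hM' : ∀ l : stdSimplex ℝ (Fin n), ‖T b l‖ ≤ M := by
    rintro ⟨l, hl0, hl1⟩
    set l' : ι → ℝ := Function.extend E l 0 with hl'
    have h1 : (fun i => l' (E i)) = l := by
      ext i
      exact E.injective.extend_apply _ _ _
    have h0 : ∀ v, 0 ≤ l' v := fun v => by
      by_cases hv : ∃ i, E i = v
      · obtain ⟨i, rfl⟩ := hv
        rw [show l' (E i) = l i from congrFun h1 i]
        exact hl0 i
      · rw [hl', Function.extend_apply' _ _ _ hv]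
        simp
    have h2 := hM l' h0 (by
      rw [hsE, Finset.sum_map]
      exact (congrArg (fun f => ∑ i, f i) h1).trans hl1) (fun v hv => by
        rw [hl', Function.extend_apply' _ _ _ (fun ⟨i, hi⟩ => hv (by rw [hsE]; simp [← hi]))]
        rfl)
    rw [hsE, homPoly_embDomain, h1] at h2
    have h3 : T b ⟨l, hl0, hl1⟩ = homPoly Finset.univ r (fun k => a (k.embDomain E)) l := by
      exact Finset.sum_coe_sort I fun k => a (k.embDomain E) * ∏ v, l v ^ k v
    rw [h3]
    exact h2
  have hM0 : 0 ≤ M := (norm_nonneg _).trans (hM' ⟨_, single_mem_stdSimplex ℝ ⟨0, Nat.pos_of_ne_zero hn⟩⟩)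
  have hTb : ‖T b‖ ≤ M := (ContinuousMap.norm_le _ hM0).2 hM'
  rw [Finset.mem_finsuppAntidiag] at hm
  have hr : (m.support : Set ι) ⊆ range E := fun v hv => by
    have := hm.2 hv
    rw [hsE] at this
    simpa using this
  have h2 := Finsupp.embDomain_comapDomain hr
  have hk : Finsupp.comapDomain E m E.injective.injOn ∈ I := by
    rw [Finset.mem_finsuppAntidiag]
    refine ⟨?_, Finset.subset_univ _⟩
    have := hm.1
    rw [hsE] at this
    exact (Finset.sum_map _ _ _).symm.trans this
  calc |a m| = ‖b ⟨_, hk⟩‖ := by rw [hb]; simp only [h2, Real.norm_eq_abs]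
    _ ≤ ‖b‖ := norm_le_pi_norm _ _
    _ ≤ C * ‖T b‖ := hCT b
    _ ≤ C * M := by gcongr

/-- A polynomial of degree at most `r` is a homogeneous polynomial of degree `r` of the barycentric
coordinates. -/
theorem exists_homPoly_eq {d r : ℕ} [DecidableEq (Space d)] {p : MvPolynomial (Fin d) ℝ}
    (hp : p.totalDegree ≤ r) (s : Finset (Space d)) :
    ∃ a : (Space d →₀ ℕ) → ℝ, ∀ l : Space d → ℝ, ∑ v ∈ s, l v = 1 →
      polyFun p (∑ v ∈ s, l v • v) = homPoly s r a l := by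
  set σ : MvPolynomial (Space d) ℝ := ∑ v ∈ s, MvPolynomial.X v with hσ
  set L : Fin d → MvPolynomial (Space d) ℝ :=
    fun i => ∑ v ∈ s, MvPolynomial.C (v i) * MvPolynomial.X v with hL
  -- The component of degree k is raised to degree r by a power of σ, the sum of the variables,
  -- which equals 1 on barycentric coordinates.
  set q : MvPolynomial (Space d) ℝ := ∑ k ∈ Finset.range (r + 1),
    σ ^ (r - k) * MvPolynomial.aeval L (MvPolynomial.homogeneousComponent k p) with hq
  have hLh : ∀ i, (L i).IsHomogeneous 1 := fun i =>
    MvPolynomial.IsHomogeneous.sum _ _ _ fun v _ => by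
      simpa using (MvPolynomial.isHomogeneous_C (Space d) (v i)).mul (MvPolynomial.isHomogeneous_X ℝ v)
  have hσh : σ.IsHomogeneous 1 :=
    MvPolynomial.IsHomogeneous.sum _ _ _ fun v _ => MvPolynomial.isHomogeneous_X ℝ v
  have hqh : q.IsHomogeneous r := MvPolynomial.IsHomogeneous.sum _ _ _ fun k hk => by
    have h1 := (hσh.pow (r - k)).mul
      ((MvPolynomial.homogeneousComponent_isHomogeneous k p).aeval L hLh)
    convert h1 using 1
    have := Finset.mem_range.1 hk
    omega
  have hσs : σ ∈ MvPolynomial.supported ℝ (s : Set (Space d)) :=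
    sum_mem fun v hv => MvPolynomial.X_mem_supported.2 hv
  have hLs : ∀ i, L i ∈ MvPolynomial.supported ℝ (s : Set (Space d)) := fun i =>
    sum_mem fun v hv => mul_mem (Subalgebra.algebraMap_mem _ _) (MvPolynomial.X_mem_supported.2 hv)
  have hqs : q ∈ MvPolynomial.supported ℝ (s : Set (Space d)) := sum_mem fun k _ =>
    mul_mem (pow_mem hσs _) (by
      rw [MvPolynomial.aeval_def, MvPolynomial.eval₂_eq]
      exact sum_mem fun m _ => mul_mem (Subalgebra.algebraMap_mem _ _)
        (prod_mem fun i _ => pow_mem (hLs i) _))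
  have hsupp : ∀ m ∈ q.support, m ∈ s.finsuppAntidiag r := fun m hm => by
    rw [Finset.mem_finsuppAntidiag']
    refine ⟨?_, fun v hv => ?_⟩
    · by_contra hne
      exact MvPolynomial.mem_support_iff.1 hm (hqh.coeff_eq_zero (by
        rwa [Finsupp.degree_apply]))
    · exact MvPolynomial.mem_supported.1 hqs ((MvPolynomial.mem_vars_iff_mem_support v).2 ⟨m, hm, hv⟩)
  refine ⟨fun m => MvPolynomial.coeff m q, fun l hl => ?_⟩
  have hσl : MvPolynomial.eval l σ = 1 := by rw [hσ, map_sum]; simpa using hl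
  have hLl : ∀ i, MvPolynomial.eval l (L i) = (∑ v ∈ s, l v • v) i := fun i => by
    rw [hL, map_sum]
    simp [mul_comm]
  have h1 : MvPolynomial.eval l q = polyFun p (∑ v ∈ s, l v • v) := by
    have hsum : p = ∑ k ∈ Finset.range (r + 1), MvPolynomial.homogeneousComponent k p := by
      conv_lhs => rw [← MvPolynomial.sum_homogeneousComponent p]
      refine Finset.sum_subset (Finset.range_mono (by omega)) fun k _ hk => ?_
      exact MvPolynomial.homogeneousComponent_eq_zero _ _ (by simpa using hk)
    unfold polyFun
    conv_rhs => rw [hsum]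
    rw [hq, map_sum, map_sum]
    refine Finset.sum_congr rfl fun k _ => ?_
    rw [map_mul, map_pow, hσl, one_pow, one_mul, MvPolynomial.aeval_def, MvPolynomial.eval₂_eq,
      MvPolynomial.eval_eq _ (MvPolynomial.homogeneousComponent k p), map_sum]
    refine Finset.sum_congr rfl fun m _ => ?_
    rw [map_mul, map_prod]
    simp only [map_pow, hLl]
    simp
  rw [← h1, MvPolynomial.eval_eq]
  unfold homPoly
  rw [Finset.sum_subset hsupp fun m _ hm => by rw [MvPolynomial.notMem_support_iff.1 hm, zero_mul]]
  refine Finset.sum_congr rfl fun m hm => ?_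
  congr 1
  refine Finset.prod_subset (Finset.mem_finsuppAntidiag.1 hm).2 fun v _ hv => ?_
  rw [Finsupp.notMem_support_iff.1 hv, pow_zero]

end Simplex

end Forchheimer

end

/-! ### Scale-invariant estimates for polynomials on balls. -/

noncomputable section

namespace Forchheimer

variable {d : ℕ}

theorem polyFun_add (p q : MvPolynomial (Fin d) ℝ) (x : Space d) :
    polyFun (p + q) x = polyFun p x + polyFun q x := by simp [polyFun]

theorem polyFun_smul (c : ℝ) (p : MvPolynomial (Fin d) ℝ) (x : Space d) :
    polyFun (c • p) x = c * polyFun p x := by simp [polyFun]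

theorem gradient_polyFun_add (p q : MvPolynomial (Fin d) ℝ) (x : Space d) :
    gradient (polyFun (p + q)) x = gradient (polyFun p) x + gradient (polyFun q) x := by
  unfold gradient
  rw [show polyFun (p + q) = polyFun p + polyFun q from funext (polyFun_add p q),
    fderiv_add (differentiable_polyFun p x) (differentiable_polyFun q x), map_add]

theorem gradient_polyFun_smul (c : ℝ) (p : MvPolynomial (Fin d) ℝ) (x : Space d) :
    gradient (polyFun (c • p)) x = c • gradient (polyFun p) x := by
  unfold gradient
  rw [show polyFun (c • p) = c • polyFun p from funext fun x => by simp [polyFun_smul],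
    fderiv_const_smul (differentiable_polyFun p x), map_smul]

theorem eq_zero_of_polyFun_eq_zero {p : MvPolynomial (Fin d) ℝ} {ρ : ℝ} (hρ : 0 < ρ)
    (h : ∀ x ∈ Metric.ball (0 : Space d) ρ, polyFun p x = 0) : p = 0 := by
  have hcont : ContinuousAt (fun x : Fin d → ℝ => (WithLp.toLp 2 x : Space d)) 0 :=
    (PiLp.continuous_toLp 2 _).continuousAt
  obtain ⟨δ, hδ, hδ'⟩ := Metric.continuousAt_iff.1 hcont ρ hρ
  refine MvPolynomial.funext_set (fun _ => Ioo (-δ) δ)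
    (fun _ => Ioo_infinite (by linarith)) fun x hx => ?_
  have hx' : dist x 0 < δ := by
    rw [dist_pi_lt_iff hδ]
    intro i
    have := hx i (mem_univ i)
    simpa [Real.dist_eq, abs_lt] using this
  have := h (WithLp.toLp 2 x) (by simpa using hδ' hx')
  simpa [polyFun] using this

/-- The polynomial `z ↦ p (x + h z)`. -/
def affinePoly (p : MvPolynomial (Fin d) ℝ) (x : Space d) (h : ℝ) : MvPolynomial (Fin d) ℝ :=
  MvPolynomial.aeval (fun i => MvPolynomial.C (x i) + MvPolynomial.C h * MvPolynomial.X i) p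

theorem polyFun_affinePoly (p : MvPolynomial (Fin d) ℝ) (x : Space d) (h : ℝ) (z : Space d) :
    polyFun (affinePoly p x h) z = polyFun p (x + h • z) := by
  unfold polyFun affinePoly
  rw [MvPolynomial.aeval_def, MvPolynomial.eval₂_eq, map_sum, MvPolynomial.eval_eq]
  refine Finset.sum_congr rfl fun m _ => ?_
  simp [map_prod]

theorem totalDegree_affinePoly_le (p : MvPolynomial (Fin d) ℝ) (x : Space d) (h : ℝ) :
    (affinePoly p x h).totalDegree ≤ p.totalDegree := by
  unfold affinePoly
  rw [MvPolynomial.aeval_def, MvPolynomial.eval₂_eq]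
  refine MvPolynomial.totalDegree_finsetSum_le fun m hm => ?_
  refine (MvPolynomial.totalDegree_mul _ _).trans ?_
  rw [MvPolynomial.algebraMap_eq, MvPolynomial.totalDegree_C, zero_add]
  refine (MvPolynomial.totalDegree_finsetProd _ _).trans ?_
  refine le_trans (Finset.sum_le_sum fun i _ => ?_) (MvPolynomial.le_totalDegree hm)
  refine (MvPolynomial.totalDegree_pow _ _).trans ?_
  have h1 : (MvPolynomial.C (x i) + MvPolynomial.C h * MvPolynomial.X i :
      MvPolynomial (Fin d) ℝ).totalDegree ≤ 1 := by
    refine (MvPolynomial.totalDegree_add _ _).trans (max_le (by simp) ?_)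
    refine (MvPolynomial.totalDegree_mul _ _).trans ?_
    simp [MvPolynomial.totalDegree_X]
  nlinarith

theorem norm_gradient_affinePoly (p : MvPolynomial (Fin d) ℝ) (x : Space d) {h : ℝ} (hh : 0 ≤ h)
    (z : Space d) :
    ‖gradient (polyFun (affinePoly p x h)) z‖ = h * ‖gradient (polyFun p) (x + h • z)‖ := by
  rw [norm_gradient, norm_gradient,
    show polyFun (affinePoly p x h) = fun z => (fun y => polyFun p (x + y)) (h • z) from
      funext (polyFun_affinePoly p x h), fderiv_comp_smul (f := fun y => polyFun p (x + y)), fderiv_comp_add_left, norm_smul,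
    Real.norm_of_nonneg hh]

theorem integral_ball_comp_affine (F : Space d → ℝ) (x : Space d) {h ρ : ℝ} (hh : 0 < h) :
    ∫ z in Metric.ball 0 ρ, F (x + h • z) = (h ^ d)⁻¹ * ∫ y in Metric.ball x (ρ * h), F y := by
  rw [← integral_indicator Metric.isOpen_ball.measurableSet,
    ← integral_indicator Metric.isOpen_ball.measurableSet]
  have h1 : (Metric.ball (0 : Space d) ρ).indicator (fun z => F (x + h • z)) =
      fun z => (fun y => (Metric.ball x (ρ * h)).indicator F (x + y)) (h • z) := by
    ext z
    have : z ∈ Metric.ball (0 : Space d) ρ ↔ x + h • z ∈ Metric.ball x (ρ * h) := by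
      simp only [Metric.mem_ball, dist_zero_right, dist_self_add_left, norm_smul,
        Real.norm_of_nonneg hh.le, mul_comm ρ]
      exact (mul_lt_mul_iff_right₀ hh).symm
    by_cases hz : z ∈ Metric.ball (0 : Space d) ρ
    · simp only [indicator_of_mem hz, indicator_of_mem (this.1 hz)]
    · simp only [indicator_of_notMem hz, indicator_of_notMem (mt this.2 hz)]
  rw [h1, Measure.integral_comp_smul_of_nonneg _ _ _ (hR := hh.le), finrank_euclideanSpace,
    Fintype.card_fin, smul_eq_mul, integral_add_left_eq_self]

/-- Values and derivatives of polynomials on a ball are controlled by the mean value on a smaller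
concentric ball. -/
theorem exists_polyFun_bound (d r : ℕ) {ρ : ℝ} (hρ : 0 < ρ) : ∃ C : ℝ, 0 < C ∧
    ∀ p : MvPolynomial (Fin d) ℝ, p.totalDegree ≤ r → ∀ (x : Space d) (h : ℝ), 0 < h →
      ∀ y ∈ Metric.closedBall x h,
        |polyFun p y| ≤ C * ((h ^ d)⁻¹ * ∫ z in Metric.ball x (ρ * h), |polyFun p z|) ∧
        h * ‖gradient (polyFun p) y‖ ≤
          C * ((h ^ d)⁻¹ * ∫ z in Metric.ball x (ρ * h), |polyFun p z|) := by
  set B := Metric.ball (0 : Space d) ρ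
  set K := Metric.closedBall (0 : Space d) 1
  have : CompactSpace K := isCompact_iff_compactSpace.1 (isCompact_closedBall _ _)
  have hL : ∀ p : MvPolynomial (Fin d) ℝ, MemLp (polyFun p) 1 (volume.restrict B) := fun p =>
    memLp_one_iff_integrable.2 (((continuous_polyFun p).continuousOn.integrableOn_compact
      (isCompact_closedBall (0 : Space d) ρ)).mono_set Metric.ball_subset_closedBall)
  let W := MvPolynomial.restrictTotalDegree (Fin d) ℝ r
  -- On polynomials of bounded degree the L¹ norm over the reference ball is a norm, so it controls
  -- values and gradients on the unit ball.
  let T : W →ₗ[ℝ] Lp ℝ 1 (volume.restrict B) :=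
    { toFun := fun p => (hL p.1).toLp
      map_add' := fun p q => by
        rw [← MemLp.toLp_add]
        exact MemLp.toLp_congr _ _ (ae_of_all _ fun x => polyFun_add _ _ x)
      map_smul' := fun c p => by
        rw [RingHom.id_apply, ← MemLp.toLp_const_smul]
        exact MemLp.toLp_congr _ _ (ae_of_all _ fun x => polyFun_smul _ _ x) }
  have hT : Function.Injective T := by
    rw [← LinearMap.ker_eq_bot, LinearMap.ker_eq_bot']
    rintro ⟨p, hp⟩ h0
    have h1 : polyFun p =ᵐ[volume.restrict B] 0 := (MemLp.toLp_eq_toLp_iff (hL p) MemLp.zero).1 (by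
      rw [MemLp.toLp_zero]
      exact h0)
    have h2 := Measure.eqOn_open_of_ae_eq h1 Metric.isOpen_ball
      (continuous_polyFun p).continuousOn continuousOn_const
    exact Subtype.ext (eq_zero_of_polyFun_eq_zero hρ h2)
  have hTn : ∀ p : W, ‖T p‖ = ∫ z in B, |polyFun p.1 z| := fun p => by
    rw [L1.norm_eq_integral_norm]
    refine integral_congr_ae ?_
    filter_upwards [(hL p.1).coeFn_toLp] with z hz
    rw [← Real.norm_eq_abs, ← hz]
    rfl
  let A₁ : W →ₗ[ℝ] C(K, ℝ) :=
    { toFun := fun p => ⟨fun z => polyFun p.1 z, (continuous_polyFun p.1).comp continuous_subtype_val⟩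
      map_add' := fun p q => by ext z; exact polyFun_add _ _ _
      map_smul' := fun c p => by ext z; exact polyFun_smul _ _ _ }
  let A₂ : W →ₗ[ℝ] C(K, Space d) :=
    { toFun := fun p => ⟨fun z => gradient (polyFun p.1) z,
        (continuous_gradient_polyFun p.1).comp continuous_subtype_val⟩
      map_add' := fun p q => by
        refine ContinuousMap.ext fun z => ?_
        exact gradient_polyFun_add _ _ _
      map_smul' := fun c p => by
        refine ContinuousMap.ext fun z => ?_
        exact gradient_polyFun_smul _ _ _ }
  obtain ⟨C₁, hC₁, h₁⟩ := exists_norm_le_of_injective T hT A₁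
  obtain ⟨C₂, hC₂, h₂⟩ := exists_norm_le_of_injective T hT A₂
  refine ⟨max C₁ C₂, lt_max_of_lt_left hC₁, ?_⟩
  intro p hp x h hh y hy
  set z : Space d := h⁻¹ • (y - x) with hz
  have hyz : y = x + h • z := by rw [hz, smul_inv_smul₀ hh.ne']; abel
  have hzK : z ∈ K := by
    rw [mem_closedBall_zero_iff, hz, norm_smul, norm_inv, Real.norm_of_nonneg hh.le,
      inv_mul_le_iff₀ hh, mul_one, ← dist_eq_norm]
    exact hy
  -- Rescaling to the reference ball produces exactly the factors h^(-d) for the mean and h for the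
  -- gradient.
  let q : W := ⟨affinePoly p x h, (MvPolynomial.mem_restrictTotalDegree _ _ _).2
    ((totalDegree_affinePoly_le p x h).trans hp)⟩
  have hTq : ‖T q‖ = (h ^ d)⁻¹ * ∫ z in Metric.ball x (ρ * h), |polyFun p z| := by
    rw [hTn, ← integral_ball_comp_affine (fun y => |polyFun p y|) x hh]
    simp only [q, polyFun_affinePoly]
    rfl
  rw [← hTq]
  constructor
  · calc |polyFun p y| = ‖A₁ q ⟨z, hzK⟩‖ := by
          rw [hyz, ← polyFun_affinePoly]
          rfl
      _ ≤ ‖A₁ q‖ := ContinuousMap.norm_coe_le_norm _ _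
      _ ≤ C₁ * ‖T q‖ := h₁ q
      _ ≤ _ := by gcongr; exact le_max_left _ _
  · calc h * ‖gradient (polyFun p) y‖ = ‖A₂ q ⟨z, hzK⟩‖ := by
          rw [hyz, ← norm_gradient_affinePoly p x hh.le]
          rfl
      _ ≤ ‖A₂ q‖ := ContinuousMap.norm_coe_le_norm _ _
      _ ≤ C₂ * ‖T q‖ := h₂ q
      _ ≤ _ := by gcongr; exact le_max_right _ _

/-- The square of a mean value is at most the mean value of the square. -/
theorem sq_setIntegral_abs_le {B : Set (Space d)} (hB : volume B ≠ ⊤) {f : Space d → ℝ}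
    (hf : MemLp f 2 (volume.restrict B)) :
    (∫ z in B, |f z|) ^ 2 ≤ (volume B).toReal * ∫ z in B, f z ^ 2 := by
  have : IsFiniteMeasure (volume.restrict B) := ⟨by simpa using hB.lt_top⟩
  have h := integral_mul_le_Lp_mul_Lq_of_nonneg (μ := volume.restrict B) (p := 2) (q := 2)
    (Real.HolderConjugate.two_two) (f := fun _ => (1 : ℝ)) (g := fun z => |f z|)
    (ae_of_all _ fun _ => zero_le_one) (ae_of_all _ fun _ => abs_nonneg _)
    (by simpa using memLp_const (1 : ℝ)) (by
      rw [show ENNReal.ofReal 2 = 2 by norm_num]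
      exact hf.abs)
  simp only [one_mul, Real.one_rpow, integral_const, smul_eq_mul, mul_one] at h
  have h0 : 0 ≤ ∫ z in B, |f z| := integral_nonneg fun _ => abs_nonneg _
  have h1 : 0 ≤ ∫ z in B, f z ^ 2 := integral_nonneg fun _ => sq_nonneg _
  have e : ∫ z in B, |f z| ^ (2 : ℝ) = ∫ z in B, f z ^ 2 := by
    refine integral_congr_ae (ae_of_all _ fun z => ?_)
    simp
  rw [e, ← Real.sqrt_eq_rpow, ← Real.sqrt_eq_rpow] at h
  have h2 := pow_le_pow_left₀ h0 h 2
  rw [mul_pow, Real.sq_sqrt measureReal_nonneg, Real.sq_sqrt h1] at h2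
  simpa [Measure.real] using h2

end Forchheimer

end

/-! ### Barycentric coordinates on the mesh and the Bernstein representation. -/

noncomputable section

namespace Forchheimer

variable {d : ℕ}

/-- `l` is the family of barycentric coordinates of `x` with respect to `s`. -/
structure IsBary (s : Finset (Space d)) (x : Space d) (l : Space d → ℝ) : Prop where
  nonneg : ∀ v, 0 ≤ l v
  sum_eq_one : ∑ v ∈ s, l v = 1
  eq_zero : ∀ v ∉ s, l v = 0
  sum_smul : ∑ v ∈ s, l v • v = x

theorem exists_isBary {s : Finset (Space d)} {x : Space d}
    (hx : x ∈ convexHull ℝ (s : Set (Space d))) : ∃ l, IsBary s x l := by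
  classical
  obtain ⟨w, hw0, hw1, hwx⟩ := Finset.mem_convexHull'.1 hx
  refine ⟨fun v => if v ∈ s then w v else 0, fun v => ?_, ?_, fun v hv => by simp [hv], ?_⟩
  · by_cases hv : v ∈ s <;> simp [hv, hw0]
  · rw [← hw1]
    exact Finset.sum_congr rfl fun v hv => by simp [hv]
  · rw [← hwx]
    exact Finset.sum_congr rfl fun v hv => by simp [hv]

theorem IsBary.mem_convexHull {s : Finset (Space d)} {x : Space d} {l : Space d → ℝ}
    (h : IsBary s x l) : x ∈ convexHull ℝ (s : Set (Space d)) :=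
  Finset.mem_convexHull'.2 ⟨l, fun v _ => h.nonneg v, h.sum_eq_one, h.sum_smul⟩

theorem IsBary.mono {s t : Finset (Space d)} {x : Space d} {l : Space d → ℝ}
    (h : IsBary s x l) (hst : s ⊆ t) : IsBary t x l where
  nonneg := h.nonneg
  sum_eq_one := by
    rw [← h.sum_eq_one]
    exact (Finset.sum_subset hst fun v _ hv => h.eq_zero v hv).symm
  eq_zero v hv := h.eq_zero v fun hv' => hv (hst hv')
  sum_smul := by
    rw [← h.sum_smul]
    exact (Finset.sum_subset hst fun v _ hv => by rw [h.eq_zero v hv, zero_smul]).symm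

theorem IsBary.unique {s : Finset (Space d)} (hs : AffineIndependent ℝ ((↑) : s → Space d))
    {x : Space d} {l l' : Space d → ℝ} (h : IsBary s x l) (h' : IsBary s x l') : l = l' := by
  have h1 := affineIndependent_iff.1 hs Finset.univ (fun v => l v - l' v)
    (by
      rw [Finset.sum_sub_distrib, Finset.sum_coe_sort s l, Finset.sum_coe_sort s l',
        h.sum_eq_one, h'.sum_eq_one, sub_self])
    (by
      simp only [sub_smul]
      rw [Finset.sum_sub_distrib, Finset.sum_coe_sort s fun v => l v • v,
        Finset.sum_coe_sort s fun v => l' v • v, h.sum_smul, h'.sum_smul, sub_self])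
  ext v
  by_cases hv : v ∈ s
  · exact sub_eq_zero.1 (h1 ⟨v, hv⟩ (Finset.mem_univ _))
  · rw [h.eq_zero v hv, h'.eq_zero v hv]

section Complex

variable (𝒯 : Geometry.SimplicialComplex ℝ (Space d))

/-- `s` is the vertex set of a cell. -/
def IsCell (s : Finset (Space d)) : Prop := s ∈ 𝒯.faces ∧ s.card = d + 1

open Classical in
/-- Barycentric coordinates with respect to the complex; as functions of `x` these are the hat
functions. -/
def bary (x : Space d) : Space d → ℝ :=
  if h : ∃ s l, IsCell 𝒯 s ∧ IsBary s x l then h.choose_spec.choose else 0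

variable {𝒯}

theorem IsCell.mem_cells {s : Finset (Space d)} (hs : IsCell 𝒯 s) :
    convexHull ℝ (s : Set (Space d)) ∈ cells 𝒯 := ⟨s, hs.1, hs.2, rfl⟩

/-- The cell chosen in the definition may differ from s. By the face-to-face property x lies in the
hull of the common vertices, and uniqueness of barycentric coordinates makes those of both cells
agree with those of the common face. -/
theorem isBary_bary {s : Finset (Space d)} (hs : IsCell 𝒯 s) {x : Space d}
    (hx : x ∈ convexHull ℝ (s : Set (Space d))) : IsBary s x (bary 𝒯 x) := by
  classical
  obtain ⟨l₀, hl₀⟩ := exists_isBary hx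
  have h : ∃ s l, IsCell 𝒯 s ∧ IsBary s x l := ⟨s, l₀, hs, hl₀⟩
  have hb : bary 𝒯 x = h.choose_spec.choose := dif_pos h
  obtain ⟨hs', hl'⟩ := h.choose_spec.choose_spec
  rw [← hb] at hl'
  set s' := h.choose
  have hx' : x ∈ convexHull ℝ ((s' ∩ s : Finset (Space d)) : Set (Space d)) := by
    rw [Finset.coe_inter, ← 𝒯.convexHull_inter_convexHull hs'.1 hs.1]
    exact ⟨hl'.mem_convexHull, hx⟩
  obtain ⟨l, hl⟩ := exists_isBary hx'
  rw [(hl'.unique (𝒯.indep hs'.1) (hl.mono Finset.inter_subset_left))]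
  exact hl.mono Finset.inter_subset_right

theorem IsBary.eq_bary {s : Finset (Space d)} (hs : IsCell 𝒯 s) {x : Space d} {l : Space d → ℝ}
    (h : IsBary s x l) : bary 𝒯 x = l :=
  (isBary_bary hs h.mem_convexHull).unique (𝒯.indep hs.1) h

/-- On each cell the hat functions are affine. -/
theorem exists_polyFun_eq_bary {s : Finset (Space d)} (hs : IsCell 𝒯 s) (v : Space d) :
    ∃ p : MvPolynomial (Fin d) ℝ, p.totalDegree ≤ 1 ∧
      ∀ x ∈ convexHull ℝ (s : Set (Space d)), bary 𝒯 x v = polyFun p x := by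
  classical
  by_cases hv : v ∈ s
  swap
  · exact ⟨0, by simp, fun x hx => by rw [(isBary_bary hs hx).eq_zero v hv]; simp [polyFun]⟩
  -- The d + 1 affinely independent vertices form an affine basis, whose coordinate functionals are
  -- the hat functions on this cell.
  have htop : affineSpan ℝ (range ((↑) : s → Space d)) = ⊤ := by
    rw [(𝒯.indep hs.1).affineSpan_eq_top_iff_card_eq_finrank_add_one, finrank_euclideanSpace,
      Fintype.card_fin, Fintype.card_coe, hs.2]
  let b : AffineBasis s ℝ (Space d) := ⟨(↑), 𝒯.indep hs.1, htop⟩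
  set f := b.coord ⟨v, hv⟩ with hf
  refine ⟨MvPolynomial.C (f 0) + ∑ i, MvPolynomial.C (f.linear (EuclideanSpace.single i 1)) *
    MvPolynomial.X i, ?_, fun x hx => ?_⟩
  · refine (MvPolynomial.totalDegree_add _ _).trans (max_le (by simp) ?_)
    refine MvPolynomial.totalDegree_finsetSum_le fun i _ => ?_
    refine (MvPolynomial.totalDegree_mul _ _).trans ?_
    simp [MvPolynomial.totalDegree_X]
  · have h1 : polyFun (MvPolynomial.C (f 0) +
        ∑ i, MvPolynomial.C (f.linear (EuclideanSpace.single i 1)) * MvPolynomial.X i) x = f x := by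
      have h2 : f x = f 0 + f.linear x := by
        have := f.map_vadd 0 x
        simp only [vadd_eq_add, add_zero] at this
        rw [this, add_comm]
      have h3 : f.linear x = ∑ i, x i * f.linear (EuclideanSpace.single i 1) := by
        conv_lhs => rw [← (EuclideanSpace.basisFun (Fin d) ℝ).sum_repr x]
        simp [map_sum]
      rw [h2, h3]
      simp [polyFun, mul_comm]
    rw [h1]
    have hb := isBary_bary hs hx
    have h4 : x = Finset.univ.affineCombination ℝ b (fun u : s => bary 𝒯 x u) := by
      rw [Finset.affineCombination_eq_linear_combination]
      · conv_lhs => rw [← hb.sum_smul]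
        exact (Finset.sum_coe_sort s fun u => bary 𝒯 x u • u).symm
      · rw [Finset.sum_coe_sort s (bary 𝒯 x), hb.sum_eq_one]
    conv_rhs => rw [h4]
    rw [hf, b.coord_apply_combination_of_mem (Finset.mem_univ _)]
    rw [Finset.sum_coe_sort s (bary 𝒯 x), hb.sum_eq_one]

/-- Piecewise polynomial functions which are given consistently on the cells are finite element
functions. -/
theorem mem_feSpace_of_polyFun (hfin : 𝒯.faces.Finite) {r : ℕ} {w : Space d → ℝ}
    (h : ∀ s, IsCell 𝒯 s → ∃ p : MvPolynomial (Fin d) ℝ, p.totalDegree ≤ r ∧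
      ∀ x ∈ convexHull ℝ (s : Set (Space d)), w x = polyFun p x) : w ∈ feSpace 𝒯 r := by
  refine ⟨?_, ?_⟩
  · rw [sUnion_eq_iUnion]
    have := (finite_cells hfin).to_subtype
    refine (locallyFinite_of_finite _).continuousOn_iUnion
      (fun S => (isCompact_cell S.2).isClosed) ?_
    rintro ⟨_, s, hs, hc, rfl⟩
    obtain ⟨p, -, hp⟩ := h s ⟨hs, hc⟩
    exact (continuous_polyFun p).continuousOn.congr hp
  · rintro _ ⟨s, hs, hc, rfl⟩
    exact h s ⟨hs, hc⟩

variable (𝒯) in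
/-- The monomials in the hat functions. -/
def bernstein (m : Space d →₀ ℕ) (x : Space d) : ℝ := ∏ v ∈ m.support, bary 𝒯 x v ^ m v

theorem bernstein_eq_prod {s : Finset (Space d)} {m : Space d →₀ ℕ} (hm : m.support ⊆ s)
    (x : Space d) : bernstein 𝒯 m x = ∏ v ∈ s, bary 𝒯 x v ^ m v := by
  unfold bernstein
  refine Finset.prod_subset hm fun v _ hv => ?_
  rw [Finsupp.notMem_support_iff.1 hv, pow_zero]

/-- Locality: a hat function vanishes on every cell that does not contain its vertex. -/
theorem bernstein_eq_zero {s : Finset (Space d)} (hs : IsCell 𝒯 s) {m : Space d →₀ ℕ}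
    (hm : ¬ m.support ⊆ s) {x : Space d} (hx : x ∈ convexHull ℝ (s : Set (Space d))) :
    bernstein 𝒯 m x = 0 := by
  obtain ⟨v, hv, hvs⟩ := Finset.not_subset.1 hm
  refine Finset.prod_eq_zero hv ?_
  rw [(isBary_bary hs hx).eq_zero v hvs, zero_pow (Finsupp.mem_support_iff.1 hv)]

theorem bary_nonneg (x v : Space d) : 0 ≤ bary 𝒯 x v := by
  unfold bary
  split_ifs with h
  · exact h.choose_spec.choose_spec.2.nonneg v
  · simp

theorem bary_le_one (x v : Space d) : bary 𝒯 x v ≤ 1 := by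
  unfold bary
  split_ifs with h
  · have hb := h.choose_spec.choose_spec.2
    by_cases hv : v ∈ h.choose
    · rw [← hb.sum_eq_one]
      exact Finset.single_le_sum (fun u _ => hb.nonneg u) hv
    · rw [hb.eq_zero v hv]
      exact zero_le_one
  · simp

theorem bernstein_nonneg (m : Space d →₀ ℕ) (x : Space d) : 0 ≤ bernstein 𝒯 m x :=
  Finset.prod_nonneg fun v _ => pow_nonneg (bary_nonneg x v) _

theorem bernstein_le_one (m : Space d →₀ ℕ) (x : Space d) : bernstein 𝒯 m x ≤ 1 :=
  Finset.prod_le_one (fun v _ => pow_nonneg (bary_nonneg x v) _)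
    fun v _ => pow_le_one₀ (bary_nonneg x v) (bary_le_one x v)

theorem bernstein_mem_feSpace (hfin : 𝒯.faces.Finite) {r : ℕ} {m : Space d →₀ ℕ}
    (hm : m.sum (fun _ k => k) = r) : bernstein 𝒯 m ∈ feSpace 𝒯 r := by
  refine mem_feSpace_of_polyFun hfin fun s hs => ?_
  choose p hp hp' using exists_polyFun_eq_bary hs
  refine ⟨∏ v ∈ m.support, p v ^ m v, ?_, fun x hx => ?_⟩
  · refine (MvPolynomial.totalDegree_finsetProd _ _).trans ?_
    rw [← hm]
    refine Finset.sum_le_sum fun v _ => ?_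
    refine (MvPolynomial.totalDegree_pow _ _).trans ?_
    nlinarith [hp v]
  · unfold bernstein polyFun
    rw [map_prod]
    refine Finset.prod_congr rfl fun v _ => ?_
    rw [map_pow, hp' v x hx]
    rfl

variable (𝒯) in
/-- The vertex sets of the cells of a finite complex. -/
def cellFinset (hfin : 𝒯.faces.Finite) : Finset (Finset (Space d)) :=
  {s ∈ hfin.toFinset | s.card = d + 1}

theorem mem_cellFinset (hfin : 𝒯.faces.Finite) {s : Finset (Space d)} :
    s ∈ cellFinset 𝒯 hfin ↔ IsCell 𝒯 s := by
  simp [cellFinset, IsCell]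

open Classical in
variable (𝒯) in
/-- The multi-indices of degree `r` which are supported on a cell. -/
def multiIndices (hfin : 𝒯.faces.Finite) (r : ℕ) : Finset (Space d →₀ ℕ) :=
  (cellFinset 𝒯 hfin).biUnion fun s => s.finsuppAntidiag r

open Classical in
theorem mem_multiIndices (hfin : 𝒯.faces.Finite) {r : ℕ} {m : Space d →₀ ℕ} :
    m ∈ multiIndices 𝒯 hfin r ↔ ∃ s, IsCell 𝒯 s ∧ m ∈ s.finsuppAntidiag r := by
  simp only [multiIndices, Finset.mem_biUnion, mem_cellFinset]

theorem bernstein_mem_feSpace_of_mem (hfin : 𝒯.faces.Finite) {r : ℕ} {m : Space d →₀ ℕ}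
    (hm : m ∈ multiIndices 𝒯 hfin r) : bernstein 𝒯 m ∈ feSpace 𝒯 r := by
  classical
  obtain ⟨s, -, hms⟩ := (mem_multiIndices hfin).1 hm
  exact bernstein_mem_feSpace hfin (Finset.mem_finsuppAntidiag'.1 hms).1

open Classical in
-- Reduces a global expansion to the indices of one cell, whose number depends only on d and r.
theorem sum_multiIndices_eq (hfin : 𝒯.faces.Finite) {r : ℕ} (F : (Space d →₀ ℕ) → ℝ)
    {s : Finset (Space d)} (hs : IsCell 𝒯 s) {x : Space d}
    (hx : x ∈ convexHull ℝ (s : Set (Space d))) :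
    ∑ m ∈ multiIndices 𝒯 hfin r, F m * bernstein 𝒯 m x =
      ∑ m ∈ s.finsuppAntidiag r, F m * bernstein 𝒯 m x := by
  symm
  refine Finset.sum_subset (fun m hm => (mem_multiIndices hfin).2 ⟨s, hs, hm⟩) fun m hm hms => ?_
  rw [bernstein_eq_zero hs _ hx, mul_zero]
  intro hsub
  obtain ⟨t, -, ht⟩ := (mem_multiIndices hfin).1 hm
  exact hms (Finset.mem_finsuppAntidiag'.2 ⟨(Finset.mem_finsuppAntidiag'.1 ht).1, hsub⟩)

open Classical in
theorem sum_multiIndices_eq_homPoly (hfin : 𝒯.faces.Finite) {r : ℕ} (c : (Space d →₀ ℕ) → ℝ)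
    {s : Finset (Space d)} (hs : IsCell 𝒯 s) {x : Space d}
    (hx : x ∈ convexHull ℝ (s : Set (Space d))) :
    ∑ m ∈ multiIndices 𝒯 hfin r, c m * bernstein 𝒯 m x = homPoly s r c (bary 𝒯 x) := by
  rw [sum_multiIndices_eq hfin c hs hx]
  refine Finset.sum_congr rfl fun m hm => ?_
  rw [bernstein_eq_prod (Finset.mem_finsuppAntidiag.1 hm).2]

open Classical in
-- On a face the monomials that involve other vertices vanish, so only coefficients supported on the
-- face are seen there.
theorem homPoly_eq_of_subset {F s : Finset (Space d)} (hFs : F ⊆ s) {r : ℕ}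
    (a : (Space d →₀ ℕ) → ℝ) {l : Space d → ℝ} (hl : ∀ v ∉ F, l v = 0) :
    homPoly s r a l = homPoly F r a l := by
  unfold homPoly
  symm
  have hsub := Finset.finsuppAntidiag_mono hFs r
  refine Finset.sum_subset_zero_on_sdiff hsub (fun m hm => ?_) fun m hm => ?_
  · obtain ⟨hms, hmF⟩ := Finset.mem_sdiff.1 hm
    have hms' := Finset.mem_finsuppAntidiag'.1 hms
    have : ¬ m.support ⊆ F := fun h => hmF (Finset.mem_finsuppAntidiag'.2 ⟨hms'.1, h⟩)
    obtain ⟨v, hv, hvF⟩ := Finset.not_subset.1 this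
    rw [Finset.prod_eq_zero (hms'.2 hv), mul_zero]
    rw [hl v hvF, zero_pow (Finsupp.mem_support_iff.1 hv)]
  · congr 1
    refine Finset.prod_subset hFs fun v _ hv => ?_
    have : m v = 0 := by
      by_contra h
      exact hv ((Finset.mem_finsuppAntidiag'.1 hm).2 (Finsupp.mem_support_iff.2 h))
    rw [this, pow_zero]

/-- Every finite element function is a combination of the functions `bernstein 𝒯 m`. -/
theorem exists_eq_sum_bernstein (hfin : 𝒯.faces.Finite) {r : ℕ} (hr : r ≠ 0) {w : Space d → ℝ}
    (hw : w ∈ feSpace 𝒯 r) : ∃ c : (Space d →₀ ℕ) → ℝ, ∀ x ∈ ⋃₀ cells 𝒯,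
      w x = ∑ m ∈ multiIndices 𝒯 hfin r, c m * bernstein 𝒯 m x := by
  classical
  have h1 : ∀ s, ∃ a : (Space d →₀ ℕ) → ℝ, IsCell 𝒯 s → ∀ l : Space d → ℝ, ∀ x, IsBary s x l →
      w x = homPoly s r a l := fun s => by
    by_cases hs : IsCell 𝒯 s
    · obtain ⟨p, hp, hpw⟩ := hw.2 _ hs.mem_cells
      obtain ⟨a, ha⟩ := exists_homPoly_eq hp s
      refine ⟨a, fun _ l x hl => ?_⟩
      rw [hpw x hl.mem_convexHull, ← ha l hl.sum_eq_one, hl.sum_smul]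
      rfl
    · exact ⟨0, fun h => absurd h hs⟩
  choose a ha using h1
  -- The coefficients found on two cells agree for common indices: both expansions represent w on
  -- the common face, and `exists_coeff_bound` with M = 0 is a uniqueness statement there.
  have hcons : ∀ s s', IsCell 𝒯 s → IsCell 𝒯 s' → ∀ m ∈ s.finsuppAntidiag r,
      m ∈ s'.finsuppAntidiag r → a s m = a s' m := by
    intro s s' hs hs' m hm hm'
    have hmF : m ∈ (s ∩ s').finsuppAntidiag r := by
      rw [Finset.mem_finsuppAntidiag'] at hm hm' ⊢
      exact ⟨hm.1, Finset.subset_inter hm.2 hm'.2⟩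
    -- A positive degree excludes the empty face, which supports no index.
    have hcard : (s ∩ s').card ≠ 0 := by
      intro h0
      rw [Finset.card_eq_zero] at h0
      rw [h0, Finset.finsuppAntidiag_empty_of_ne_zero hr] at hmF
      simp at hmF
    obtain ⟨C, -, hC⟩ := exists_coeff_bound (s ∩ s').card r hcard
    have h2 := hC (s ∩ s') rfl (fun m => a s m - a s' m) 0 (fun l hl0 hl1 hl => by
      have hb : IsBary (s ∩ s') (∑ v ∈ s ∩ s', l v • v) l := ⟨hl0, hl1, hl, rfl⟩
      have e1 := ha s hs l _ (hb.mono Finset.inter_subset_left)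
      have e2 := ha s' hs' l _ (hb.mono Finset.inter_subset_right)
      rw [homPoly_eq_of_subset Finset.inter_subset_left _ hl] at e1
      rw [homPoly_eq_of_subset Finset.inter_subset_right _ hl] at e2
      have e3 : homPoly (s ∩ s') r (fun m => a s m - a s' m) l =
          homPoly (s ∩ s') r (a s) l - homPoly (s ∩ s') r (a s') l := by
        simp [homPoly, sub_mul]
      rw [e3, ← e1, ← e2, sub_self, abs_zero]) m hmF
    rw [mul_zero] at h2
    exact sub_eq_zero.1 (abs_nonpos_iff.1 h2)
  refine ⟨fun m => if h : ∃ s, IsCell 𝒯 s ∧ m ∈ s.finsuppAntidiag r then a h.choose m else 0, ?_⟩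
  rintro x ⟨_, ⟨s, hs, hsc, rfl⟩, hx⟩
  have hcell : IsCell 𝒯 s := ⟨hs, hsc⟩
  rw [sum_multiIndices_eq_homPoly hfin _ hcell hx, ha s hcell _ x (isBary_bary hcell hx)]
  refine Finset.sum_congr rfl fun m hm => ?_
  have h : ∃ s, IsCell 𝒯 s ∧ m ∈ s.finsuppAntidiag r := ⟨s, hcell, hm⟩
  beta_reduce
  rw [dif_pos h]
  congr 1
  exact hcons _ _ hcell h.choose_spec.1 m hm h.choose_spec.2

/-- The coefficients of a finite element function are controlled by its values on one cell. -/
theorem exists_bernstein_coeff_bound (d r : ℕ) : ∃ C : ℝ, 0 < C ∧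
    ∀ (𝒯 : Geometry.SimplicialComplex ℝ (Space d)) (hfin : 𝒯.faces.Finite)
      (s : Finset (Space d)), IsCell 𝒯 s → ∀ (c : (Space d →₀ ℕ) → ℝ) (M : ℝ),
      (∀ x ∈ convexHull ℝ (s : Set (Space d)),
        |∑ m ∈ multiIndices 𝒯 hfin r, c m * bernstein 𝒯 m x| ≤ M) →
      ∀ m : Space d →₀ ℕ, m.sum (fun _ k => k) = r → m.support ⊆ s → |c m| ≤ C * M := by
  classical
  obtain ⟨C, hC, h⟩ := exists_coeff_bound (d + 1) r (Nat.succ_ne_zero d)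
  refine ⟨C, hC, fun 𝒯 hfin s hs c M hM m hm hms => ?_⟩
  refine h s hs.2 c M (fun l hl0 hl1 hl => ?_) m (Finset.mem_finsuppAntidiag'.2 ⟨hm, hms⟩)
  have hb : IsBary s (∑ v ∈ s, l v • v) l := ⟨hl0, hl1, hl, rfl⟩
  have h1 := hM _ hb.mem_convexHull
  rwa [sum_multiIndices_eq_homPoly hfin _ hs hb.mem_convexHull, hb.eq_bary hs] at h1

end Complex

end Forchheimer

end

/-! ### From one cell to the whole domain on quasi-uniform meshes. -/

noncomputable section

namespace Forchheimer

variable {d : ℕ}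

theorem setLIntegral_biUnion_finset_le {ι α : Type*} [MeasurableSpace α] {μ : Measure α}
    (I : Finset ι) (s : ι → Set α) (F : α → ℝ≥0∞) :
    ∫⁻ x in ⋃ i ∈ I, s i, F x ∂μ ≤ ∑ i ∈ I, ∫⁻ x in s i, F x ∂μ := by
  classical
  induction I using Finset.induction_on with
  | empty => simp
  | insert i I hi ih =>
    rw [Finset.set_biUnion_insert, Finset.sum_insert hi]
    exact (lintegral_union_le _ _ _).trans (add_le_add le_rfl ih)

section Cells

variable {𝒯 : Geometry.SimplicialComplex ℝ (Space d)} {Ω : Set (Space d)} {σ h : ℝ}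

theorem IsCell.isBounded (s : Finset (Space d)) :
    Bornology.IsBounded (convexHull ℝ (s : Set (Space d))) :=
  (s.finite_toSet.isCompact_convexHull ℝ).isBounded

theorem IsQuasiUniformTriangulation.dist_le (hT : IsQuasiUniformTriangulation Ω σ h 𝒯)
    {s : Finset (Space d)} (hs : IsCell 𝒯 s) {x y : Space d}
    (hx : x ∈ convexHull ℝ (s : Set (Space d))) (hy : y ∈ convexHull ℝ (s : Set (Space d))) :
    dist x y ≤ h :=
  (Metric.dist_le_diam_of_mem (IsCell.isBounded s) hx hy).trans (hT.diam_le _ hs.mem_cells)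

theorem IsQuasiUniformTriangulation.subset_closedBall (hσ : 0 < σ)
    (hT : IsQuasiUniformTriangulation Ω σ h 𝒯) {s : Finset (Space d)} (hs : IsCell 𝒯 s)
    {x : Space d} (hx : Metric.ball x (σ * h) ⊆ convexHull ℝ (s : Set (Space d)) ∩ Ω) :
    convexHull ℝ (s : Set (Space d)) ⊆ Metric.closedBall x h := fun _ hy =>
  hT.dist_le hs hy (hx (Metric.mem_ball_self (mul_pos hσ hT.h_pos))).1

/-- If the interiors met, the common face would have nonempty interior, hence d + 1 vertices, and
would equal both cells. -/
theorem interior_inter_interior_cell {s t : Finset (Space d)} (hs : IsCell 𝒯 s)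
    (ht : IsCell 𝒯 t) (hst : s ≠ t) :
    Disjoint (interior (convexHull ℝ (s : Set (Space d))))
      (interior (convexHull ℝ (t : Set (Space d)))) := by
  classical
  rw [disjoint_iff_inter_eq_empty, ← interior_inter, 𝒯.convexHull_inter_convexHull hs.1 ht.1,
    ← Finset.coe_inter]
  by_contra hne
  have h1 := interior_convexHull_nonempty_iff_affineSpan_eq_top.1 (nonempty_iff_ne_empty.2 hne)
  have hind : AffineIndependent ℝ ((↑) : (s ∩ t : Finset (Space d)) → Space d) :=
    (𝒯.indep hs.1).mono (by simp)
  have h2 : affineSpan ℝ (range ((↑) : (s ∩ t : Finset (Space d)) → Space d)) = ⊤ := by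
    rw [Subtype.range_coe_subtype]
    simpa [Set.ofPred_and] using h1
  rw [hind.affineSpan_eq_top_iff_card_eq_finrank_add_one, finrank_euclideanSpace,
    Fintype.card_fin, Fintype.card_coe] at h2
  have hs' : s ∩ t = s := Finset.eq_of_subset_of_card_le Finset.inter_subset_left
    (by rw [h2, hs.2])
  have ht' : s ∩ t = t := Finset.eq_of_subset_of_card_le Finset.inter_subset_right
    (by rw [h2, ht.2])
  exact hst (hs'.symm.trans ht')

/-- Summing estimates over the cells. -/
theorem lintegral_le_of_cell_le (hΩ : MeasurableSet Ω) (hσ : 0 < σ)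
    (hT : IsQuasiUniformTriangulation Ω σ h 𝒯) {F G : Space d → ℝ≥0∞} {K : ℝ≥0∞}
    (hFG : ∀ s, IsCell 𝒯 s → ∀ x, Metric.ball x (σ * h) ⊆ convexHull ℝ (s : Set (Space d)) ∩ Ω →
      ∀ y ∈ interior (convexHull ℝ (s : Set (Space d))) ∩ Ω,
        F y ≤ K * ∫⁻ z in Metric.ball x (σ * h), G z) :
    ∫⁻ y in Ω, F y ≤ K * volume (Metric.closedBall (0 : Space d) h) * ∫⁻ z in Ω, G z := by
  classical
  choose! c hc using fun s (hs : IsCell 𝒯 s) => hT.exists_ball _ hs.mem_cells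
  set I := cellFinset 𝒯 hT.finite
  have hI : ∀ s ∈ I, IsCell 𝒯 s := fun s hs => (mem_cellFinset hT.finite).1 hs
  have hball : ∀ s ∈ I, Metric.ball (c s) (σ * h) ⊆ interior (convexHull ℝ (s : Set (Space d))) :=
    fun s hs => interior_maximal ((hc s (hI s hs)).trans inter_subset_left) Metric.isOpen_ball
  have h1 : ∫⁻ y in Ω, F y ≤
      ∑ s ∈ I, ∫⁻ y in interior (convexHull ℝ (s : Set (Space d))) ∩ Ω, F y := by
    refine le_trans ?_ (setLIntegral_biUnion_finset_le I
      (fun s => interior (convexHull ℝ (s : Set (Space d))) ∩ Ω) F)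
    refine lintegral_mono' (Measure.restrict_mono_ae ?_) le_rfl
    rw [ae_le_set]
    have h2 := ae_mem_interior_cell hΩ hT.finite (subset_closure.trans hT.covers)
    rw [ae_restrict_iff' hΩ] at h2
    refine measure_mono_null ?_ h2
    rintro y ⟨hyΩ, hy⟩ hy'
    obtain ⟨_, ⟨s, hs, hsc, rfl⟩, hys⟩ := hy' hyΩ
    exact hy (mem_biUnion ((mem_cellFinset hT.finite).2 ⟨hs, hsc⟩) ⟨hys, hyΩ⟩)
  refine h1.trans ?_
  have h2 : ∀ s ∈ I, ∫⁻ y in interior (convexHull ℝ (s : Set (Space d))) ∩ Ω, F y ≤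
      K * volume (Metric.closedBall (0 : Space d) h) *
        ∫⁻ z in Metric.ball (c s) (σ * h), G z := fun s hs => by
    calc ∫⁻ y in interior (convexHull ℝ (s : Set (Space d))) ∩ Ω, F y
        ≤ ∫⁻ y in interior (convexHull ℝ (s : Set (Space d))) ∩ Ω,
            (K * ∫⁻ z in Metric.ball (c s) (σ * h), G z) :=
          setLIntegral_mono' (isOpen_interior.measurableSet.inter hΩ)
            (hFG s (hI s hs) _ (hc s (hI s hs)))
      _ = (K * ∫⁻ z in Metric.ball (c s) (σ * h), G z) *
            volume (interior (convexHull ℝ (s : Set (Space d))) ∩ Ω) := setLIntegral_const _ _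
      _ ≤ (K * ∫⁻ z in Metric.ball (c s) (σ * h), G z) *
            volume (Metric.closedBall (0 : Space d) h) := by
          refine mul_le_mul' le_rfl ?_
          rw [← Measure.addHaar_closedBall_center volume (c s) h]
          exact measure_mono (inter_subset_left.trans (interior_subset.trans
            (hT.subset_closedBall hσ (hI s hs) (hc s (hI s hs)))))
      _ = _ := by ring
  refine (Finset.sum_le_sum h2).trans ?_
  rw [← Finset.mul_sum]
  gcongr
  -- The inscribed balls lie in the disjoint cell interiors and inside Ω, so the cell contributions
  -- add up without overlap.
  rw [← lintegral_biUnion_finset]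
  · refine lintegral_mono_set (iUnion₂_subset fun s hs => ?_)
    exact (hc s (hI s hs)).trans inter_subset_right
  · intro s hs t ht hst
    exact (interior_inter_interior_cell (hI s hs) (hI t ht) hst).mono (hball s hs) (hball t ht)
  · exact fun s _ => Metric.isOpen_ball.measurableSet

end Cells

/-- A cell lies in the ball of radius h around the centre of its inscribed ball, so its polynomial
is controlled by the inscribed ball alone. As this ball lies in Ω, cells cut by the boundary need no
separate treatment. -/
theorem exists_feSpace_cell_bound (d r : ℕ) {σ : ℝ} (hσ : 0 < σ) : ∃ C : ℝ, 0 < C ∧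
    ∀ (Ω : Set (Space d)) (h : ℝ) (𝒯 : Geometry.SimplicialComplex ℝ (Space d)),
      IsQuasiUniformTriangulation Ω σ h 𝒯 → ∀ w ∈ feSpace 𝒯 r, ∀ s, IsCell 𝒯 s → ∀ x,
      Metric.ball x (σ * h) ⊆ convexHull ℝ (s : Set (Space d)) ∩ Ω →
      (∀ y ∈ convexHull ℝ (s : Set (Space d)), w y ^ 2 ≤
        C * ((h ^ d)⁻¹ * ∫ z in Metric.ball x (σ * h), w z ^ 2)) ∧
      ∀ y ∈ interior (convexHull ℝ (s : Set (Space d))), ∀ M,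
        (∀ z ∈ convexHull ℝ (s : Set (Space d)), |w z| ≤ M) → h * ‖gradient w y‖ ≤ C * M := by
  obtain ⟨C, hC, hbd⟩ := exists_polyFun_bound d r hσ
  set b : ℝ := σ ^ d * volume.real (Metric.ball (0 : Space d) 1) with hb
  have hb0 : 0 ≤ b := by positivity
  have hvol : ∀ (x : Space d) (h : ℝ), 0 < h →
      volume.real (Metric.ball x (σ * h)) = b * h ^ d := fun x h hh => by
    rw [Measure.real, Measure.addHaar_ball_of_pos _ _ (by positivity), finrank_euclideanSpace,
      Fintype.card_fin, ENNReal.toReal_mul, ENNReal.toReal_ofReal (by positivity), hb, Measure.real]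
    ring
  refine ⟨C ^ 2 * b + C * b + C, by positivity, ?_⟩
  intro Ω h 𝒯 hT w hw s hs x hx
  have hh := hT.h_pos
  obtain ⟨p, hp, hpw⟩ := hw.2 _ hs.mem_cells
  have hsub := hT.subset_closedBall hσ hs hx
  have hB : Metric.ball x (σ * h) ⊆ convexHull ℝ (s : Set (Space d)) := hx.trans inter_subset_left
  have hI : ∫ z in Metric.ball x (σ * h), |polyFun p z| = ∫ z in Metric.ball x (σ * h), |w z| :=
    setIntegral_congr_fun Metric.isOpen_ball.measurableSet fun z hz => by
      simp only [hpw z (hB hz)]; rfl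
  have hI2 : ∫ z in Metric.ball x (σ * h), polyFun p z ^ 2 =
      ∫ z in Metric.ball x (σ * h), w z ^ 2 :=
    setIntegral_congr_fun Metric.isOpen_ball.measurableSet fun z hz => by
      simp only [hpw z (hB hz)]; rfl
  have hfinB : volume (Metric.ball x (σ * h)) ≠ ⊤ := measure_ball_lt_top.ne
  have : IsFiniteMeasure (volume.restrict (Metric.ball x (σ * h))) :=
    ⟨by simpa using hfinB.lt_top⟩
  have hmem : MemLp (polyFun p) 2 (volume.restrict (Metric.ball x (σ * h))) := by
    obtain ⟨M, hM⟩ := (isCompact_closedBall x (σ * h)).exists_bound_of_continuousOn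
      (continuous_polyFun p).continuousOn
    refine MemLp.of_bound (continuous_polyFun p).aestronglyMeasurable M ?_
    filter_upwards [ae_restrict_mem Metric.isOpen_ball.measurableSet] with z hz
    exact hM z (Metric.ball_subset_closedBall hz)
  constructor
  · intro y hy
    have h1 := (hbd p hp x h hh y (hsub hy)).1
    have h2 := sq_setIntegral_abs_le hfinB hmem
    rw [hI2, ← Measure.real, hvol x h hh] at h2
    rw [show w y = polyFun p y from hpw y hy]
    have h3 := pow_le_pow_left₀ (abs_nonneg _) h1 2
    rw [sq_abs] at h3
    refine h3.trans ?_
    have hJ : 0 ≤ ∫ z in Metric.ball x (σ * h), w z ^ 2 := integral_nonneg fun _ => sq_nonneg _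
    set J := ∫ z in Metric.ball x (σ * h), w z ^ 2
    have hhd : 0 < h ^ d := by positivity
    calc (C * ((h ^ d)⁻¹ * ∫ z in Metric.ball x (σ * h), |polyFun p z|)) ^ 2
        = (C * (h ^ d)⁻¹) ^ 2 * (∫ z in Metric.ball x (σ * h), |polyFun p z|) ^ 2 := by ring
      _ ≤ (C * (h ^ d)⁻¹) ^ 2 * (b * h ^ d * J) := by gcongr
      _ = C ^ 2 * b * ((h ^ d)⁻¹ * J) := by field_simp
      _ ≤ _ := by
        gcongr
        nlinarith [mul_nonneg hC.le hb0]
  · intro y hy M hM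
    rw [gradient_eq_of_mem_interior hpw hy]
    have hM0 : 0 ≤ M := (abs_nonneg _).trans (hM y (interior_subset hy))
    refine (hbd p hp x h hh y (hsub (interior_subset hy))).2.trans ?_
    rw [hI]
    have h4 : ∫ z in Metric.ball x (σ * h), |w z| ≤ M * (b * h ^ d) := by
      rw [← hvol x h hh]
      have := norm_setIntegral_le_of_norm_le_const (μ := volume) (f := fun z => |w z|)
        (s := Metric.ball x (σ * h)) (C := M) measure_ball_lt_top fun z hz => by
          rw [Real.norm_eq_abs, abs_abs]; exact hM z (hB hz)
      exact (le_abs_self _).trans this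
    have hhd : 0 < h ^ d := by positivity
    calc C * ((h ^ d)⁻¹ * ∫ z in Metric.ball x (σ * h), |w z|)
        ≤ C * ((h ^ d)⁻¹ * (M * (b * h ^ d))) := by gcongr
      _ = C * b * M := by field_simp
      _ ≤ _ := by
        gcongr
        nlinarith [mul_nonneg (sq_nonneg C) hb0]

end Forchheimer

end

/-! ### Weighted decay estimate for the projection. -/

noncomputable section

namespace Forchheimer

variable {d : ℕ}

/-- A polynomially decaying weight. -/
def wgt (k : ℕ) (H : ℝ) (x₀ x : Space d) : ℝ := ((1 + ‖x - x₀‖ / H) ^ k)⁻¹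

theorem wgt_pos (k : ℕ) {H : ℝ} (hH : 0 < H) (x₀ x : Space d) : 0 < wgt k H x₀ x := by
  unfold wgt
  positivity

theorem wgt_le_one (k : ℕ) {H : ℝ} (hH : 0 < H) (x₀ x : Space d) : wgt k H x₀ x ≤ 1 :=
  inv_le_one_of_one_le₀ (one_le_pow₀ (le_add_of_nonneg_right (by positivity)))

theorem wgt_self (k : ℕ) (H : ℝ) (x : Space d) : wgt k H x x = 1 := by simp [wgt]

theorem continuous_wgt (k : ℕ) {H : ℝ} (hH : 0 < H) (x₀ : Space d) : Continuous (wgt k H x₀) := by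
  unfold wgt
  exact Continuous.inv₀ (by fun_prop) fun x => by positivity

/-- At the stretched length scale h/ε a step of length h changes 1 + ‖x - x₀‖/H by a factor of at
most 1 + ε. -/
theorem wgt_le_mul {k : ℕ} {h ε : ℝ} (hh : 0 < h) (hε : 0 < ε) {x₀ x y : Space d}
    (hxy : dist x y ≤ h) : wgt k (h / ε) x₀ x ≤ (1 + ε) ^ k * wgt k (h / ε) x₀ y := by
  unfold wgt
  have hH : 0 < h / ε := by positivity
  rw [← div_eq_mul_inv, inv_eq_one_div, div_le_div_iff₀ (by positivity) (by positivity), one_mul,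
    ← mul_pow]
  refine pow_le_pow_left₀ (by positivity) ?_ k
  have h1 : ‖y - x₀‖ ≤ ‖x - x₀‖ + h := by
    rw [dist_comm, dist_eq_norm] at hxy
    calc ‖y - x₀‖ = ‖(y - x) + (x - x₀)‖ := by congr 1; abel
      _ ≤ ‖y - x‖ + ‖x - x₀‖ := norm_add_le _ _
      _ ≤ _ := by linarith
  have h2 : ‖y - x₀‖ / (h / ε) ≤ ‖x - x₀‖ / (h / ε) + ε := by
    calc ‖y - x₀‖ / (h / ε) ≤ (‖x - x₀‖ + h) / (h / ε) := by gcongr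
      _ = _ := by field_simp
  have h3 : 0 ≤ ε * (‖x - x₀‖ / (h / ε)) := by positivity
  nlinarith

/-- Returning from the stretched scale to h costs only a constant once ε is fixed. -/
theorem wgt_div_le {k : ℕ} {h ε : ℝ} (hh : 0 < h) (hε : 0 < ε) (hε1 : ε ≤ 1) (x₀ x : Space d) :
    wgt k (h / ε) x₀ x ≤ (ε ^ k)⁻¹ * wgt k h x₀ x := by
  unfold wgt
  rw [← mul_inv, ← mul_pow]
  refine inv_anti₀ (by positivity) (pow_le_pow_left₀ (by positivity) ?_ k)
  have : ‖x - x₀‖ / (h / ε) = ε * (‖x - x₀‖ / h) := by field_simp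
  rw [this, mul_add, mul_one]
  linarith

/-- A commutator estimate. For w = Σ c B, z = Σ φ c B and v = Σ φ² c B, constant φ would give z² =
wv; each term of the difference contains a factor φ_n - φ_m, small relative to φ. -/
theorem abs_sum_mul_sum_sub_sq_le {ι : Type*} (A : Finset ι) (c φ B : ι → ℝ) {δ : ℝ}
    (hφ : ∀ m ∈ A, 0 ≤ φ m) (hB : ∀ m ∈ A, 0 ≤ B m)
    (h : ∀ m ∈ A, ∀ n ∈ A, |φ n - φ m| ≤ δ * φ m) :
    |(∑ m ∈ A, φ m * c m * B m) ^ 2 - (∑ m ∈ A, c m * B m) * ∑ m ∈ A, φ m * (φ m * c m) * B m| ≤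
      δ * (∑ m ∈ A, |φ m * c m| * B m) ^ 2 := by
  have e : (∑ m ∈ A, φ m * c m * B m) ^ 2 -
      (∑ m ∈ A, c m * B m) * ∑ m ∈ A, φ m * (φ m * c m) * B m =
      ∑ m ∈ A, ∑ n ∈ A, (φ m * c m * B m * (φ n * c n * B n) -
        c m * B m * (φ n * (φ n * c n) * B n)) := by
    rw [sq, Finset.sum_mul_sum, Finset.sum_mul_sum, ← Finset.sum_sub_distrib]
    exact Finset.sum_congr rfl fun m _ => (Finset.sum_sub_distrib _ _).symm
  rw [e, sq, Finset.sum_mul_sum, Finset.mul_sum]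
  refine (Finset.abs_sum_le_sum_abs _ _).trans (Finset.sum_le_sum fun m hm => ?_)
  rw [Finset.mul_sum]
  refine (Finset.abs_sum_le_sum_abs _ _).trans (Finset.sum_le_sum fun n hn => ?_)
  have e2 : φ m * c m * B m * (φ n * c n * B n) - c m * B m * (φ n * (φ n * c n) * B n) =
      -((φ n - φ m) * ((c m * B m) * (φ n * c n * B n))) := by ring
  have e3 : δ * (|φ m * c m| * B m * (|φ n * c n| * B n)) =
      (δ * φ m) * ((|c m| * B m) * (φ n * |c n| * B n)) := by
    rw [abs_mul, abs_mul, abs_of_nonneg (hφ m hm), abs_of_nonneg (hφ n hn)]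
    ring
  rw [e2, e3, abs_neg, abs_mul]
  refine mul_le_mul (h m hm n hn) (le_of_eq ?_) (abs_nonneg _)
    ((abs_nonneg _).trans (h m hm n hn))
  rw [abs_mul, abs_mul, abs_mul, abs_mul, abs_of_nonneg (hφ n hn), abs_of_nonneg (hB n hn),
    abs_of_nonneg (hB m hm)]

section

variable {𝒯 : Geometry.SimplicialComplex ℝ (Space d)} {Ω : Set (Space d)} {σ h : ℝ}

/-- Real-valued form of `lintegral_le_of_cell_le`: the factor h^(-d) cancels the volume of a ball of
radius h and leaves that of the unit ball. -/
theorem integral_le_of_cell_le (hΩ : MeasurableSet Ω) (hσ : 0 < σ)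
    (hT : IsQuasiUniformTriangulation Ω σ h 𝒯) {F G : Space d → ℝ} {K : ℝ} (hK : 0 ≤ K)
    (hF0 : ∀ x, 0 ≤ F x) (hG0 : ∀ x, 0 ≤ G x) (hF : IntegrableOn F Ω) (hG : IntegrableOn G Ω)
    (hFG : ∀ s, IsCell 𝒯 s → ∀ x, Metric.ball x (σ * h) ⊆ convexHull ℝ (s : Set (Space d)) ∩ Ω →
      ∀ y ∈ convexHull ℝ (s : Set (Space d)),
        F y ≤ K * ((h ^ d)⁻¹ * ∫ z in Metric.ball x (σ * h), G z)) :
    ∫ y in Ω, F y ≤ K * volume.real (Metric.closedBall (0 : Space d) 1) * ∫ z in Ω, G z := by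
  have hh := hT.h_pos
  have h1 := lintegral_le_of_cell_le (F := fun y => ENNReal.ofReal (F y))
    (G := fun y => ENNReal.ofReal (G y)) (K := ENNReal.ofReal (K * (h ^ d)⁻¹)) hΩ hσ hT
    (fun s hs x hx y hy => by
      have h2 := hFG s hs x hx y (interior_subset hy.1)
      rw [← ofReal_integral_eq_lintegral_ofReal (hG.mono_set (hx.trans inter_subset_right))
        (ae_of_all _ hG0), ← ENNReal.ofReal_mul (by positivity)]
      exact ENNReal.ofReal_le_ofReal (h2.trans (le_of_eq (by ring))))
  rw [← ofReal_integral_eq_lintegral_ofReal hF (ae_of_all _ hF0),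
    ← ofReal_integral_eq_lintegral_ofReal hG (ae_of_all _ hG0),
    Measure.addHaar_closedBall' _ _ hh.le, finrank_euclideanSpace, Fintype.card_fin,
    ← ofReal_measureReal (measure_closedBall_lt_top.ne), ← ENNReal.ofReal_mul (by positivity),
    ← ENNReal.ofReal_mul (by positivity), ← ENNReal.ofReal_mul (by positivity)] at h1
  have hG1 : 0 ≤ ∫ z in Ω, G z := integral_nonneg hG0
  rw [ENNReal.ofReal_le_ofReal_iff (by positivity)] at h1
  refine h1.trans (le_of_eq ?_)
  field_simp

end

theorem card_finsuppAntidiag_cell {r : ℕ} [DecidableEq (Space d)]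
    {𝒯 : Geometry.SimplicialComplex ℝ (Space d)} {s : Finset (Space d)} (hs : IsCell 𝒯 s) :
    (s.finsuppAntidiag r).card = (d + r).choose r := by
  rw [Finset.card_finsuppAntidiag_nat_eq_choose, hs.2]
  congr 1
  omega

/-- Bernstein functions take values in [0, 1], so it suffices to count the indices of a cell. -/
theorem sum_abs_mul_bernstein_le {r : ℕ} [DecidableEq (Space d)]
    {𝒯 : Geometry.SimplicialComplex ℝ (Space d)} {s : Finset (Space d)} (hs : IsCell 𝒯 s)
    {e : (Space d →₀ ℕ) → ℝ} {M : ℝ} (hM : ∀ m ∈ s.finsuppAntidiag r, |e m| ≤ M) (x : Space d) :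
    ∑ m ∈ s.finsuppAntidiag r, |e m| * bernstein 𝒯 m x ≤ ((d + r).choose r : ℝ) * M := by
  calc ∑ m ∈ s.finsuppAntidiag r, |e m| * bernstein 𝒯 m x
      ≤ ∑ _m ∈ s.finsuppAntidiag r, M := Finset.sum_le_sum fun m hm => by
        have h1 := hM m hm
        calc |e m| * bernstein 𝒯 m x ≤ |e m| * 1 := by
              gcongr
              exact bernstein_le_one m x
          _ ≤ M := by linarith
    _ = _ := by rw [Finset.sum_const, card_finsuppAntidiag_cell hs, nsmul_eq_mul]

open Classical in
-- Take the weight at a vertex in the support of the index. This is independent of the cell and lies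
-- in every cell supporting the index; positive degree makes the support nonempty.
theorem exists_wgt_family (k r : ℕ) (hr : r ≠ 0)
    (𝒯 : Geometry.SimplicialComplex ℝ (Space d)) (x₀ : Space d) (H : ℝ) :
    ∃ φ : (Space d →₀ ℕ) → ℝ, ∀ s, IsCell 𝒯 s → ∀ m ∈ s.finsuppAntidiag r,
      ∃ y ∈ convexHull ℝ (s : Set (Space d)), φ m = wgt k H x₀ y := by
  refine ⟨fun m => if hm : m.support.Nonempty then wgt k H x₀ hm.choose else 0,
    fun s _ m hm => ?_⟩
  rw [Finset.mem_finsuppAntidiag'] at hm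
  have hne : m.support.Nonempty := by
    rw [Finset.nonempty_iff_ne_empty]
    intro h0
    rw [Finsupp.support_eq_empty] at h0
    apply hr
    rw [← hm.1, h0, Finsupp.sum_zero_index]
  refine ⟨hne.choose, subset_convexHull ℝ _ (hm.2 hne.choose_spec), ?_⟩
  simp only [dif_pos hne]

theorem exists_eps (k : ℕ) {δ : ℝ} (hδ : 0 < δ) :
    ∃ ε : ℝ, 0 < ε ∧ ε ≤ 1 ∧ (1 + ε) ^ k ≤ 1 + δ := by
  have h1 : Tendsto (fun ε : ℝ => (1 + ε) ^ k) (𝓝[>] 0) (𝓝 ((1 + 0) ^ k)) :=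
    ((continuous_const.add continuous_id).pow k).continuousAt.tendsto.mono_left nhdsWithin_le_nhds
  rw [add_zero, one_pow] at h1
  have h2 := (h1.eventually (gt_mem_nhds (show (1 : ℝ) < 1 + δ by linarith))).and
    (Ioc_mem_nhdsGT (zero_lt_one' ℝ))
  obtain ⟨ε, h3, h4⟩ := h2.exists
  exact ⟨ε, h4.1, h4.2, h3.le⟩

set_option maxHeartbeats 1000000 in
/-- Decay estimate for the gradient of the `L²`-projection. -/
theorem exists_gradient_projection_bound (d r k : ℕ) (hr : r ≠ 0) {σ : ℝ} (hσ : 0 < σ) :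
    ∃ C : ℝ, 0 < C ∧ ∀ (Ω : Set (Space d)), IsOpen Ω → Bornology.IsBounded Ω → ∀ (h : ℝ)
      (𝒯 : Geometry.SimplicialComplex ℝ (Space d)), IsQuasiUniformTriangulation Ω σ h 𝒯 →
      ∀ u w : Space d → ℝ, MemLp u 2 (vol Ω) → IsL2Projection Ω (feSpace 𝒯 r) u w →
      ∀ s, IsCell 𝒯 s → ∀ x₀ ∈ convexHull ℝ (s : Set (Space d)),
      ∀ y ∈ interior (convexHull ℝ (s : Set (Space d))),
        h * ‖gradient w y‖ ≤ C * ((h ^ d)⁻¹ * ∫ x in Ω, |u x| * wgt k h x₀ x) := by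
  classical
  obtain ⟨C₁, hC₁, hcell⟩ := exists_feSpace_cell_bound d r hσ
  obtain ⟨C₂, hC₂, hcoef⟩ := exists_bernstein_coeff_bound d r
  set N : ℝ := ((d + r).choose r : ℝ) with hN
  have hN0 : 0 ≤ N := Nat.cast_nonneg _
  set b : ℝ := volume.real (Metric.closedBall (0 : Space d) 1) with hb
  have hb0 : 0 ≤ b := measureReal_nonneg
  set Q : ℝ := N ^ 2 * (C₂ ^ 2 * C₁) with hQ
  have hQ0 : 0 ≤ Q := by positivity
  -- Q collects the constants lost on a cell and b those lost in summing cells; this δ keeps the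
  -- commutator below half of ∫z².
  set δ : ℝ := (2 * (Q * b + 1))⁻¹ with hδ
  have hδ0 : 0 < δ := by positivity
  have hδQ : δ * Q * b ≤ 1 / 2 := by
    rw [hδ, mul_assoc, inv_mul_le_iff₀ (by positivity)]
    linarith
  have hδ1 : δ ≤ 1 := inv_le_one_of_one_le₀ (by nlinarith [mul_nonneg hQ0 hb0])
  obtain ⟨ε, hε, hε1, hεk⟩ := exists_eps k hδ0
  refine ⟨C₁ * (2 * N * (4 * N * (C₂ ^ 2 * C₁))) * (ε ^ k)⁻¹ + 1, by positivity, ?_⟩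
  intro Ω hΩ hΩb h 𝒯 hT u w hu hw s₀ hs₀ x₀ hx₀ y hy
  have hh := hT.h_pos
  have hfin := hT.finite
  have hfinμ := isFiniteMeasure_vol hΩb
  set H := h / ε with hH
  have hH0 : 0 < H := by positivity
  obtain ⟨φ, hφ⟩ := exists_wgt_family k r hr 𝒯 x₀ H
  obtain ⟨c, hc⟩ := exists_eq_sum_bernstein hfin hr hw.1
  have hφ0 : ∀ s, IsCell 𝒯 s → ∀ m ∈ s.finsuppAntidiag r, 0 < φ m := fun s hs m hm => by
    obtain ⟨v, -, hv⟩ := hφ s hs m hm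
    rw [hv]
    exact wgt_pos k hH0 _ _
  have hφ_le : ∀ s, IsCell 𝒯 s → ∀ m ∈ s.finsuppAntidiag r,
      ∀ x ∈ convexHull ℝ (s : Set (Space d)), φ m ≤ 2 * wgt k H x₀ x := fun s hs m hm x hx => by
    obtain ⟨v, hvs, hv⟩ := hφ s hs m hm
    rw [hv]
    refine (wgt_le_mul hh hε (hT.dist_le hs hvs hx)).trans ?_
    have := wgt_pos k hH0 x₀ x
    gcongr
    linarith
  have hle_φ : ∀ s, IsCell 𝒯 s → ∀ m ∈ s.finsuppAntidiag r,
      ∀ x ∈ convexHull ℝ (s : Set (Space d)), wgt k H x₀ x ≤ 2 * φ m := fun s hs m hm x hx => by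
    obtain ⟨v, hvs, hv⟩ := hφ s hs m hm
    rw [hv]
    refine (wgt_le_mul hh hε (hT.dist_le hs hx hvs)).trans ?_
    have := wgt_pos k hH0 x₀ v
    gcongr
    linarith
  have hφ_sub : ∀ s, IsCell 𝒯 s → ∀ m ∈ s.finsuppAntidiag r, ∀ n ∈ s.finsuppAntidiag r,
      |φ n - φ m| ≤ δ * φ m := fun s hs m hm n hn => by
    obtain ⟨v, hvs, hv⟩ := hφ s hs m hm
    obtain ⟨v', hvs', hv'⟩ := hφ s hs n hn
    have h1 : φ n ≤ (1 + δ) * φ m := by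
      have := wgt_pos k hH0 x₀ v
      rw [hv, hv']
      refine (wgt_le_mul hh hε (hT.dist_le hs hvs' hvs)).trans ?_
      gcongr
    have h2 : φ m ≤ (1 + δ) * φ n := by
      have := wgt_pos k hH0 x₀ v'
      rw [hv, hv']
      refine (wgt_le_mul hh hε (hT.dist_le hs hvs hvs')).trans ?_
      gcongr
    have h0 := hφ0 s hs m hm
    rw [abs_le]
    constructor
    · rcases le_total (φ n) (φ m) with h3 | h3
      · nlinarith
      · nlinarith
    · linarith
  set I := multiIndices 𝒯 hfin r with hI
  set e : (Space d →₀ ℕ) → ℝ := fun m => φ m * c m with he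
  set z : Space d → ℝ := fun x => ∑ m ∈ I, e m * bernstein 𝒯 m x with hz
  -- The test function: the expansion of w with coefficients multiplied by φ². Multiplying
  -- coefficients, not values, keeps it in the finite element space.
  set v : Space d → ℝ := fun x => ∑ m ∈ I, φ m * e m * bernstein 𝒯 m x with hv
  have hmem : ∀ a : (Space d →₀ ℕ) → ℝ, (fun x => ∑ m ∈ I, a m * bernstein 𝒯 m x) ∈ feSpace 𝒯 r := by
    intro a
    have : (fun x => ∑ m ∈ I, a m * bernstein 𝒯 m x) = ∑ m ∈ I, a m • bernstein 𝒯 m := by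
      ext x
      simp
    rw [this, ← mem_feSubmodule]
    exact Submodule.sum_mem _ fun m hm => Submodule.smul_mem _ _
      (mem_feSubmodule.2 (bernstein_mem_feSpace_of_mem hfin hm))
  have hzW := hmem e
  have hvW := hmem fun m => φ m * e m
  have hzL : MemLp z 2 (vol Ω) := memLp_feSpace hΩ hΩb hfin hT.covers hzW 2
  have hvL : MemLp v 2 (vol Ω) := memLp_feSpace hΩ hΩb hfin hT.covers hvW 2
  have hwL : MemLp w 2 (vol Ω) := memLp_feSpace hΩ hΩb hfin hT.covers hw.1 2
  have hz2 : IntegrableOn (fun x => z x ^ 2) Ω := hzL.integrable_sq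
  set Z := ∫ x in Ω, z x ^ 2 with hZ
  have hZ0 : 0 ≤ Z := integral_nonneg fun _ => sq_nonneg _
  -- bounds for the coefficients on a cell
  have hcoef1 : ∀ s, IsCell 𝒯 s → ∀ x,
      Metric.ball x (σ * h) ⊆ convexHull ℝ (s : Set (Space d)) ∩ Ω →
      ∀ m ∈ s.finsuppAntidiag r,
      |e m| ≤ C₂ * √(C₁ * ((h ^ d)⁻¹ * ∫ t in Metric.ball x (σ * h), z t ^ 2)) := by
    intro s hs x hx m hm
    rw [Finset.mem_finsuppAntidiag'] at hm
    refine hcoef 𝒯 hfin s hs e _ (fun t ht => ?_) m hm.1 hm.2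
    exact Real.abs_le_sqrt ((hcell Ω h 𝒯 hT z hzW s hs x hx).1 t ht)
  have hcoef2 : ∀ s, IsCell 𝒯 s → ∀ m ∈ s.finsuppAntidiag r,
      |e m| ≤ C₂ * √(C₁ * ((h ^ d)⁻¹ * Z)) := by
    intro s hs m hm
    obtain ⟨x, hx⟩ := hT.exists_ball _ hs.mem_cells
    refine (hcoef1 s hs x hx m hm).trans ?_
    have : ∫ t in Metric.ball x (σ * h), z t ^ 2 ≤ Z :=
      setIntegral_mono_set hz2 (ae_of_all _ fun _ => sq_nonneg _)
        (hx.trans inter_subset_right).eventuallyLE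
    gcongr
  set E := C₂ * √(C₁ * ((h ^ d)⁻¹ * Z)) with hE
  have hE0 : 0 ≤ E := by positivity
  have hE2 : E ^ 2 = C₂ ^ 2 * C₁ * (h ^ d)⁻¹ * Z := by
    rw [hE, mul_pow, Real.sq_sqrt (by positivity)]
    ring
  -- coercivity
  have hcoer : ∫ x in Ω, |z x ^ 2 - w x * v x| ≤ 1 / 2 * Z := by
    have hint : IntegrableOn (fun x => z x ^ 2 - w x * v x) Ω := hz2.sub (hwL.integrable_mul hvL)
    refine (integral_le_of_cell_le (K := δ * Q) hΩ.measurableSet hσ hT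
      (by positivity) (fun x => abs_nonneg _) (fun x => sq_nonneg (z x)) hint.abs hz2 ?_).trans ?_
    · intro s hs x hx t ht
      have e1 : w t = ∑ m ∈ s.finsuppAntidiag r, c m * bernstein 𝒯 m t := by
        rw [hc t ⟨_, hs.mem_cells, ht⟩, sum_multiIndices_eq hfin c hs ht]
      have e2 : z t = ∑ m ∈ s.finsuppAntidiag r, φ m * c m * bernstein 𝒯 m t :=
        sum_multiIndices_eq hfin e hs ht
      have e3 : v t = ∑ m ∈ s.finsuppAntidiag r, φ m * (φ m * c m) * bernstein 𝒯 m t :=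
        sum_multiIndices_eq hfin (fun m => φ m * e m) hs ht
      rw [e1, e2, e3]
      refine (abs_sum_mul_sum_sub_sq_le _ c φ _ (fun m hm => (hφ0 s hs m hm).le)
        (fun m _ => bernstein_nonneg m t) (hφ_sub s hs)).trans ?_
      have h1 := sum_abs_mul_bernstein_le hs (hcoef1 s hs x hx) t
      have hJ : 0 ≤ ∫ t in Metric.ball x (σ * h), z t ^ 2 := integral_nonneg fun _ => sq_nonneg _
      rw [mul_assoc δ]
      refine mul_le_mul_of_nonneg_left ?_ hδ0.le
      refine (pow_le_pow_left₀ (Finset.sum_nonneg fun m _ =>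
        mul_nonneg (abs_nonneg _) (bernstein_nonneg m t)) h1 2).trans (le_of_eq ?_)
      rw [mul_pow, mul_pow, Real.sq_sqrt (by positivity), hQ]
      ring
    · gcongr
  have hwv : 1 / 2 * Z ≤ ∫ x in Ω, w x * v x := by
    have h1 : ∫ x in Ω, (z x ^ 2 - w x * v x) ≤ 1 / 2 * Z :=
      (le_abs_self _).trans ((abs_integral_le_integral_abs).trans hcoer)
    have h2 : ∫ x in Ω, (z x ^ 2 - w x * v x) = Z - ∫ x in Ω, w x * v x :=
      integral_sub hz2 (hwL.integrable_mul hvL)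
    linarith
  -- the right-hand side
  set J := ∫ x in Ω, |u x| * wgt k H x₀ x with hJ
  have huint : Integrable (fun x => |u x|) (vol Ω) := (hu.integrable (by norm_num)).abs
  have hwint : ∀ H', 0 < H' → Integrable (fun x => |u x| * wgt k H' x₀ x) (vol Ω) := fun H' hH' =>
    huint.mul_bdd (c := 1) (continuous_wgt k hH' x₀).aestronglyMeasurable (ae_of_all _ fun x => by
      rw [Real.norm_of_nonneg (wgt_pos k hH' x₀ x).le]
      exact wgt_le_one k hH' x₀ x)
  have huv : ∫ x in Ω, w x * v x ≤ 2 * N * E * J := by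
    rw [hw.2 v hvW, hJ, ← integral_const_mul]
    refine integral_mono_ae (hu.integrable_mul hvL) ((hwint H hH0).const_mul _) ?_
    filter_upwards [ae_restrict_mem hΩ.measurableSet] with x hx
    obtain ⟨_, ⟨s, hs, hsc, rfl⟩, hxs⟩ := hT.covers (subset_closure hx)
    have hs' : IsCell 𝒯 s := ⟨hs, hsc⟩
    have e3 : v x = ∑ m ∈ s.finsuppAntidiag r, φ m * e m * bernstein 𝒯 m x :=
      sum_multiIndices_eq hfin (fun m => φ m * e m) hs' hxs
    have hwx := wgt_pos k hH0 x₀ x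
    have h1 : |v x| ≤ N * (2 * wgt k H x₀ x * E) := by
      rw [e3]
      refine (Finset.abs_sum_le_sum_abs _ _).trans ?_
      have h2 := sum_abs_mul_bernstein_le (e := fun m => φ m * e m) hs'
        (M := 2 * wgt k H x₀ x * E) (fun m hm => by
          rw [abs_mul, abs_of_pos (hφ0 s hs' m hm)]
          exact mul_le_mul (hφ_le s hs' m hm x hxs) (hcoef2 s hs' m hm) (abs_nonneg _)
            (by positivity)) x
      refine le_trans (le_of_eq (Finset.sum_congr rfl fun m _ => ?_)) h2
      rw [abs_mul, abs_of_nonneg (bernstein_nonneg m x)]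
    calc u x * v x ≤ |u x| * |v x| := by rw [← abs_mul]; exact le_abs_self _
      _ ≤ |u x| * (N * (2 * wgt k H x₀ x * E)) := by gcongr
      _ = 2 * N * E * (|u x| * wgt k H x₀ x) := by ring
  -- E² is proportional to ∫z², while duality bounds ∫z² by E times the weighted integral J, so one
  -- factor E cancels.
  have hEJ : E ≤ 4 * N * (C₂ ^ 2 * C₁) * ((h ^ d)⁻¹ * J) := by
    have hJ0 : 0 ≤ J := integral_nonneg fun x =>
      mul_nonneg (abs_nonneg _) (wgt_pos k hH0 x₀ x).le
    rcases hE0.eq_or_lt with h0 | h0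
    · rw [← h0]
      positivity
    · have h1 : Z ≤ 4 * N * E * J := by linarith only [hwv, huv]
      have h2 : E * E ≤ (4 * N * (C₂ ^ 2 * C₁) * ((h ^ d)⁻¹ * J)) * E := by
        calc E * E = C₂ ^ 2 * C₁ * (h ^ d)⁻¹ * Z := by rw [← hE2]; ring
          _ ≤ C₂ ^ 2 * C₁ * (h ^ d)⁻¹ * (4 * N * E * J) := by gcongr
          _ = _ := by ring
      exact le_of_mul_le_mul_right h2 h0
  -- back to the cell
  have hcm : ∀ m ∈ s₀.finsuppAntidiag r, |c m| ≤ 2 * E := fun m hm => by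
    have h1 := hle_φ s₀ hs₀ m hm x₀ hx₀
    rw [wgt_self] at h1
    have h2 := hcoef2 s₀ hs₀ m hm
    rw [he] at h2
    simp only at h2
    rw [abs_mul, abs_of_pos (hφ0 s₀ hs₀ m hm)] at h2
    nlinarith [abs_nonneg (c m)]
  have hwb : ∀ t ∈ convexHull ℝ (s₀ : Set (Space d)), |w t| ≤ N * (2 * E) := fun t ht => by
    rw [hc t ⟨_, hs₀.mem_cells, ht⟩, sum_multiIndices_eq hfin c hs₀ ht]
    refine (Finset.abs_sum_le_sum_abs _ _).trans ?_
    refine le_trans (le_of_eq (Finset.sum_congr rfl fun m _ => ?_))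
      (sum_abs_mul_bernstein_le hs₀ hcm t)
    rw [abs_mul, abs_of_nonneg (bernstein_nonneg m t)]
  obtain ⟨xb, hxb⟩ := hT.exists_ball _ hs₀.mem_cells
  have hgrad := (hcell Ω h 𝒯 hT w hw.1 s₀ hs₀ xb hxb).2 y hy _ hwb
  have hJJ : J ≤ (ε ^ k)⁻¹ * ∫ x in Ω, |u x| * wgt k h x₀ x := by
    rw [hJ, ← integral_const_mul]
    refine integral_mono (hwint H hH0) ((hwint h hh).const_mul _) fun x => ?_
    have := wgt_div_le (k := k) hh hε hε1 x₀ x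
    calc |u x| * wgt k H x₀ x ≤ |u x| * ((ε ^ k)⁻¹ * wgt k h x₀ x) := by gcongr
      _ = _ := by ring
  have hJ0' : 0 ≤ ∫ x in Ω, |u x| * wgt k h x₀ x := integral_nonneg fun x =>
    mul_nonneg (abs_nonneg _) (wgt_pos k hh x₀ x).le
  set J' := ∫ x in Ω, |u x| * wgt k h x₀ x
  calc h * ‖gradient w y‖ ≤ C₁ * (N * (2 * E)) := hgrad
    _ ≤ C₁ * (N * (2 * (4 * N * (C₂ ^ 2 * C₁) * ((h ^ d)⁻¹ * ((ε ^ k)⁻¹ * J'))))) := by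
        gcongr
        exact hEJ.trans (by gcongr)
    _ = C₁ * (2 * N * (4 * N * (C₂ ^ 2 * C₁))) * (ε ^ k)⁻¹ * ((h ^ d)⁻¹ * J') := by ring
    _ ≤ _ := by
        gcongr
        linarith

end Forchheimer

end

/-! ### Projection stability in terms of translation differences. -/

noncomputable section

namespace Forchheimer

variable {d : ℕ}

/-- Hölder's inequality with a weight. -/
theorem lintegral_mul_rpow_le {α : Type*} [MeasurableSpace α] {μ : Measure α} {β : ℝ} (hβ : 1 < β)
    {f g : α → ℝ≥0∞} (hf : AEMeasurable f μ) (hg : AEMeasurable g μ) :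
    (∫⁻ x, f x * g x ∂μ) ^ β ≤ (∫⁻ x, g x ∂μ) ^ (β - 1) * ∫⁻ x, f x ^ β * g x ∂μ := by
  have hpq := Real.HolderConjugate.conjExponent hβ
  set q := β.conjExponent with hq
  have hβ0 : 0 < β := by linarith
  have hq0 : 0 < q := hpq.symm.pos
  have hsum : 1 / β + 1 / q = 1 := by simpa using hpq.inv_add_inv_eq_one
  -- Hölder's inequality after splitting the weight as g^(1/β) · g^(1/q).
  have h1 := ENNReal.lintegral_mul_le_Lp_mul_Lq μ hpq (f := fun x => f x * g x ^ (1 / β))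
    (g := fun x => g x ^ (1 / q)) (hf.mul (hg.pow_const _)) (hg.pow_const _)
  have e1 : ∀ x, ((fun x => f x * g x ^ (1 / β)) * fun x => g x ^ (1 / q)) x = f x * g x := by
    intro x
    simp only [Pi.mul_apply]
    rw [mul_assoc, ← ENNReal.rpow_add_of_nonneg _ _ (by positivity) (by positivity), hsum,
      ENNReal.rpow_one]
  have e2 : ∀ x, (f x * g x ^ (1 / β)) ^ β = f x ^ β * g x := fun x => by
    rw [ENNReal.mul_rpow_of_nonneg _ _ hβ0.le, ← ENNReal.rpow_mul, one_div_mul_cancel hβ0.ne',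
      ENNReal.rpow_one]
  have e3 : ∀ x, (g x ^ (1 / q)) ^ q = g x := fun x => by
    rw [← ENNReal.rpow_mul, one_div_mul_cancel hq0.ne', ENNReal.rpow_one]
  simp only [e1, e2, e3] at h1
  calc (∫⁻ x, f x * g x ∂μ) ^ β
      ≤ ((∫⁻ x, f x ^ β * g x ∂μ) ^ (1 / β) * (∫⁻ x, g x ∂μ) ^ (1 / q)) ^ β :=
        ENNReal.rpow_le_rpow h1 hβ0.le
    _ = (∫⁻ x, g x ∂μ) ^ (β - 1) * ∫⁻ x, f x ^ β * g x ∂μ := by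
        rw [ENNReal.mul_rpow_of_nonneg _ _ hβ0.le, ← ENNReal.rpow_mul, ← ENNReal.rpow_mul,
          one_div_mul_cancel hβ0.ne', ENNReal.rpow_one, mul_comm]
        congr 2
        field_simp at hsum ⊢
        linarith

/-- The decay exponent d + 3 is spent as follows: 2 absorbs ‖z‖^β since β ≤ 2, and d + 1 leaves an
integrable function on ℝ^d. Scaling gives the powers of h. -/
theorem exists_lintegral_wgt_bound (d : ℕ) {β : ℝ} (hβ0 : 0 ≤ β) (hβ : β ≤ 2) :
    ∃ W : ℝ, 0 < W ∧ ∀ h : ℝ, 0 < h →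
      ∫⁻ z : Space d, ENNReal.ofReal (wgt (d + 3) h 0 z) * ‖z‖ₑ ^ β ≤
        ENNReal.ofReal (W * (h ^ d * h ^ β)) := by
  set f : Space d → ℝ := fun ζ => (1 + ‖ζ‖) ^ (-((d : ℝ) + 1)) with hf
  have hfi : Integrable f := integrable_one_add_norm (by
    rw [finrank_euclideanSpace, Fintype.card_fin]; linarith)
  have hf0 : ∀ ζ, 0 ≤ f ζ := fun ζ => by positivity
  have hI0 : 0 ≤ ∫ ζ, f ζ := integral_nonneg hf0
  refine ⟨(∫ ζ, f ζ) + 1, by positivity, fun h hh => ?_⟩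
  have hpt : ∀ z : Space d, ENNReal.ofReal (wgt (d + 3) h 0 z) * ‖z‖ₑ ^ β ≤
      ENNReal.ofReal (h ^ β * f (h⁻¹ • z)) := fun z => by
    rw [← ofReal_norm, ENNReal.ofReal_rpow_of_nonneg (norm_nonneg _) hβ0,
      ← ENNReal.ofReal_mul (wgt_pos _ hh _ _).le]
    refine ENNReal.ofReal_le_ofReal ?_
    set t := ‖z‖ / h with ht
    have ht0 : 0 ≤ t := by positivity
    have e1 : ‖z‖ = t * h := by rw [ht]; field_simp
    have e2 : ‖h⁻¹ • z‖ = t := by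
      rw [norm_smul, norm_inv, Real.norm_of_nonneg hh.le, ht]
      ring
    have h1 : t ^ β ≤ (1 + t) ^ 2 := by
      calc t ^ β ≤ (1 + t) ^ β := Real.rpow_le_rpow ht0 (by linarith) hβ0
        _ ≤ (1 + t) ^ (2 : ℝ) := Real.rpow_le_rpow_of_exponent_le (by linarith) hβ
        _ = (1 + t) ^ 2 := by norm_num
    simp only [wgt, sub_zero, hf, e2]
    rw [← ht, e1, Real.mul_rpow ht0 hh.le, Real.rpow_neg (by positivity),
      show ((d : ℝ) + 1) = ((d + 1 : ℕ) : ℝ) by push_cast; ring, Real.rpow_natCast]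
    have h2 : ((1 + t) ^ (d + 3))⁻¹ * (1 + t) ^ 2 = ((1 + t) ^ (d + 1))⁻¹ := by
      rw [show d + 3 = (d + 1) + 2 by ring, pow_add (1 + t) (d + 1) 2]
      field_simp
    calc ((1 + t) ^ (d + 3))⁻¹ * (t ^ β * h ^ β)
        ≤ ((1 + t) ^ (d + 3))⁻¹ * ((1 + t) ^ 2 * h ^ β) := by gcongr
      _ = h ^ β * (((1 + t) ^ (d + 3))⁻¹ * (1 + t) ^ 2) := by ring
      _ = _ := by rw [h2]
  refine (lintegral_mono hpt).trans ?_
  have hint : Integrable (fun z : Space d => h ^ β * f (h⁻¹ • z)) :=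
    (hfi.comp_smul (inv_ne_zero hh.ne')).const_mul _
  rw [← ofReal_integral_eq_lintegral_ofReal hint (ae_of_all _ fun z => by positivity),
    integral_const_mul, Measure.integral_comp_smul]
  refine ENNReal.ofReal_le_ofReal ?_
  rw [finrank_euclideanSpace, Fintype.card_fin, smul_eq_mul, inv_pow, inv_inv,
    abs_of_pos (by positivity)]
  have : 0 ≤ h ^ β * h ^ d := by positivity
  nlinarith

/-- Constants belong to the space and are reproduced. This permits subtracting u(x₀), which turns a
bound by |u| into one by differences. -/
theorem IsL2Projection.sub_const {Ω : Set (Space d)} (hΩ : IsOpen Ω) (hΩb : Bornology.IsBounded Ω)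
    {𝒯 : Geometry.SimplicialComplex ℝ (Space d)} (hfin : 𝒯.faces.Finite)
    (hcov : closure Ω ⊆ ⋃₀ cells 𝒯) {r : ℕ} {u w : Space d → ℝ} (hu : MemLp u 2 (vol Ω))
    (h : IsL2Projection Ω (feSpace 𝒯 r) u w) (κ : ℝ) :
    IsL2Projection Ω (feSpace 𝒯 r) (fun x => u x - κ) (fun x => w x - κ) := by
  have hw := memLp_feSpace hΩ hΩb hfin hcov h.1 2
  have := isFiniteMeasure_vol hΩb
  refine ⟨?_, fun v hv => ?_⟩
  · have h1 := Submodule.sub_mem (feSubmodule 𝒯 r) (mem_feSubmodule.2 h.1)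
      (mem_feSubmodule.2 (const_mem_feSpace κ))
    exact h1
  · have hvL := memLp_feSpace hΩ hΩb hfin hcov hv 2
    have h2 : Integrable (fun x => κ * v x) (vol Ω) := (hvL.integrable (by norm_num)).const_mul κ
    have e1 : ∫ x in Ω, (w x - κ) * v x = (∫ x in Ω, w x * v x) - ∫ x in Ω, κ * v x := by
      have h3 : Integrable (fun x => w x * v x) (vol Ω) := hw.integrable_mul hvL
      rw [← integral_sub h3 h2]
      exact integral_congr_ae (ae_of_all _ fun x => by ring)
    have e2 : ∫ x in Ω, (u x - κ) * v x = (∫ x in Ω, u x * v x) - ∫ x in Ω, κ * v x := by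
      have h3 : Integrable (fun x => u x * v x) (vol Ω) := hu.integrable_mul hvL
      rw [← integral_sub h3 h2]
      exact integral_congr_ae (ae_of_all _ fun x => by ring)
    rw [e1, e2, h.2 v hv]

/-- Tonelli with x = y + z. The weight depends only on z, so differences may be estimated one
translation at a time. -/
theorem lintegral_differences_eq {Ω : Set (Space d)} (hΩ : MeasurableSet Ω) {u : Space d → ℝ}
    (hu : Measurable u) (β : ℝ) {k : ℕ} {h : ℝ} (hh : 0 < h) :
    ∫⁻ y in Ω, ∫⁻ x in Ω, ‖u x - u y‖ₑ ^ β * ENNReal.ofReal (wgt k h y x) =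
      ∫⁻ z, ENNReal.ofReal (wgt k h 0 z) *
        ∫⁻ y in Ω ∩ (fun y => y + z) ⁻¹' Ω, ‖u (y + z) - u y‖ₑ ^ β := by
  have hw : Measurable fun p : Space d × Space d => ENNReal.ofReal (wgt k h p.1 p.2) := by
    have : Continuous fun p : Space d × Space d => wgt k h p.1 p.2 := by
      unfold wgt
      exact Continuous.inv₀ (by fun_prop) fun x => by positivity
    exact this.measurable.ennreal_ofReal
  set F : Space d × Space d → ℝ≥0∞ := fun p => (Ω ×ˢ Ω).indicator
    (fun p => ‖u p.2 - u p.1‖ₑ ^ β * ENNReal.ofReal (wgt k h p.1 p.2)) p with hF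
  have hFm : Measurable F := Measurable.indicator
    (((((hu.comp measurable_snd).sub (hu.comp measurable_fst)).enorm).pow_const β).mul hw)
    (hΩ.prod hΩ)
  have e1 : ∫⁻ y in Ω, ∫⁻ x in Ω, ‖u x - u y‖ₑ ^ β * ENNReal.ofReal (wgt k h y x) =
      ∫⁻ y, ∫⁻ x, F (y, x) := by
    rw [← lintegral_indicator hΩ]
    refine lintegral_congr fun y => ?_
    by_cases hy : y ∈ Ω
    · rw [indicator_of_mem hy, ← lintegral_indicator hΩ]
      refine lintegral_congr fun x => ?_
      by_cases hx : x ∈ Ω <;> simp [hF, hx, hy]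
    · simp [hF, hy]
  have e2 : ∫⁻ y, ∫⁻ x, F (y, x) = ∫⁻ z, ∫⁻ y, F (y, y + z) := by
    have h1 : ∫⁻ y, ∫⁻ x, F (y, x) = ∫⁻ y, ∫⁻ z, F (y, y + z) := lintegral_congr fun y =>
      (lintegral_add_left_eq_self (fun x => F (y, x)) y).symm
    rw [h1]
    exact lintegral_lintegral_swap (f := fun y z => F (y, y + z))
      (hFm.comp (measurable_fst.prodMk (measurable_fst.add measurable_snd))).aemeasurable
  rw [e1, e2]
  refine lintegral_congr fun z => ?_
  have hmz : MeasurableSet (Ω ∩ (fun y => y + z) ⁻¹' Ω) := hΩ.inter (measurable_add_const z hΩ)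
  rw [← lintegral_const_mul _ (by fun_prop), ← lintegral_indicator hmz]
  refine lintegral_congr fun y => ?_
  by_cases hy : y ∈ Ω <;> by_cases hx : y + z ∈ Ω <;> simp [hF, hx, hy, wgt, mul_comm]

/-- `W^{1,β}`-stability of the `L²`-projection, in terms of differences of the function. -/
theorem exists_lintegral_gradient_projection_bound (d r : ℕ) (hr : r ≠ 0) {σ : ℝ} (hσ : 0 < σ)
    {β : ℝ} (hβ1 : 1 < β) (hβ2 : β ≤ 2) :
    ∃ C : ℝ≥0∞, C ≠ ⊤ ∧ ∀ (Ω : Set (Space d)), IsOpen Ω → Bornology.IsBounded Ω → ∀ (h : ℝ)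
      (𝒯 : Geometry.SimplicialComplex ℝ (Space d)), IsQuasiUniformTriangulation Ω σ h 𝒯 →
      ∀ u w : Space d → ℝ, Measurable u → MemLp u 2 (vol Ω) →
      IsL2Projection Ω (feSpace 𝒯 r) u w → ∀ S : ℝ≥0∞,
      (∀ z : Space d, ∫⁻ y in Ω ∩ (fun y => y + z) ⁻¹' Ω, ‖u (y + z) - u y‖ₑ ^ β ≤ ‖z‖ₑ ^ β * S) →
      ∫⁻ y in Ω, ‖gradient w y‖ₑ ^ β ≤ C * S := by
  obtain ⟨C, hC, hdecay⟩ := exists_gradient_projection_bound d r (d + 3) hr hσ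
  obtain ⟨W₀, hW₀, hw₀⟩ := exists_lintegral_wgt_bound d le_rfl (by norm_num : (0 : ℝ) ≤ 2)
  obtain ⟨W₁, hW₁, hw₁⟩ := exists_lintegral_wgt_bound d (by linarith : 0 ≤ β) hβ2
  have hβ0 : 0 < β := by linarith
  set b : ℝ := volume.real (Metric.ball (0 : Space d) 1) with hb
  have hb0 : 0 < b := by
    refine ENNReal.toReal_pos ?_ measure_ball_lt_top.ne
    exact (Metric.measure_ball_pos volume _ one_pos).ne'
  set b' : ℝ := volume.real (Metric.closedBall (0 : Space d) 1) with hb'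
  refine ⟨ENNReal.ofReal (C ^ β * (σ ^ d * b)⁻¹ * b' * W₀ ^ (β - 1) * W₁),
    ENNReal.ofReal_ne_top, ?_⟩
  intro Ω hΩ hΩb h 𝒯 hT u w hum hu hw S hS
  have hh := hT.h_pos
  have := isFiniteMeasure_vol hΩb
  set G : Space d → ℝ≥0∞ := fun y =>
    ∫⁻ x in Ω, ‖u x - u y‖ₑ ^ β * ENNReal.ofReal (wgt (d + 3) h y x) with hG
  set A : ℝ := C * (h * h ^ d)⁻¹ with hA
  have hA0 : 0 < A := by positivity
  -- pointwise bound
  have hpt : ∀ s, IsCell 𝒯 s → ∀ x₀ ∈ convexHull ℝ (s : Set (Space d)),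
      ∀ y ∈ interior (convexHull ℝ (s : Set (Space d))),
      ‖gradient w y‖ₑ ^ β ≤
        ENNReal.ofReal (A ^ β * (W₀ * h ^ d) ^ (β - 1)) * G x₀ := by
    intro s hs x₀ hx₀ y hy
    -- The decay estimate is used for u - u(x₀); the gradient of the projection is unchanged.
    have h1 := hdecay Ω hΩ hΩb h 𝒯 hT (fun x => u x - u x₀) (fun x => w x - u x₀)
      (hu.sub (memLp_const _)) (hw.sub_const hΩ hΩb hT.finite hT.covers hu _) s hs x₀ hx₀ y hy
    have e0 : gradient (fun x => w x - u x₀) y = gradient w y := by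
      unfold gradient
      rw [fderiv_sub_const]
    rw [e0] at h1
    have h2 : ‖gradient w y‖ ≤ A * ∫ x in Ω, |u x - u x₀| * wgt (d + 3) h x₀ x := by
      rw [mul_comm, ← le_div_iff₀ hh] at h1
      refine h1.trans (le_of_eq ?_)
      rw [hA]
      field_simp
    have hint : Integrable (fun x => |u x - u x₀| * wgt (d + 3) h x₀ x) (vol Ω) :=
      ((hu.sub (memLp_const _)).integrable (by norm_num)).abs.mul_bdd (c := 1)
        (continuous_wgt _ hh x₀).aestronglyMeasurable (ae_of_all _ fun x => by
          rw [Real.norm_of_nonneg (wgt_pos _ hh x₀ x).le]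
          exact wgt_le_one _ hh x₀ x)
    have h3 : ‖gradient w y‖ₑ ≤ ENNReal.ofReal A *
        ∫⁻ x in Ω, ‖u x - u x₀‖ₑ * ENNReal.ofReal (wgt (d + 3) h x₀ x) := by
      rw [← ofReal_norm]
      refine (ENNReal.ofReal_le_ofReal h2).trans ?_
      rw [ENNReal.ofReal_mul hA0.le, ofReal_integral_eq_lintegral_ofReal hint
        (ae_of_all _ fun x => mul_nonneg (abs_nonneg _) (wgt_pos _ hh _ _).le)]
      refine mul_le_mul' le_rfl (lintegral_mono fun x => ?_)
      rw [ENNReal.ofReal_mul (abs_nonneg _), ← Real.norm_eq_abs, ofReal_norm]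
    have h4 : ∫⁻ x in Ω, ENNReal.ofReal (wgt (d + 3) h x₀ x) ≤ ENNReal.ofReal (W₀ * h ^ d) := by
      refine (setLIntegral_le_lintegral _ _).trans ?_
      have h5 := hw₀ h hh
      simp only [ENNReal.rpow_zero, mul_one, Real.rpow_zero] at h5
      refine le_trans (le_of_eq ?_) h5
      rw [← lintegral_sub_right_eq_self (fun z => ENNReal.ofReal (wgt (d + 3) h 0 z)) x₀]
      simp [wgt]
    have h6 := lintegral_mul_rpow_le (μ := vol Ω) hβ1 (f := fun x => ‖u x - u x₀‖ₑ)
      (g := fun x => ENNReal.ofReal (wgt (d + 3) h x₀ x))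
      (hum.sub_const _).enorm.aemeasurable
      (continuous_wgt _ hh x₀).measurable.ennreal_ofReal.aemeasurable
    calc ‖gradient w y‖ₑ ^ β ≤ (ENNReal.ofReal A *
          ∫⁻ x in Ω, ‖u x - u x₀‖ₑ * ENNReal.ofReal (wgt (d + 3) h x₀ x)) ^ β :=
          ENNReal.rpow_le_rpow h3 hβ0.le
      _ = ENNReal.ofReal (A ^ β) *
          (∫⁻ x in Ω, ‖u x - u x₀‖ₑ * ENNReal.ofReal (wgt (d + 3) h x₀ x)) ^ β := by
          rw [ENNReal.mul_rpow_of_nonneg _ _ hβ0.le, ENNReal.ofReal_rpow_of_pos hA0]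
      _ ≤ ENNReal.ofReal (A ^ β) * (ENNReal.ofReal ((W₀ * h ^ d) ^ (β - 1)) * G x₀) := by
          refine mul_le_mul' le_rfl (h6.trans (mul_le_mul' ?_ le_rfl))
          rw [← ENNReal.ofReal_rpow_of_pos (by positivity)]
          exact ENNReal.rpow_le_rpow h4 (by linarith)
      _ = _ := by rw [ENNReal.ofReal_mul (by positivity), mul_assoc]
  -- average over the balls and sum
  set V : ℝ := σ ^ d * h ^ d * b with hV
  have hV0 : 0 < V := by positivity
  have hvol : ∀ x : Space d, volume (Metric.ball x (σ * h)) = ENNReal.ofReal V := fun x => by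
    rw [Measure.addHaar_ball_of_pos _ _ (by positivity), finrank_euclideanSpace, Fintype.card_fin,
      ← ofReal_measureReal (measure_ball_lt_top.ne), ← ENNReal.ofReal_mul (by positivity), hV,
      mul_pow]
  have hsum := lintegral_le_of_cell_le hΩ.measurableSet hσ hT
    (F := fun y => ‖gradient w y‖ₑ ^ β) (G := G)
    (K := ENNReal.ofReal (A ^ β * (W₀ * h ^ d) ^ (β - 1) * V⁻¹)) (by
      intro s hs x hx y hy
      have h1 : ∫⁻ _ in Metric.ball x (σ * h), ‖gradient w y‖ₑ ^ β ≤
          ∫⁻ z in Metric.ball x (σ * h),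
            ENNReal.ofReal (A ^ β * (W₀ * h ^ d) ^ (β - 1)) * G z :=
        setLIntegral_mono' Metric.isOpen_ball.measurableSet fun z hz =>
          hpt s hs z (hx hz).1 y hy.1
      rw [setLIntegral_const, lintegral_const_mul' _ _ ENNReal.ofReal_ne_top, hvol] at h1
      have h2 : ‖gradient w y‖ₑ ^ β =
          ‖gradient w y‖ₑ ^ β * ENNReal.ofReal V * ENNReal.ofReal V⁻¹ := by
        rw [mul_assoc, ← ENNReal.ofReal_mul hV0.le, mul_inv_cancel₀ hV0.ne', ENNReal.ofReal_one,
          mul_one]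
      rw [h2, show ENNReal.ofReal (A ^ β * (W₀ * h ^ d) ^ (β - 1) * V⁻¹) =
        ENNReal.ofReal (A ^ β * (W₀ * h ^ d) ^ (β - 1)) * ENNReal.ofReal V⁻¹ from
          ENNReal.ofReal_mul (by positivity), mul_right_comm (ENNReal.ofReal _)]
      exact mul_le_mul' h1 le_rfl)
  refine hsum.trans ?_
  have hGint : ∫⁻ y in Ω, G y ≤ ENNReal.ofReal (W₁ * (h ^ d * h ^ β)) * S := by
    rw [hG, lintegral_differences_eq hΩ.measurableSet hum β hh]
    calc _ ≤ ∫⁻ z : Space d, ENNReal.ofReal (wgt (d + 3) h 0 z) * ‖z‖ₑ ^ β * S :=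
          lintegral_mono fun z => by
            rw [mul_assoc]
            exact mul_le_mul' le_rfl (hS z)
      _ = (∫⁻ z : Space d, ENNReal.ofReal (wgt (d + 3) h 0 z) * ‖z‖ₑ ^ β) * S := by
          refine lintegral_mul_const _ ?_
          exact (continuous_wgt _ hh 0).measurable.ennreal_ofReal.mul (by fun_prop)
      _ ≤ _ := mul_le_mul' (hw₁ h hh) le_rfl
  refine (mul_le_mul' le_rfl hGint).trans (le_of_eq ?_)
  rw [Measure.addHaar_closedBall' _ _ hh.le, finrank_euclideanSpace, Fintype.card_fin,
    ← ofReal_measureReal (measure_closedBall_lt_top.ne), ← mul_assoc,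
    ← ENNReal.ofReal_mul (by positivity), ← ENNReal.ofReal_mul (by positivity),
    ← ENNReal.ofReal_mul (by positivity)]
  -- All powers of h cancel, so the constant does not depend on the mesh size.
  congr 2
  have hhd : 0 < h ^ d := by positivity
  rw [hA, Real.mul_rpow hC.le (by positivity), Real.mul_rpow hW₀.le hhd.le, Real.inv_rpow
    (by positivity), Real.mul_rpow hh.le hhd.le, Real.rpow_sub_one hhd.ne', hV]
  have hhβ : 0 < h ^ β := by positivity
  have hhdβ : 0 < (h ^ d) ^ β := by positivity
  field_simp
  rfl

end Forchheimer

end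

/-! ### Differences along segments and short paths inside the domain. -/

noncomputable section

namespace Forchheimer

variable {d : ℕ}

/-- `u` is a limit in `W^{1,1}(Ω)` of `C¹` functions on the whole space, with gradient `G`. -/
def IsSmoothLimit (Ω : Set (Space d)) (u : Space d → ℝ) (G : Space d → Space d) : Prop :=
  ∃ v : ℕ → Space d → ℝ, (∀ n, ContDiff ℝ 1 (v n)) ∧
    Tendsto (fun n => ∫⁻ x in Ω, ‖v n x - u x‖ₑ) atTop (𝓝 0) ∧
    Tendsto (fun n => ∫⁻ x in Ω, ‖gradient (v n) x - G x‖ₑ) atTop (𝓝 0)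

theorem enorm_sub_le_lintegral_gradient {v : Space d → ℝ} (hv : ContDiff ℝ 1 v) (y p : Space d) :
    ‖v (y + p) - v y‖ₑ ≤ ‖p‖ₑ * ∫⁻ t in Ioc (0 : ℝ) 1, ‖gradient v (y + t • p)‖ₑ := by
  have hd : ∀ t : ℝ, HasDerivAt (fun t : ℝ => v (y + t • p)) (fderiv ℝ v (y + t • p) p) t :=
    fun t => by
      have h1 : HasDerivAt (fun t : ℝ => y + t • p) p t := by
        have h := ((hasDerivAt_id t).smul_const p).const_add y
        rw [one_smul] at h
        exact h
      exact ((hv.differentiable one_ne_zero _).hasFDerivAt).comp_hasDerivAt t h1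
  have hc : Continuous fun t : ℝ => fderiv ℝ v (y + t • p) p :=
    ((hv.continuous_fderiv one_ne_zero).comp (by fun_prop)).clm_apply continuous_const
  have h2 := intervalIntegral.integral_eq_sub_of_hasDerivAt (fun t _ => hd t)
    (hc.intervalIntegrable 0 1)
  simp only [one_smul, zero_smul, add_zero] at h2
  rw [← h2, intervalIntegral.integral_of_le zero_le_one]
  refine (enorm_integral_le_lintegral_enorm _).trans ?_
  rw [← lintegral_const_mul' _ _ (enorm_ne_top)]
  refine lintegral_mono fun t => ?_
  rw [← ofReal_norm, ← ofReal_norm, ← ofReal_norm, ← ENNReal.ofReal_mul (norm_nonneg _),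
    norm_gradient, mul_comm]
  exact ENNReal.ofReal_le_ofReal ((fderiv ℝ v (y + t • p)).le_opNorm p)

theorem setLIntegral_add_le {Ω E : Set (Space d)} (hΩ : MeasurableSet Ω) (hE : MeasurableSet E)
    {q : Space d} (hq : ∀ y ∈ E, y + q ∈ Ω) (f : Space d → ℝ≥0∞) :
    ∫⁻ y in E, f (y + q) ≤ ∫⁻ y in Ω, f y := by
  rw [← lintegral_indicator hE, ← lintegral_indicator hΩ,
    ← lintegral_add_right_eq_self (fun y => Ω.indicator f y) q]
  refine lintegral_mono fun y => ?_
  by_cases hy : y ∈ E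
  · rw [indicator_of_mem hy, indicator_of_mem (hq y hy)]
  · simp [hy]

/-- For each fixed t the translate of E by q + tp lies in Ω, so after exchanging the integrals every
slice is bounded by the integral over Ω. -/
theorem lintegral_segment_le {Ω E : Set (Space d)} (hΩ : MeasurableSet Ω) (hE : MeasurableSet E)
    {q p : Space d} (h : ∀ y ∈ E, ∀ t ∈ Icc (0 : ℝ) 1, y + q + t • p ∈ Ω) {f : Space d → ℝ≥0∞}
    (hf : Measurable f) :
    ∫⁻ y in E, ∫⁻ t in Ioc (0 : ℝ) 1, f (y + q + t • p) ≤ ∫⁻ y in Ω, f y := by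
  have hm : Measurable fun x : Space d × ℝ => x.1 + q + x.2 • p := by fun_prop
  have hswap := lintegral_lintegral_swap (μ := volume.restrict E)
    (ν := volume.restrict (Ioc (0 : ℝ) 1)) (f := fun y t => f (y + q + t • p))
    (hf.comp hm).aemeasurable
  rw [hswap]
  have h1 : ∀ t ∈ Ioc (0 : ℝ) 1, ∫⁻ y in E, f (y + q + t • p) ≤ ∫⁻ y in Ω, f y := fun t ht => by
    simp only [add_assoc]
    exact setLIntegral_add_le hΩ hE (q := q + t • p)
      (fun y hy => by rw [← add_assoc]; exact h y hy t ⟨ht.1.le, ht.2⟩) f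
  refine (setLIntegral_mono' measurableSet_Ioc h1).trans ?_
  simp

/-- The difference quotient along a segment contained in `Ω` is controlled by the gradient. -/
theorem ae_enorm_sub_le {Ω E : Set (Space d)} (hΩ : MeasurableSet Ω) (hE : MeasurableSet E)
    {u : Space d → ℝ} {G : Space d → Space d} (hu : Measurable u) (hG : Measurable G)
    (huG : IsSmoothLimit Ω u G) {q p : Space d}
    (h : ∀ y ∈ E, ∀ t ∈ Icc (0 : ℝ) 1, y + q + t • p ∈ Ω) :
    ∀ᵐ y ∂(volume.restrict E), ‖u (y + q + p) - u (y + q)‖ₑ ≤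
      ‖p‖ₑ * ∫⁻ t in Ioc (0 : ℝ) 1, ‖G (y + q + t • p)‖ₑ := by
  obtain ⟨v, hv, hv0, hv1⟩ := huG
  have hline : Measurable fun x : Space d × ℝ => x.1 + q + x.2 • p := by fun_prop
  have h0 : ∀ y ∈ E, y + q ∈ Ω := fun y hy => by simpa using h y hy 0 (by simp)
  have h1 : ∀ y ∈ E, y + (q + p) ∈ Ω := fun y hy => by
    simpa [add_assoc] using h y hy 1 (by simp)
  set R : ℕ → Space d → ℝ≥0∞ := fun n y => ‖v n (y + (q + p)) - u (y + (q + p))‖ₑ +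
    ‖v n (y + q) - u (y + q)‖ₑ +
    ‖p‖ₑ * ∫⁻ t in Ioc (0 : ℝ) 1, ‖gradient (v n) (y + q + t • p) - G (y + q + t • p)‖ₑ with hR
  have hvm : ∀ n, Measurable (v n) := fun n => (hv n).continuous.measurable
  have hgm : ∀ n, Measurable fun x => ‖gradient (v n) x - G x‖ₑ := fun n =>
    ((measurable_gradient (v n)).sub hG).enorm
  have hRint : ∀ n, ∫⁻ y in E, R n y ≤ (∫⁻ x in Ω, ‖v n x - u x‖ₑ) + (∫⁻ x in Ω, ‖v n x - u x‖ₑ) +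
      ‖p‖ₑ * ∫⁻ x in Ω, ‖gradient (v n) x - G x‖ₑ := fun n => by
    have hm := ((hvm n).sub hu).enorm
    have hm1 : Measurable fun y => ‖v n (y + (q + p)) - u (y + (q + p))‖ₑ :=
      hm.comp (measurable_add_const (q + p))
    have hm2 : Measurable fun y => ‖v n (y + q) - u (y + q)‖ₑ := hm.comp (measurable_add_const q)
    have hm12 : Measurable fun y => ‖v n (y + (q + p)) - u (y + (q + p))‖ₑ +
        ‖v n (y + q) - u (y + q)‖ₑ := hm1.add hm2
    simp only [hR]
    rw [lintegral_add_left hm12, lintegral_add_left hm1, lintegral_const_mul' _ _ enorm_ne_top]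
    refine add_le_add (add_le_add ?_ ?_) (mul_le_mul' le_rfl ?_)
    · exact setLIntegral_add_le hΩ hE h1 fun x => ‖v n x - u x‖ₑ
    · exact setLIntegral_add_le hΩ hE h0 fun x => ‖v n x - u x‖ₑ
    · exact lintegral_segment_le hΩ hE h (hgm n)
  have hRlim : Tendsto (fun n => ∫⁻ y in E, R n y) atTop (𝓝 0) := by
    refine tendsto_of_tendsto_of_tendsto_of_le_of_le tendsto_const_nhds ?_ (fun _ => bot_le) hRint
    have := (hv0.add hv0).add (ENNReal.Tendsto.const_mul hv1 (Or.inr (enorm_ne_top (x := p))))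
    simpa using this
  set a : Space d → ℝ≥0∞ := fun y => ‖u (y + q + p) - u (y + q)‖ₑ with ha
  set b : Space d → ℝ≥0∞ := fun y => ‖p‖ₑ * ∫⁻ t in Ioc (0 : ℝ) 1, ‖G (y + q + t • p)‖ₑ with hb
  -- The inequality holds for the smooth approximations; R n is the approximation error and tends to
  -- 0 in L¹(E). With truncated subtraction this forces a ≤ b almost everywhere.
  have hab : ∀ n y, a y - b y ≤ R n y := fun n y => by
    rw [tsub_le_iff_right]
    have e1 : u (y + q + p) - u (y + q) = -(v n (y + (q + p)) - u (y + (q + p))) +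
        (v n (y + q) - u (y + q)) + (v n (y + q + p) - v n (y + q)) := by
      rw [add_assoc]
      ring
    have e2 : a y ≤ ‖v n (y + (q + p)) - u (y + (q + p))‖ₑ + ‖v n (y + q) - u (y + q)‖ₑ +
        ‖v n (y + q + p) - v n (y + q)‖ₑ := by
      rw [ha]
      simp only [e1]
      refine (enorm_add_le _ _).trans (add_le_add ((enorm_add_le _ _).trans ?_) le_rfl)
      rw [enorm_neg]
    have e3 : ∫⁻ t in Ioc (0 : ℝ) 1, ‖gradient (v n) (y + q + t • p)‖ₑ ≤
        (∫⁻ t in Ioc (0 : ℝ) 1, ‖gradient (v n) (y + q + t • p) - G (y + q + t • p)‖ₑ) +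
          ∫⁻ t in Ioc (0 : ℝ) 1, ‖G (y + q + t • p)‖ₑ := by
      have hm : Measurable fun t : ℝ =>
          ‖gradient (v n) (y + q + t • p) - G (y + q + t • p)‖ₑ :=
        (hgm n).comp (hline.comp measurable_prodMk_left)
      rw [← lintegral_add_left hm]
      refine lintegral_mono fun t => ?_
      calc ‖gradient (v n) (y + q + t • p)‖ₑ = ‖(gradient (v n) (y + q + t • p) -
            G (y + q + t • p)) + G (y + q + t • p)‖ₑ := by rw [sub_add_cancel]
        _ ≤ _ := enorm_add_le _ _
    refine e2.trans ?_
    refine (add_le_add le_rfl ((enorm_sub_le_lintegral_gradient (hv n) (y + q) p).trans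
      (mul_le_mul' le_rfl e3))).trans (le_of_eq ?_)
    rw [hR, hb]
    simp only [mul_add]
    ring
  have hzero : ∫⁻ y in E, (a y - b y) = 0 := by
    refine le_antisymm (ge_of_tendsto' hRlim fun n => lintegral_mono (hab n)) bot_le
  have ham : Measurable a := by
    have h1 : Measurable fun y => u (y + q + p) := hu.comp (by fun_prop)
    have h2 : Measurable fun y => u (y + q) := hu.comp (by fun_prop)
    exact (h1.sub h2).enorm
  have hbm : Measurable b := by
    have : Measurable fun y => ∫⁻ t in Ioc (0 : ℝ) 1, ‖G (y + q + t • p)‖ₑ :=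
      (hG.enorm.comp hline).lintegral_prod_right'
    exact this.const_mul _
  have habm : Measurable fun y => a y - b y := ham.sub hbm
  rw [lintegral_eq_zero_iff habm] at hzero
  filter_upwards [hzero] with y hy
  exact tsub_eq_zero_iff_le.1 hy

/-- Raise the segment inequality to the power β, use Jensen over t in [0, 1], and integrate with
`lintegral_segment_le`. -/
theorem lintegral_sub_rpow_le {Ω E : Set (Space d)} (hΩ : MeasurableSet Ω) (hE : MeasurableSet E)
    {u : Space d → ℝ} {G : Space d → Space d} (hu : Measurable u) (hG : Measurable G)
    (huG : IsSmoothLimit Ω u G) {q p : Space d}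
    (h : ∀ y ∈ E, ∀ t ∈ Icc (0 : ℝ) 1, y + q + t • p ∈ Ω) {β : ℝ} (hβ : 1 < β) :
    ∫⁻ y in E, ‖u (y + q + p) - u (y + q)‖ₑ ^ β ≤ ‖p‖ₑ ^ β * ∫⁻ y in Ω, ‖G y‖ₑ ^ β := by
  have hβ0 : 0 < β := by linarith
  have hline : Measurable fun x : Space d × ℝ => x.1 + q + x.2 • p := by fun_prop
  have h1 : ∀ᵐ y ∂(volume.restrict E), ‖u (y + q + p) - u (y + q)‖ₑ ^ β ≤
      ‖p‖ₑ ^ β * ∫⁻ t in Ioc (0 : ℝ) 1, ‖G (y + q + t • p)‖ₑ ^ β := by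
    filter_upwards [ae_enorm_sub_le hΩ hE hu hG huG h] with y hy
    refine (ENNReal.rpow_le_rpow hy hβ0.le).trans ?_
    rw [ENNReal.mul_rpow_of_nonneg _ _ hβ0.le]
    refine mul_le_mul' le_rfl ?_
    have hm : Measurable fun t : ℝ => ‖G (y + q + t • p)‖ₑ :=
      hG.enorm.comp (hline.comp measurable_prodMk_left)
    have h2 := lintegral_mul_rpow_le (μ := volume.restrict (Ioc (0 : ℝ) 1)) hβ
      hm.aemeasurable (aemeasurable_const (b := (1 : ℝ≥0∞)))
    simpa using h2
  refine (lintegral_mono_ae h1).trans ?_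
  rw [lintegral_const_mul' _ _ (ENNReal.rpow_ne_top_of_nonneg hβ0.le enorm_ne_top)]
  exact mul_le_mul' le_rfl (lintegral_segment_le hΩ hE h (hG.enorm.pow_const β))

/-- Near each point of the closure of a `C¹` domain, close points can be joined by short paths made
of three segments. -/
theorem HasC1Boundary.exists_path {Ω : Set (Space d)} (hC : HasC1Boundary Ω) (hΩ : IsOpen Ω)
    {x : Space d} (hx : x ∈ closure Ω) :
    ∃ R δ c : ℝ, 0 < R ∧ 0 < δ ∧ 0 ≤ c ∧ ∀ z : Space d, ‖z‖ < δ → ∃ p : Space d, ‖p‖ ≤ c * ‖z‖ ∧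
      ∀ y ∈ Metric.ball x R, y ∈ Ω → y + z ∈ Ω → ∀ t ∈ Icc (0 : ℝ) 1,
        y + t • p ∈ Ω ∧ y + z + t • p ∈ Ω ∧ y + p + t • z ∈ Ω := by
  by_cases hxΩ : x ∈ Ω
  · obtain ⟨R, hR, hRΩ⟩ := Metric.isOpen_iff.1 hΩ x hxΩ
    refine ⟨R / 2, R / 2, 0, by positivity, by positivity, le_rfl, fun z hz => ⟨0, by simp, ?_⟩⟩
    intro y hy hyΩ hyz t ht
    refine ⟨by simpa using hyΩ, by simpa using hyz, hRΩ ?_⟩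
    have h1 : dist y x < R / 2 := hy
    have h2 : ‖t • z‖ ≤ ‖z‖ := by
      rw [norm_smul, Real.norm_of_nonneg ht.1]
      nlinarith [ht.2, norm_nonneg z]
    rw [add_zero, Metric.mem_ball]
    calc dist (y + t • z) x ≤ dist (y + t • z) y + dist y x := dist_triangle _ _ _
      _ = ‖t • z‖ + dist y x := by simp [dist_eq_norm]
      _ < R := by linarith
  · have hxf : x ∈ frontier Ω := by
      rw [hΩ.frontier_eq]
      exact ⟨hx, hxΩ⟩
    obtain ⟨φ, D, hD, hchart⟩ := hC.exists_chart hΩ hxf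
    obtain ⟨e₀, he₀⟩ : ∃ e, D e ≠ 0 := by
      by_contra! h0
      exact hD (ContinuousLinearMap.ext h0)
    -- Normalized so that D e = -1: moving along e decreases φ and leads into Ω.
    set e : Space d := (-(D e₀)⁻¹) • e₀ with he
    have hDe : D e = -1 := by
      rw [he, map_smul, smul_eq_mul, neg_mul, inv_mul_cancel₀ he₀]
    set L := ‖e‖ with hL
    have hL0 : 0 ≤ L := norm_nonneg _
    set η : ℝ := (2 * (L + 1))⁻¹ with hη
    have hη0 : 0 < η := by positivity
    have hηL : η * L ≤ 1 / 2 := by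
      rw [hη, inv_mul_le_iff₀ (by positivity)]
      linarith
    obtain ⟨R, hR, hin, -, hφ⟩ := hchart η hη0
    -- Moving by m‖z‖ along e lowers φ by at least (‖D‖ + η)‖z‖, enough to compensate its largest
    -- possible increase along z. The path y, y + p, y + p + z, y + z therefore stays in Ω.
    set m : ℝ := 2 * (‖D‖ + η) with hm
    have hm0 : 0 < m := by positivity
    refine ⟨R / 2, R / 2 / (1 + m * L), m * L, by positivity, by positivity, by positivity, ?_⟩
    intro z hz
    rw [lt_div_iff₀ (by positivity)] at hz
    refine ⟨(m * ‖z‖) • e, ?_, ?_⟩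
    · rw [norm_smul, Real.norm_of_nonneg (by positivity)]
      exact le_of_eq (by ring)
    intro y hy hyΩ hyz t ht
    have hy' : dist y x < R / 2 := hy
    have hz0 : 0 ≤ ‖z‖ := norm_nonneg z
    -- all points involved lie in the ball
    have hball : ∀ s r : ℝ, s ∈ Icc (0 : ℝ) 1 → r ∈ Icc (0 : ℝ) 1 →
        y + (r • z + (s * (m * ‖z‖)) • e) ∈ Metric.ball x R := by
      intro s r hs hr
      have h1 : ‖r • z + (s * (m * ‖z‖)) • e‖ ≤ ‖z‖ * (1 + m * L) := by
        refine (norm_add_le _ _).trans ?_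
        rw [norm_smul, norm_smul, Real.norm_of_nonneg hr.1,
          Real.norm_of_nonneg (mul_nonneg hs.1 (by positivity))]
        have h2 : r * ‖z‖ ≤ 1 * ‖z‖ := by gcongr; exact hr.2
        have h3 : s * (m * ‖z‖) * L ≤ 1 * (m * ‖z‖) * L := by gcongr; exact hs.2
        nlinarith
      rw [Metric.mem_ball]
      calc dist (y + (r • z + (s * (m * ‖z‖)) • e)) x
          ≤ dist (y + (r • z + (s * (m * ‖z‖)) • e)) y + dist y x := dist_triangle _ _ _
        _ = ‖r • z + (s * (m * ‖z‖)) • e‖ + dist y x := by simp [dist_eq_norm]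
        _ < R := by linarith
    -- moving in the direction `e` decreases `φ`
    have hdec : ∀ a : Space d, ∀ s : ℝ, 0 ≤ s → a ∈ Metric.ball x R → a + s • e ∈ Metric.ball x R →
        φ (a + s • e) ≤ φ a - s / 2 := by
      intro a s hs ha hae
      have h1 := (abs_le.1 (hφ _ hae a ha)).2
      rw [add_sub_cancel_left, map_smul, hDe, norm_smul, Real.norm_of_nonneg hs, ← hL,
        smul_eq_mul] at h1
      nlinarith
    have hyR : y ∈ Metric.ball x R := by simpa using hball 0 0 (by simp) (by simp)
    have hyzR : y + z ∈ Metric.ball x R := by simpa using hball 0 1 (by simp) (by simp)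
    have ht0 : 0 ≤ t * (m * ‖z‖) := mul_nonneg ht.1 (by positivity)
    have e1 : y + t • (m * ‖z‖) • e = y + (t * (m * ‖z‖)) • e := by rw [smul_smul]
    have e2 : y + z + t • (m * ‖z‖) • e = y + z + (t * (m * ‖z‖)) • e := by rw [smul_smul]
    refine ⟨?_, ?_, ?_⟩
    · have hb : y + (t * (m * ‖z‖)) • e ∈ Metric.ball x R := by simpa using hball t 0 ht (by simp)
      rw [e1, hin _ hb]
      have := hdec y _ ht0 hyR hb
      have := (hin y hyR).1 hyΩ
      linarith
    · have hb : y + z + (t * (m * ‖z‖)) • e ∈ Metric.ball x R := by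
        simpa [add_assoc] using hball t 1 ht (by simp)
      rw [e2, hin _ hb]
      have := hdec (y + z) _ ht0 hyzR hb
      have := (hin _ hyzR).1 hyz
      linarith
    · have hb1 : y + (m * ‖z‖) • e ∈ Metric.ball x R := by
        simpa using hball 1 0 (by simp) (by simp)
      have hb2 : y + (m * ‖z‖) • e + t • z ∈ Metric.ball x R := by
        have := hball 1 t (by simp) ht
        rwa [one_mul, add_comm (t • z), ← add_assoc] at this
      rw [hin _ hb2]
      have h1 := hdec y (m * ‖z‖) (by positivity) hyR hb1
      have h2 := (hin y hyR).1 hyΩ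
      have h3 := (abs_le.1 (hφ _ hb2 _ hb1)).2
      rw [add_sub_cancel_left, map_smul, norm_smul, Real.norm_of_nonneg ht.1, smul_eq_mul] at h3
      have h4 : D z ≤ ‖D‖ * ‖z‖ := (le_abs_self _).trans (D.le_opNorm z)
      have h5 : t * D z ≤ t * (‖D‖ * ‖z‖) := mul_le_mul_of_nonneg_left h4 ht.1
      have h6 : t * ((‖D‖ + η) * ‖z‖) ≤ 1 * ((‖D‖ + η) * ‖z‖) := by gcongr; exact ht.2
      have h7 : m * ‖z‖ / 2 = (‖D‖ + η) * ‖z‖ := by rw [hm]; ring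
      nlinarith

end Forchheimer

end

/-! ### Translation differences bounded by the Sobolev norm. -/

noncomputable section

namespace Forchheimer

variable {d : ℕ}

theorem enorm_add_three_rpow_le {β : ℝ} (hβ : 1 ≤ β) (a b c : ℝ) :
    ‖a + b + c‖ₑ ^ β ≤ 2 ^ (β - 1) * (2 ^ (β - 1) * (‖a‖ₑ ^ β + ‖b‖ₑ ^ β) + ‖c‖ₑ ^ β) := by
  have hβ0 : 0 ≤ β := by linarith
  calc ‖a + b + c‖ₑ ^ β ≤ (‖a + b‖ₑ + ‖c‖ₑ) ^ β := ENNReal.rpow_le_rpow (enorm_add_le _ _) hβ0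
    _ ≤ 2 ^ (β - 1) * (‖a + b‖ₑ ^ β + ‖c‖ₑ ^ β) := ENNReal.rpow_add_le_mul_rpow_add_rpow _ _ hβ
    _ ≤ _ := by
      refine mul_le_mul' le_rfl (add_le_add ?_ le_rfl)
      exact (ENNReal.rpow_le_rpow (enorm_add_le _ _) hβ0).trans
        (ENNReal.rpow_add_le_mul_rpow_add_rpow _ _ hβ)

/-- Differences are controlled by the gradient, locally. -/
theorem HasC1Boundary.exists_local_difference_bound {Ω : Set (Space d)} (hC : HasC1Boundary Ω)
    (hΩ : IsOpen Ω) {β : ℝ} (hβ : 1 < β) {x : Space d} (hx : x ∈ closure Ω) :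
    ∃ R : ℝ, 0 < R ∧ ∃ δ : ℝ, 0 < δ ∧ ∃ A : ℝ≥0∞, A ≠ ⊤ ∧
      ∀ (u : Space d → ℝ) (G : Space d → Space d), Measurable u → Measurable G →
        IsSmoothLimit Ω u G → ∀ z : Space d, ‖z‖ < δ →
        ∫⁻ y in Metric.ball x R ∩ (Ω ∩ (fun y => y + z) ⁻¹' Ω), ‖u (y + z) - u y‖ₑ ^ β ≤
          ‖z‖ₑ ^ β * (A * ∫⁻ y in Ω, ‖G y‖ₑ ^ β) := by
  obtain ⟨R, δ, c, hR, hδ, hc, hpath⟩ := hC.exists_path hΩ hx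
  have hβ0 : 0 ≤ β := by linarith
  set κ : ℝ≥0∞ := 2 ^ (β - 1) with hκ
  have hκt : κ ≠ ⊤ := ENNReal.rpow_ne_top_of_nonneg (by linarith) (by simp)
  set c' : ℝ≥0∞ := ENNReal.ofReal c ^ β with hc'
  have hct : c' ≠ ⊤ := ENNReal.rpow_ne_top_of_nonneg hβ0 ENNReal.ofReal_ne_top
  refine ⟨R, hR, δ, hδ, κ * (κ * (c' + 1) + c'), ?_, ?_⟩
  · exact ENNReal.mul_ne_top hκt (ENNReal.add_ne_top.2
      ⟨ENNReal.mul_ne_top hκt (ENNReal.add_ne_top.2 ⟨hct, by simp⟩), hct⟩)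
  intro u G hu hG huG z hz
  obtain ⟨p, hp, hpΩ⟩ := hpath z hz
  set E := Metric.ball x R ∩ (Ω ∩ (fun y => y + z) ⁻¹' Ω) with hE
  have hEm : MeasurableSet E := Metric.isOpen_ball.measurableSet.inter
    (hΩ.measurableSet.inter (measurable_add_const z hΩ.measurableSet))
  have hpe : ‖p‖ₑ ^ β ≤ c' * ‖z‖ₑ ^ β := by
    rw [hc', ← ENNReal.mul_rpow_of_nonneg _ _ hβ0]
    refine ENNReal.rpow_le_rpow ?_ hβ0
    rw [← ofReal_norm, ← ofReal_norm, ← ENNReal.ofReal_mul hc]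
    exact ENNReal.ofReal_le_ofReal hp
  set I := ∫⁻ y in Ω, ‖G y‖ₑ ^ β with hI
  have i1 : ∫⁻ y in E, ‖u (y + p) - u y‖ₑ ^ β ≤ ‖p‖ₑ ^ β * I := by
    have := lintegral_sub_rpow_le hΩ.measurableSet hEm hu hG huG (q := 0) (p := p)
      (fun y hy t ht => by simpa using (hpΩ y hy.1 hy.2.1 hy.2.2 t ht).1) hβ
    simpa using this
  have i2 : ∫⁻ y in E, ‖u (y + p + z) - u (y + p)‖ₑ ^ β ≤ ‖z‖ₑ ^ β * I :=
    lintegral_sub_rpow_le hΩ.measurableSet hEm hu hG huG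
      (fun y hy t ht => (hpΩ y hy.1 hy.2.1 hy.2.2 t ht).2.2) hβ
  have i3 : ∫⁻ y in E, ‖-(u (y + z + p) - u (y + z))‖ₑ ^ β ≤ ‖p‖ₑ ^ β * I := by
    simp only [enorm_neg]
    exact lintegral_sub_rpow_le hΩ.measurableSet hEm hu hG huG
      (fun y hy t ht => (hpΩ y hy.1 hy.2.1 hy.2.2 t ht).2.1) hβ
  have m1 : Measurable fun y => ‖u (y + p) - u y‖ₑ ^ β :=
    (((hu.comp (measurable_add_const p)).sub hu).enorm).pow_const β
  have m2 : Measurable fun y => ‖u (y + p + z) - u (y + p)‖ₑ ^ β := by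
    have h1 : Measurable fun y => u (y + p + z) := hu.comp (by fun_prop)
    have h2 : Measurable fun y => u (y + p) := hu.comp (by fun_prop)
    exact ((h1.sub h2).enorm).pow_const β
  have m12 : Measurable fun y => ‖u (y + p) - u y‖ₑ ^ β + ‖u (y + p + z) - u (y + p)‖ₑ ^ β :=
    m1.add m2
  calc ∫⁻ y in E, ‖u (y + z) - u y‖ₑ ^ β
      ≤ ∫⁻ y in E, κ * (κ * (‖u (y + p) - u y‖ₑ ^ β + ‖u (y + p + z) - u (y + p)‖ₑ ^ β) +
          ‖-(u (y + z + p) - u (y + z))‖ₑ ^ β) := by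
        refine lintegral_mono fun y => ?_
        have e : u (y + z) - u y = (u (y + p) - u y) + (u (y + p + z) - u (y + p)) +
            -(u (y + z + p) - u (y + z)) := by
          rw [add_right_comm y p z]
          ring
        rw [e]
        exact enorm_add_three_rpow_le hβ.le _ _ _
    _ = κ * (κ * ((∫⁻ y in E, ‖u (y + p) - u y‖ₑ ^ β) +
          ∫⁻ y in E, ‖u (y + p + z) - u (y + p)‖ₑ ^ β) +
          ∫⁻ y in E, ‖-(u (y + z + p) - u (y + z))‖ₑ ^ β) := by
        rw [lintegral_const_mul' _ _ hκt, lintegral_add_left (m12.const_mul κ),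
          lintegral_const_mul' _ _ hκt, lintegral_add_left m1]
    _ ≤ κ * (κ * (c' * ‖z‖ₑ ^ β * I + ‖z‖ₑ ^ β * I) + c' * ‖z‖ₑ ^ β * I) := by
        have h1 := i1.trans (mul_le_mul' hpe le_rfl)
        have h3 := i3.trans (mul_le_mul' hpe le_rfl)
        gcongr
    _ = _ := by ring

/-- Differences are controlled by the function and its gradient. -/
theorem exists_difference_bound {Ω : Set (Space d)} (hC : HasC1Boundary Ω)
    (hΩ : IsOpen Ω) (hΩb : Bornology.IsBounded Ω) {β : ℝ} (hβ : 1 < β) :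
    ∃ A : ℝ≥0∞, A ≠ ⊤ ∧
      ∀ (u : Space d → ℝ) (G : Space d → Space d), Measurable u → Measurable G →
        IsSmoothLimit Ω u G → ∀ z : Space d,
        ∫⁻ y in Ω ∩ (fun y => y + z) ⁻¹' Ω, ‖u (y + z) - u y‖ₑ ^ β ≤
          ‖z‖ₑ ^ β * (A * ((∫⁻ y in Ω, ‖u y‖ₑ ^ β) + ∫⁻ y in Ω, ‖G y‖ₑ ^ β)) := by
  have hβ0 : 0 < β := by linarith
  have hK : IsCompact (closure Ω) := hΩb.isCompact_closure
  obtain ⟨δ, hδ, A, hA, hloc⟩ := hK.induction_on (p := fun s => ∃ δ : ℝ, 0 < δ ∧ ∃ A : ℝ≥0∞, A ≠ ⊤ ∧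
      ∀ (u : Space d → ℝ) (G : Space d → Space d), Measurable u → Measurable G →
        IsSmoothLimit Ω u G → ∀ z : Space d, ‖z‖ < δ →
        ∫⁻ y in s ∩ (Ω ∩ (fun y => y + z) ⁻¹' Ω), ‖u (y + z) - u y‖ₑ ^ β ≤
          ‖z‖ₑ ^ β * (A * ∫⁻ y in Ω, ‖G y‖ₑ ^ β))
    ⟨1, one_pos, 0, by simp, by simp⟩
    (fun s t hst ⟨δ, hδ, A, hA, h⟩ => ⟨δ, hδ, A, hA, fun u G hu hG huG z hz =>
      (lintegral_mono_set (inter_subset_inter_left _ hst)).trans (h u G hu hG huG z hz)⟩)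
    (fun s t ⟨δ, hδ, A, hA, h⟩ ⟨δ', hδ', A', hA', h'⟩ => ⟨min δ δ', lt_min hδ hδ', A + A',
      by simp [hA, hA'], fun u G hu hG huG z hz => by
        rw [union_inter_distrib_right]
        refine (lintegral_union_le _ _ _).trans ?_
        rw [add_mul, mul_add]
        exact add_le_add (h u G hu hG huG z (hz.trans_le (min_le_left _ _)))
          (h' u G hu hG huG z (hz.trans_le (min_le_right _ _)))⟩)
    (fun x hx => by
      obtain ⟨R, hR, δ, hδ, A, hA, h⟩ := hC.exists_local_difference_bound hΩ hβ hx
      exact ⟨Metric.ball x R, mem_nhdsWithin_of_mem_nhds (Metric.ball_mem_nhds x hR),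
        δ, hδ, A, hA, h⟩)
  -- For ‖z‖ ≥ δ the triangle inequality suffices, since ‖z‖^β δ^(-β) ≥ 1; this is where the
  -- function itself enters the bound.
  set B : ℝ≥0∞ := (ENNReal.ofReal δ ^ β)⁻¹ * (2 ^ (β - 1) * 2) with hB
  have hδe : ENNReal.ofReal δ ≠ 0 := by simpa using hδ
  have hδβ : ENNReal.ofReal δ ^ β ≠ 0 := fun h => by
    rw [ENNReal.rpow_eq_zero_iff] at h
    rcases h with ⟨h, -⟩ | ⟨h, -⟩
    · exact hδe h
    · exact ENNReal.ofReal_ne_top h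
  have hδβt : ENNReal.ofReal δ ^ β ≠ ⊤ :=
    ENNReal.rpow_ne_top_of_nonneg hβ0.le ENNReal.ofReal_ne_top
  refine ⟨A + B, ENNReal.add_ne_top.2 ⟨hA, ENNReal.mul_ne_top (ENNReal.inv_ne_top.2 hδβ)
    (ENNReal.mul_ne_top (ENNReal.rpow_ne_top_of_nonneg (by linarith) (by simp)) (by simp))⟩, ?_⟩
  intro u G hu hG huG z
  set I := ∫⁻ y in Ω, ‖G y‖ₑ ^ β
  set J := ∫⁻ y in Ω, ‖u y‖ₑ ^ β
  rcases lt_or_ge ‖z‖ δ with hz | hz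
  · have h1 := hloc u G hu hG huG z hz
    rw [inter_eq_right.2 (inter_subset_left.trans subset_closure)] at h1
    refine h1.trans (mul_le_mul' le_rfl ?_)
    exact mul_le_mul' le_self_add le_add_self
  · set E := Ω ∩ (fun y => y + z) ⁻¹' Ω with hE
    have hEm : MeasurableSet E := hΩ.measurableSet.inter
      (measurable_add_const z hΩ.measurableSet)
    have h1 : ∫⁻ y in E, ‖u (y + z)‖ₑ ^ β ≤ J :=
      setLIntegral_add_le hΩ.measurableSet hEm (fun y hy => hy.2) fun y => ‖u y‖ₑ ^ β
    have h2 : ∫⁻ y in E, ‖u y‖ₑ ^ β ≤ J := lintegral_mono_set inter_subset_left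
    have m1 : Measurable fun y => ‖u (y + z)‖ₑ ^ β :=
      ((hu.comp (measurable_add_const z)).enorm).pow_const β
    have hκt : (2 : ℝ≥0∞) ^ (β - 1) ≠ ⊤ :=
      ENNReal.rpow_ne_top_of_nonneg (by linarith) (by simp)
    have h3 : ∫⁻ y in E, ‖u (y + z) - u y‖ₑ ^ β ≤ 2 ^ (β - 1) * (J + J) := by
      calc ∫⁻ y in E, ‖u (y + z) - u y‖ₑ ^ β
          ≤ ∫⁻ y in E, 2 ^ (β - 1) * (‖u (y + z)‖ₑ ^ β + ‖u y‖ₑ ^ β) :=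
            lintegral_mono fun y => (ENNReal.rpow_le_rpow enorm_sub_le hβ0.le).trans
              (ENNReal.rpow_add_le_mul_rpow_add_rpow _ _ hβ.le)
        _ = 2 ^ (β - 1) * ((∫⁻ y in E, ‖u (y + z)‖ₑ ^ β) + ∫⁻ y in E, ‖u y‖ₑ ^ β) := by
            rw [lintegral_const_mul' _ _ hκt, lintegral_add_left m1]
        _ ≤ _ := mul_le_mul' le_rfl (add_le_add h1 h2)
    have h4 : ENNReal.ofReal δ ^ β ≤ ‖z‖ₑ ^ β := by
      refine ENNReal.rpow_le_rpow ?_ hβ0.le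
      rw [← ofReal_norm]
      exact ENNReal.ofReal_le_ofReal hz
    have h5 : 1 ≤ ‖z‖ₑ ^ β * (ENNReal.ofReal δ ^ β)⁻¹ := by
      rw [← ENNReal.mul_inv_cancel hδβ hδβt]
      exact mul_le_mul' h4 le_rfl
    calc ∫⁻ y in E, ‖u (y + z) - u y‖ₑ ^ β ≤ 1 * (2 ^ (β - 1) * (J + J)) := by rwa [one_mul]
      _ ≤ (‖z‖ₑ ^ β * (ENNReal.ofReal δ ^ β)⁻¹) * (2 ^ (β - 1) * (J + J)) := mul_le_mul' h5 le_rfl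
      _ = ‖z‖ₑ ^ β * (B * J) := by rw [hB]; ring
      _ ≤ _ := mul_le_mul' le_rfl (mul_le_mul' le_add_self le_self_add)

end Forchheimer

end

/-! ### Stability of the projection in W^{1,β}. -/

noncomputable section

namespace Forchheimer

variable {d : ℕ}

theorem HasTrace.isSmoothLimit {Ω : Set (Space d)} {u : Space d → ℝ} {G : Space d → Space d}
    {τ : Space d → ℝ} (h : HasTrace Ω u G τ) : IsSmoothLimit Ω u G := by
  obtain ⟨-, v, hv, h0, h1, -⟩ := h
  simp only [eLpNorm_one_eq_lintegral_enorm] at h0 h1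
  exact ⟨v, hv, h0, h1⟩

theorem IsSmoothLimit.congr {Ω : Set (Space d)} {u u' : Space d → ℝ} {G G' : Space d → Space d}
    (h : IsSmoothLimit Ω u G) (hu : u =ᵐ[vol Ω] u') (hG : G =ᵐ[vol Ω] G') :
    IsSmoothLimit Ω u' G' := by
  obtain ⟨v, hv, h0, h1⟩ := h
  refine ⟨v, hv, ?_, ?_⟩
  · refine h0.congr fun n => lintegral_congr_ae ?_
    filter_upwards [hu] with x hx
    rw [hx]
  · refine h1.congr fun n => lintegral_congr_ae ?_
    filter_upwards [hG] with x hx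
    rw [hx]

theorem gradient_eq_zero_of_feSpace_zero {𝒯 : Geometry.SimplicialComplex ℝ (Space d)}
    {w : Space d → ℝ} (hw : w ∈ feSpace 𝒯 0) {S : Set (Space d)} (hS : S ∈ cells 𝒯) {x : Space d}
    (hx : x ∈ interior S) : gradient w x = 0 := by
  obtain ⟨p, hp, hpw⟩ := hw.2 S hS
  rw [gradient_eq_of_mem_interior hpw hx,
    MvPolynomial.totalDegree_eq_zero_iff_eq_C.1 (Nat.le_zero.1 hp)]
  have : polyFun (MvPolynomial.C (MvPolynomial.coeff 0 p) : MvPolynomial (Fin d) ℝ) =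
      fun _ => MvPolynomial.coeff 0 p := by
    ext x
    simp [polyFun]
  rw [this]
  simp [gradient]

/-- `W^{1,β}`-stability of the `L²`-projection onto finite element spaces. -/
theorem exists_projection_stability {Ω : Set (Space d)} (hC : HasC1Boundary Ω)
    (hΩ : IsOpen Ω) (hΩb : Bornology.IsBounded Ω) (r : ℕ) {σ : ℝ} (hσ : 0 < σ)
    {β : ℝ} (hβ1 : 1 < β) (hβ2 : β ≤ 2) :
    ∃ C : ℝ≥0∞, C ≠ ⊤ ∧ ∀ (h : ℝ) (𝒯 : Geometry.SimplicialComplex ℝ (Space d)),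
      IsQuasiUniformTriangulation Ω σ h 𝒯 → ∀ (u w : Space d → ℝ) (G : Space d → Space d),
      MemLp u 2 (vol Ω) → AEStronglyMeasurable G (vol Ω) → IsSmoothLimit Ω u G →
      IsL2Projection Ω (feSpace 𝒯 r) u w →
      ∫⁻ y in Ω, ‖gradient w y‖ₑ ^ β ≤
        C * ((∫⁻ y in Ω, ‖u y‖ₑ ^ β) + ∫⁻ y in Ω, ‖G y‖ₑ ^ β) := by
  have hβ0 : 0 < β := by linarith
  -- The Bernstein argument needs positive degree; for degree zero the gradient vanishes on the
  -- interior of every cell.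
  rcases Nat.eq_zero_or_pos r with rfl | hr
  · refine ⟨0, by simp, fun h 𝒯 hT u w G _ _ _ hw => ?_⟩
    rw [zero_mul, nonpos_iff_eq_zero]
    refine (lintegral_congr_ae ?_).trans lintegral_zero
    filter_upwards [ae_mem_interior_cell hΩ.measurableSet hT.finite
      (subset_closure.trans hT.covers)] with x ⟨S, hS, hx⟩
    rw [gradient_eq_zero_of_feSpace_zero hw.1 hS hx, enorm_zero, ENNReal.zero_rpow_of_pos hβ0]
  · obtain ⟨A, hA, hdiff⟩ := exists_difference_bound hC hΩ hΩb hβ1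
    obtain ⟨C, hC', hproj⟩ := exists_lintegral_gradient_projection_bound d r hr.ne' hσ hβ1 hβ2
    refine ⟨C * A, ENNReal.mul_ne_top hC' hA, fun h 𝒯 hT u w G hu hG huG hw => ?_⟩
    -- The difference estimates are stated for measurable functions, so representatives are chosen;
    -- every quantity involved is insensitive to null sets.
    set u' := hu.1.mk u with hu'
    have hum : Measurable u' := hu.1.stronglyMeasurable_mk.measurable
    have huu : u =ᵐ[vol Ω] u' := hu.1.ae_eq_mk
    set G' := hG.mk G with hG'
    have hGm : Measurable G' := hG.stronglyMeasurable_mk.measurable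
    have hGG : G =ᵐ[vol Ω] G' := hG.ae_eq_mk
    have hw' : IsL2Projection Ω (feSpace 𝒯 r) u' w := ⟨hw.1, fun v hv => by
      rw [hw.2 v hv]
      refine integral_congr_ae ?_
      filter_upwards [huu] with x hx
      rw [hx]⟩
    have h1 := hproj Ω hΩ hΩb h 𝒯 hT u' w hum ((memLp_congr_ae huu).1 hu) hw' _
      (hdiff u' G' hum hGm (huG.congr huu hGG))
    rw [← mul_assoc] at h1
    refine h1.trans (le_of_eq ?_)
    congr 2
    · refine lintegral_congr_ae ?_
      filter_upwards [huu] with x hx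
      rw [hx]
    · refine lintegral_congr_ae ?_
      filter_upwards [hGG] with x hx
      rw [hx]

end Forchheimer

end

/-! ### The finite element problem as a Galerkin flow in L². -/

noncomputable section

namespace Forchheimer

variable {d : ℕ}

section Separating

variable {V : Type*} [NormedAddCommGroup V] [NormedSpace ℝ V] [FiniteDimensional ℝ V]

/-- Double annihilator in finite dimension: functionals with trivial common kernel span the dual.
With point evaluations as the family, pointwise regularity in time becomes regularity of the
coefficient vector. -/
theorem mem_span_of_separating {ι : Type*} {l : ι → Module.Dual ℝ V}
    (hsep : ∀ v, (∀ i, l i v = 0) → v = 0) (f : Module.Dual ℝ V) :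
    f ∈ Submodule.span ℝ (range l) := by
  have h1 : (Submodule.span ℝ (range l)).dualCoannihilator = ⊥ := by
    rw [eq_bot_iff]
    intro v hv
    rw [Submodule.mem_dualCoannihilator] at hv
    exact hsep v fun i => hv _ (Submodule.subset_span ⟨i, rfl⟩)
  rw [← Subspace.dualCoannihilator_dualAnnihilator_eq (W := Submodule.span ℝ (range l)), h1,
    Submodule.dualAnnihilator_bot]
  trivial

theorem differentiableAt_of_separating {ι : Type*} {l : ι → Module.Dual ℝ V}
    (hsep : ∀ v, (∀ i, l i v = 0) → v = 0) {c : ℝ → V} {t : ℝ}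
    (h : ∀ i, DifferentiableAt ℝ (fun s => l i (c s)) t) : DifferentiableAt ℝ c t := by
  have h1 : ∀ f : Module.Dual ℝ V, DifferentiableAt ℝ (fun s => f (c s)) t := fun f => by
    refine Submodule.span_induction (p := fun f _ => DifferentiableAt ℝ (fun s => f (c s)) t)
      ?_ ?_ ?_ ?_ (mem_span_of_separating hsep f)
    · rintro _ ⟨i, rfl⟩
      exact h i
    · simp
    · intro f g _ _ hf hg
      exact hf.add hg
    · intro a f _ hf
      exact hf.const_mul a
  set b := Module.finBasis ℝ V
  have h2 : c = fun s => ∑ i, b.coord i (c s) • b i := by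
    ext s
    exact (b.sum_repr (c s)).symm
  rw [h2]
  exact DifferentiableAt.fun_sum fun i _ => (h1 (b.coord i)).smul_const _

theorem continuousWithinAt_of_separating {ι : Type*} {l : ι → Module.Dual ℝ V}
    (hsep : ∀ v, (∀ i, l i v = 0) → v = 0) {c : ℝ → V} {J : Set ℝ} {t : ℝ}
    (h : ∀ i, ContinuousWithinAt (fun s => l i (c s)) J t) : ContinuousWithinAt c J t := by
  have h1 : ∀ f : Module.Dual ℝ V, ContinuousWithinAt (fun s => f (c s)) J t := fun f => by
    refine Submodule.span_induction (p := fun f _ => ContinuousWithinAt (fun s => f (c s)) J t)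
      ?_ ?_ ?_ ?_ (mem_span_of_separating hsep f)
    · rintro _ ⟨i, rfl⟩
      exact h i
    · exact continuousWithinAt_const
    · intro f g _ _ hf hg
      exact hf.add hg
    · intro a f _ hf
      exact continuousWithinAt_const.mul hf
  set b := Module.finBasis ℝ V
  have h2 : c = fun s => ∑ i, b.coord i (c s) • b i := by
    ext s
    exact (b.sum_repr (c s)).symm
  rw [h2]
  exact tendsto_finsetSum _ fun i _ => (h1 (b.coord i)).smul continuousWithinAt_const

end Separating

section Space

variable {𝒯 : Geometry.SimplicialComplex ℝ (Space d)} {Ω : Set (Space d)} {r : ℕ}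

/-- Both functions are continuous on the open set Ω. This links L² classes to the pointwise
formulation of the time derivative. -/
theorem eqOn_of_ae_eq_feSpace (hΩ : IsOpen Ω) (hcov : closure Ω ⊆ ⋃₀ cells 𝒯)
    {w w' : Space d → ℝ} (hw : w ∈ feSpace 𝒯 r) (hw' : w' ∈ feSpace 𝒯 r)
    (h : w =ᵐ[vol Ω] w') : EqOn w w' Ω :=
  Measure.eqOn_open_of_ae_eq h hΩ (hw.1.mono (subset_closure.trans hcov))
    (hw'.1.mono (subset_closure.trans hcov))

theorem gradient_eq_of_eqOn (hΩ : IsOpen Ω) {w w' : Space d → ℝ} (h : EqOn w w' Ω) {x : Space d}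
    (hx : x ∈ Ω) : gradient w x = gradient w' x := by
  unfold gradient
  rw [Filter.EventuallyEq.fderiv_eq (h.eventuallyEq_of_mem (hΩ.mem_nhds hx))]

/-- The finite element space as a subspace of `L²(Ω)`, with a linear choice of representatives. -/
theorem exists_feSpace_L2 (hΩ : IsOpen Ω) (hΩb : Bornology.IsBounded Ω) (hfin : 𝒯.faces.Finite)
    (hcov : closure Ω ⊆ ⋃₀ cells 𝒯) (r : ℕ) :
    ∃ (V : Submodule ℝ (Lp ℝ 2 (vol Ω))) (_ : FiniteDimensional ℝ V)
      (s : V →ₗ[ℝ] feSubmodule 𝒯 r), (∀ v : V, (v.1 : Space d → ℝ) =ᵐ[vol Ω] (s v).1) ∧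
      ∀ w ∈ feSpace 𝒯 r, ∃ v : V, (v.1 : Space d → ℝ) =ᵐ[vol Ω] w := by
  have hL : ∀ {r : ℕ} (w : feSubmodule 𝒯 r), MemLp w.1 2 (vol Ω) := fun w =>
    memLp_feSpace hΩ hΩb hfin hcov (mem_feSubmodule.1 w.2) 2
  let T : feSubmodule 𝒯 r →ₗ[ℝ] Lp ℝ 2 (vol Ω) :=
    { toFun := fun w => (hL w).toLp
      map_add' := fun w w' => MemLp.toLp_add (hL w) (hL w')
      map_smul' := fun a w => MemLp.toLp_const_smul a (hL w) }
  have hT : ∀ w, (T w : Space d → ℝ) =ᵐ[vol Ω] w.1 := fun w => (hL w).coeFn_toLp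
  have hfd : FiniteDimensional ℝ (LinearMap.range T) := by
    -- Expanding in degree r + 1 instead of r makes the Bernstein representation available for r = 0
    -- as well; only finite dimensionality is at stake.
    have hB : ∀ m ∈ multiIndices 𝒯 hfin (r + 1), MemLp (bernstein 𝒯 m) 2 (vol Ω) := fun m hm =>
      memLp_feSpace hΩ hΩb hfin hcov (bernstein_mem_feSpace_of_mem hfin hm) 2
    have hle : LinearMap.range T ≤ Submodule.span ℝ (range
        fun m : multiIndices 𝒯 hfin (r + 1) => (hB m.1 m.2).toLp) := by
      rintro _ ⟨w, rfl⟩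
      obtain ⟨c, hc⟩ := exists_eq_sum_bernstein hfin (Nat.succ_ne_zero r)
        (feSpace_mono (Nat.le_succ r) (mem_feSubmodule.1 w.2))
      have h1 : T w = ∑ m : multiIndices 𝒯 hfin (r + 1), c m.1 • (hB m.1 m.2).toLp := by
        refine Lp.ext ?_
        have h2 : ∀ᵐ x ∂(vol Ω), ∀ m : multiIndices 𝒯 hfin (r + 1),
            (c m.1 • (hB m.1 m.2).toLp : Lp ℝ 2 (vol Ω)) x = c m.1 * bernstein 𝒯 m.1 x := by
          rw [ae_all_iff]
          intro m
          filter_upwards [Lp.coeFn_smul (c m.1) (hB m.1 m.2).toLp, (hB m.1 m.2).coeFn_toLp]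
            with x h3 h4
          rw [h3, Pi.smul_apply, h4, smul_eq_mul]
        filter_upwards [hT w, Lp.coeFn_finsetSum Finset.univ
          (fun m : multiIndices 𝒯 hfin (r + 1) => c m.1 • (hB m.1 m.2).toLp), h2,
          ae_restrict_mem hΩ.measurableSet] with x h3 h4 h5 hx
        rw [h3, h4, hc x (hcov (subset_closure hx)), ← Finset.sum_coe_sort, Finset.sum_apply]
        exact Finset.sum_congr rfl fun m _ => (h5 m).symm
      rw [h1]
      exact Submodule.sum_mem _ fun m _ => Submodule.smul_mem _ _ (Submodule.subset_span ⟨m, rfl⟩)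
    have : FiniteDimensional ℝ (Submodule.span ℝ (range
        fun m : multiIndices 𝒯 hfin (r + 1) => (hB m.1 m.2).toLp)) :=
      FiniteDimensional.span_of_finite ℝ (Set.finite_range _)
    exact Submodule.finiteDimensional_of_le hle
  obtain ⟨s, hs⟩ := LinearMap.exists_rightInverse_of_surjective T.rangeRestrict
    (LinearMap.range_rangeRestrict T)
  refine ⟨LinearMap.range T, hfd, s, fun v => ?_, fun w hw => ⟨⟨T ⟨w, hw⟩, ⟨_, rfl⟩⟩, hT _⟩⟩
  have h1 : T (s v) = v.1 := congrArg Subtype.val (LinearMap.congr_fun hs v)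
  rw [← h1]
  exact hT _

end Space

end Forchheimer

end

noncomputable section

namespace Forchheimer

variable {d : ℕ} {𝒯 : Geometry.SimplicialComplex ℝ (Space d)} {Ω : Set (Space d)} {r : ℕ}

/-- A linear family of finite element functions yields a linear map into the space of `L²`
gradients. -/
theorem exists_gradient_L2 (hΩ : IsOpen Ω) (hΩb : Bornology.IsBounded Ω) (hfin : 𝒯.faces.Finite)
    (hcov : closure Ω ⊆ ⋃₀ cells 𝒯) {V : Type*} [NormedAddCommGroup V] [NormedSpace ℝ V]
    [FiniteDimensional ℝ V] (s : V →ₗ[ℝ] feSubmodule 𝒯 r) :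
    ∃ D : V →L[ℝ] Lp (Space d) 2 (vol Ω),
      ∀ v, (D v : Space d → Space d) =ᵐ[vol Ω] gradient (s v).1 := by
  have hs : ∀ v, (s v).1 ∈ feSpace 𝒯 r := fun v => mem_feSubmodule.1 (s v).2
  have hL : ∀ v, MemLp (gradient (s v).1) 2 (vol Ω) := fun v =>
    memLp_gradient_feSpace hΩ hΩb hfin hcov (hs v) 2
  let D : V →ₗ[ℝ] Lp (Space d) 2 (vol Ω) :=
    { toFun := fun v => (hL v).toLp
      map_add' := fun v w => by
        rw [← MemLp.toLp_add, MemLp.toLp_eq_toLp_iff]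
        filter_upwards [ae_differentiableAt_feSpace hΩ hfin hcov (hs v),
          ae_differentiableAt_feSpace hΩ hfin hcov (hs w)] with x hv hw
        rw [map_add, Pi.add_apply]
        unfold gradient
        rw [Submodule.coe_add, fderiv_add hv hw, map_add]
      map_smul' := fun a v => by
        rw [RingHom.id_apply, ← MemLp.toLp_const_smul, MemLp.toLp_eq_toLp_iff]
        filter_upwards [ae_differentiableAt_feSpace hΩ hfin hcov (hs v)] with x hv
        rw [map_smul, Pi.smul_apply]
        unfold gradient
        rw [Submodule.coe_smul, fderiv_const_smul hv, map_smul] }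
  exact ⟨LinearMap.toContinuousLinearMap D, fun v => (hL v).coeFn_toLp⟩

/-- A linear family of finite element functions yields a linear map into `L¹(∂Ω)`. -/
theorem exists_restriction_L1 (hcov : closure Ω ⊆ ⋃₀ cells 𝒯)
    (hint : ∀ w ∈ feSpace 𝒯 r, ∫⁻ y, ‖w y‖ₑ ∂(surf Ω) < ⊤)
    {V : Type*} [NormedAddCommGroup V] [NormedSpace ℝ V]
    [FiniteDimensional ℝ V] (s : V →ₗ[ℝ] feSubmodule 𝒯 r) :
    ∃ R : V →L[ℝ] Lp ℝ 1 (surf Ω), ∀ v, (R v : Space d → ℝ) =ᵐ[surf Ω] (s v).1 := by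
  have hs : ∀ v, (s v).1 ∈ feSpace 𝒯 r := fun v => mem_feSubmodule.1 (s v).2
  have hL : ∀ v, MemLp (s v).1 1 (surf Ω) := fun v =>
    ⟨((hs v).1.mono (frontier_subset_closure.trans hcov)).aestronglyMeasurable
      isClosed_frontier.measurableSet, by
      rw [eLpNorm_one_eq_lintegral_enorm]
      exact hint _ (hs v)⟩
  let R : V →ₗ[ℝ] Lp ℝ 1 (surf Ω) :=
    { toFun := fun v => (hL v).toLp
      map_add' := fun v w => by
        rw [← MemLp.toLp_add, MemLp.toLp_eq_toLp_iff, map_add, Submodule.coe_add]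
      map_smul' := fun a v => by
        rw [RingHom.id_apply, ← MemLp.toLp_const_smul, MemLp.toLp_eq_toLp_iff, map_smul,
          Submodule.coe_smul] }
  exact ⟨LinearMap.toContinuousLinearMap R, fun v => (hL v).coeFn_toLp⟩

/-- The boundary pairing on a linear family of finite element functions, with its trace bound. -/
theorem exists_boundary_pairing (hΩ : IsOpen Ω) (hΩb : Bornology.IsBounded Ω)
    (hfin : 𝒯.faces.Finite) (hcov : closure Ω ⊆ ⋃₀ cells 𝒯) {C : ℝ≥0∞} (hC : C ≠ ⊤)
    (htr : ∀ w ∈ feSpace 𝒯 r,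
      ∫⁻ y, ‖w y‖ₑ ∂(surf Ω) ≤ C * ((∫⁻ y in Ω, ‖w y‖ₑ) + ∫⁻ y in Ω, ‖gradient w y‖ₑ))
    {V : Type*} [NormedAddCommGroup V] [NormedSpace ℝ V]
    [FiniteDimensional ℝ V] (s : V →ₗ[ℝ] feSubmodule 𝒯 r) :
    ∃ ℓ : Lp ℝ ∞ (surf Ω) →L[ℝ] V →L[ℝ] ℝ,
      (∀ y v, ℓ y v = ∫ x, y x * (s v).1 x ∂(surf Ω)) ∧
      ∀ y v, |ℓ y v| ≤ C.toReal * ‖y‖ *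
        ((∫ x in Ω, ‖(s v).1 x‖) + ∫ x in Ω, ‖gradient (s v).1 x‖) := by
  have hs : ∀ v, (s v).1 ∈ feSpace 𝒯 r := fun v => mem_feSubmodule.1 (s v).2
  have h0 : ∀ w ∈ feSpace 𝒯 r, Integrable w (vol Ω) := fun w hw =>
    memLp_one_iff_integrable.1 (memLp_feSpace hΩ hΩb hfin hcov hw 1)
  have h1 : ∀ w ∈ feSpace 𝒯 r, Integrable (gradient w) (vol Ω) := fun w hw =>
    memLp_one_iff_integrable.1 (memLp_gradient_feSpace hΩ hΩb hfin hcov hw 1)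
  have hint : ∀ w ∈ feSpace 𝒯 r, ∫⁻ y, ‖w y‖ₑ ∂(surf Ω) < ⊤ := fun w hw =>
    (htr w hw).trans_lt (ENNReal.mul_lt_top hC.lt_top (ENNReal.add_lt_top.2
      ⟨(h0 w hw).2, (h1 w hw).2⟩))
  obtain ⟨R, hR⟩ := exists_restriction_L1 hcov hint s
  let L := (ContinuousLinearMap.mul ℝ ℝ).lpPairing (surf Ω) ∞ 1
  have hL : ∀ y v, L y (R v) = ∫ x, y x * (s v).1 x ∂(surf Ω) := fun y v => by
    rw [ContinuousLinearMap.lpPairing_eq_integral]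
    refine integral_congr_ae ?_
    filter_upwards [hR v] with x hx
    rw [hx, ContinuousLinearMap.mul_apply']
  refine ⟨(ContinuousLinearMap.precomp ℝ R).comp L, fun y v => hL y v, fun y v => ?_⟩
  have h2 : ∀ᵐ x ∂(surf Ω), ‖y x‖ ≤ ‖y‖ := by
    filter_upwards [enorm_ae_le_eLpNormEssSup (y : Space d → ℝ) (surf Ω)] with x hx
    rw [← eLpNorm_exponent_top, ← Lp.enorm_def] at hx
    exact enorm_le_iff_norm_le.1 hx
  have h3 : Integrable (fun x => ‖y‖ * ‖(s v).1 x‖) (surf Ω) :=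
    (Integrable.norm ⟨((hs v).1.mono (frontier_subset_closure.trans hcov)).aestronglyMeasurable
      isClosed_frontier.measurableSet, hint _ (hs v)⟩).const_mul _
  have h4 : ∫ x, ‖(s v).1 x‖ ∂(surf Ω) ≤ C.toReal *
      ((∫ x in Ω, ‖(s v).1 x‖) + ∫ x in Ω, ‖gradient (s v).1 x‖) := by
    rw [integral_norm_eq_lintegral_enorm (((hs v).1.mono
        (frontier_subset_closure.trans hcov)).aestronglyMeasurable isClosed_frontier.measurableSet),
      integral_norm_eq_lintegral_enorm (h0 _ (hs v)).1,
      integral_norm_eq_lintegral_enorm (h1 _ (hs v)).1,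
      ← ENNReal.toReal_add (h0 _ (hs v)).2.ne (h1 _ (hs v)).2.ne, ← ENNReal.toReal_mul]
    exact ENNReal.toReal_mono (ENNReal.mul_ne_top hC (ENNReal.add_ne_top.2
      ⟨(h0 _ (hs v)).2.ne, (h1 _ (hs v)).2.ne⟩)) (htr _ (hs v))
  calc |((ContinuousLinearMap.precomp ℝ R).comp L) y v|
      = ‖∫ x, y x * (s v).1 x ∂(surf Ω)‖ := by rw [← hL y v, Real.norm_eq_abs]; rfl
    _ ≤ ∫ x, ‖y‖ * ‖(s v).1 x‖ ∂(surf Ω) := by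
      refine norm_integral_le_of_norm_le h3 ?_
      filter_upwards [h2] with x hx
      rw [norm_mul]
      exact mul_le_mul_of_nonneg_right hx (norm_nonneg _)
    _ = ‖y‖ * ∫ x, ‖(s v).1 x‖ ∂(surf Ω) := integral_const_mul _ _
    _ ≤ ‖y‖ * (C.toReal * ((∫ x in Ω, ‖(s v).1 x‖) + ∫ x in Ω, ‖gradient (s v).1 x‖)) :=
      mul_le_mul_of_nonneg_left h4 (norm_nonneg _)
    _ = _ := by ring

/-- A solution of the semidiscrete problem is a Galerkin flow in a space of coefficients. -/
theorem IsSemidiscreteSolution.exists_galerkinFlow {P : GenPoly} (hΩ : IsOpen Ω)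
    (hΩb : Bornology.IsBounded Ω) (hfin : 𝒯.faces.Finite) (hcov : closure Ω ⊆ ⋃₀ cells 𝒯)
    {C : ℝ≥0∞} (hC : C ≠ ⊤)
    (htr : ∀ w ∈ feSpace 𝒯 r,
      ∫⁻ y, ‖w y‖ₑ ∂(surf Ω) ≤ C * ((∫⁻ y in Ω, ‖w y‖ₑ) + ∫⁻ y in Ω, ‖gradient w y‖ₑ))
    {T : ℝ} (hT : 0 < T) {ψ ψt : ℝ → Lp ℝ ∞ (surf Ω)}
    (hψ : ∀ t ∈ Icc 0 T, HasDerivWithinAt ψ (ψt t) (Icc 0 T) t) (hψt : ContinuousOn ψt (Icc 0 T))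
    {f ft : ℝ → Lp ℝ 2 (vol Ω)} (hft : MemLp ft 2 (volume.restrict (Ioo 0 T)))
    (hf : ∀ t ∈ Icc 0 T, f t = f 0 + ∫ s in 0..t, ft s) {ρ0 : Space d → ℝ}
    {ρ ρt : ℝ → Space d → ℝ}
    (hρ : IsSemidiscreteSolution P Ω (feSpace 𝒯 r) T (fun t => ψ t) (fun t => f t) ρ0 ρ ρt) :
    ∃ (V : Submodule ℝ (Lp ℝ 2 (vol Ω))) (_ : FiniteDimensional ℝ V)
      (S : GalerkinFlow P (vol Ω) (Space d) (Lp ℝ ∞ (surf Ω)) V C.toReal T),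
      S.ψ = ψ ∧ S.ψt = ψt ∧ S.f = f ∧ S.ft = ft ∧
      (∀ t ∈ Ioo 0 T, (S.ι (S.c' t) : Space d → ℝ) =ᵐ[vol Ω] ρt t) ∧
      (S.ι (S.c 0) : Space d → ℝ) =ᵐ[vol Ω] ρ 0 ∧
      (S.D (S.c 0) : Space d → Space d) =ᵐ[vol Ω] gradient (ρ 0) := by
  have := isFiniteMeasure_vol hΩb
  obtain ⟨V, hV, s, hs, hex⟩ := exists_feSpace_L2 hΩ hΩb hfin hcov r
  have hsm : ∀ v, (s v).1 ∈ feSpace 𝒯 r := fun v => mem_feSubmodule.1 (s v).2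
  obtain ⟨D, hD⟩ := exists_gradient_L2 hΩ hΩb hfin hcov s
  obtain ⟨ℓ, hℓ, hℓb⟩ := exists_boundary_pairing hΩ hΩb hfin hcov hC htr s
  choose! c₀ hc₀ using fun t (ht : t ∈ Icc 0 T) => hex (ρ t) (hρ.mem t ht)
  have heq : ∀ t ∈ Icc 0 T, EqOn (s (c₀ t)).1 (ρ t) Ω := fun t ht =>
    eqOn_of_ae_eq_feSpace hΩ hcov (hsm _) (hρ.mem t ht) ((hs _).symm.trans (hc₀ t ht))
  let l : Ω → Module.Dual ℝ V := fun x =>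
    (LinearMap.proj x.1).comp ((feSubmodule 𝒯 r).subtype.comp s)
  -- Evaluations at points of Ω separate the coefficient space, because its elements are classes of
  -- functions on Ω.
  have hsep : ∀ v, (∀ x, l x v = 0) → v = 0 := fun v hv => by
    refine Subtype.ext (Lp.ext ?_)
    filter_upwards [hs v, Lp.coeFn_zero ℝ 2 (vol Ω), ae_restrict_mem hΩ.measurableSet]
      with x h1 h2 hx
    rw [h1, Submodule.coe_zero, h2]
    exact hv ⟨x, hx⟩
  have hev : ∀ t ∈ Ioo 0 T, ∀ x : Ω, (fun u => l x (c₀ u)) =ᶠ[𝓝 t] fun u => ρ u x.1 :=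
    fun t ht x => by
      filter_upwards [isOpen_Ioo.mem_nhds ht] with u hu
      exact heq u (Ioo_subset_Icc_self hu) x.2
  have hdiff : ∀ t ∈ Ioo 0 T, DifferentiableAt ℝ c₀ t := fun t ht =>
    differentiableAt_of_separating hsep fun x =>
      ((hρ.hasDerivAt t ht x.1 x.2).congr_of_eventuallyEq (hev t ht x)).differentiableAt
  have hcont : ContinuousOn c₀ (Icc 0 T) := fun t ht =>
    continuousWithinAt_of_separating hsep fun x =>
      (hρ.continuousOn x.1 x.2 t ht).congr (fun u hu => heq u hu x.2) (heq t ht x.2)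
  have hder : ∀ t ∈ Ioo 0 T, EqOn (s (deriv c₀ t)).1 (ρt t) Ω := fun t ht x hx => by
    have h1 : HasDerivAt (fun u => l ⟨x, hx⟩ (c₀ u)) (l ⟨x, hx⟩ (deriv c₀ t)) t :=
      (LinearMap.toContinuousLinearMap (l ⟨x, hx⟩)).hasFDerivAt.comp_hasDerivAt t
        (hdiff t ht).hasDerivAt
    exact h1.unique ((hρ.hasDerivAt t ht x hx).congr_of_eventuallyEq (hev t ht ⟨x, hx⟩))
  have hder' : ∀ t ∈ Ioo 0 T, ((deriv c₀ t).1 : Space d → ℝ) =ᵐ[vol Ω] ρt t := fun t ht => by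
    filter_upwards [hs (deriv c₀ t), ae_restrict_mem hΩ.measurableSet] with x h1 hx
    rw [h1, hder t ht hx]
  have hgrad : ∀ t ∈ Icc 0 T, (D (c₀ t) : Space d → Space d) =ᵐ[vol Ω] gradient (ρ t) :=
    fun t ht => by
      filter_upwards [hD (c₀ t), ae_restrict_mem hΩ.measurableSet] with x h1 hx
      rw [h1, gradient_eq_of_eqOn hΩ (heq t ht) hx]
  refine ⟨V, hV, GalerkinFlow.mk V.subtypeL D ℓ ψ ψt f ft c₀ (deriv c₀) Subtype.val_injective
    (fun y w => ?_) hψ hψt hft hf hcont (fun t ht => (hdiff t ht).hasDerivAt) (fun t ht w => ?_),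
    rfl, rfl, rfl, rfl, hder', hc₀ 0 ⟨le_rfl, hT.le⟩, hgrad 0 ⟨le_rfl, hT.le⟩⟩
  · refine (hℓb y w).trans (le_of_eq ?_)
    congr 2
    · refine integral_congr_ae ?_
      filter_upwards [hs w] with x hx
      rw [← hx]; rfl
    · refine integral_congr_ae ?_
      filter_upwards [hD w] with x hx
      rw [hx]
  · have h := hρ.equation t ht _ (hsm w)
    rw [P.inner_fluxL2, L2.inner_def, L2.inner_def, hℓ]
    convert h using 2
    · refine integral_congr_ae ?_
      filter_upwards [hder' t ht, hs w] with x h1 h2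
      change inner ℝ ((deriv c₀ t).1 x) (w.1 x) = _
      rw [h1, h2, RCLike.inner_apply, conj_trivial, mul_comm]
    · refine integral_congr_ae ?_
      filter_upwards [hgrad t (Ioo_subset_Icc_self ht), hD w] with x h1 h2
      change inner ℝ (P.flux (D (c₀ t) x)) (D w x) = _
      rw [h1, h2, GenPoly.flux, real_inner_smul_left]
    · refine integral_congr_ae ?_
      filter_upwards [hs w] with x h2
      change inner ℝ (f t x) (w.1 x) = _
      rw [h2, RCLike.inner_apply, conj_trivial, mul_comm]

end Forchheimer

end

/-! ### The initial datum and the quantity 𝓜. -/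

noncomputable section

namespace Forchheimer

variable {d : ℕ} {Ω : Set (Space d)}

theorem lpNorm_rpow {X F : Type*} [MeasurableSpace X] [NormedAddCommGroup F] {μ : Measure X}
    {β : ℝ} (hβ : 0 < β) (u : X → F) :
    lpNorm u (ENNReal.ofReal β) μ ^ β = (∫⁻ x, ‖u x‖ₑ ^ β ∂μ).toReal := by
  rw [lpNorm, eLpNorm_eq_lintegral_rpow_enorm_toReal (by simpa using hβ) ENNReal.ofReal_ne_top,
    ENNReal.toReal_ofReal hβ.le, ENNReal.toReal_rpow, ← ENNReal.rpow_mul, one_div,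
    inv_mul_cancel₀ hβ.ne', ENNReal.rpow_one]

/-- From t^β ≤ 1 + t²: the low-order part of the W^{1,β} norm is paid for by the L² norm and the
volume. -/
theorem lintegral_rpow_le_add {X F : Type*} [MeasurableSpace X] [NormedAddCommGroup F]
    {μ : Measure X} [IsFiniteMeasure μ] {β : ℝ} (hβ0 : 0 < β) (hβ2 : β ≤ 2) {u : X → F}
    (hu : MemLp u 2 μ) :
    (∫⁻ x, ‖u x‖ₑ ^ β ∂μ).toReal ≤ (μ univ).toReal + lpNorm u 2 μ ^ 2 := by
  have h2 : lpNorm u 2 μ ^ 2 = (∫⁻ x, ‖u x‖ₑ ^ (2 : ℝ) ∂μ).toReal := by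
    rw [← lpNorm_rpow two_pos, ← Real.rpow_natCast]
    simp
  have h3 : ∫⁻ x, ‖u x‖ₑ ^ (2 : ℝ) ∂μ < ⊤ := by
    have := lintegral_rpow_enorm_lt_top_of_eLpNorm_lt_top two_ne_zero ENNReal.ofNat_ne_top hu.2
    simpa using this
  rw [h2, ← ENNReal.toReal_add (measure_ne_top _ _) h3.ne]
  refine ENNReal.toReal_mono (ENNReal.add_ne_top.2 ⟨measure_ne_top _ _, h3.ne⟩) ?_
  calc ∫⁻ x, ‖u x‖ₑ ^ β ∂μ ≤ ∫⁻ x, 1 + ‖u x‖ₑ ^ (2 : ℝ) ∂μ := by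
        refine lintegral_mono fun x => ?_
        rcases le_total (‖u x‖ₑ) 1 with h | h
        · exact (ENNReal.rpow_le_one h hβ0.le).trans le_self_add
        · exact (ENNReal.rpow_le_rpow_of_exponent_le h hβ2).trans le_add_self
    _ = μ univ + ∫⁻ x, ‖u x‖ₑ ^ (2 : ℝ) ∂μ := by
      rw [lintegral_add_left measurable_const, lintegral_one]

/-- The `L²`-projection is a contraction. -/
theorem IsL2Projection.norm_le {W : Set (Space d → ℝ)} {u w : Space d → ℝ}
    (h : IsL2Projection Ω W u w) (hu : MemLp u 2 (vol Ω)) {v : Lp ℝ 2 (vol Ω)}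
    (hv : (v : Space d → ℝ) =ᵐ[vol Ω] w) : ‖v‖ ≤ lpNorm u 2 (vol Ω) := by
  have h1 : inner ℝ v v = inner ℝ hu.toLp v := by
    rw [L2.inner_def, L2.inner_def]
    refine Eq.trans ?_ ((h.2 w h.1).trans ?_)
    · refine integral_congr_ae ?_
      filter_upwards [hv] with x hx
      rw [hx, RCLike.inner_apply, conj_trivial]
    · refine integral_congr_ae ?_
      filter_upwards [hv, hu.coeFn_toLp] with x hx hx'
      rw [hx, hx', RCLike.inner_apply, conj_trivial, mul_comm]
  have h2 : ‖v‖ * ‖v‖ ≤ ‖hu.toLp‖ * ‖v‖ := by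
    rw [← real_inner_self_eq_norm_mul_norm, h1]
    exact real_inner_le_norm _ _
  rw [Lp.norm_toLp] at h2
  rcases (norm_nonneg v).eq_or_lt with h3 | h3
  · rw [← h3]
    exact ENNReal.toReal_nonneg
  · exact le_of_mul_le_mul_right h2 h3

/-- The energy of the projected initial datum is controlled by the initial datum. -/
theorem exists_initial_energy_bound (P : GenPoly) (hC : HasC1Boundary Ω)
    (hΩ : IsOpen Ω) (hΩb : Bornology.IsBounded Ω) (r : ℕ) {σ : ℝ} (hσ : 0 < σ) :
    ∃ C : ℝ, 0 ≤ C ∧ ∀ (h : ℝ) (𝒯 : Geometry.SimplicialComplex ℝ (Space d)),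
      IsQuasiUniformTriangulation Ω σ h 𝒯 → ∀ (u w : Space d → ℝ) (G : Space d → Space d),
      MemLp u 2 (vol Ω) → MemLp G (ENNReal.ofReal P.β) (vol Ω) → IsSmoothLimit Ω u G →
      IsL2Projection Ω (feSpace 𝒯 r) u w → ∀ v : Lp (Space d) 2 (vol Ω),
      (v : Space d → Space d) =ᵐ[vol Ω] gradient w →
      P.energy v ≤
        C * (1 + lpNorm u 2 (vol Ω) ^ 2 + lpNorm G (ENNReal.ofReal P.β) (vol Ω) ^ P.β) := by
  have := isFiniteMeasure_vol hΩb
  obtain ⟨Ce, hCe, he⟩ := P.energy_le_modular (vol Ω) (Space d)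
  -- This constant is independent of the mesh and makes the initial energy bound uniform in h.
  obtain ⟨Cs, hCs, hs⟩ := exists_projection_stability hC hΩ hΩb r hσ P.one_lt_β P.β_lt_two.le
  set m := (vol Ω univ).toReal
  have hm : 0 ≤ m := ENNReal.toReal_nonneg
  have hCs0 : 0 ≤ Cs.toReal := ENNReal.toReal_nonneg
  refine ⟨Ce * (Cs.toReal * (m + 1)), by positivity, fun h 𝒯 h𝒯 u w G hu hG hl hp v hv => ?_⟩
  have hG' : ∫⁻ y in Ω, ‖G y‖ₑ ^ P.β < ⊤ := by
    have := lintegral_rpow_enorm_lt_top_of_eLpNorm_lt_top (by simpa using P.β_pos)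
      ENNReal.ofReal_ne_top hG.2
    rwa [ENNReal.toReal_ofReal P.β_pos.le] at this
  have hu' : ∫⁻ y in Ω, ‖u y‖ₑ ^ P.β < ⊤ := by
    have hb : MemLp u (ENNReal.ofReal P.β) (vol Ω) := hu.mono_exponent (by
      rw [← ENNReal.ofReal_ofNat]
      exact ENNReal.ofReal_le_ofReal P.β_lt_two.le)
    have := lintegral_rpow_enorm_lt_top_of_eLpNorm_lt_top (by simpa using P.β_pos)
      ENNReal.ofReal_ne_top hb.2
    rwa [ENNReal.toReal_ofReal P.β_pos.le] at this
  have h1 : P.modular v = (∫⁻ y in Ω, ‖gradient w y‖ₑ ^ P.β).toReal := by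
    rw [GenPoly.modular, integral_eq_lintegral_of_nonneg_ae
      (Eventually.of_forall fun x => Real.rpow_nonneg (norm_nonneg _) _)
      (P.integrable_norm_rpow_β v).1]
    congr 1
    refine lintegral_congr_ae ?_
    filter_upwards [hv] with x hx
    rw [hx, ← ENNReal.ofReal_rpow_of_nonneg (norm_nonneg _) P.β_pos.le, ofReal_norm]
  have h2 : P.modular v ≤ Cs.toReal * ((∫⁻ y in Ω, ‖u y‖ₑ ^ P.β).toReal +
      (∫⁻ y in Ω, ‖G y‖ₑ ^ P.β).toReal) := by
    rw [h1, ← ENNReal.toReal_add hu'.ne hG'.ne, ← ENNReal.toReal_mul]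
    exact ENNReal.toReal_mono (ENNReal.mul_ne_top hCs (ENNReal.add_ne_top.2 ⟨hu'.ne, hG'.ne⟩))
      (hs h 𝒯 h𝒯 u w G hu hG.1 hl hp)
  have h3 := lintegral_rpow_le_add P.β_pos P.β_lt_two.le hu
  rw [← lpNorm_rpow P.β_pos G] at h2
  set n := lpNorm u 2 (vol Ω) ^ 2
  set q := lpNorm G (ENNReal.ofReal P.β) (vol Ω) ^ P.β
  have hn : 0 ≤ n := sq_nonneg _
  have hq : 0 ≤ q := Real.rpow_nonneg ENNReal.toReal_nonneg _
  calc P.energy v ≤ Ce * P.modular v := he v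
    _ ≤ Ce * (Cs.toReal * ((m + n) + q)) := by gcongr; exact h2.trans (by gcongr)
    _ ≤ Ce * (Cs.toReal * ((m + 1) * (1 + n + q))) := by
      gcongr
      nlinarith [mul_nonneg hm hn, mul_nonneg hm hq]
    _ = _ := by ring

theorem continuousOn_bdryWeight (P : GenPoly) {ψ : ℝ → Lp ℝ ∞ (surf Ω)} {J : Set ℝ}
    (hψ : ContinuousOn ψ J) : ContinuousOn (bdryWeight P ψ) J :=
  continuousOn_const.add (hψ.norm.rpow_const fun _ _ => Or.inr (by linarith [P.two_lt_lam]))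

theorem one_le_bdryWeight (P : GenPoly) (ψ : ℝ → Lp ℝ ∞ (surf Ω)) (t : ℝ) :
    1 ≤ bdryWeight P ψ t :=
  le_add_of_nonneg_right (Real.rpow_nonneg (norm_nonneg _) _)

theorem one_le_dataWeight (P : GenPoly) (ψ : ℝ → Lp ℝ ∞ (surf Ω)) (f : ℝ → Lp ℝ 2 (vol Ω))
    (t : ℝ) : 1 ≤ dataWeight P ψ f t :=
  (one_le_bdryWeight P ψ t).trans (le_add_of_nonneg_right (sq_nonneg _))

/-- The double time integral and the boundary product are nonnegative, so omitting them gives a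
lower bound. -/
theorem le_bigM (P : GenPoly) {T : ℝ} (hT : 0 ≤ T) (ψ ψt : ℝ → Lp ℝ ∞ (surf Ω))
    (f : ℝ → Lp ℝ 2 (vol Ω)) (ρ0 : Space d → ℝ) (G0 : Space d → Space d) (τ0 : Space d → ℝ) :
    sSup (bdryWeight P ψ '' Icc 0 T)
      + (∫ t in 0..T, (bdryWeight P ψt t + dataWeight P ψ f t))
      + lpNorm ρ0 2 (vol Ω) ^ 2 + lpNorm G0 (ENNReal.ofReal P.β) (vol Ω) ^ P.β ≤
    bigM P T ψ ψt f ρ0 G0 τ0 := by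
  have h1 : 0 ≤ ∫ t in 0..T, ∫ s in 0..t, dataWeight P ψ f s :=
    intervalIntegral.integral_nonneg hT fun t ht => intervalIntegral.integral_nonneg ht.1
      fun s _ => zero_le_one.trans (one_le_dataWeight P ψ f s)
  have h2 : 0 ≤ lpNorm (ψ 0) 2 (surf Ω) * lpNorm τ0 2 (surf Ω) :=
    mul_nonneg ENNReal.toReal_nonneg ENNReal.toReal_nonneg
  unfold bigM
  linarith

/-- A pointwise bound in `L²` gives a bound of the norm in `L^∞(J; L²)`. -/
theorem normLinftyL2_sq_le {t₀ T : ℝ} {u : ℝ → Space d → ℝ} {U : ℝ → Lp ℝ 2 (vol Ω)}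
    {R : ℝ} (hR : 0 ≤ R) (hU : ∀ t ∈ Ioo t₀ T, (U t : Space d → ℝ) =ᵐ[vol Ω] u t)
    (h : ∀ t ∈ Ioo t₀ T, ‖U t‖ ^ 2 ≤ R) :
    normLinftyL2 Ω (Ioo t₀ T) u ^ 2 ≤ ENNReal.ofReal R := by
  have h1 : normLinftyL2 Ω (Ioo t₀ T) u ≤ ENNReal.ofReal (√R) := by
    refine essSup_le_of_ae_le _ ?_
    filter_upwards [ae_restrict_mem measurableSet_Ioo] with t ht
    rw [← eLpNorm_congr_ae (hU t ht), ← Lp.enorm_def, ← ofReal_norm]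
    exact ENNReal.ofReal_le_ofReal (Real.le_sqrt_of_sq_le (h t ht))
  calc normLinftyL2 Ω (Ioo t₀ T) u ^ 2 ≤ ENNReal.ofReal (√R) ^ 2 := by gcongr
    _ = ENNReal.ofReal R := by
      rw [← ENNReal.ofReal_pow (Real.sqrt_nonneg _), Real.sq_sqrt hR]

end Forchheimer

end

/-! ### Assembly of the estimate. -/

theorem mainTheorem9 (d : ℕ) (hd : 2 ≤ d) (P : Forchheimer.GenPoly)
    (Ω : Set (Forchheimer.Space d)) (hΩ_open : IsOpen Ω) (hΩ_bdd : Bornology.IsBounded Ω)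
    (hΩ_C1 : Forchheimer.HasC1Boundary Ω) (r : ℕ) (σ : ℝ) (hσ : 0 < σ) (Tmax : ℝ) :
    ∃ C : ℝ, 0 < C ∧
      ∀ (T t₀ : ℝ), 0 < t₀ → t₀ < T → T ≤ Tmax →
      ∀ (h : ℝ) (𝒯 : Geometry.SimplicialComplex ℝ (Forchheimer.Space d)),
        Forchheimer.IsQuasiUniformTriangulation Ω σ h 𝒯 →
      ∀ (ψ ψt : ℝ → Lp ℝ ∞ (Forchheimer.surf Ω)),
        (∀ t ∈ Icc 0 T, HasDerivWithinAt ψ (ψt t) (Icc 0 T) t) →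
        ContinuousOn ψt (Icc 0 T) →
      ∀ (f ft : ℝ → Lp ℝ 2 (Forchheimer.vol Ω)),
        MemLp ft 2 (volume.restrict (Ioo 0 T)) →
        (∀ t ∈ Icc 0 T, f t = f 0 + ∫ s in 0..t, ft s) →
      ∀ (ρ0 : Forchheimer.Space d → ℝ) (G0 : Forchheimer.Space d → Forchheimer.Space d)
        (τ0 : Forchheimer.Space d → ℝ),
        MemLp ρ0 ∞ (Forchheimer.vol Ω) →
        MemLp G0 (ENNReal.ofReal P.β) (Forchheimer.vol Ω) →
        Forchheimer.HasWeakGradient Ω ρ0 G0 →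
        Forchheimer.HasTrace Ω ρ0 G0 τ0 →
      ∀ (ρ ρt : ℝ → Forchheimer.Space d → ℝ),
        Forchheimer.IsSemidiscreteSolution P Ω (Forchheimer.feSpace 𝒯 r) T
          (fun t => ψ t) (fun t => f t) ρ0 ρ ρt →
        Forchheimer.normLinftyL2 Ω (Ioo t₀ T) ρt ^ 2 ≤
          ENNReal.ofReal
            (C * t₀⁻¹ * Forchheimer.bigM P T ψ ψt f ρ0 G0 τ0
              + C * Forchheimer.bigM P T ψ ψt f ρ0 G0 τ0
              + C * ∫ t in 0..T, Forchheimer.bdryWeight P ψt t * (1 + ‖ft t‖ ^ 2)) := by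
  have := Forchheimer.isFiniteMeasure_vol hΩ_bdd
  obtain ⟨Ct, hCt, htr⟩ := Forchheimer.exists_trace_bound (by omega) hΩ_open hΩ_bdd hΩ_C1
  obtain ⟨A, hA, hbound⟩ := Forchheimer.exists_galerkin_bound P (Forchheimer.vol Ω)
    (Forchheimer.Space d) (Lp ℝ ∞ (Forchheimer.surf Ω)) (κ := Ct.toReal) ENNReal.toReal_nonneg Tmax
  obtain ⟨Ce, hCe, hinit⟩ :=
    Forchheimer.exists_initial_energy_bound P hΩ_C1 hΩ_open hΩ_bdd r hσ
  -- A is the constant of the Galerkin estimate. Ce bounds the initial energy by 𝓜, and the added 1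
  -- accounts for the remaining data.
  refine ⟨A * (Ce + 1), by positivity, ?_⟩
  intro T t₀ ht₀ ht₀T hTmax h 𝒯 h𝒯 ψ ψt hψ hψt f ft hft hf ρ0 G0 τ0 hρ0 hG0 _ hτ0 ρ ρt hρ
  have hT : 0 < T := ht₀.trans ht₀T
  have hρ0' : MemLp ρ0 2 (Forchheimer.vol Ω) := hρ0.mono_exponent le_top
  obtain ⟨V, hV, S, h1, h2, h3, h4, hd', hc0, hD0⟩ := hρ.exists_galerkinFlow hΩ_open hΩ_bdd
    h𝒯.finite h𝒯.covers hCt (htr 𝒯 h𝒯.finite h𝒯.covers r) hT hψ hψt hft hf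
  have hM := Forchheimer.le_bigM P hT.le ψ ψt f ρ0 G0 τ0
  set M := Forchheimer.bigM P T ψ ψt f ρ0 G0 τ0
  have he := hinit h 𝒯 h𝒯 ρ0 (ρ 0) G0 hρ0' hG0 hτ0.isSmoothLimit hρ.initial _ hD0
  have hn : ‖S.ι (S.c 0)‖ ^ 2 ≤ Forchheimer.lpNorm ρ0 2 (Forchheimer.vol Ω) ^ 2 :=
    pow_le_pow_left₀ (norm_nonneg _) (hρ.initial.norm_le hρ0' hc0) 2
  have hbdd : BddAbove (Forchheimer.bdryWeight P ψ '' Icc 0 T) :=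
    (isCompact_Icc.image_of_continuousOn (Forchheimer.continuousOn_bdryWeight P
      fun t ht => (hψ t ht).continuousWithinAt)).bddAbove
  have hB : ∀ t ∈ Icc 0 T, Forchheimer.bdryWeight P ψ t ≤
      sSup (Forchheimer.bdryWeight P ψ '' Icc 0 T) := fun t ht => le_csSup hbdd ⟨t, ht, rfl⟩
  have hB1 := (Forchheimer.one_le_bdryWeight P ψ 0).trans (hB 0 ⟨le_rfl, hT.le⟩)
  have hw : ∫ s in 0..T, (S.ht s + S.kt s) =
      ∫ t in 0..T, (Forchheimer.bdryWeight P ψt t + Forchheimer.dataWeight P ψ f t) := by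
    unfold Forchheimer.GalerkinFlow.ht Forchheimer.GalerkinFlow.kt
    rw [h1, h2, h3]
    rfl
  have hw' : ∫ s in 0..T, S.ht s * (1 + ‖S.ft s‖ ^ 2) =
      ∫ t in 0..T, Forchheimer.bdryWeight P ψt t * (1 + ‖ft t‖ ^ 2) := by
    unfold Forchheimer.GalerkinFlow.ht
    rw [h2, h4]
    rfl
  have hJ : 0 ≤ ∫ t in 0..T, Forchheimer.bdryWeight P ψt t * (1 + ‖ft t‖ ^ 2) :=
    intervalIntegral.integral_nonneg hT.le fun t _ => mul_nonneg
      (zero_le_one.trans (Forchheimer.one_le_bdryWeight P ψt t)) (by positivity)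
  have hI : 0 ≤ ∫ t in 0..T,
      (Forchheimer.bdryWeight P ψt t + Forchheimer.dataWeight P ψ f t) :=
    intervalIntegral.integral_nonneg hT.le fun t _ => add_nonneg
      (zero_le_one.trans (Forchheimer.one_le_bdryWeight P ψt t))
      (zero_le_one.trans (Forchheimer.one_le_dataWeight P ψ f t))
  have hq : 0 ≤ Forchheimer.lpNorm G0 (ENNReal.ofReal P.β) (Forchheimer.vol Ω) ^ P.β :=
    Real.rpow_nonneg ENNReal.toReal_nonneg _
  have hn0 := sq_nonneg (Forchheimer.lpNorm ρ0 2 (Forchheimer.vol Ω))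
  have hM0 : 0 ≤ M := by linarith only [hM, hB1, hI, hq, hn0]
  have hdata : P.energy (S.D (S.c 0)) + (‖S.ι (S.c 0)‖ ^ 2 +
      sSup (Forchheimer.bdryWeight P ψ '' Icc 0 T) + ∫ s in 0..T, (S.ht s + S.kt s)) ≤
      (Ce + 1) * M := by
    rw [hw]
    have h5 : Ce * (1 + Forchheimer.lpNorm ρ0 2 (Forchheimer.vol Ω) ^ 2 +
        Forchheimer.lpNorm G0 (ENNReal.ofReal P.β) (Forchheimer.vol Ω) ^ P.β) ≤ Ce * M :=
      mul_le_mul_of_nonneg_left (by linarith only [hM, hB1, hI]) hCe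
    linarith only [he, h5, hn, hM, hq]
  refine Forchheimer.normLinftyL2_sq_le (by positivity)
    (fun t ht => hd' t ⟨ht₀.trans ht.1, ht.2⟩) fun t ht => ?_
  refine (hbound V T S (sSup (Forchheimer.bdryWeight P ψ '' Icc 0 T)) t₀ t hTmax
    (by rw [h1]; exact hB) ht₀ ht.1 ht.2).trans ?_
  rw [hw']
  have h6 : A * t₀⁻¹ * (P.energy (S.D (S.c 0)) + (‖S.ι (S.c 0)‖ ^ 2 +
      sSup (Forchheimer.bdryWeight P ψ '' Icc 0 T) + ∫ s in 0..T, (S.ht s + S.kt s))) ≤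
      A * t₀⁻¹ * ((Ce + 1) * M) := mul_le_mul_of_nonneg_left hdata (by positivity)
  have h7 := mul_le_mul_of_nonneg_left hdata hA.le
  have h8 := mul_nonneg (mul_nonneg hA.le hCe) hJ
  linarith only [h6, h7, h8]
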